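/- **Setting.** For $\mu>0$ let $\mathcal T_\mu(D)$ be the Fourier multiplier with symbol $T_\mu(\xi)=\frac{\tanh(\sqrt\mu|\xi|)}{\sqrt\mu|\xi|}$, and consider, for real-valued functions $\zeta,v$ of $(x,t)$, $x\in\mathbb R$, the Whitham–Boussinesq system $$\begin{cases}\partial_t\zeta+\partial_x v+\varepsilon\,\partial_x(\zeta v)=0,\\ \partial_t v+\mathcal T_\mu(D)\partial_x\zeta+\varepsilon\, v\,\partial_x v=0.\end{cases}\qquad(\ast)$$ Let $V^s_{\sqrt\mu}(\mathbb R)$ be the space of pairs of real-valued functions with finite norm $$\|(\zeta,v)\|_{V^s_{\sqrt\mu}}^2=\|\zeta\|_{H^s}^2+\|v\|_{H^s}^2+\sqrt\mu\,\|D^{1/2}v\|_{H^s}^2,$$ where $\|f\|_{H^s}=\|(1+D^2)^{s/2}f\|_{L^2}$ and $D^{1/2}$ has symbol $|\xi|^{1/2}$. **Theorem.** Let $s>\frac32$, $h_0\in(0,1)$ and $c_0>0$. There are constants $c>0$ and $C>0$, depending only on $s$, $h_0$ and $c_0$, such that the following holds for all $\mu,\varepsilon\in(0,1)$. Let $(\zeta_0,v_0)\in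 V^s_{\sqrt\mu}(\mathbb R)$, $(\zeta_0,v_0)\neq 0$, satisfy the non-cavitation condition $$1+\varepsilon\zeta_0(x)\ge h_0\quad\text{for all }x\in\mathbb R,$$ and suppose that $\varepsilon\le c_0\,\|(\zeta_0,v_0)\|_{V^s_{\sqrt\mu}}^{-1}$. Put $T=c\,\|(\zeta_0,v_0)\|_{V^s_{\sqrt\mu}}^{-1}$. Then: 1. The system $(\ast)$ with initial data $(\zeta_0,v_0)$ has a unique solution $$(\zeta,v)\in C([0,T/\varepsilon];V^s_{\sqrt\mu}(\mathbb R))\cap C^1([0,T/\varepsilon];V^{s-1}_{\sqrt\mu}(\mathbb R)),$$ and it satisfies $$\sup_{t\in[0,T/\varepsilon]}\|(\zeta,v)(t)\|_{V^s_{\sqrt\mu}}\le C\,\|(\zeta_0,v_0)\|_{V^s_{\sqrt\mu}}.$$ 2. The flow map is continuous with respect to the initial data: there is a neighbourhood $\mathcal U$ of $(\zeta_0,v_0)$ in $V^s_{\sqrt\mu}(\mathbb R)$ such that for every initial datum in $\mathcal U$ the system $(\ast)$ has a unique solution in $C([0,T/\varepsilon];V^s_{\sqrt\mu}(\mathbb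 R))\cap C^1([0,T/\varepsilon];V^{s-1}_{\sqrt\mu}(\mathbb R))$ (with the same $T$), and the map from $\mathcal U$ to $C([0,T/\varepsilon];V^s_{\sqrt\mu}(\mathbb R))$ sending a datum to its solution is continuous. -/

import Mathlib

open MeasureTheory Set Filter Topology
open scoped ENNReal FourierTransform

namespace WhithamBoussinesq

noncomputable section

/-- Real-valued square integrable functions on the line. -/
abbrev RealL2 : Type := Lp ℝ 2 (volume : Measure ℝ)

/-- Complex-valued square integrable functions on the line. -/
abbrev ComplexL2 : Type := Lp ℂ 2 (volume : Measure ℝ)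

/-- A pair `(ζ, v)`: surface elevation and velocity variable at a fixed time. -/
abbrev State : Type := RealL2 × RealL2

/-- A real `L²` function regarded as a complex `L²` function. -/
def complexify (f : RealL2) : ComplexL2 := Complex.ofRealCLM.compLp f

/-- The unitary `L²` Fourier transform `ξ ↦ ∫ f(x) e^{-2πixξ} dx` of a real `L²` function. With
this normalisation the angular frequency attached to `ξ` is `2πξ`, so that a multiplier `m(D)`
acts as multiplication by `m(2πξ)`, and no constant appears in Plancherel's identity. -/
def fourier (f : RealL2) : ComplexL2 := 𝓕 (complexify f)

/-- `g = m(D) f` in `L²`, where `m` is given as a function of the angular frequency. -/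
def IsFourierMultiplier (m : ℝ → ℂ) (f g : RealL2) : Prop :=
  ∀ᵐ ξ : ℝ, fourier g ξ = m (2 * Real.pi * ξ) * fourier f ξ

/-- `g = ∂ₓ f` with both functions in `L²`; the symbol of `∂ₓ` is `iξ`. -/
def IsSpaceDeriv (f g : RealL2) : Prop :=
  IsFourierMultiplier (fun ξ => Complex.I * (ξ : ℂ)) f g

/-- The symbol `T_μ(ξ) = tanh(√μ|ξ|) / (√μ|ξ|)`, extended by its limit `1` at `ξ = 0`. -/
def symbolT (μ ξ : ℝ) : ℝ :=
  if ξ = 0 then 1 else Real.tanh (Real.sqrt μ * |ξ|) / (Real.sqrt μ * |ξ|)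

/-- `p` is the pointwise product of `f` and `g`. -/
def IsProduct (f g p : RealL2) : Prop :=
  ∀ᵐ x : ℝ, p x = f x * g x

/-- The quadratic form `∫ w |f̂|²`, i.e. the square of `‖√w(D) f‖_{L²}`, possibly infinite,
for a nonnegative weight `w` of the angular frequency. -/
def weightedNormSq (w : ℝ → ℝ) (f : RealL2) : ℝ≥0∞ :=
  ∫⁻ ξ : ℝ, ENNReal.ofReal (w (2 * Real.pi * ξ)) * ‖fourier f ξ‖ₑ ^ 2

/-- `‖f‖²_{H^s} = ‖J^s f‖²_{L²}`, where `J^s` has symbol `(1 + ξ²)^{s/2}`. -/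
def sobolevNormSq (s : ℝ) (f : RealL2) : ℝ≥0∞ :=
  weightedNormSq (fun ξ => (1 + ξ ^ 2) ^ s) f

/-- `‖D^{1/2} f‖²_{H^s}`, where `D^{1/2}` has symbol `|ξ|^{1/2}`. -/
def halfDerivSobolevNormSq (s : ℝ) (f : RealL2) : ℝ≥0∞ :=
  weightedNormSq (fun ξ => |ξ| * (1 + ξ ^ 2) ^ s) f

/-- The norm of `V^s_{√μ}`:
`‖(ζ, v)‖² = ‖ζ‖²_{H^s} + ‖v‖²_{H^s} + √μ ‖D^{1/2} v‖²_{H^s}`. It takes the value `∞` exactly on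
the pairs of `L²` functions that do not belong to `V^s_{√μ}` (for `s ≥ 0`). -/
def vNorm (s μ : ℝ) (U : State) : ℝ≥0∞ :=
  (sobolevNormSq s U.1 + sobolevNormSq s U.2
    + ENNReal.ofReal (Real.sqrt μ) * halfDerivSobolevNormSq s U.2) ^ (1 / 2 : ℝ)

/-- `(ζ, v) ∈ V^s_{√μ}(ℝ)`. -/
def MemV (s μ : ℝ) (U : State) : Prop := vNorm s μ U < ∞

/-- `U ∈ C([0, τ]; V^s_{√μ})`. -/
def ContinuousInV (s μ τ : ℝ) (U : ℝ → State) : Prop :=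
  ∀ t ∈ Icc 0 τ, MemV s μ (U t) ∧
    Tendsto (fun r => vNorm s μ (U r - U t)) (𝓝[Icc 0 τ] t) (𝓝 0)

/-- `U'` is the time derivative of `U` on `[0, τ]` (one-sided at the end points) in `V^s_{√μ}`. -/
def HasTimeDerivInV (s μ τ : ℝ) (U U' : ℝ → State) : Prop :=
  ∀ t ∈ Icc 0 τ,
    Tendsto (fun r => vNorm s μ ((r - t)⁻¹ • (U r - U t) - U' t))
      (𝓝[Icc 0 τ \ {t}] t) (𝓝 0)

/-- The system at a fixed time, `(ζt, vt)` standing for the time derivative of `(ζ, v)`: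
`ζt + ∂ₓ v + ε ∂ₓ(ζ v) = 0` and `vt + T_μ(D) ∂ₓ ζ + ε v ∂ₓ v = 0`. -/
def SatisfiesSystem (ε μ : ℝ) (U Ut : State) : Prop :=
  ∃ ζx vx ζv ζvx Tζx vvx : RealL2,
    IsSpaceDeriv U.1 ζx ∧ IsSpaceDeriv U.2 vx ∧
    IsProduct U.1 U.2 ζv ∧ IsSpaceDeriv ζv ζvx ∧
    IsFourierMultiplier (fun ξ => (symbolT μ ξ : ℂ)) ζx Tζx ∧
    IsProduct U.2 vx vvx ∧
    Ut.1 + vx + ε • ζvx = 0 ∧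
    Ut.2 + Tζx + ε • vvx = 0

/-- `U` lies in `C([0, τ]; V^s_{√μ}) ∩ C¹([0, τ]; V^{s-1}_{√μ})` and solves the system on
`[0, τ]`. -/
def IsSolution (s μ ε τ : ℝ) (U : ℝ → State) : Prop :=
  ContinuousInV s μ τ U ∧
    ∃ U' : ℝ → State,
      ContinuousInV (s - 1) μ τ U' ∧ HasTimeDerivInV (s - 1) μ τ U U' ∧
      ∀ t ∈ Icc 0 τ, SatisfiesSystem ε μ (U t) (U' t)

/-- `U` is a solution on `[0, τ]` with initial value `U₀`, and the only one. -/
def IsUniqueSolution (s μ ε τ : ℝ) (U₀ : State) (U : ℝ → State) : Prop :=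
  IsSolution s μ ε τ U ∧ U 0 = U₀ ∧
    ∀ W : ℝ → State, IsSolution s μ ε τ W → W 0 = U₀ → EqOn W U (Icc 0 τ)

/-- The non-cavitation condition `1 + ε ζ₀ ≥ h₀`. For `ζ₀ ∈ H^s`, `s > 1/2`, which has a continuous
representative, the inequality almost everywhere is the inequality everywhere for it. -/
def NonCavitation (ε h₀ : ℝ) (ζ₀ : RealL2) : Prop :=
  ∀ᵐ x : ℝ, h₀ ≤ 1 + ε * ζ₀ x

end

end WhithamBoussinesq

/-! Multiplying a solution by `ε` turns the system into the one with `ε = 1` and data of size about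
`ε n`, where `n` is the norm of the datum (`SatisfiesSystem.smul`). It therefore suffices to solve
the system with `ε = 1` on a time interval of length proportional to the inverse of the size of the
data, as long as that size stays below a fixed bound. This is what the condition on `ε` provides.

The linear part is symmetric in the unknowns `ζ` and `y = T_μ(D)^{-1/2} v`. Since `max(1, x) ≤ x
coth x ≤ 1 + x`, the norm of `V^s` is equivalent to the `H^s` norm of `(ζ, y)`, with constants
independent of `μ`. Write `P = T_μ(D)^{1/2} ∂ₓ`. The leading terms are `(1 + ζ) P y` and `P ζ`,
together with transport by `v`. In the energy `‖ζ‖² + ⟨(1 + ζ) y, y⟩` the leading terms cancel up to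
the commutator `[P, ζ]`, and non-cavitation makes the energy coercive. The symbol `T_μ(D)^{-1/2}` in
front of the quadratic term of the second equation is also harmless: commuting it with `v` gains the
derivative that it meets, uniformly in `μ` (`abs_psi_sub_mul_le`). The abstract cancellation is
`abstract_energy_inequality`.

All estimates are made on the Fourier side, where products are convolutions and a commutator with a
multiplier is an integral operator with an explicit kernel. A pointwise bound on the kernel and
Young's inequality `L¹ * L² ⊂ L²` reduce everything to `∫ (1 + k²)^{1/2} |f̂|`, which the `H^s` norm
controls exactly because `s > 3/2`. Sobolev weights are handled as arbitrary even, monotone weights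
of polynomial growth. The pointwise commutator bound `IsWeight.abs_sub_mul_le` depends only on the
growth order, so `weighted_energy_inequality` holds for the Sobolev weight, for its bounded
truncations, and for its product with the tail weight `min(1, |ξ|/R)`, all with the same constant.

Solutions are constructed with the frequency cut-off `max(0, 1 - δ|ξ|)`. For `δ > 0` the vector
field is locally Lipschitz on `H^s`, so the equation is an ordinary differential equation. The
cut-off commutes with multiplication up to one gained derivative, uniformly in `δ`, so the energy
bounds, and with them the lifespan, do not depend on `δ` (`exists_goodRegSol`).

Two regularised solutions differ by `O(√δ)` in `L²` (`GoodRegSol.difference_le`). The weighted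
inequality with the tail weight bounds the high frequencies at time `t` by those of the datum,
uniformly in `δ`. Smallness in `L²` and uniformly small tails give uniform convergence in `H^s`
(`uniformCauchySeqOn_of_tail`), and the limit solves the system (`exists_goodSol`). Comparing an
arbitrary solution with the regularised ones gives uniqueness and `L²` stability. Combined with the
tail bound, stability gives continuity of the flow in the top norm (`GoodSol.exists_close`), with no
separate regularisation of the data. -/

namespace WhithamBoussinesq

/-! ### Multiplication by bounded symbols on `L²`. -/

noncomputable section

/-- A bounded measurable symbol. -/
structure BddMeas (m : ℝ → ℂ) : Prop where
  meas : Measurable m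
  bdd : ∃ C : ℝ, ∀ ξ, ‖m ξ‖ ≤ C

lemma BddMeas.memLp {m : ℝ → ℂ} (hm : BddMeas m) (f : ComplexL2) :
    MemLp (fun ξ => m ξ * f ξ) 2 := by
  obtain ⟨C, hC⟩ := hm.bdd
  exact (Lp.memLp f).of_le_mul
    (hm.meas.aestronglyMeasurable.mul (Lp.memLp f).aestronglyMeasurable)
    (c := C) (ae_of_all _ fun ξ => by rw [norm_mul]; gcongr; exact hC ξ)

lemma BddMeas.mul {m n : ℝ → ℂ} (hm : BddMeas m) (hn : BddMeas n) :
    BddMeas (fun ξ => m ξ * n ξ) := by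
  obtain ⟨C, hC⟩ := hm.bdd
  obtain ⟨D, hD⟩ := hn.bdd
  refine ⟨hm.meas.mul hn.meas, C * D, fun ξ => ?_⟩
  rw [norm_mul]
  exact mul_le_mul (hC ξ) (hD ξ) (norm_nonneg _) ((norm_nonneg _).trans (hC ξ))

lemma BddMeas.of_real {r : ℝ → ℝ} (hr : Measurable r) {C : ℝ} (hC : ∀ ξ, |r ξ| ≤ C) :
    BddMeas (fun ξ => (r ξ : ℂ)) :=
  ⟨Complex.measurable_ofReal.comp hr, C, fun ξ => by
    rw [Complex.norm_real]; exact hC ξ⟩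

open Classical in
/-- Multiplication by a bounded symbol. -/
def mulOp (m : ℝ → ℂ) : ComplexL2 →L[ℝ] ComplexL2 :=
  if hm : BddMeas m then
    LinearMap.mkContinuous
      { toFun := fun f => (hm.memLp f).toLp _
        map_add' := fun f g => by
          apply Lp.ext
          filter_upwards [(hm.memLp (f + g)).coeFn_toLp, (hm.memLp f).coeFn_toLp,
            (hm.memLp g).coeFn_toLp, Lp.coeFn_add f g,
            Lp.coeFn_add ((hm.memLp f).toLp _) ((hm.memLp g).toLp _)] with ξ h1 h2 h3 h4 h5
          rw [h1, h5, Pi.add_apply, h2, h3, h4, Pi.add_apply, mul_add]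
        map_smul' := fun c f => by
          apply Lp.ext
          filter_upwards [(hm.memLp (c • f)).coeFn_toLp, (hm.memLp f).coeFn_toLp,
            Lp.coeFn_smul c f, Lp.coeFn_smul c ((hm.memLp f).toLp _)] with ξ h1 h2 h3 h4
          rw [h1, RingHom.id_apply, h4, Pi.smul_apply, h2, h3, Pi.smul_apply, mul_smul_comm] }
      (Classical.choose hm.bdd) (fun f => by
        apply Lp.norm_le_mul_norm_of_ae_le_mul
        filter_upwards [(hm.memLp f).coeFn_toLp] with ξ h1
        simp only [LinearMap.coe_mk, AddHom.coe_mk]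
        rw [h1, norm_mul]
        gcongr
        exact Classical.choose_spec hm.bdd ξ)
  -- The junk value makes `mulOp` a total function of the symbol. Every use supplies `BddMeas`.
  else 0

lemma mulOp_ae {m : ℝ → ℂ} (hm : BddMeas m) (f : ComplexL2) :
    mulOp m f =ᵐ[volume] fun ξ => m ξ * f ξ := by
  rw [mulOp, dif_pos hm]
  exact (hm.memLp f).coeFn_toLp

lemma norm_mulOp_le {m : ℝ → ℂ} (hm : Measurable m) {C : ℝ} (hC : ∀ ξ, ‖m ξ‖ ≤ C)
    (f : ComplexL2) : ‖mulOp m f‖ ≤ C * ‖f‖ := by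
  apply Lp.norm_le_mul_norm_of_ae_le_mul
  filter_upwards [mulOp_ae ⟨hm, C, hC⟩ f] with ξ h1
  rw [h1, norm_mul]
  gcongr
  exact hC ξ

lemma mulOp_mulOp {m n : ℝ → ℂ} (hm : BddMeas m) (hn : BddMeas n) (f : ComplexL2) :
    mulOp m (mulOp n f) = mulOp (fun ξ => m ξ * n ξ) f := by
  apply Lp.ext
  filter_upwards [mulOp_ae hm (mulOp n f), mulOp_ae hn f, mulOp_ae (hm.mul hn) f] with ξ h1 h2 h3
  rw [h1, h2, h3, mul_assoc]

lemma mulOp_one (f : ComplexL2) : mulOp (fun _ => 1) f = f := by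
  apply Lp.ext
  filter_upwards [mulOp_ae (m := fun _ => 1) ⟨measurable_const, 1, by simp⟩ f] with ξ h1
  rw [h1, one_mul]

lemma inner_eq_integral_re (f g : ComplexL2) :
    inner ℝ f g = ∫ ξ, ((starRingEnd ℂ) (f ξ) * g ξ).re := by
  rw [L2.inner_def]
  congr 1
  ext ξ
  simp [Complex.inner]
  ring

lemma inner_congr {f g f' g' : ComplexL2}
    (h : ∀ᵐ ξ : ℝ, (starRingEnd ℂ) (f ξ) * g ξ = (starRingEnd ℂ) (f' ξ) * g' ξ) :
    inner ℝ f g = inner ℝ f' g' := by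
  rw [inner_eq_integral_re, inner_eq_integral_re]
  apply integral_congr_ae
  filter_upwards [h] with ξ hξ
  rw [hξ]

lemma inner_mulOp_left {m : ℝ → ℂ} (hm : BddMeas m) (hr : ∀ ξ, (starRingEnd ℂ) (m ξ) = m ξ)
    (f g : ComplexL2) : inner ℝ (mulOp m f) g = inner ℝ f (mulOp m g) := by
  apply inner_congr
  filter_upwards [mulOp_ae hm f, mulOp_ae hm g] with ξ h1 h2
  rw [h1, h2, map_mul, hr]
  ring

lemma inner_mulOp_left_skew {m : ℝ → ℂ} (hm : BddMeas m)
    (hr : ∀ ξ, (starRingEnd ℂ) (m ξ) = -m ξ)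
    (f g : ComplexL2) : inner ℝ (mulOp m f) g = -inner ℝ f (mulOp m g) := by
  rw [← inner_neg_right]
  apply inner_congr
  filter_upwards [mulOp_ae hm f, mulOp_ae hm g, Lp.coeFn_neg (mulOp m g)] with ξ h1 h2 h3
  rw [h1, h3, Pi.neg_apply, h2, map_mul, hr]
  ring

/-! ### Young's inequality -/

/-- This is Cauchy–Schwarz for the measure `F (a - b) db`, with `F` split as `F^{1/2} F^{1/2}`,
followed by Tonelli and translation invariance. -/
lemma lintegral_young (F G : ℝ → ℝ≥0∞) (hF : Measurable F) (hG : Measurable G) :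
    ∫⁻ a, (∫⁻ b, F (a - b) * G b) ^ 2 ≤ (∫⁻ ξ, F ξ) ^ 2 * ∫⁻ ξ, G ξ ^ 2 := by
  have hFab : Measurable (fun p : ℝ × ℝ => F (p.1 - p.2)) :=
    hF.comp (measurable_fst.sub measurable_snd)
  have key : ∀ a, (∫⁻ b, F (a - b) * G b) ^ 2 ≤ (∫⁻ ξ, F ξ) * ∫⁻ b, F (a - b) * G b ^ 2 := by
    intro a
    have hFa : Measurable (fun b => F (a - b)) := hF.comp (measurable_const.sub measurable_id)
    have h := ENNReal.lintegral_mul_le_Lp_mul_Lq (volume : Measure ℝ)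
      Real.HolderConjugate.two_two
      (f := fun b => F (a - b) ^ (1 / 2 : ℝ)) (g := fun b => F (a - b) ^ (1 / 2 : ℝ) * G b)
      (hFa.pow_const _).aemeasurable ((hFa.pow_const _).mul hG).aemeasurable
    have e1 : ∀ b, ((fun b => F (a - b) ^ (1 / 2 : ℝ)) *
        (fun b => F (a - b) ^ (1 / 2 : ℝ) * G b)) b = F (a - b) * G b := by
      intro b
      simp only [Pi.mul_apply]
      rw [← mul_assoc, ← ENNReal.rpow_add_of_nonneg _ _ (by norm_num) (by norm_num)]
      norm_num
    have e2 : ∀ b, (F (a - b) ^ (1 / 2 : ℝ)) ^ (2 : ℝ) = F (a - b) := by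
      intro b
      rw [← ENNReal.rpow_mul]; norm_num
    have e3 : ∀ b, (F (a - b) ^ (1 / 2 : ℝ) * G b) ^ (2 : ℝ) = F (a - b) * G b ^ 2 := by
      intro b
      rw [ENNReal.mul_rpow_of_nonneg _ _ (by norm_num), e2, ENNReal.rpow_two]
    simp only [e1, e2, e3] at h
    rw [lintegral_sub_left_eq_self (fun ξ => F ξ) a] at h
    calc (∫⁻ b, F (a - b) * G b) ^ 2 ≤ ((∫⁻ ξ, F ξ) ^ (1 / 2 : ℝ) *
          (∫⁻ b, F (a - b) * G b ^ 2) ^ (1 / 2 : ℝ)) ^ 2 := by gcongr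
      _ = _ := by
        rw [mul_pow]
        congr 1 <;> (rw [← ENNReal.rpow_natCast, ← ENNReal.rpow_mul]; norm_num)
  calc ∫⁻ a, (∫⁻ b, F (a - b) * G b) ^ 2
      ≤ ∫⁻ a, (∫⁻ ξ, F ξ) * ∫⁻ b, F (a - b) * G b ^ 2 := lintegral_mono key
    _ = (∫⁻ ξ, F ξ) * ∫⁻ a, ∫⁻ b, F (a - b) * G b ^ 2 := by
        rw [lintegral_const_mul]
        exact (hFab.mul ((hG.pow_const 2).comp measurable_snd)).lintegral_prod_right'
    _ = (∫⁻ ξ, F ξ) * ∫⁻ b, ∫⁻ a, F (a - b) * G b ^ 2 := by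
        rw [lintegral_lintegral_swap]
        exact (hFab.mul ((hG.pow_const 2).comp measurable_snd)).aemeasurable
    _ = (∫⁻ ξ, F ξ) * ∫⁻ b, (∫⁻ ξ, F ξ) * G b ^ 2 := by
        congr 2
        ext b
        rw [lintegral_mul_const _ (show Measurable (fun a => F (a - b)) from hF.comp (measurable_id.sub_const b)),
          lintegral_sub_right_eq_self (fun ξ => F ξ) b]
    _ = _ := by
        rw [lintegral_const_mul _ (hG.pow_const 2), ← mul_assoc, sq]

lemma lintegral_young_one (F G : ℝ → ℝ≥0∞) (hF : Measurable F) (hG : Measurable G) :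
    ∫⁻ a, (∫⁻ b, F (a - b) * G b) = (∫⁻ ξ, F ξ) * ∫⁻ ξ, G ξ := by
  have hFab : Measurable (fun p : ℝ × ℝ => F (p.1 - p.2)) :=
    hF.comp (measurable_fst.sub measurable_snd)
  rw [lintegral_lintegral_swap]
  · have : ∀ b, ∫⁻ a, F (a - b) * G b = (∫⁻ ξ, F ξ) * G b := by
      intro b
      rw [lintegral_mul_const _ (show Measurable (fun a => F (a - b)) from hF.comp (measurable_id.sub_const b)),
          lintegral_sub_right_eq_self (fun ξ => F ξ) b]
    simp only [this]
    rw [lintegral_const_mul _ hG]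
  · exact (hFab.mul (hG.comp measurable_snd)).aemeasurable

lemma enorm_sq_eq_lintegral (f : ComplexL2) : ‖f‖ₑ ^ 2 = ∫⁻ ξ, ‖f ξ‖ₑ ^ 2 := by
  rw [Lp.enorm_def, eLpNorm_eq_lintegral_rpow_enorm_toReal (by norm_num) (by norm_num)]
  simp only [ENNReal.toReal_ofNat, ENNReal.rpow_two]
  rw [← ENNReal.rpow_two, ← ENNReal.rpow_mul]
  norm_num

/-- `∫ w |f| ≤ A`. -/
def L1Le (w : ℝ → ℝ) (f : ℝ → ℂ) (A : ℝ) : Prop :=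
  ∫⁻ ξ, ENNReal.ofReal (w ξ) * ‖f ξ‖ₑ ≤ ENNReal.ofReal A

lemma lintegral_convol_comm (F G : ℝ → ℝ≥0∞) (a : ℝ) :
    ∫⁻ b, F (a - b) * G b = ∫⁻ b, G (a - b) * F b := by
  rw [← lintegral_sub_left_eq_self (fun b => F (a - b) * G b) a]
  congr 1
  ext b
  rw [sub_sub_cancel, mul_comm]

/-- The `L²` norm is controlled by a convolution majorant of the type `L¹ * L² + L² * L¹`. -/
lemma norm_le_of_convol (h : ComplexL2) {F₁ G₁ F₂ G₂ : ℝ → ℝ≥0∞} (hF₁ : Measurable F₁)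
    (hG₁ : Measurable G₁) (hF₂ : Measurable F₂) (hG₂ : Measurable G₂) {A₁ B₁ A₂ B₂ : ℝ}
    (hA₁ : 0 ≤ A₁) (hB₁ : 0 ≤ B₁) (hA₂ : 0 ≤ A₂) (hB₂ : 0 ≤ B₂)
    (iF₁ : ∫⁻ ξ, F₁ ξ ≤ ENNReal.ofReal A₁) (iG₁ : ∫⁻ ξ, G₁ ξ ^ 2 ≤ ENNReal.ofReal (B₁ ^ 2))
    (iF₂ : ∫⁻ ξ, F₂ ξ ^ 2 ≤ ENNReal.ofReal (A₂ ^ 2)) (iG₂ : ∫⁻ ξ, G₂ ξ ≤ ENNReal.ofReal B₂)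
    (hle : ∀ᵐ a : ℝ, ‖h a‖ₑ ≤ (∫⁻ b, F₁ (a - b) * G₁ b) + ∫⁻ b, F₂ (a - b) * G₂ b) :
    ‖h‖ ≤ A₁ * B₁ + A₂ * B₂ := by
  have hmeas : ∀ F G : ℝ → ℝ≥0∞, Measurable F → Measurable G →
      Measurable (fun a => ∫⁻ b, F (a - b) * G b) := fun F G hF hG =>
    ((hF.comp (measurable_fst.sub measurable_snd)).mul (hG.comp measurable_snd)).lintegral_prod_right'
  have hy : ∀ F G : ℝ → ℝ≥0∞, Measurable F → Measurable G → ∀ A B : ℝ, 0 ≤ A → 0 ≤ B →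
      ∫⁻ ξ, F ξ ≤ ENNReal.ofReal A → ∫⁻ ξ, G ξ ^ 2 ≤ ENNReal.ofReal (B ^ 2) →
      (∫⁻ a, (∫⁻ b, F (a - b) * G b) ^ (2 : ℝ)) ^ (1 / (2 : ℝ)) ≤ ENNReal.ofReal (A * B) := by
    intro F G hF hG A B hA hB iF iG
    simp only [ENNReal.rpow_two]
    calc (∫⁻ a, (∫⁻ b, F (a - b) * G b) ^ 2) ^ (1 / (2 : ℝ))
        ≤ ((ENNReal.ofReal A) ^ 2 * ENNReal.ofReal (B ^ 2)) ^ (1 / (2 : ℝ)) := by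
          refine ENNReal.rpow_le_rpow ((lintegral_young F G hF hG).trans ?_) (by norm_num)
          gcongr
      _ = ENNReal.ofReal (A * B) := by
          rw [← ENNReal.ofReal_pow hA, ← ENNReal.ofReal_mul (by positivity), ← mul_pow,
            ENNReal.ofReal_rpow_of_nonneg (by positivity) (by norm_num), ← Real.sqrt_eq_rpow,
            Real.sqrt_sq (by positivity)]
  have h1 := hy F₁ G₁ hF₁ hG₁ A₁ B₁ hA₁ hB₁ iF₁ iG₁
  have h2 := hy G₂ F₂ hG₂ hF₂ B₂ A₂ hB₂ hA₂ iG₂ iF₂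
  have h3 : ‖h‖ₑ ≤ ENNReal.ofReal (A₁ * B₁ + A₂ * B₂) := by
    rw [Lp.enorm_def, eLpNorm_eq_lintegral_rpow_enorm_toReal (by norm_num) (by norm_num)]
    simp only [ENNReal.toReal_ofNat]
    calc (∫⁻ ξ, ‖h ξ‖ₑ ^ (2 : ℝ)) ^ (1 / (2 : ℝ))
        ≤ (∫⁻ a, (((fun a => ∫⁻ b, F₁ (a - b) * G₁ b) + fun a => ∫⁻ b, G₂ (a - b) * F₂ b) a)
            ^ (2 : ℝ)) ^ (1 / (2 : ℝ)) := by
          refine ENNReal.rpow_le_rpow (lintegral_mono_ae ?_) (by norm_num)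
          filter_upwards [hle] with a ha
          refine ENNReal.rpow_le_rpow ?_ (by norm_num)
          rw [Pi.add_apply, lintegral_convol_comm G₂ F₂]
          exact ha
      _ ≤ _ := ENNReal.lintegral_Lp_add_le (hmeas F₁ G₁ hF₁ hG₁).aemeasurable
          (hmeas G₂ F₂ hG₂ hF₂).aemeasurable (by norm_num)
      _ ≤ ENNReal.ofReal (A₁ * B₁) + ENNReal.ofReal (B₂ * A₂) := add_le_add h1 h2
      _ = _ := by rw [← ENNReal.ofReal_add (by positivity) (by positivity), mul_comm B₂]
  rw [← ofReal_norm, ENNReal.ofReal_le_ofReal_iff (by positivity)] at h3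
  exact h3

/-! ### Convolution -/

/-- The convolution of two functions. -/
def conv (f g : ℝ → ℂ) (a : ℝ) : ℂ := ∫ b, f (a - b) * g b

lemma measurePreserving_sub_left' (a : ℝ) :
    MeasurePreserving (fun b : ℝ => a - b) volume volume :=
  Measure.measurePreserving_sub_left volume a

lemma integrable_conv {f g : ℝ → ℂ} (hf : MemLp f 2) (hg : MemLp g 2) (a : ℝ) :
    Integrable (fun b => f (a - b) * g b) :=
  (hf.comp_measurePreserving (measurePreserving_sub_left' a)).integrable_mul hg

lemma conv_comm (f g : ℝ → ℂ) (a : ℝ) : conv f g a = conv g f a := by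
  rw [conv, ← integral_sub_left_eq_self (fun b => f (a - b) * g b) volume a, conv]
  congr 1
  ext b
  rw [sub_sub_cancel, mul_comm]

lemma conv_add_left {f f' g : ℝ → ℂ} (hf : MemLp f 2) (hf' : MemLp f' 2) (hg : MemLp g 2)
    (a : ℝ) : conv (fun ξ => f ξ + f' ξ) g a = conv f g a + conv f' g a := by
  rw [conv, conv, conv, ← integral_add (integrable_conv hf hg a) (integrable_conv hf' hg a)]
  congr 1
  ext b
  ring

lemma conv_add_right {f g g' : ℝ → ℂ} (hf : MemLp f 2) (hg : MemLp g 2) (hg' : MemLp g' 2)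
    (a : ℝ) : conv f (fun ξ => g ξ + g' ξ) a = conv f g a + conv f g' a := by
  rw [conv_comm, conv_add_left hg hg' hf, conv_comm g, conv_comm g']

lemma conv_const_mul_left (f g : ℝ → ℂ) (c : ℂ) (a : ℝ) :
    conv (fun ξ => c * f ξ) g a = c * conv f g a := by
  rw [conv, conv, ← integral_const_mul]
  congr 1
  ext b
  ring

lemma conv_const_mul_right (f g : ℝ → ℂ) (c : ℂ) (a : ℝ) :
    conv f (fun ξ => c * g ξ) a = c * conv f g a := by
  rw [conv_comm, conv_const_mul_left, conv_comm]

lemma conv_congr {f g f' g' : ℝ → ℂ} (hf : f =ᵐ[volume] f') (hg : g =ᵐ[volume] g') (a : ℝ) :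
    conv f g a = conv f' g' a := by
  refine integral_congr_ae ?_
  filter_upwards [(measurePreserving_sub_left' a).quasiMeasurePreserving.ae hf, hg] with b h1 h2
  rw [h1, h2]

lemma enorm_conv_le (f g : ℝ → ℂ) (a : ℝ) :
    ‖conv f g a‖ₑ ≤ ∫⁻ b, ‖f (a - b)‖ₑ * ‖g b‖ₑ := by
  refine (enorm_integral_le_lintegral_enorm _).trans (le_of_eq ?_)
  congr 1
  ext b
  rw [enorm_mul]

lemma stronglyMeasurable_conv {f g : ℝ → ℂ} (hf : StronglyMeasurable f)
    (hg : StronglyMeasurable g) : StronglyMeasurable (conv f g) := by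
  refine StronglyMeasurable.integral_prod_right (f := fun a b => f (a - b) * g b) ?_
  exact (hf.comp_measurable (measurable_fst.sub measurable_snd)).mul
    (hg.comp_measurable measurable_snd)

lemma measurable_enorm_coe (f : ComplexL2) : Measurable (fun ξ => ‖f ξ‖ₑ) :=
  (Lp.stronglyMeasurable f).measurable.enorm

lemma memLp_conv {f g : ComplexL2} (hf : Integrable f) : MemLp (conv f g) 2 := by
  refine ⟨(stronglyMeasurable_conv (Lp.stronglyMeasurable f)
    (Lp.stronglyMeasurable g)).aestronglyMeasurable, ?_⟩
  rw [eLpNorm_eq_lintegral_rpow_enorm_toReal (by norm_num) (by norm_num)]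
  simp only [ENNReal.toReal_ofNat, ENNReal.rpow_two]
  refine ENNReal.rpow_lt_top_of_nonneg (by norm_num) (ne_of_lt ?_)
  calc ∫⁻ a, ‖conv f g a‖ₑ ^ 2 ≤ ∫⁻ a, (∫⁻ b, ‖f (a - b)‖ₑ * ‖g b‖ₑ) ^ 2 :=
        lintegral_mono fun a => by gcongr; exact enorm_conv_le _ _ _
    _ ≤ _ := lintegral_young (fun ξ => ‖f ξ‖ₑ) (fun ξ => ‖g ξ‖ₑ) (measurable_enorm_coe f)
        (measurable_enorm_coe g)
    _ < ∞ := by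
        refine ENNReal.mul_lt_top (ENNReal.pow_lt_top hf.2) ?_
        rw [← enorm_sq_eq_lintegral]
        exact ENNReal.pow_lt_top enorm_lt_top

open Classical in
/-- Convolution with an integrable function, as an operator on `L²`. -/
def convOp (f : ComplexL2) : ComplexL2 →L[ℝ] ComplexL2 :=
  if hf : Integrable f then
    LinearMap.mkContinuous
      { toFun := fun g => (memLp_conv (g := g) hf).toLp _
        map_add' := fun g g' => by
          apply Lp.ext
          filter_upwards [(memLp_conv (g := g + g') hf).coeFn_toLp,
            (memLp_conv (g := g) hf).coeFn_toLp, (memLp_conv (g := g') hf).coeFn_toLp,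
            Lp.coeFn_add ((memLp_conv (g := g) hf).toLp _)
              ((memLp_conv (g := g') hf).toLp _)] with ξ h1 h2 h3 h5
          rw [h1, h5, Pi.add_apply, h2, h3, conv_congr (ae_eq_refl _) (Lp.coeFn_add g g')]
          exact conv_add_right (Lp.memLp f) (Lp.memLp g) (Lp.memLp g') ξ
        map_smul' := fun c g => by
          apply Lp.ext
          filter_upwards [(memLp_conv (g := c • g) hf).coeFn_toLp,
            (memLp_conv (g := g) hf).coeFn_toLp,
            Lp.coeFn_smul c ((memLp_conv (g := g) hf).toLp _)] with ξ h1 h2 h4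
          rw [h1, RingHom.id_apply, h4, Pi.smul_apply, h2,
            conv_congr (ae_eq_refl _) (Lp.coeFn_smul c g)]
          exact conv_const_mul_right f g (c : ℂ) ξ }
      (∫⁻ ξ, ‖f ξ‖ₑ).toReal (fun g => by
        have := norm_le_of_convol ((memLp_conv (g := g) hf).toLp _)
          (F₁ := fun ξ => ‖f ξ‖ₑ) (G₁ := fun ξ => ‖g ξ‖ₑ) (F₂ := 0) (G₂ := 0)
          (A₁ := (∫⁻ ξ, ‖f ξ‖ₑ).toReal) (B₁ := ‖g‖) (A₂ := 0) (B₂ := 0)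
          (measurable_enorm_coe f) (measurable_enorm_coe g) measurable_zero measurable_zero
          (by positivity) (by positivity) le_rfl le_rfl
          (by rw [ENNReal.ofReal_toReal hf.2.ne])
          (by rw [ENNReal.ofReal_pow (norm_nonneg _), ofReal_norm, enorm_sq_eq_lintegral])
          (by simp) (by simp)
          (by filter_upwards [(memLp_conv (g := g) hf).coeFn_toLp] with a ha
              rw [ha]
              exact (enorm_conv_le _ _ _).trans le_self_add)
        simpa using this)
  else 0

lemma convOp_ae {f : ComplexL2} (hf : Integrable f) (g : ComplexL2) :
    convOp f g =ᵐ[volume] conv f g := by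
  rw [convOp, dif_pos hf]
  exact (memLp_conv (g := g) hf).coeFn_toLp

lemma L1Le.integrable {f : ComplexL2} {A : ℝ} (h : L1Le (fun _ => 1) f A) : Integrable f := by
  refine ⟨(Lp.memLp f).aestronglyMeasurable, ?_⟩
  rw [HasFiniteIntegral]
  refine lt_of_le_of_lt ?_ (h.trans_lt ENNReal.ofReal_lt_top)
  simp

lemma norm_convOp_apply_le {f : ComplexL2} {A : ℝ} (hA : 0 ≤ A) (hf : L1Le (fun _ => 1) f A)
    (g : ComplexL2) : ‖convOp f g‖ ≤ A * ‖g‖ := by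
  have := norm_le_of_convol (convOp f g)
    (F₁ := fun ξ => ‖f ξ‖ₑ) (G₁ := fun ξ => ‖g ξ‖ₑ) (F₂ := 0) (G₂ := 0)
    (A₁ := A) (B₁ := ‖g‖) (A₂ := 0) (B₂ := 0)
    (measurable_enorm_coe f) (measurable_enorm_coe g) measurable_zero measurable_zero
    (by positivity) (by positivity) le_rfl le_rfl
    (by simpa [L1Le] using hf)
    (by rw [ENNReal.ofReal_pow (norm_nonneg _), ofReal_norm, enorm_sq_eq_lintegral])
    (by simp) (by simp)
    (by filter_upwards [convOp_ae hf.integrable g] with a ha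
        rw [ha]
        exact (enorm_conv_le _ _ _).trans le_self_add)
  simpa using this

lemma convOp_add {f f' : ComplexL2} (hf : Integrable f) (hf' : Integrable f') (g : ComplexL2) :
    convOp (f + f') g = convOp f g + convOp f' g := by
  have hff : Integrable (f + f' : ComplexL2) :=
    (hf.add hf').congr (Lp.coeFn_add f f').symm
  apply Lp.ext
  filter_upwards [convOp_ae hff g, convOp_ae hf g, convOp_ae hf' g,
    Lp.coeFn_add (convOp f g) (convOp f' g)] with ξ h1 h2 h3 h4
  rw [h1, h4, Pi.add_apply, h2, h3, conv_congr (Lp.coeFn_add f f') (ae_eq_refl _)]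
  exact conv_add_left (Lp.memLp f) (Lp.memLp f') (Lp.memLp g) ξ

lemma convOp_smul {f : ComplexL2} (hf : Integrable f) (c : ℝ) (g : ComplexL2) :
    convOp (c • f) g = c • convOp f g := by
  have hff : Integrable (c • f : ComplexL2) := (hf.smul c).congr (Lp.coeFn_smul c f).symm
  apply Lp.ext
  filter_upwards [convOp_ae hff g, convOp_ae hf g, Lp.coeFn_smul c (convOp f g)] with ξ h1 h2 h4
  rw [h1, h4, Pi.smul_apply, h2, conv_congr (Lp.coeFn_smul c f) (ae_eq_refl _)]
  exact conv_const_mul_left f g (c : ℂ) ξ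

/-! ### The `L²` Fourier transform and convolutions -/

lemma fourierInv_apply_eq (f : ℝ → ℂ) (x : ℝ) :
    𝓕⁻ f x = ∫ ξ : ℝ, Complex.exp (2 * Real.pi * x * ξ * Complex.I) * f ξ := by
  rw [Real.fourierInv_eq']
  congr 1
  ext ξ
  rw [smul_eq_mul]
  congr 2
  simp [mul_comm, mul_assoc, mul_left_comm]

lemma continuous_fourierInv_of_integrable {f : ℝ → ℂ} (hf : Integrable f) :
    Continuous (𝓕⁻ f) :=
  VectorFourier.fourierIntegral_continuous Real.continuous_fourierChar
    (L := -innerₗ ℝ) (by simp only [LinearMap.neg_apply, innerₗ_apply_apply]; fun_prop) hf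

lemma norm_fourierInv_le (f : ℝ → ℂ) (x : ℝ) : ‖𝓕⁻ f x‖ ≤ ∫ ξ, ‖f ξ‖ :=
  VectorFourier.norm_fourierIntegral_le_integral_norm _ _ _ _ _

lemma bddMeas_fourierInv {f : ℝ → ℂ} (hf : Integrable f) : BddMeas (𝓕⁻ f) :=
  ⟨(continuous_fourierInv_of_integrable hf).measurable, _, norm_fourierInv_le f⟩

/-- The `L²` inverse transform is defined by density and the pointwise one by an integral. Both are
locally integrable, and against smooth compactly supported functions they agree: the first by
duality for tempered distributions, the second by Fubini. -/
lemma coe_fourierInv_ae {f : ComplexL2} (hf : Integrable f) :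
    ((𝓕⁻ f : ComplexL2) : ℝ → ℂ) =ᵐ[volume] 𝓕⁻ (f : ℝ → ℂ) := by
  refine ae_eq_of_integral_contDiff_smul_eq
    ((Lp.memLp (𝓕⁻ f : ComplexL2)).locallyIntegrable (by norm_num))
    (continuous_fourierInv_of_integrable hf).locallyIntegrable fun g hg hgc => ?_
  have hc : HasCompactSupport (fun x => (g x : ℂ)) :=
    hgc.comp_left (g := fun r : ℝ => (r : ℂ)) Complex.ofReal_zero
  have hs : ContDiff ℝ ((⊤ : ℕ∞) : WithTop ℕ∞) (fun x => (g x : ℂ)) :=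
    Complex.ofRealCLM.contDiff.comp hg
  have h := congrArg (fun T : TemperedDistribution ℝ ℂ => T (hc.toSchwartzMap hs))
    (Lp.fourierInv_toTemperedDistribution_eq f)
  simp only [TemperedDistribution.fourierInv_apply, Lp.toTemperedDistribution_apply] at h
  have hflip : (-innerₗ ℝ : ℝ →ₗ[ℝ] ℝ →ₗ[ℝ] ℝ).flip = -innerₗ ℝ := by
    ext; simp
  have h2 : ∫ x : ℝ, (𝓕⁻ (hc.toSchwartzMap hs)) x • f x
      = ∫ x : ℝ, (hc.toSchwartzMap hs) x • 𝓕⁻ (f : ℝ → ℂ) x := by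
    have := VectorFourier.integral_fourierIntegral_smul_eq_flip (L := -innerₗ ℝ)
      (μ := volume) (ν := volume) Real.continuous_fourierChar
      (by simp only [LinearMap.neg_apply, innerₗ_apply_apply]; fun_prop)
      (hc.toSchwartzMap hs).integrable hf
    rw [hflip] at this
    rw [SchwartzMap.fourierInv_coe]
    exact this
  rw [h2] at h
  simpa using h.symm

lemma fourierInv_conv {f g : ℝ → ℂ} (hf : Integrable f) (hg : Integrable g) (x : ℝ) :
    𝓕⁻ (conv f g) x = 𝓕⁻ f x * 𝓕⁻ g x := by
  have h := Real.fourier_mul_convolution_eq (R := ℂ) hf hg (-x)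
  have e : convolution f g (ContinuousLinearMap.mul ℂ ℂ) volume = conv f g := by
    ext a
    rw [conv_comm, convolution, conv]
    congr 1
    ext b
    simp [mul_comm]
  rw [e] at h
  simpa only [Real.fourierInv_eq_fourier_neg] using h

lemma integrable_conv_of_integrable {f g : ComplexL2} (hf : Integrable f) (hg : Integrable g) :
    Integrable (conv f g) := by
  refine ⟨(stronglyMeasurable_conv (Lp.stronglyMeasurable f)
    (Lp.stronglyMeasurable g)).aestronglyMeasurable, ?_⟩
  refine lt_of_le_of_lt (lintegral_mono fun a => enorm_conv_le f g a) ?_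
  rw [lintegral_young_one (fun ξ => ‖f ξ‖ₑ) (fun ξ => ‖g ξ‖ₑ) (measurable_enorm_coe f)
    (measurable_enorm_coe g)]
  exact ENNReal.mul_lt_top hf.2 hg.2

/-- The inverse Fourier transform on `L²` as a real-linear isometry. -/
def invF : ComplexL2 →L[ℝ] ComplexL2 :=
  (((Lp.fourierTransformₗᵢ ℝ ℂ).symm : ComplexL2 →L[ℂ] ComplexL2)).restrictScalars ℝ

lemma invF_apply (f : ComplexL2) : invF f = 𝓕⁻ f := rfl

lemma norm_invF (f : ComplexL2) : ‖invF f‖ = ‖f‖ := (Lp.fourierTransformₗᵢ ℝ ℂ).symm.norm_map f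

lemma invF_injective : Function.Injective invF := (Lp.fourierTransformₗᵢ ℝ ℂ).symm.injective

lemma invF_fourier (f : ComplexL2) : invF (𝓕 f) = f :=
  (Lp.fourierTransformₗᵢ ℝ ℂ).symm_apply_apply f

lemma inner_invF (f g : ComplexL2) : inner ℝ (invF f) (invF g) = inner ℝ f g := by
  rw [real_inner_eq_norm_add_mul_self_sub_norm_mul_self_sub_norm_mul_self_div_two,
    real_inner_eq_norm_add_mul_self_sub_norm_mul_self_sub_norm_mul_self_div_two,
    ← map_add, norm_invF, norm_invF, norm_invF]

/-- The convolution theorem. -/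
lemma invF_convOp {f : ComplexL2} (hf : Integrable f) (g : ComplexL2) :
    invF (convOp f g) = mulOp (𝓕⁻ (f : ℝ → ℂ)) (invF g) := by
  -- The pointwise convolution theorem needs both factors integrable. Both sides are continuous in
  -- `g`, so Schwartz functions suffice.
  have hd := SchwartzMap.denseRange_toLpCLM (E := ℝ) (F := ℂ) (p := 2) (μ := volume)
    ENNReal.ofNat_ne_top
  refine DenseRange.induction_on
    (p := fun g => invF (convOp f g) = mulOp (𝓕⁻ (f : ℝ → ℂ)) (invF g)) hd g
    (isClosed_eq (by fun_prop) (by fun_prop)) fun χ => ?_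
  set G : ComplexL2 := SchwartzMap.toLpCLM ℝ ℂ 2 volume χ with hG
  have hGχ : (G : ℝ → ℂ) =ᵐ[volume] χ := χ.coeFn_toLp 2 volume
  have hGi : Integrable G := χ.integrable.congr hGχ.symm
  have hci : Integrable (convOp f G) :=
    (integrable_conv_of_integrable hf hGi).congr (convOp_ae hf G).symm
  apply Lp.ext
  filter_upwards [coe_fourierInv_ae hci, mulOp_ae (bddMeas_fourierInv hf) (invF G),
    coe_fourierInv_ae hGi] with x h1 h2 h3
  rw [h2, invF_apply, h1, invF_apply, h3, ← fourierInv_conv hf hGi]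
  rw [fourierInv_apply_eq, fourierInv_apply_eq]
  apply integral_congr_ae
  filter_upwards [convOp_ae hf G] with ξ hξ
  rw [hξ]

/-- In physical space both operators are multiplications by functions. -/
lemma convOp_comm {f f' : ComplexL2} (hf : Integrable f) (hf' : Integrable f') (g : ComplexL2) :
    convOp f (convOp f' g) = convOp f' (convOp f g) := by
  apply invF_injective
  rw [invF_convOp hf, invF_convOp hf', invF_convOp hf', invF_convOp hf,
    mulOp_mulOp (bddMeas_fourierInv hf) (bddMeas_fourierInv hf'),
    mulOp_mulOp (bddMeas_fourierInv hf') (bddMeas_fourierInv hf)]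
  congr 2
  ext ξ
  ring

/-! ### Hermitian functions: the Fourier transforms of real functions -/

/-- `f ↦ conj f(-·)`. -/
def reflConj : ComplexL2 →L[ℝ] ComplexL2 :=
  LinearMap.mkContinuous
    { toFun := fun f => (((Lp.memLp f).comp_measurePreserving
          (Measure.measurePreserving_neg volume)).star).toLp _
      map_add' := fun f g => by
        have hn := (Measure.measurePreserving_neg (volume : Measure ℝ)).quasiMeasurePreserving
        apply Lp.ext
        refine (MemLp.coeFn_toLp _).trans ?_
        refine EventuallyEq.trans ?_ (Lp.coeFn_add _ _).symm
        filter_upwards [MemLp.coeFn_toLp (((Lp.memLp f).comp_measurePreserving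
          (Measure.measurePreserving_neg volume)).star), MemLp.coeFn_toLp
          (((Lp.memLp g).comp_measurePreserving (Measure.measurePreserving_neg volume)).star),
          hn.ae (Lp.coeFn_add f g)] with ξ h1 h2 h3
        rw [Pi.add_apply, h1, h2]
        simp only [Pi.star_apply, Function.comp_apply]
        rw [h3, Pi.add_apply, star_add]
      map_smul' := fun c f => by
        have hn := (Measure.measurePreserving_neg (volume : Measure ℝ)).quasiMeasurePreserving
        apply Lp.ext
        refine (MemLp.coeFn_toLp _).trans ?_
        refine EventuallyEq.trans ?_ (Lp.coeFn_smul _ _).symm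
        filter_upwards [MemLp.coeFn_toLp (((Lp.memLp f).comp_measurePreserving
          (Measure.measurePreserving_neg volume)).star),
          hn.ae (Lp.coeFn_smul c f)] with ξ h1 h3
        rw [Pi.smul_apply, h1]
        simp only [Pi.star_apply, Function.comp_apply]
        rw [h3, Pi.smul_apply, star_smul, RingHom.id_apply]
        simp }
    1 (fun f => by
      rw [one_mul]
      simp only [LinearMap.coe_mk, AddHom.coe_mk]
      rw [Lp.norm_toLp, Lp.norm_def]
      refine ENNReal.toReal_mono (Lp.eLpNorm_ne_top f) (le_of_eq ?_)
      have h1 : eLpNorm (star ((f : ℝ → ℂ) ∘ fun x => -x)) 2 volume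
          = eLpNorm ((f : ℝ → ℂ) ∘ fun x => -x) 2 volume :=
        eLpNorm_congr_norm_ae (ae_of_all _ fun x => by simp)
      rw [h1]
      exact eLpNorm_comp_measurePreserving (Lp.memLp f).aestronglyMeasurable
        (Measure.measurePreserving_neg volume))

lemma reflConj_ae (f : ComplexL2) :
    reflConj f =ᵐ[volume] fun ξ => (starRingEnd ℂ) (f (-ξ)) :=
  MemLp.coeFn_toLp (((Lp.memLp f).comp_measurePreserving
          (Measure.measurePreserving_neg volume)).star)

/-- `f` is the Fourier transform of a real function. -/
def Herm (f : ComplexL2) : Prop := reflConj f = f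

lemma Herm.ae {f : ComplexL2} (h : Herm f) : ∀ᵐ ξ : ℝ, (starRingEnd ℂ) (f (-ξ)) = f ξ := by
  filter_upwards [reflConj_ae f] with ξ h1
  rw [← h1, h]

lemma reflConj_reflConj (f : ComplexL2) : reflConj (reflConj f) = f := by
  apply Lp.ext
  filter_upwards [reflConj_ae (reflConj f),
    (Measure.measurePreserving_neg (volume : Measure ℝ)).quasiMeasurePreserving.ae (reflConj_ae f)]
    with ξ h1 h2
  rw [h1, h2]
  simp

lemma norm_reflConj_le (f : ComplexL2) : ‖reflConj f‖ ≤ ‖f‖ := by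
  simpa using LinearMap.mkContinuous_norm_le _ zero_le_one _ |> (reflConj).le_of_opNorm_le (x := f)

lemma reflConj_mulOp {m : ℝ → ℂ} (hm : BddMeas m) (hs : ∀ ξ, (starRingEnd ℂ) (m (-ξ)) = m ξ)
    (f : ComplexL2) : reflConj (mulOp m f) = mulOp m (reflConj f) := by
  apply Lp.ext
  filter_upwards [reflConj_ae (mulOp m f), mulOp_ae hm (reflConj f), reflConj_ae f,
    (Measure.measurePreserving_neg (volume : Measure ℝ)).quasiMeasurePreserving.ae (mulOp_ae hm f)]
    with ξ h1 h2 h3 h4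
  rw [h1, h2, h3, h4, map_mul, hs]

lemma integrable_reflConj {f : ComplexL2} (hf : Integrable f) : Integrable (reflConj f) := by
  have h1 : Integrable (fun ξ => f (-ξ)) := hf.comp_neg
  have h2 : Integrable (fun ξ => (starRingEnd ℂ) (f (-ξ))) :=
    (Complex.conjCLE : ℂ →L[ℝ] ℂ).integrable_comp h1
  exact h2.congr (reflConj_ae f).symm

lemma reflConj_convOp {f : ComplexL2} (hf : Integrable f) (g : ComplexL2) :
    reflConj (convOp f g) = convOp (reflConj f) (reflConj g) := by
  apply Lp.ext
  filter_upwards [reflConj_ae (convOp f g), convOp_ae (integrable_reflConj hf) (reflConj g),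
    (Measure.measurePreserving_neg (volume : Measure ℝ)).quasiMeasurePreserving.ae (convOp_ae hf g)]
    with a h1 h2 h4
  rw [h1, h2, h4, conv_congr (reflConj_ae f) (reflConj_ae g), conv, conv, ← integral_conj,
    ← integral_neg_eq_self]
  congr 1
  ext b
  rw [map_mul]
  congr 3
  ring

lemma fourierInv_real {f : ComplexL2} (h : Herm f) (x : ℝ) :
    (starRingEnd ℂ) (𝓕⁻ (f : ℝ → ℂ) x) = 𝓕⁻ (f : ℝ → ℂ) x := by
  rw [fourierInv_apply_eq, ← integral_conj, ← integral_neg_eq_self]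
  apply integral_congr_ae
  filter_upwards [h.ae] with ξ h1
  rw [map_mul, h1, ← Complex.exp_conj]
  congr 2
  simp only [map_mul, Complex.conj_ofReal, Complex.conj_I, map_ofNat]
  push_cast
  ring

/-- In physical space this is multiplication by a real function, which is symmetric. -/
lemma inner_convOp_left {f : ComplexL2} (hf : Integrable f) (hh : Herm f) (g g' : ComplexL2) :
    inner ℝ (convOp f g) g' = inner ℝ g (convOp f g') := by
  rw [← inner_invF, invF_convOp hf, inner_mulOp_left (bddMeas_fourierInv hf) (fourierInv_real hh),
    ← invF_convOp hf, inner_invF]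

/-- By Plancherel and the convolution theorem, `g ↦ g + f * g` is multiplication by `1 + 𝓕⁻ f` in
physical space, so a pointwise lower bound becomes a lower bound of the quadratic form. Only the
real part of `𝓕⁻ f` enters the real inner product. -/
lemma coercive_of_fourierInv_ge {f : ComplexL2} (hf : Integrable f) {h : ℝ}
    (hge : ∀ᵐ x : ℝ, h ≤ 1 + (𝓕⁻ (f : ℝ → ℂ) x).re) (g : ComplexL2) :
    h * ‖g‖ ^ 2 ≤ inner ℝ (g + convOp f g) g := by
  have key : ∀ u : ComplexL2, h * ‖u‖ ^ 2 ≤ inner ℝ (u + mulOp (𝓕⁻ (f : ℝ → ℂ)) u) u := by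
    intro u
    rw [← real_inner_self_eq_norm_sq, ← real_inner_smul_left, L2.inner_def, L2.inner_def]
    refine integral_mono_ae (L2.integrable_inner _ _) (L2.integrable_inner _ _) ?_
    filter_upwards [hge, Lp.coeFn_smul h u, Lp.coeFn_add u (mulOp (𝓕⁻ (f : ℝ → ℂ)) u),
      mulOp_ae (bddMeas_fourierInv hf) u] with x h1 h2 h3 h4
    rw [h2, h3, Pi.smul_apply, Pi.add_apply, h4]
    simp only [Complex.inner, Complex.mul_re, Complex.conj_re, Complex.conj_im, Complex.add_re,
      Complex.add_im, Complex.mul_im, Complex.real_smul, Complex.ofReal_re, Complex.ofReal_im]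
    nlinarith [sq_nonneg (u x).re, sq_nonneg (u x).im,
      mul_nonneg (sub_nonneg.2 h1) (add_nonneg (sq_nonneg (u x).re) (sq_nonneg (u x).im))]
  have := key (invF g)
  rwa [norm_invF, ← invF_convOp hf, ← map_add, inner_invF] at this

/-- Pointwise complex conjugation on `L²`. -/
def conjL2 : ComplexL2 →L[ℝ] ComplexL2 :=
  (Complex.conjCLE : ℂ →L[ℝ] ℂ).compLpL 2 volume

lemma conjL2_ae (f : ComplexL2) : conjL2 f =ᵐ[volume] fun x => (starRingEnd ℂ) (f x) :=
  ContinuousLinearMap.coeFn_compLpL (Complex.conjCLE : ℂ →L[ℝ] ℂ) f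

lemma conjL2_invF (f : ComplexL2) : conjL2 (invF f) = invF (reflConj f) := by
  have hd := SchwartzMap.denseRange_toLpCLM (E := ℝ) (F := ℂ) (p := 2) (μ := volume)
    ENNReal.ofNat_ne_top
  refine DenseRange.induction_on
    (p := fun f => conjL2 (invF f) = invF (reflConj f)) hd f
    (isClosed_eq (by fun_prop) (by fun_prop)) fun χ => ?_
  set G : ComplexL2 := SchwartzMap.toLpCLM ℝ ℂ 2 volume χ with hG
  have hGχ : (G : ℝ → ℂ) =ᵐ[volume] χ := χ.coeFn_toLp 2 volume
  have hGi : Integrable G := χ.integrable.congr hGχ.symm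
  apply Lp.ext
  filter_upwards [conjL2_ae (invF G), coe_fourierInv_ae hGi,
    coe_fourierInv_ae (integrable_reflConj hGi)] with x h1 h2 h3
  rw [h1, invF_apply, h2, invF_apply, h3, fourierInv_apply_eq, fourierInv_apply_eq,
    ← integral_conj, ← integral_neg_eq_self]
  apply integral_congr_ae
  filter_upwards [reflConj_ae G] with ξ hξ
  rw [hξ, map_mul, ← Complex.exp_conj]
  congr 2
  simp only [map_mul, Complex.conj_ofReal, Complex.conj_I, map_ofNat]
  push_cast
  ring

lemma complexify_ae (f : RealL2) : complexify f =ᵐ[volume] fun x => (f x : ℂ) :=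
  ContinuousLinearMap.coeFn_compLp Complex.ofRealCLM f

lemma conjL2_complexify (f : RealL2) : conjL2 (complexify f) = complexify f := by
  apply Lp.ext
  filter_upwards [conjL2_ae (complexify f), complexify_ae f] with x h1 h2
  rw [h1, h2]
  simp

lemma invF_fourier_real (f : RealL2) : invF (fourier f) = complexify f := invF_fourier _

lemma herm_fourier (f : RealL2) : Herm (fourier f) := by
  apply invF_injective
  rw [← conjL2_invF, invF_fourier_real, conjL2_complexify]

/-- The real part of the inverse Fourier transform. -/
def realInvF : ComplexL2 →L[ℝ] RealL2 :=
  (Complex.reCLM.compLpL 2 volume).comp invF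

lemma fourier_realInvF {f : ComplexL2} (hf : Herm f) : fourier (realInvF f) = f := by
  apply invF_injective
  rw [invF_fourier_real]
  apply Lp.ext
  filter_upwards [complexify_ae (realInvF f),
    ContinuousLinearMap.coeFn_compLpL Complex.reCLM (invF f), conjL2_ae (invF f)] with x h1 h2 h3
  rw [conjL2_invF, hf] at h3
  rw [h1]
  simp only [realInvF, ContinuousLinearMap.comp_apply]
  rw [h2, Complex.reCLM_apply]
  exact Complex.conj_eq_iff_re.1 h3.symm

lemma fourier_injective : Function.Injective fourier := by
  intro f g h
  have h2 : complexify f = complexify g := by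
    rw [← invF_fourier_real, ← invF_fourier_real, h]
  apply Lp.ext
  filter_upwards [complexify_ae f, complexify_ae g] with x h3 h4
  rw [h2, h4] at h3
  exact_mod_cast h3.symm

/-- The Fourier transform on real `L²` as a continuous real-linear map. -/
def fourierL : RealL2 →L[ℝ] ComplexL2 :=
  (((Lp.fourierTransformₗᵢ ℝ ℂ) : ComplexL2 →L[ℂ] ComplexL2).restrictScalars ℝ).comp
    (Complex.ofRealCLM.compLpL 2 volume)

/-- The Fourier transform of a product is a convolution. -/
lemma isProduct_iff {f g p : RealL2} (hf : Integrable (fourier f)) :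
    IsProduct f g p ↔ fourier p = convOp (fourier f) (fourier g) := by
  have h1 : ((complexify f : ComplexL2) : ℝ → ℂ) =ᵐ[volume] 𝓕⁻ (fourier f : ℝ → ℂ) := by
    rw [← invF_fourier_real]
    exact coe_fourierInv_ae hf
  have h2 : (invF (convOp (fourier f) (fourier g)) : ℝ → ℂ) =ᵐ[volume]
      fun x => (f x : ℂ) * g x := by
    rw [invF_convOp hf]
    filter_upwards [mulOp_ae (bddMeas_fourierInv hf) (invF (fourier g)), h1, complexify_ae f,
      complexify_ae g] with x a1 a2 a3 a4
    rw [a1, ← a2, a3, invF_fourier_real, a4]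
  constructor
  · intro h
    apply invF_injective
    rw [invF_fourier_real]
    apply Lp.ext
    filter_upwards [h2, complexify_ae p, h] with x a1 a2 a3
    rw [a1, a2, a3]
    push_cast
    ring
  · intro h
    rw [← h, invF_fourier_real] at h2
    unfold IsProduct
    filter_upwards [h2, complexify_ae p] with x a1 a2
    rw [a2] at a1
    exact_mod_cast a1

/-! ### The dispersive symbol -/

/-- The angular frequency. -/
def freq (ξ : ℝ) : ℝ := 2 * Real.pi * ξ

lemma freq_sub (a b : ℝ) : freq (a - b) = freq a - freq b := by simp only [freq]; ring

lemma freq_neg (a : ℝ) : freq (-a) = -freq a := by simp only [freq]; ring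

lemma measurable_freq : Measurable freq := by unfold freq; fun_prop

lemma abs_abs_freq_sub_le (a b : ℝ) : |(|freq a| - |freq b|)| ≤ |freq (a - b)| := by
  rw [freq_sub]; exact abs_abs_sub_abs_le _ _

lemma abs_freq_le_add (a b : ℝ) : |freq a| ≤ |freq (a - b)| + |freq b| := by
  rw [freq_sub]
  calc |freq a| = |(freq a - freq b) + freq b| := by ring_nf
    _ ≤ _ := abs_add_le _ _

/-- This identity and the next write `x coth x ± x` through `x / (1 - e^{-2x})` and `x / (e^{2x} -
1)`. Their monotonicity follows from convexity of the exponential, and it is the Lipschitz bound for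
`x coth x`. -/
lemma div_tanh_add_self {x : ℝ} (hx : 0 < x) :
    x / Real.tanh x + x = 2 * (x / (1 - Real.exp (-(2 * x)))) := by
  have h1 : Real.exp (-(2 * x)) < 1 := by simpa using Real.exp_lt_exp.2 (show -(2 * x) < 0 by linarith)
  have hs : 0 < Real.sinh x := Real.sinh_pos_iff.2 hx
  have hc := Real.cosh_pos x
  have h2 : Real.exp (-(2 * x)) = Real.exp (-x) * Real.exp (-x) := by rw [← Real.exp_add]; ring_nf
  have h3 : Real.exp x * Real.exp (-x) = 1 := by rw [← Real.exp_add]; simp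
  rw [Real.tanh_eq_sinh_div_cosh, div_div_eq_mul_div, div_add' _ _ _ hs.ne', mul_div_assoc',
    div_eq_div_iff hs.ne' (by linarith), h2, Real.sinh_eq, Real.cosh_eq]
  linear_combination (-x * Real.exp (-x)) * h3

lemma div_tanh_sub_self {x : ℝ} (hx : 0 < x) :
    x / Real.tanh x - x = 2 * (x / (Real.exp (2 * x) - 1)) := by
  have h1 : 1 < Real.exp (2 * x) := Real.one_lt_exp_iff.2 (by linarith)
  have hs : 0 < Real.sinh x := Real.sinh_pos_iff.2 hx
  have h2 : Real.exp (2 * x) = Real.exp x * Real.exp x := by rw [← Real.exp_add]; ring_nf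
  have h3 : Real.exp x * Real.exp (-x) = 1 := by rw [← Real.exp_add]; simp
  rw [Real.tanh_eq_sinh_div_cosh, div_div_eq_mul_div, div_sub' hs.ne', mul_div_assoc',
    div_eq_div_iff hs.ne' (by linarith), h2, Real.sinh_eq, Real.cosh_eq]
  linear_combination (x * Real.exp x) * h3

lemma sinh_le_mul_cosh {x : ℝ} (hx : 0 ≤ x) : Real.sinh x ≤ x * Real.cosh x := by
  have h : MonotoneOn (fun x => x * Real.cosh x - Real.sinh x) (Ici 0) := by
    refine monotoneOn_of_deriv_nonneg (convex_Ici 0) (by fun_prop) (by fun_prop) fun y hy => ?_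
    rw [interior_Ici] at hy
    have : HasDerivAt (fun x => x * Real.cosh x - Real.sinh x)
        (1 * Real.cosh y + y * Real.sinh y - Real.cosh y) y :=
      ((hasDerivAt_id y).mul (Real.hasDerivAt_cosh y)).sub (Real.hasDerivAt_sinh y)
    rw [this.deriv]
    have hp := mul_nonneg (le_of_lt hy) (Real.sinh_nonneg_iff.2 (le_of_lt hy))
    linarith
  have := h (mem_Ici.2 le_rfl) hx hx
  simp at this
  linarith

/-- `x coth x`, extended by `1` at `0`. -/
def xcoth (x : ℝ) : ℝ := if x = 0 then 1 else x / Real.tanh x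

lemma one_le_xcoth {x : ℝ} (hx : 0 ≤ x) : 1 ≤ xcoth x := by
  unfold xcoth
  split_ifs with h
  · exact le_rfl
  · have hx' : 0 < x := lt_of_le_of_ne hx (Ne.symm h)
    have ht : 0 < Real.tanh x := by
      rw [Real.tanh_eq_sinh_div_cosh]
      exact div_pos (Real.sinh_pos_iff.2 hx') (Real.cosh_pos x)
    rw [le_div_iff₀ ht, one_mul, Real.tanh_eq_sinh_div_cosh, div_le_iff₀ (Real.cosh_pos x)]
    exact sinh_le_mul_cosh hx

lemma self_le_xcoth {x : ℝ} (hx : 0 ≤ x) : x ≤ xcoth x := by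
  unfold xcoth
  split_ifs with h
  · rw [h]; norm_num
  · have hx' : 0 < x := lt_of_le_of_ne hx (Ne.symm h)
    have h1 : 1 < Real.exp (2 * x) := Real.one_lt_exp_iff.2 (by linarith)
    have := div_tanh_sub_self hx'
    have h2 : 0 ≤ x / (Real.exp (2 * x) - 1) := div_nonneg hx (by linarith)
    linarith

lemma xcoth_le {x : ℝ} (hx : 0 ≤ x) : xcoth x ≤ 1 + x := by
  unfold xcoth
  split_ifs with h
  · rw [h]; norm_num
  · have hx' : 0 < x := lt_of_le_of_ne hx (Ne.symm h)
    have h1 : 1 < Real.exp (2 * x) := Real.one_lt_exp_iff.2 (by linarith)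
    have := div_tanh_sub_self hx'
    have h2 : x / (Real.exp (2 * x) - 1) ≤ 1 / 2 := by
      rw [div_le_iff₀ (by linarith)]
      have := Real.add_one_le_exp (2 * x)
      linarith
    linarith

/-- The function `x coth x + x` is increasing and `x coth x - x` is decreasing, and together these
say that `x coth x` is 1-Lipschitz. -/
lemma abs_xcoth_sub_le_of_le {x y : ℝ} (hx : 0 ≤ x) (hxy : x ≤ y) :
    |xcoth y - xcoth x| ≤ y - x := by
  rcases hx.eq_or_lt with rfl | hx'
  · have h0 : xcoth 0 = 1 := by simp [xcoth]
    rw [h0, abs_le]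
    have := one_le_xcoth hxy
    have := xcoth_le hxy
    constructor <;> linarith
  · have hy' : 0 < y := hx'.trans_le hxy
    have e1 : xcoth x = x / Real.tanh x := by rw [xcoth, if_neg hx'.ne']
    have e2 : xcoth y = y / Real.tanh y := by rw [xcoth, if_neg hy'.ne']
    have hX : 1 < Real.exp (2 * x) := Real.one_lt_exp_iff.2 (by linarith)
    have hY : 1 < Real.exp (2 * y) := Real.one_lt_exp_iff.2 (by linarith)
    have hX' : Real.exp (-(2 * x)) < 1 := by simpa using Real.exp_lt_exp.2 (show -(2 * x) < 0 by linarith)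
    have hY' : Real.exp (-(2 * y)) < 1 := by simpa using Real.exp_lt_exp.2 (show -(2 * y) < 0 by linarith)
    -- The slopes of the secants of `exp` through the origin are increasing, on both sides of `0`.
    have c1 := convexOn_exp.secant_mono (a := 0) (x := 2 * x) (y := 2 * y) (mem_univ _)
      (mem_univ _) (mem_univ _) (by linarith) (by linarith) (by linarith)
    have c2 := convexOn_exp.secant_mono (a := 0) (x := -(2 * y)) (y := -(2 * x)) (mem_univ _)
      (mem_univ _) (mem_univ _) (by linarith) (by linarith) (by linarith)
    simp only [Real.exp_zero, sub_zero] at c1 c2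
    rw [div_le_div_iff₀ (by linarith) (by linarith)] at c1
    rw [← neg_div_neg_eq, ← neg_div_neg_eq (Real.exp (-(2 * x)) - 1), neg_neg, neg_neg,
      div_le_div_iff₀ (by linarith) (by linarith)] at c2
    have m1 : y / (Real.exp (2 * y) - 1) ≤ x / (Real.exp (2 * x) - 1) := by
      rw [div_le_div_iff₀ (by linarith) (by linarith)]; linarith
    have m2 : x / (1 - Real.exp (-(2 * x))) ≤ y / (1 - Real.exp (-(2 * y))) := by
      rw [div_le_div_iff₀ (by linarith) (by linarith)]; linarith
    have s1 := div_tanh_sub_self hx'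
    have s2 := div_tanh_sub_self hy'
    have a1 := div_tanh_add_self hx'
    have a2 := div_tanh_add_self hy'
    rw [e1, e2, abs_le]
    constructor <;> linarith

lemma abs_xcoth_sub_le {x y : ℝ} (hx : 0 ≤ x) (hy : 0 ≤ y) : |xcoth y - xcoth x| ≤ |y - x| := by
  rcases le_total x y with h | h
  · rw [abs_of_nonneg (sub_nonneg.2 h)]; exact abs_xcoth_sub_le_of_le hx h
  · rw [abs_sub_comm, abs_sub_comm y, abs_of_nonneg (sub_nonneg.2 h)]
    exact abs_xcoth_sub_le_of_le hy h

/-- `√μ |ξ|` in terms of the Fourier variable. -/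
def sfreq (μ ξ : ℝ) : ℝ := Real.sqrt μ * |freq ξ|

lemma sfreq_nonneg (μ ξ : ℝ) : 0 ≤ sfreq μ ξ := by unfold sfreq; positivity

/-- The symbol of `T_μ(D)^{-1/2}`. -/
def psi (μ ξ : ℝ) : ℝ := Real.sqrt (xcoth (sfreq μ ξ))

/-- The symbol of `T_μ(D)^{1/2}`. -/
def phi (μ ξ : ℝ) : ℝ := (psi μ ξ)⁻¹

lemma psi_sq (μ ξ : ℝ) : psi μ ξ ^ 2 = xcoth (sfreq μ ξ) :=
  Real.sq_sqrt (zero_le_one.trans (one_le_xcoth (sfreq_nonneg μ ξ)))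

lemma one_le_psi (μ ξ : ℝ) : 1 ≤ psi μ ξ := Real.one_le_sqrt.2 (one_le_xcoth (sfreq_nonneg μ ξ))

lemma psi_pos (μ ξ : ℝ) : 0 < psi μ ξ := zero_lt_one.trans_le (one_le_psi μ ξ)

lemma phi_pos (μ ξ : ℝ) : 0 < phi μ ξ := inv_pos.2 (psi_pos μ ξ)

lemma phi_le_one (μ ξ : ℝ) : phi μ ξ ≤ 1 := inv_le_one_of_one_le₀ (one_le_psi μ ξ)

lemma psi_mul_phi (μ ξ : ℝ) : psi μ ξ * phi μ ξ = 1 := mul_inv_cancel₀ (psi_pos μ ξ).ne'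

lemma psi_neg (μ ξ : ℝ) : psi μ (-ξ) = psi μ ξ := by simp [psi, sfreq, freq_neg]

lemma phi_neg (μ ξ : ℝ) : phi μ (-ξ) = phi μ ξ := by simp [phi, psi_neg]

lemma phi_sq {μ : ℝ} (hμ : 0 < μ) (ξ : ℝ) : phi μ ξ ^ 2 = symbolT μ (freq ξ) := by
  rw [phi, inv_pow, psi_sq, xcoth, symbolT]
  have h0 : sfreq μ ξ = 0 ↔ freq ξ = 0 := by
    simp [sfreq, (Real.sqrt_pos.2 hμ).ne']
  by_cases h : freq ξ = 0
  · simp [h, h0.2 h]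
  · rw [if_neg (mt h0.1 h), if_neg h, inv_div]
    rfl

lemma measurable_xcoth : Measurable xcoth := by
  unfold xcoth
  refine Measurable.ite (measurableSet_singleton 0) measurable_const ?_
  refine measurable_id.div ?_
  have : Real.tanh = fun x => Real.sinh x / Real.cosh x := funext Real.tanh_eq_sinh_div_cosh
  rw [this]
  exact Real.measurable_sinh.div Real.measurable_cosh

lemma measurable_psi (μ : ℝ) : Measurable (psi μ) := by
  unfold psi sfreq
  exact (measurable_xcoth.comp (measurable_const.mul measurable_freq.abs)).sqrt

lemma measurable_phi (μ : ℝ) : Measurable (phi μ) := (measurable_psi μ).inv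

/-- The square `ψ²` is Lipschitz in `√μ|ξ|` and dominates `√μ|ξ|`, so the factor `√μ` produced by
the difference is consumed by the frequency. This makes the commutator of `T_μ(D)^{-1/2}` with a
function gain a derivative uniformly in `μ`. -/
lemma abs_psi_sub_mul_le (μ a b : ℝ) :
    |psi μ a - psi μ b| * |freq b| ≤ |freq (a - b)| * psi μ b := by
  have h1 := abs_xcoth_sub_le (sfreq_nonneg μ b) (sfreq_nonneg μ a)
  rw [← psi_sq, ← psi_sq] at h1
  have h2 : |sfreq μ a - sfreq μ b| ≤ Real.sqrt μ * |freq (a - b)| := by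
    rw [sfreq, sfreq, ← mul_sub, abs_mul, abs_of_nonneg (Real.sqrt_nonneg μ)]
    exact mul_le_mul_of_nonneg_left (abs_abs_freq_sub_le a b) (Real.sqrt_nonneg μ)
  have h3 : Real.sqrt μ * |freq b| ≤ psi μ b ^ 2 := by
    rw [psi_sq]; exact self_le_xcoth (sfreq_nonneg μ b)
  have ha := psi_pos μ a
  have hb := psi_pos μ b
  have h4 : psi μ a ^ 2 - psi μ b ^ 2 = (psi μ a - psi μ b) * (psi μ a + psi μ b) := by ring
  rw [h4, abs_mul, abs_of_pos (add_pos ha hb)] at h1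
  have h5 : |psi μ a - psi μ b| * psi μ b ≤ Real.sqrt μ * |freq (a - b)| := by
    refine le_trans ?_ (h1.trans h2)
    gcongr
    linarith
  -- The estimate is proved after multiplication by `ψ(b)`, which factors `ψ(a)² - ψ(b)²`, and the
  -- factor is cancelled at the end.
  have h6 : |psi μ a - psi μ b| * |freq b| * psi μ b ≤ |freq (a - b)| * psi μ b * psi μ b := by
    calc |psi μ a - psi μ b| * |freq b| * psi μ b
        = (|psi μ a - psi μ b| * psi μ b) * |freq b| := by ring
      _ ≤ (Real.sqrt μ * |freq (a - b)|) * |freq b| := by gcongr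
      _ = |freq (a - b)| * (Real.sqrt μ * |freq b|) := by ring
      _ ≤ |freq (a - b)| * psi μ b ^ 2 := by gcongr
      _ = _ := by ring
  exact le_of_mul_le_mul_right h6 hb

/-- Since `φ = 1/ψ`, the difference is that of `ψ` divided by `ψ(a) ψ(b)`. The bound for `ψ` pays
for `ψ(a)`, and `ψ(b) ≥ 1` is discarded. -/
lemma abs_phi_sub_mul_le (μ a b : ℝ) : |phi μ a - phi μ b| * |freq a| ≤ |freq (a - b)| := by
  have ha := psi_pos μ a
  have hb := psi_pos μ b
  have h := abs_psi_sub_mul_le μ b a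
  rw [phi, phi, inv_sub_inv ha.ne' hb.ne', abs_div, abs_of_pos (mul_pos ha hb), div_mul_eq_mul_div,
    div_le_iff₀ (mul_pos ha hb)]
  refine h.trans ?_
  rw [freq_sub, freq_sub, abs_sub_comm (freq b)]
  have := one_le_psi μ b
  calc |freq a - freq b| * psi μ a = |freq a - freq b| * (psi μ a * 1) := by ring
    _ ≤ _ := by gcongr

/-- Subadditivity of `√μ|ξ|` together with `max(1, x) ≤ x coth x ≤ 1 + x` gives the squared
inequality with constant `4`. -/
lemma psi_le_mul (μ a b : ℝ) : psi μ a ≤ 2 * (psi μ (a - b) * psi μ b) := by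
  have h1 : psi μ a ^ 2 ≤ (2 * (psi μ (a - b) * psi μ b)) ^ 2 := by
    rw [mul_pow, mul_pow, psi_sq, psi_sq, psi_sq]
    have u := sfreq_nonneg μ (a - b)
    have v := sfreq_nonneg μ b
    have w := xcoth_le (sfreq_nonneg μ a)
    have hadd : sfreq μ a ≤ sfreq μ (a - b) + sfreq μ b := by
      rw [sfreq, sfreq, sfreq, ← mul_add]
      gcongr
      exact abs_freq_le_add a b
    have a1 := one_le_xcoth u
    have a2 := self_le_xcoth u
    have b1 := one_le_xcoth v
    have b2 := self_le_xcoth v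
    nlinarith [mul_nonneg (sub_nonneg.2 a1) (sub_nonneg.2 b1)]
  exact (abs_le_of_sq_le_sq' h1
    (by have := psi_pos μ (a - b); have := psi_pos μ b; positivity)).2

/-! ### The cut-off symbol -/

/-- The frequency cut-off `max(0, 1 - δ|ξ|)`. -/
def cut (δ ξ : ℝ) : ℝ := max 0 (1 - δ * |freq ξ|)

lemma cut_nonneg (δ ξ : ℝ) : 0 ≤ cut δ ξ := le_max_left _ _

lemma cut_le_one {δ : ℝ} (hδ : 0 < δ) (ξ : ℝ) : cut δ ξ ≤ 1 :=
  max_le zero_le_one (by have := mul_nonneg hδ.le (abs_nonneg (freq ξ)); linarith)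

lemma measurable_cut (δ : ℝ) : Measurable (cut δ) := by
  unfold cut
  exact measurable_const.max (measurable_const.sub (measurable_const.mul measurable_freq.abs))

lemma cut_neg (δ ξ : ℝ) : cut δ (-ξ) = cut δ ξ := by simp [cut, freq_neg]

lemma cut_mul_freq_le {δ : ℝ} (hδ : 0 < δ) (ξ : ℝ) : cut δ ξ * |freq ξ| ≤ 1 / δ := by
  rw [le_div_iff₀ hδ]
  have h1 := cut_le_one hδ ξ
  have h0 := cut_nonneg δ ξ
  rcases le_total (δ * |freq ξ|) 1 with h | h
  · nlinarith [mul_nonneg hδ.le (abs_nonneg (freq ξ))]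
  · have : cut δ ξ = 0 := max_eq_left (by linarith)
    rw [this]; norm_num

/-- The bound does not involve `δ`: the cut-off has Lipschitz constant `δ`, but it varies only where
`|freq| ≤ 1/δ`. If only `b` lies in that region, the weight `|freq a|` is transferred to `b` at the
cost of `|freq (a - b)|`, which explains the factor `2`. -/
lemma abs_cut_sub_mul_le {δ : ℝ} (hδ : 0 < δ) (a b : ℝ) :
    |cut δ a - cut δ b| * |freq a| ≤ 2 * |freq (a - b)| := by
  have hlip : |cut δ a - cut δ b| ≤ δ * |freq (a - b)| := by
    calc |cut δ a - cut δ b| ≤ |(1 - δ * |freq a|) - (1 - δ * |freq b|)| := by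
          have := abs_max_sub_max_le_abs (1 - δ * |freq a|) (1 - δ * |freq b|) 0
          rw [max_comm, max_comm _ (0 : ℝ)] at this
          exact this
      _ = δ * |(|freq a| - |freq b|)| := by
          rw [show (1 - δ * |freq a|) - (1 - δ * |freq b|) = -(δ * (|freq a| - |freq b|)) by ring,
            abs_neg, abs_mul, abs_of_pos hδ]
      _ ≤ _ := mul_le_mul_of_nonneg_left (abs_abs_freq_sub_le a b) hδ.le
  rcases le_total (δ * |freq a|) 1 with h | h
  · calc |cut δ a - cut δ b| * |freq a| ≤ (δ * |freq (a - b)|) * |freq a| := by gcongr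
      _ = |freq (a - b)| * (δ * |freq a|) := by ring
      _ ≤ |freq (a - b)| * 1 := by gcongr
      _ ≤ _ := by linarith [abs_nonneg (freq (a - b))]
  · have ha : cut δ a = 0 := max_eq_left (by linarith)
    rw [ha] at hlip ⊢
    rw [zero_sub, abs_neg, abs_of_nonneg (cut_nonneg δ b)] at hlip ⊢
    have h1 := abs_freq_le_add a b
    have h2 := cut_le_one hδ b
    have h0 := cut_nonneg δ b
    have h3 : cut δ b * |freq b| ≤ |freq (a - b)| := by
      rcases le_total (δ * |freq b|) 1 with h' | h'
      · calc cut δ b * |freq b| ≤ (δ * |freq (a - b)|) * |freq b| := by gcongr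
          _ = |freq (a - b)| * (δ * |freq b|) := by ring
          _ ≤ |freq (a - b)| * 1 := by gcongr
          _ = _ := mul_one _
      · have hb : cut δ b = 0 := max_eq_left (by linarith)
        rw [hb, zero_mul]; exact abs_nonneg _
    calc cut δ b * |freq a| ≤ cut δ b * (|freq (a - b)| + |freq b|) := by gcongr
      _ = cut δ b * |freq (a - b)| + cut δ b * |freq b| := by ring
      _ ≤ 1 * |freq (a - b)| + |freq (a - b)| := by gcongr
      _ = _ := by ring

/-- Here `1 - cut = min(1, δ|ξ|)` is bounded by its square root. The half power is chosen because
after one derivative only `s - 1 > 1/2` derivatives are left to spend. -/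
lemma one_sub_cut_le {δ : ℝ} (hδ : 0 < δ) (ξ : ℝ) :
    1 - cut δ ξ ≤ Real.sqrt δ * Real.sqrt |freq ξ| := by
  rw [← Real.sqrt_mul hδ.le]
  have h0 : 0 ≤ δ * |freq ξ| := by positivity
  rcases le_total (δ * |freq ξ|) 1 with h | h
  · have : cut δ ξ = 1 - δ * |freq ξ| := max_eq_right (by linarith)
    rw [this, sub_sub_cancel]
    refine Real.le_sqrt_of_sq_le ?_
    nlinarith
  · have := cut_nonneg δ ξ
    have h2 : 1 ≤ Real.sqrt (δ * |freq ξ|) := Real.one_le_sqrt.2 h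
    linarith

/-! ### Weights -/

/-- Even weights, nondecreasing in `|ξ|`, of polynomial growth of order `n`. -/
structure IsWeight (n : ℕ) (w : ℝ → ℝ) : Prop where
  meas : Measurable w
  nonneg : ∀ ξ, 0 ≤ w ξ
  mono : ∀ a b, |a| ≤ |b| → w a ≤ w b
  growth : ∀ l a, 1 ≤ l → w (l * a) ≤ l ^ n * w a

lemma IsWeight.mul {n m : ℕ} {w v : ℝ → ℝ} (hw : IsWeight n w) (hv : IsWeight m v) :
    IsWeight (n + m) (fun ξ => w ξ * v ξ) where
  meas := hw.meas.mul hv.meas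
  nonneg ξ := mul_nonneg (hw.nonneg ξ) (hv.nonneg ξ)
  mono a b h := mul_le_mul (hw.mono a b h) (hv.mono a b h) (hv.nonneg a) (hw.nonneg b)
  growth l a hl := by
    calc w (l * a) * v (l * a) ≤ (l ^ n * w a) * (l ^ m * v a) :=
          mul_le_mul (hw.growth l a hl) (hv.growth l a hl) (hv.nonneg _)
            (mul_nonneg (by positivity) (hw.nonneg a))
      _ = _ := by ring

lemma IsWeight.mono_order {n m : ℕ} {w : ℝ → ℝ} (hw : IsWeight n w) (h : n ≤ m) :
    IsWeight m w where
  meas := hw.meas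
  nonneg := hw.nonneg
  mono := hw.mono
  growth l a hl := (hw.growth l a hl).trans
    (mul_le_mul_of_nonneg_right (pow_le_pow_right₀ hl h) (hw.nonneg a))

/-- A weight frozen beyond a frequency, which makes it bounded. -/
def capWeight (w : ℝ → ℝ) (r : ℝ) (ξ : ℝ) : ℝ := w (min |ξ| r)

lemma IsWeight.cap {n : ℕ} {w : ℝ → ℝ} (hw : IsWeight n w) {r : ℝ} (hr : 0 ≤ r) :
    IsWeight n (capWeight w r) where
  meas := hw.meas.comp (measurable_id.abs.min measurable_const)
  nonneg ξ := hw.nonneg _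
  mono a b h := hw.mono _ _ (by
    rw [abs_of_nonneg (le_min (abs_nonneg _) hr), abs_of_nonneg (le_min (abs_nonneg _) hr)]
    exact min_le_min_right _ h)
  growth l a hl := by
    have h0 : 0 ≤ min |a| r := le_min (abs_nonneg _) hr
    have hl0 : 0 ≤ l := by linarith
    refine le_trans (hw.mono _ (l * min |a| r) ?_) (hw.growth l _ hl)
    rw [abs_of_nonneg (le_min (abs_nonneg _) hr), abs_of_nonneg (mul_nonneg hl0 h0), abs_mul,
      abs_of_nonneg hl0, mul_min_of_nonneg _ _ hl0]
    refine min_le_min le_rfl ?_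
    nlinarith

lemma IsWeight.cap_le {n : ℕ} {w : ℝ → ℝ} (hw : IsWeight n w) {r : ℝ} (hr : 0 ≤ r) (ξ : ℝ) :
    capWeight w r ξ ≤ w ξ :=
  hw.mono _ _ (by rw [abs_of_nonneg (le_min (abs_nonneg _) hr)]; exact min_le_left _ _)

lemma IsWeight.cap_eq {n : ℕ} {w : ℝ → ℝ} (hw : IsWeight n w) {r ξ : ℝ} (h : |ξ| ≤ r) :
    capWeight w r ξ = w ξ := by
  rw [capWeight, min_eq_left h]
  exact le_antisymm (hw.mono _ _ (by simp)) (hw.mono _ _ (by simp))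

lemma IsWeight.cap_bdd {n : ℕ} {w : ℝ → ℝ} (hw : IsWeight n w) {r : ℝ} (hr : 0 ≤ r) (ξ : ℝ) :
    |capWeight w r ξ| ≤ w r := by
  rw [capWeight, abs_of_nonneg (hw.nonneg _)]
  refine hw.mono _ _ ?_
  rw [abs_of_nonneg (le_min (abs_nonneg _) hr), abs_of_nonneg hr]
  exact min_le_right _ _

/-- By convexity the power lies below its chord on `[0, 1]`. This plays the role of the mean value
theorem for weights that need not be differentiable. -/
lemma one_add_pow_sub_one_le {t : ℝ} (h0 : 0 ≤ t) (h1 : t ≤ 1) (n : ℕ) :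
    (1 + t) ^ n ≤ 1 + t * (2 ^ n - 1) := by
  induction n with
  | zero => simp
  | succ n ih =>
    have h2 : (1 : ℝ) ≤ 2 ^ n := one_le_pow₀ (by norm_num)
    calc (1 + t) ^ (n + 1) = (1 + t) ^ n * (1 + t) := pow_succ _ _
      _ ≤ (1 + t * (2 ^ n - 1)) * (1 + t) := by gcongr
      _ ≤ _ := by
        rw [pow_succ]
        nlinarith [mul_nonneg h0 (mul_nonneg (sub_nonneg.2 h1) (sub_nonneg.2 h2))]

lemma IsWeight.le_pow_mul {n : ℕ} {w : ℝ → ℝ} (hw : IsWeight n w) {l a b : ℝ} (hl : 1 ≤ l)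
    (h : |a| ≤ l * |b|) : w a ≤ l ^ n * w b :=
  (hw.mono a (l * b) (by rwa [abs_mul, abs_of_pos (zero_lt_one.trans_le hl)])).trans
    (hw.growth l b hl)

/-- A pointwise form of the Kato–Ponce commutator estimate: the derivative on the second factor is
moved to the first, or the whole weight is. The constant sees only the growth order `n`, so it is
the same for all truncations of a weight. -/
lemma IsWeight.abs_sub_mul_le {n : ℕ} {w : ℝ → ℝ} (hw : IsWeight n w) (a b : ℝ) :
    |w a - w b| * |freq b| ≤
      4 * 3 ^ n * (|freq (a - b)| * w b + w (a - b) * |freq b|) := by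
  have hf : ∀ x, |freq x| = 2 * Real.pi * |x| := fun x => by
    rw [freq, abs_mul, abs_of_pos (by positivity)]
  suffices h : |w a - w b| * |b| ≤ 4 * 3 ^ n * (|a - b| * w b + w (a - b) * |b|) by
    rw [hf, hf]
    have hp := Real.pi_pos
    calc |w a - w b| * (2 * Real.pi * |b|) = 2 * Real.pi * (|w a - w b| * |b|) := by ring
      _ ≤ 2 * Real.pi * (4 * 3 ^ n * (|a - b| * w b + w (a - b) * |b|)) := by gcongr
      _ = _ := by ring
  have wa := hw.nonneg a
  have wb := hw.nonneg b
  have wab := hw.nonneg (a - b)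
  have h3 : (1 : ℝ) ≤ 3 ^ n := one_le_pow₀ (by norm_num)
  have h23 : (2 : ℝ) ^ n ≤ 3 ^ n := pow_le_pow_left₀ (by norm_num) (by norm_num) n
  have htri : |a| ≤ |a - b| + |b| := by
    calc |a| = |(a - b) + b| := by ring_nf
      _ ≤ _ := abs_add_le _ _
  have htri' : |b| ≤ |a - b| + |a| := by
    calc |b| = |a - (a - b)| := by ring_nf
      _ ≤ |a| + |a - b| := abs_sub _ _
      _ = _ := add_comm _ _
  have hz : 0 ≤ |a - b| * w b := by positivity
  -- If `b` is not large compared with `a - b`, then `a` is not either, and both weights are bounded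
  -- by the weight at `a - b`. Otherwise `a` and `b` are comparable and the difference of weights is
  -- a true increment.
  rcases le_or_gt |b| (2 * |a - b|) with hfar | hnear
  · have e1 : w a ≤ 3 ^ n * w (a - b) := hw.le_pow_mul (by norm_num) (by linarith)
    have e2 : w b ≤ 3 ^ n * w (a - b) :=
      (hw.le_pow_mul (by norm_num) hfar).trans (by gcongr)
    have e3 : |w a - w b| ≤ 3 ^ n * w (a - b) := by
      rw [abs_le]; constructor <;> linarith
    calc |w a - w b| * |b| ≤ 3 ^ n * w (a - b) * |b| := by gcongr
      _ = 3 ^ n * (w (a - b) * |b|) := by ring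
      _ ≤ 4 * 3 ^ n * (|a - b| * w b + w (a - b) * |b|) := by
        have : 0 ≤ w (a - b) * |b| := by positivity
        nlinarith [mul_nonneg (zero_le_one.trans h3) this, mul_nonneg (zero_le_one.trans h3) hz]
  · have hb : 0 < |b| := by linarith [abs_nonneg (a - b)]
    have hmain : |w a - w b| * |b| ≤ 4 * 3 ^ n * (|a - b| * w b) := by
      rcases le_total |b| |a| with hba | hab
      · have e1 : w b ≤ w a := hw.mono _ _ hba
        -- The relative increment is at most `1` in the near region, where the growth bound can be
        -- linearised. The denominator is the smaller of the two moduli, so that the dilation factor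
        -- `1 + t` is at least `1`.
        set t := (|a| - |b|) / |b| with ht
        have t0 : 0 ≤ t := div_nonneg (by linarith) hb.le
        have t1 : t ≤ 1 := by rw [ht, div_le_one hb]; linarith
        have e2 : w a ≤ (1 + t) ^ n * w b := hw.le_pow_mul (by linarith) (by
          rw [ht, add_mul, div_mul_cancel₀ _ hb.ne']; linarith)
        have e3 := one_add_pow_sub_one_le t0 t1 n
        have e4 : w a - w b ≤ t * 2 ^ n * w b := by nlinarith [mul_nonneg t0 wb]
        have e5 : t * |b| ≤ |a - b| := by
          rw [ht, div_mul_cancel₀ _ hb.ne']; linarith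
        rw [abs_of_nonneg (by linarith)]
        calc (w a - w b) * |b| ≤ (t * 2 ^ n * w b) * |b| := by gcongr
          _ = 2 ^ n * ((t * |b|) * w b) := by ring
          _ ≤ 3 ^ n * (|a - b| * w b) := by gcongr
          _ ≤ _ := by nlinarith [mul_nonneg (zero_le_one.trans h3) hz]
      · have e1 : w a ≤ w b := hw.mono _ _ hab
        have ha : 0 < |a| := by linarith
        set t := (|b| - |a|) / |a| with ht
        have t0 : 0 ≤ t := div_nonneg (by linarith) ha.le
        have t1 : t ≤ 1 := by rw [ht, div_le_one ha]; linarith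
        have e2 : w b ≤ (1 + t) ^ n * w a := hw.le_pow_mul (by linarith) (by
          rw [ht, add_mul, div_mul_cancel₀ _ ha.ne']; linarith)
        have e3 := one_add_pow_sub_one_le t0 t1 n
        have e4 : w b - w a ≤ t * 2 ^ n * w a := by nlinarith [mul_nonneg t0 wa]
        have e5 : t * |b| ≤ 2 * |a - b| := by
          have : t * |a| ≤ |a - b| := by rw [ht, div_mul_cancel₀ _ ha.ne']; linarith
          have : |b| ≤ 2 * |a| := by linarith
          nlinarith
        rw [abs_sub_comm, abs_of_nonneg (by linarith)]
        calc (w b - w a) * |b| ≤ (t * 2 ^ n * w a) * |b| := by gcongr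
          _ = 2 ^ n * ((t * |b|) * w a) := by ring
          _ ≤ 3 ^ n * ((2 * |a - b|) * w b) := by gcongr
          _ ≤ _ := by nlinarith [mul_nonneg (zero_le_one.trans h3) hz]
    refine hmain.trans ?_
    gcongr
    have : 0 ≤ w (a - b) * |b| := by positivity
    linarith

lemma IsWeight.le_add {n : ℕ} {w : ℝ → ℝ} (hw : IsWeight n w) (a b : ℝ) :
    w a ≤ 2 ^ n * (w (a - b) + w b) := by
  have htri : |a| ≤ |a - b| + |b| := by
    calc |a| = |(a - b) + b| := by ring_nf
      _ ≤ _ := abs_add_le _ _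
  have := hw.nonneg (a - b)
  have := hw.nonneg b
  rcases le_total |a - b| |b| with h | h
  · calc w a ≤ 2 ^ n * w b := hw.le_pow_mul (by norm_num) (by linarith)
      _ ≤ _ := by gcongr; linarith
  · calc w a ≤ 2 ^ n * w (a - b) := hw.le_pow_mul (by norm_num) (by linarith)
      _ ≤ _ := by gcongr; linarith

/-- `(1 + |ξ|²)^{σ/2}` in terms of the Fourier variable. -/
def bracket (σ ξ : ℝ) : ℝ := (1 + freq ξ ^ 2) ^ (σ / 2)

lemma bracket_pos (σ ξ : ℝ) : 0 < bracket σ ξ := Real.rpow_pos_of_pos (by positivity) _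

lemma one_le_bracket {σ : ℝ} (hσ : 0 ≤ σ) (ξ : ℝ) : 1 ≤ bracket σ ξ :=
  Real.one_le_rpow (by nlinarith [sq_nonneg (freq ξ)]) (by positivity)

lemma bracket_mono {σ τ : ℝ} (h : σ ≤ τ) (ξ : ℝ) : bracket σ ξ ≤ bracket τ ξ :=
  Real.rpow_le_rpow_of_exponent_le (by nlinarith [sq_nonneg (freq ξ)]) (by linarith)

lemma bracket_add (σ τ ξ : ℝ) : bracket (σ + τ) ξ = bracket σ ξ * bracket τ ξ := by
  rw [bracket, bracket, bracket, ← Real.rpow_add (by positivity)]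
  congr 1; ring

lemma bracket_zero (ξ : ℝ) : bracket 0 ξ = 1 := by simp [bracket]

lemma bracket_neg_mul (σ ξ : ℝ) : bracket (-σ) ξ * bracket σ ξ = 1 := by
  rw [← bracket_add, neg_add_cancel, bracket_zero]

lemma bracket_neg (σ ξ : ℝ) : bracket σ (-ξ) = bracket σ ξ := by simp [bracket, freq_neg]

lemma bracket_sq (σ ξ : ℝ) : bracket σ ξ ^ 2 = (1 + freq ξ ^ 2) ^ σ := by
  rw [bracket, ← Real.rpow_natCast, ← Real.rpow_mul (by positivity)]
  norm_num

lemma measurable_bracket (σ : ℝ) : Measurable (bracket σ) := by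
  unfold bracket
  exact (measurable_const.add (measurable_freq.pow_const 2)).pow_const _

lemma abs_freq_le_bracket (ξ : ℝ) : |freq ξ| ≤ bracket 1 ξ := by
  rw [bracket, ← Real.sqrt_eq_rpow]
  refine Real.le_sqrt_of_sq_le ?_
  rw [sq_abs]; linarith

lemma isWeight_bracket {σ : ℝ} (hσ : 0 ≤ σ) {n : ℕ} (hn : σ ≤ n) : IsWeight n (bracket σ) where
  meas := measurable_bracket σ
  nonneg ξ := (bracket_pos σ ξ).le
  mono a b h := by
    refine Real.rpow_le_rpow (by positivity) ?_ (by positivity)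
    have : a ^ 2 ≤ b ^ 2 := sq_le_sq.2 h
    simp only [freq, mul_pow]
    gcongr
  growth l a hl := by
    have hl0 : 0 ≤ l := by linarith
    calc bracket σ (l * a) ≤ (l ^ 2 * (1 + freq a ^ 2)) ^ (σ / 2) := by
          refine Real.rpow_le_rpow (by positivity) ?_ (by positivity)
          have : freq (l * a) = l * freq a := by simp only [freq]; ring
          rw [this]
          nlinarith
      _ = l ^ σ * bracket σ a := by
          rw [Real.mul_rpow (by positivity) (by positivity), bracket, ← Real.rpow_natCast,
            ← Real.rpow_mul hl0]
          congr 2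
          push_cast
          ring
      _ ≤ _ := by
          gcongr
          · exact (bracket_pos σ a).le
          · rw [← Real.rpow_natCast]
            exact Real.rpow_le_rpow_of_exponent_le hl hn

/-- The weight `min(1, |ξ|/R)`, measuring high frequencies. -/
def tailWeight (R ξ : ℝ) : ℝ := min 1 (|freq ξ| / R)

lemma tailWeight_le_one (R ξ : ℝ) : tailWeight R ξ ≤ 1 := min_le_left _ _

lemma isWeight_tailWeight {R : ℝ} (hR : 0 < R) : IsWeight 1 (tailWeight R) where
  meas := measurable_const.min (measurable_freq.abs.div_const R)
  nonneg ξ := le_min zero_le_one (by positivity)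
  mono a b h := by
    refine min_le_min le_rfl ?_
    have : |freq a| ≤ |freq b| := by
      simp only [freq, abs_mul]
      gcongr
    gcongr
  growth l a hl := by
    have hl0 : 0 ≤ l := by linarith
    have : freq (l * a) = l * freq a := by simp only [freq]; ring
    rw [tailWeight, tailWeight, this, abs_mul, abs_of_nonneg hl0, pow_one,
      mul_min_of_nonneg _ _ hl0, mul_div_assoc]
    refine min_le_min ?_ le_rfl
    linarith

lemma isWeight_bracket_tail {σ R : ℝ} (hσ : 0 ≤ σ) {n : ℕ} (hn : σ ≤ n) (hR : 0 < R) :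
    IsWeight (n + 1) (fun ξ => bracket σ ξ * tailWeight R ξ) :=
  (isWeight_bracket hσ hn).mul (isWeight_tailWeight hR)

/-! ### An energy inequality for abstract symmetrizable systems -/

section Abstract

variable {E : Type*} [NormedAddCommGroup E] [InnerProductSpace ℝ E]

/-- With `B` skew and `K`, `M` symmetric, moving all operators to the other side of `⟨M B x, K x⟩`
reproduces this quantity with the opposite sign, up to the commutators `[B, M]` and `B [K, M]`. Thus
no unbounded factor remains: this is integration by parts in a transport term. -/
lemma abs_inner_transport_le (K B M : E →L[ℝ] E)
    (hK : ∀ x y, inner ℝ (K x) y = inner ℝ x (K y))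
    (hB : ∀ x y, inner ℝ (B x) y = -inner ℝ x (B y))
    (hM : ∀ x y, inner ℝ (M x) y = inner ℝ x (M y))
    (hKB : ∀ x, K (B x) = B (K x)) (hK1 : ∀ x, ‖K x‖ ≤ ‖x‖) {m : ℝ} (hm : 0 ≤ m)
    (h1 : ∀ x, ‖B (M x) - M (B x)‖ ≤ m * ‖x‖)
    (h2 : ∀ x, ‖B (K (M x) - M (K x))‖ ≤ m * ‖x‖) (x : E) :
    2 * |inner ℝ (M (B x)) (K x)| ≤ 2 * m * ‖x‖ ^ 2 := by
  have e1 : inner ℝ (M (B x)) (K x) = -inner ℝ x (B (M (K x)) - M (B (K x)))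
      - inner ℝ x (M (B (K x))) := by
    rw [hM, hB, inner_sub_right]; ring
  have e2 : inner ℝ x (M (B (K x))) = inner ℝ (K (M x) - M (K x)) (B x)
      + inner ℝ (M (B x)) (K x) := by
    rw [← hM, ← hKB, ← hK, inner_sub_left, hM (K x), real_inner_comm (K x)]; ring
  have e3 : inner ℝ (K (M x) - M (K x)) (B x) = -inner ℝ (B (K (M x) - M (K x))) x := by
    rw [hB]; ring
  have e4 : 2 * inner ℝ (M (B x)) (K x) = -inner ℝ x (B (M (K x)) - M (B (K x)))
      + inner ℝ (B (K (M x) - M (K x))) x := by linarith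
  have b1 : |inner ℝ x (B (M (K x)) - M (B (K x)))| ≤ ‖x‖ * (m * ‖x‖) :=
    (abs_real_inner_le_norm _ _).trans (by
      gcongr
      exact (h1 (K x)).trans (by gcongr; exact hK1 x))
  have b2 : |inner ℝ (B (K (M x) - M (K x))) x| ≤ (m * ‖x‖) * ‖x‖ :=
    (abs_real_inner_le_norm _ _).trans (by gcongr; exact h2 x)
  calc 2 * |inner ℝ (M (B x)) (K x)| = |2 * inner ℝ (M (B x)) (K x)| := by
        rw [abs_mul, abs_two]
    _ ≤ |inner ℝ x (B (M (K x)) - M (B (K x)))| + |inner ℝ (B (K (M x) - M (K x))) x| := by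
        rw [e4]
        exact (abs_add_le _ _).trans (by rw [abs_neg])
    _ ≤ _ := by nlinarith

/-- The model is `K` the cut-off, `B` the derivative, `P` the derivative composed with
`T_μ(D)^{1/2}`, `S = 1 + ζ` the symmetrizer and `C` multiplication by the velocity. The hypotheses
contain only bounds for `S`, `C` and their commutators, and the conclusion involves no norm of `B`
or `P`. This makes it uniform in the regularisation. -/
lemma abstract_energy_inequality (K B P S C : E →L[ℝ] E)
    (hK : ∀ x y, inner ℝ (K x) y = inner ℝ x (K y))
    (hB : ∀ x y, inner ℝ (B x) y = -inner ℝ x (B y))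
    (hP : ∀ x y, inner ℝ (P x) y = -inner ℝ x (P y))
    (hS : ∀ x y, inner ℝ (S x) y = inner ℝ x (S y))
    (hC : ∀ x y, inner ℝ (C x) y = inner ℝ x (C y))
    (hSC : ∀ x, S (C x) = C (S x)) (hKB : ∀ x, K (B x) = B (K x))
    (hKP : ∀ x, K (P x) = P (K x)) (hK1 : ∀ x, ‖K x‖ ≤ ‖x‖) {a c : ℝ} (ha : 0 ≤ a) (hc : 0 ≤ c)
    (nS : ∀ x, ‖S x‖ ≤ (1 + a) * ‖x‖) (nC : ∀ x, ‖C x‖ ≤ c * ‖x‖)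
    (sP : ∀ x, ‖P (S x) - S (P x)‖ ≤ a * ‖x‖)
    (sB : ∀ x, ‖B (S x) - S (B x)‖ ≤ a * ‖x‖)
    (sK : ∀ x, ‖B (K (S x) - S (K x))‖ ≤ a * ‖x‖)
    (cB : ∀ x, ‖B (C x) - C (B x)‖ ≤ c * ‖x‖)
    (cK : ∀ x, ‖B (K (C x) - C (K x))‖ ≤ c * ‖x‖)
    {Z y Zt yt F G : E} (eZ : Zt = -(K (S (P y))) - K (C (B Z)) + F)
    (ey : yt = -(K (P Z)) - K (C (B y)) + G) :
    2 * inner ℝ Zt Z + 2 * inner ℝ (S yt) y ≤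
      (a + 8 * c + 14 * (a * c)) * (‖Z‖ ^ 2 + ‖y‖ ^ 2) + 2 * (‖F‖ * ‖Z‖)
        + 2 * ((1 + a) * ‖G‖ * ‖y‖) := by
  -- The point of the symmetrizer: the coupling terms of the two equations are adjoint to each other
  -- with opposite signs, up to `[P, S]`.
  have cross : inner ℝ (K (S (P y))) Z + inner ℝ (S (K (P Z))) y
      = -inner ℝ (P (S y) - S (P y)) (K Z) := by
    have h2 : inner ℝ (S (K (P Z))) y = -inner ℝ (P (S y)) (K Z) := by
      rw [hS, hKP, hP, real_inner_comm]
    rw [hK, h2, inner_sub_left]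
    ring
  have bcross : |inner ℝ (P (S y) - S (P y)) (K Z)| ≤ a * ‖y‖ * ‖Z‖ :=
    (abs_real_inner_le_norm _ _).trans (mul_le_mul (sP y) (hK1 Z) (norm_nonneg _) (by positivity))
  have bKS : ∀ x, ‖K (S x) - S (K x)‖ ≤ 2 * (1 + a) * ‖x‖ := fun x => by
    calc ‖K (S x) - S (K x)‖ ≤ ‖K (S x)‖ + ‖S (K x)‖ := norm_sub_le _ _
      _ ≤ (1 + a) * ‖x‖ + (1 + a) * ‖x‖ := by
        gcongr
        · exact (hK1 _).trans (nS x)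
        · exact (nS _).trans (by gcongr; exact hK1 x)
      _ = _ := by ring
  have bKC : ∀ x, ‖K (C x) - C (K x)‖ ≤ 2 * c * ‖x‖ := fun x => by
    calc ‖K (C x) - C (K x)‖ ≤ ‖K (C x)‖ + ‖C (K x)‖ := norm_sub_le _ _
      _ ≤ c * ‖x‖ + c * ‖x‖ := by
        gcongr
        · exact (hK1 _).trans (nC x)
        · exact (nC _).trans (by gcongr; exact hK1 x)
      _ = _ := by ring
  have t1 := abs_inner_transport_le K B C hK hB hC hKB hK1 hc cB cK Z
  -- In the second equation the transport coefficient is `S C`, symmetric because `S` and `C`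
  -- commute. Its commutator constant is the sum `a c + 2 a c + (1 + a) c`.
  have t2 := abs_inner_transport_le K B (S.comp C) hK hB
    (fun x y => by
      simp only [ContinuousLinearMap.comp_apply]
      rw [hS, hC, hSC])
    hKB hK1 (m := c * (1 + 4 * a)) (by positivity)
    (fun x => by
      simp only [ContinuousLinearMap.comp_apply]
      have : B (S (C x)) - S (C (B x)) = (B (S (C x)) - S (B (C x))) + S (B (C x) - C (B x)) := by
        rw [map_sub]; abel
      rw [this]
      calc _ ≤ ‖B (S (C x)) - S (B (C x))‖ + ‖S (B (C x) - C (B x))‖ := norm_add_le _ _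
        _ ≤ a * (c * ‖x‖) + (1 + a) * (c * ‖x‖) := by
          gcongr
          · exact (sB _).trans (by gcongr; exact nC x)
          · exact (nS _).trans (by gcongr; exact cB x)
        _ ≤ _ := by nlinarith [mul_nonneg (mul_nonneg ha hc) (norm_nonneg x)])
    (fun x => by
      simp only [ContinuousLinearMap.comp_apply]
      have : B (K (S (C x)) - S (C (K x))) = B (K (S (C x)) - S (K (C x)))
          + (B (S (K (C x) - C (K x))) - S (B (K (C x) - C (K x))))
          + S (B (K (C x) - C (K x))) := by
        simp only [map_sub]; abel
      rw [this]
      calc _ ≤ ‖B (K (S (C x)) - S (K (C x)))‖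
          + ‖B (S (K (C x) - C (K x))) - S (B (K (C x) - C (K x)))‖
          + ‖S (B (K (C x) - C (K x)))‖ := norm_add₃_le
        _ ≤ a * (c * ‖x‖) + a * (2 * c * ‖x‖) + (1 + a) * (c * ‖x‖) := by
          gcongr
          · exact (sK _).trans (by gcongr; exact nC x)
          · exact (sB _).trans (by gcongr; exact bKC x)
          · exact (nS _).trans (by gcongr; exact cK x)
        _ = _ := by ring) y
  simp only [ContinuousLinearMap.comp_apply] at t2
  -- The symmetrizer and the cut-off do not commute. Their commutator is moved onto `y`, where it
  -- absorbs the derivative `B`.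
  have t3 : inner ℝ (S (K (C (B y)))) y = inner ℝ (S (C (B y))) (K y)
      - inner ℝ y (B (C (K (S y) - S (K y))) - C (B (K (S y) - S (K y))))
      - inner ℝ y (C (B (K (S y) - S (K y)))) := by
    have : inner ℝ y (B (C (K (S y) - S (K y)))) = -inner ℝ (C (B y)) (K (S y) - S (K y)) := by
      rw [hC, hB]; ring
    rw [hS, hK, hS, inner_sub_right y, this, inner_sub_right (C (B y))]
    ring
  have b3 : |inner ℝ y (B (C (K (S y) - S (K y))) - C (B (K (S y) - S (K y))))|
      ≤ ‖y‖ * (c * (2 * (1 + a) * ‖y‖)) :=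
    (abs_real_inner_le_norm _ _).trans (by
      gcongr
      exact (cB _).trans (by gcongr; exact bKS y))
  have b4 : |inner ℝ y (C (B (K (S y) - S (K y))))| ≤ ‖y‖ * (c * (a * ‖y‖)) :=
    (abs_real_inner_le_norm _ _).trans (by
      gcongr
      exact (nC _).trans (by gcongr; exact sK y))
  have b5 : inner ℝ F Z ≤ ‖F‖ * ‖Z‖ := real_inner_le_norm _ _
  have b6 : inner ℝ (S G) y ≤ (1 + a) * ‖G‖ * ‖y‖ :=
    (real_inner_le_norm _ _).trans (by gcongr; exact nS G)
  have e1 : 2 * inner ℝ Zt Z + 2 * inner ℝ (S yt) y =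
      -(2 * (inner ℝ (K (S (P y))) Z + inner ℝ (S (K (P Z))) y))
      - 2 * inner ℝ (C (B Z)) (K Z) - 2 * inner ℝ (S (K (C (B y)))) y
      + 2 * inner ℝ F Z + 2 * inner ℝ (S G) y := by
    rw [eZ, ey]
    simp only [map_add, map_sub, map_neg, inner_add_left, inner_sub_left, inner_neg_left]
    rw [hK (C (B Z))]
    ring
  rw [e1, cross, t3]
  have c1 := abs_le.1 bcross
  have c2 := neg_le_abs (inner ℝ (C (B Z)) (K Z))
  have c3 := neg_le_abs (inner ℝ (S (C (B y))) (K y))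
  have c4 := abs_le.1 b3
  have c5 := abs_le.1 b4
  have hyz : 2 * (a * ‖y‖ * ‖Z‖) ≤ a * (‖Z‖ ^ 2 + ‖y‖ ^ 2) := by
    nlinarith [mul_nonneg ha (sq_nonneg (‖y‖ - ‖Z‖))]
  nlinarith [mul_nonneg hc (sq_nonneg ‖Z‖), mul_nonneg hc (sq_nonneg ‖y‖),
    mul_nonneg (mul_nonneg ha hc) (sq_nonneg ‖Z‖), mul_nonneg (mul_nonneg ha hc) (sq_nonneg ‖y‖)]

end Abstract

/-! ### Bilinear estimates -/

/-- `‖w f‖_{L²} ≤ B`. -/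
def L2Le (w : ℝ → ℝ) (f : ℝ → ℂ) (B : ℝ) : Prop :=
  ∫⁻ ξ, (ENNReal.ofReal (w ξ) * ‖f ξ‖ₑ) ^ 2 ≤ ENNReal.ofReal (B ^ 2)

lemma L1Le.mono {w w' : ℝ → ℝ} {f : ℝ → ℂ} {A : ℝ} (h : L1Le w f A) (hw : ∀ ξ, w' ξ ≤ w ξ) :
    L1Le w' f A :=
  (lintegral_mono fun ξ => by gcongr; exact hw ξ).trans h

lemma L1Le.mono_right {w : ℝ → ℝ} {f : ℝ → ℂ} {A A' : ℝ} (h : L1Le w f A) (hA : A ≤ A') :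
    L1Le w f A' := h.trans (ENNReal.ofReal_le_ofReal hA)

lemma L1Le_zero (f : ℝ → ℂ) : L1Le (fun _ => 0) f 0 := by simp [L1Le]

lemma L2Le_zero (f : ℝ → ℂ) : L2Le (fun _ => 0) f 0 := by simp [L2Le]

lemma L2Le_mulOp {w : ℝ → ℝ} (hw : ∀ ξ, 0 ≤ w ξ) (hm : BddMeas (fun ξ => (w ξ : ℂ)))
    (f : ComplexL2) : L2Le w f ‖mulOp (fun ξ => (w ξ : ℂ)) f‖ := by
  unfold L2Le
  rw [ENNReal.ofReal_pow (norm_nonneg _), ofReal_norm, enorm_sq_eq_lintegral]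
  refine le_of_eq (lintegral_congr_ae ?_)
  filter_upwards [mulOp_ae hm f] with ξ h
  rw [h, enorm_mul]
  congr 2
  rw [← ofReal_norm, Complex.norm_real, Real.norm_of_nonneg (hw ξ)]

lemma L2Le_one (f : ComplexL2) : L2Le (fun _ => 1) f ‖f‖ := by
  unfold L2Le
  rw [ENNReal.ofReal_pow (norm_nonneg _), ofReal_norm, enorm_sq_eq_lintegral]
  simp

/-- The fundamental bilinear estimate: the pointwise bound on the kernel decides. -/
lemma norm_le_of_kernel {h f g : ComplexL2} {l n n' m m' : ℝ → ℂ} (hl : BddMeas l)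
    (hn : BddMeas n) (hn' : BddMeas n')
    (hh : ∀ᵐ a : ℝ, h a = m a * conv (fun ξ => l ξ * f ξ) (fun ξ => n ξ * g ξ) a
      - m' a * conv (fun ξ => l ξ * f ξ) (fun ξ => n' ξ * g ξ) a)
    {p₁ q₁ p₂ q₂ : ℝ → ℝ} (mp₁ : Measurable p₁) (mq₁ : Measurable q₁) (mp₂ : Measurable p₂)
    (mq₂ : Measurable q₂) (pp₁ : ∀ ξ, 0 ≤ p₁ ξ) (pp₂ : ∀ ξ, 0 ≤ p₂ ξ)
    (pq₁ : ∀ ξ, 0 ≤ q₁ ξ) (pq₂ : ∀ ξ, 0 ≤ q₂ ξ)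
    (hk : ∀ a b, ‖l (a - b)‖ * ‖m a * n b - m' a * n' b‖ ≤
      p₁ (a - b) * q₁ b + p₂ (a - b) * q₂ b)
    {A₁ B₁ A₂ B₂ : ℝ} (hA₁ : 0 ≤ A₁) (hB₁ : 0 ≤ B₁) (hA₂ : 0 ≤ A₂) (hB₂ : 0 ≤ B₂)
    (i₁ : L1Le p₁ f A₁) (j₁ : L2Le q₁ g B₁) (i₂ : L2Le p₂ f A₂) (j₂ : L1Le q₂ g B₂) :
    ‖h‖ ≤ A₁ * B₁ + A₂ * B₂ := by
  have mf := measurable_enorm_coe f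
  have mg := measurable_enorm_coe g
  refine norm_le_of_convol h (F₁ := fun ξ => ENNReal.ofReal (p₁ ξ) * ‖f ξ‖ₑ)
    (G₁ := fun ξ => ENNReal.ofReal (q₁ ξ) * ‖g ξ‖ₑ)
    (F₂ := fun ξ => ENNReal.ofReal (p₂ ξ) * ‖f ξ‖ₑ)
    (G₂ := fun ξ => ENNReal.ofReal (q₂ ξ) * ‖g ξ‖ₑ)
    (mp₁.ennreal_ofReal.mul mf) (mq₁.ennreal_ofReal.mul mg) (mp₂.ennreal_ofReal.mul mf)
    (mq₂.ennreal_ofReal.mul mg) hA₁ hB₁ hA₂ hB₂ i₁ j₁ i₂ j₂ ?_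
  filter_upwards [hh] with a ha
  have e : h a = ∫ b, (l (a - b) * (m a * n b - m' a * n' b)) * (f (a - b) * g b) := by
    rw [ha, conv, conv, ← integral_const_mul, ← integral_const_mul, ← integral_sub]
    · congr 1
      ext b
      ring
    · exact (integrable_conv (hl.memLp f) (hn.memLp g) a).const_mul _
    · exact (integrable_conv (hl.memLp f) (hn'.memLp g) a).const_mul _
  rw [e]
  refine (enorm_integral_le_lintegral_enorm _).trans ?_
  rw [← lintegral_add_left]
  · refine lintegral_mono fun b => ?_
    rw [enorm_mul, enorm_mul (f (a - b)), ← ofReal_norm (l (a - b) * _), norm_mul]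
    calc ENNReal.ofReal (‖l (a - b)‖ * ‖m a * n b - m' a * n' b‖) * (‖f (a - b)‖ₑ * ‖g b‖ₑ)
        ≤ ENNReal.ofReal (p₁ (a - b) * q₁ b + p₂ (a - b) * q₂ b)
          * (‖f (a - b)‖ₑ * ‖g b‖ₑ) := by gcongr; exact hk a b
      _ = _ := by
        rw [ENNReal.ofReal_add (mul_nonneg (pp₁ _) (pq₁ _)) (mul_nonneg (pp₂ _) (pq₂ _)),
          ENNReal.ofReal_mul (pp₁ _), ENNReal.ofReal_mul (pp₂ _)]
        ring
  · exact ((mp₁.ennreal_ofReal.mul mf).comp (measurable_const.sub measurable_id)).mul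
      (mq₁.ennreal_ofReal.mul mg)

lemma convOp_mulOp_ae {l n : ℝ → ℂ} (hl : BddMeas l) (hn : BddMeas n) {f : ComplexL2}
    (hf : Integrable (mulOp l f)) (g : ComplexL2) :
    convOp (mulOp l f) (mulOp n g) =ᵐ[volume]
      conv (fun ξ => l ξ * f ξ) (fun ξ => n ξ * g ξ) := by
  filter_upwards [convOp_ae hf (mulOp n g)] with a ha
  rw [ha]
  exact conv_congr (mulOp_ae hl f) (mulOp_ae hn g) a

/-! ### The regularised system on the Fourier side -/

/-- Symbol of the frequency cut-off. -/
def symK (δ ξ : ℝ) : ℂ := (cut δ ξ : ℝ)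

/-- Symbol of the regularised derivative. -/
def symB (δ ξ : ℝ) : ℂ := Complex.I * ((freq ξ * cut δ ξ : ℝ) : ℂ)

/-- Symbol of the regularised derivative composed with `T_μ(D)^{1/2}`. -/
def symP (δ μ ξ : ℝ) : ℂ := Complex.I * ((freq ξ * cut δ ξ * phi μ ξ : ℝ) : ℂ)

/-- Symbol of `T_μ(D)^{1/2}`. -/
def symPhi (μ ξ : ℝ) : ℂ := (phi μ ξ : ℝ)

/-- Symbol of the cut-off composed with `T_μ(D)^{-1/2}`. -/
def symKPsi (δ μ ξ : ℝ) : ℂ := ((cut δ ξ * psi μ ξ : ℝ) : ℂ)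

lemma norm_symB (δ ξ : ℝ) : ‖symB δ ξ‖ = |freq ξ| * cut δ ξ := by
  rw [symB, norm_mul, Complex.norm_I, one_mul, Complex.norm_real, Real.norm_eq_abs, abs_mul,
    abs_of_nonneg (cut_nonneg δ ξ)]

lemma norm_symP (δ μ ξ : ℝ) : ‖symP δ μ ξ‖ = |freq ξ| * cut δ ξ * phi μ ξ := by
  rw [symP, norm_mul, Complex.norm_I, one_mul, Complex.norm_real, Real.norm_eq_abs, abs_mul,
    abs_mul, abs_of_nonneg (cut_nonneg δ ξ), abs_of_pos (phi_pos μ ξ)]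

lemma norm_symK (δ ξ : ℝ) : ‖symK δ ξ‖ = cut δ ξ := by
  rw [symK, Complex.norm_real, Real.norm_of_nonneg (cut_nonneg δ ξ)]

lemma norm_symPhi (μ ξ : ℝ) : ‖symPhi μ ξ‖ = phi μ ξ := by
  rw [symPhi, Complex.norm_real, Real.norm_of_nonneg (phi_pos μ ξ).le]

lemma psi_le_one_add (μ ξ : ℝ) : psi μ ξ ≤ 1 + Real.sqrt μ * |freq ξ| := by
  have h := xcoth_le (sfreq_nonneg μ ξ)
  rw [← psi_sq] at h
  have h1 := one_le_psi μ ξ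
  have : psi μ ξ ≤ psi μ ξ ^ 2 := by nlinarith
  exact this.trans h

lemma bddMeas_one : BddMeas (fun _ => 1) := ⟨measurable_const, 1, by simp⟩

lemma bddMeas_symPhi (μ : ℝ) : BddMeas (symPhi μ) :=
  BddMeas.of_real (measurable_phi μ) (C := 1) fun ξ => by
    rw [abs_of_pos (phi_pos μ ξ)]; exact phi_le_one μ ξ

section Symbols

variable {δ : ℝ} (hδ : 0 < δ) (μ : ℝ)
include hδ

lemma bddMeas_symK : BddMeas (symK δ) :=
  BddMeas.of_real (measurable_cut δ) (C := 1) fun ξ => by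
    rw [abs_of_nonneg (cut_nonneg δ ξ)]; exact cut_le_one hδ ξ

lemma norm_symB_le (ξ : ℝ) : ‖symB δ ξ‖ ≤ |freq ξ| := by
  rw [norm_symB]
  exact mul_le_of_le_one_right (abs_nonneg _) (cut_le_one hδ ξ)

lemma bddMeas_symB : BddMeas (symB δ) := by
  refine ⟨?_, 1 / δ, fun ξ => ?_⟩
  · exact (Complex.measurable_ofReal.comp (measurable_freq.mul (measurable_cut δ))).const_mul _
  · rw [norm_symB, mul_comm]
    exact cut_mul_freq_le hδ ξ

lemma norm_symP_le (ξ : ℝ) : ‖symP δ μ ξ‖ ≤ |freq ξ| := by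
  rw [norm_symP]
  have := cut_le_one hδ ξ
  have h1 := phi_le_one μ ξ
  have h2 := (phi_pos μ ξ).le
  have h3 := cut_nonneg δ ξ
  calc |freq ξ| * cut δ ξ * phi μ ξ ≤ |freq ξ| * 1 * 1 := by gcongr
    _ = _ := by ring

lemma bddMeas_symP : BddMeas (symP δ μ) := by
  refine ⟨?_, 1 / δ, fun ξ => ?_⟩
  · exact (Complex.measurable_ofReal.comp
      ((measurable_freq.mul (measurable_cut δ)).mul (measurable_phi μ))).const_mul _
  · rw [norm_symP, mul_comm |freq ξ|]
    exact (mul_le_of_le_one_right (mul_nonneg (cut_nonneg δ ξ) (abs_nonneg _))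
      (phi_le_one μ ξ)).trans (cut_mul_freq_le hδ ξ)

lemma bddMeas_symKPsi : BddMeas (symKPsi δ μ) := by
  refine BddMeas.of_real ((measurable_cut δ).mul (measurable_psi μ))
    (C := 1 + Real.sqrt μ * (1 / δ)) fun ξ => ?_
  have h0 := cut_nonneg δ ξ
  rw [abs_of_nonneg (mul_nonneg h0 (psi_pos μ ξ).le)]
  calc cut δ ξ * psi μ ξ ≤ cut δ ξ * (1 + Real.sqrt μ * |freq ξ|) := by
        gcongr; exact psi_le_one_add μ ξ
    _ = cut δ ξ + Real.sqrt μ * (cut δ ξ * |freq ξ|) := by ring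
    _ ≤ _ := by
      gcongr
      · exact cut_le_one hδ ξ
      · exact cut_mul_freq_le hδ ξ

lemma abs_freq_mul_cut_sub_le (a b : ℝ) :
    |freq a * cut δ a - freq b * cut δ b| ≤ 3 * |freq (a - b)| := by
  have e : freq a * cut δ a - freq b * cut δ b
      = freq a * (cut δ a - cut δ b) + freq (a - b) * cut δ b := by rw [freq_sub]; ring
  rw [e]
  refine (abs_add_le _ _).trans ?_
  rw [abs_mul, abs_mul, abs_of_nonneg (cut_nonneg δ b)]
  have h1 := abs_cut_sub_mul_le hδ a b
  have h2 : |freq (a - b)| * cut δ b ≤ |freq (a - b)| :=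
    mul_le_of_le_one_right (abs_nonneg _) (cut_le_one hδ b)
  linarith

lemma norm_symB_sub_le (a b : ℝ) : ‖symB δ a - symB δ b‖ ≤ 4 * |freq (a - b)| := by
  rw [symB, symB, ← mul_sub, norm_mul, Complex.norm_I, one_mul, ← Complex.ofReal_sub,
    Complex.norm_real]
  exact (abs_freq_mul_cut_sub_le hδ a b).trans (by linarith [abs_nonneg (freq (a - b))])

/-- The factor `phi` contributes `1` and the regularised derivative contributes `3`. Neither
constant depends on `δ` or `μ`, so the commutator of `P` with a function is bounded uniformly. -/
lemma norm_symP_sub_le (a b : ℝ) : ‖symP δ μ a - symP δ μ b‖ ≤ 4 * |freq (a - b)| := by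
  rw [symP, symP, ← mul_sub, norm_mul, Complex.norm_I, one_mul, ← Complex.ofReal_sub,
    Complex.norm_real, Real.norm_eq_abs]
  have e : freq a * cut δ a * phi μ a - freq b * cut δ b * phi μ b
      = cut δ a * ((phi μ a - phi μ b) * freq a)
        + (freq a * cut δ a - freq b * cut δ b) * phi μ b := by ring
  rw [e]
  refine (abs_add_le _ _).trans ?_
  rw [abs_mul, abs_mul, abs_mul, abs_of_nonneg (cut_nonneg δ a), abs_of_pos (phi_pos μ b)]
  have h1 := abs_phi_sub_mul_le μ a b
  have h2 : cut δ a * (|phi μ a - phi μ b| * |freq a|) ≤ |phi μ a - phi μ b| * |freq a| :=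
    mul_le_of_le_one_left (by positivity) (cut_le_one hδ a)
  have h3 : |freq a * cut δ a - freq b * cut δ b| * phi μ b
      ≤ |freq a * cut δ a - freq b * cut δ b| :=
    mul_le_of_le_one_right (abs_nonneg _) (phi_le_one μ b)
  have h4 := abs_freq_mul_cut_sub_le hδ a b
  linarith

lemma norm_symB_mul_sub_le (a b : ℝ) :
    ‖symB δ a * symK δ a - symB δ a * symK δ b‖ ≤ 4 * |freq (a - b)| := by
  rw [← mul_sub, norm_mul, symK, symK, ← Complex.ofReal_sub, Complex.norm_real, Real.norm_eq_abs]
  have h1 := abs_cut_sub_mul_le hδ a b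
  have h2 := norm_symB_le hδ a
  calc ‖symB δ a‖ * |cut δ a - cut δ b| ≤ |freq a| * |cut δ a - cut δ b| := by gcongr
    _ ≤ _ := by rw [mul_comm]; linarith [abs_nonneg (freq (a - b))]

end Symbols

/-- The operator-level bilinear estimate. -/
lemma norm_bilin_le {f g : ComplexL2} {l n n' m m' : ℝ → ℂ} (hl : BddMeas l)
    (hn : BddMeas n) (hn' : BddMeas n') (hm : BddMeas m) (hm' : BddMeas m')
    (hf : Integrable (mulOp l f))
    {p₁ q₁ p₂ q₂ : ℝ → ℝ} (mp₁ : Measurable p₁) (mq₁ : Measurable q₁) (mp₂ : Measurable p₂)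
    (mq₂ : Measurable q₂) (pp₁ : ∀ ξ, 0 ≤ p₁ ξ) (pp₂ : ∀ ξ, 0 ≤ p₂ ξ)
    (pq₁ : ∀ ξ, 0 ≤ q₁ ξ) (pq₂ : ∀ ξ, 0 ≤ q₂ ξ)
    (hk : ∀ a b, ‖l (a - b)‖ * ‖m a * n b - m' a * n' b‖ ≤
      p₁ (a - b) * q₁ b + p₂ (a - b) * q₂ b)
    {A₁ B₁ A₂ B₂ : ℝ} (hA₁ : 0 ≤ A₁) (hB₁ : 0 ≤ B₁) (hA₂ : 0 ≤ A₂) (hB₂ : 0 ≤ B₂)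
    (i₁ : L1Le p₁ f A₁) (j₁ : L2Le q₁ g B₁) (i₂ : L2Le p₂ f A₂) (j₂ : L1Le q₂ g B₂) :
    ‖mulOp m (convOp (mulOp l f) (mulOp n g)) - mulOp m' (convOp (mulOp l f) (mulOp n' g))‖
      ≤ A₁ * B₁ + A₂ * B₂ := by
  refine norm_le_of_kernel (l := l) (n := n) (n' := n') (m := m) (m' := m') hl hn hn' ?_
    mp₁ mq₁ mp₂ mq₂ pp₁ pp₂ pq₁ pq₂ hk hA₁ hB₁ hA₂ hB₂ i₁ j₁ i₂ j₂
  filter_upwards [Lp.coeFn_sub (mulOp m (convOp (mulOp l f) (mulOp n g)))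
    (mulOp m' (convOp (mulOp l f) (mulOp n' g))), mulOp_ae hm (convOp (mulOp l f) (mulOp n g)),
    mulOp_ae hm' (convOp (mulOp l f) (mulOp n' g)), convOp_mulOp_ae hl hn hf g,
    convOp_mulOp_ae hl hn' hf g] with a h1 h2 h3 h4 h5
  rw [h1, Pi.sub_apply, h2, h3, h4, h5]

lemma L1Le.const_mul {w : ℝ → ℝ} {f : ComplexL2} {A c : ℝ} (h : L1Le w f A) (hc : 0 ≤ c)
    (hw : Measurable w) : L1Le (fun ξ => c * w ξ) f (c * A) := by
  unfold L1Le at *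
  simp only [ENNReal.ofReal_mul hc, mul_assoc]
  rw [lintegral_const_mul _ (show Measurable (fun ξ => ENNReal.ofReal (w ξ) * ‖f ξ‖ₑ) from
    hw.ennreal_ofReal.mul (measurable_enorm_coe f))]
  gcongr

lemma L1Le.one {f : ComplexL2} {A : ℝ} (h : L1Le (bracket 1) f A) : L1Le (fun _ => 1) f A :=
  h.mono fun ξ => one_le_bracket zero_le_one ξ

lemma L1Le_mulOp {w : ℝ → ℝ} {f : ComplexL2} {A : ℝ} (h : L1Le w f A) {l : ℝ → ℂ}
    (hl : BddMeas l) (hl1 : ∀ ξ, ‖l ξ‖ ≤ 1) : L1Le w (mulOp l f) A := by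
  refine le_trans (lintegral_mono_ae ?_) h
  filter_upwards [mulOp_ae hl f] with ξ h1
  rw [h1, enorm_mul]
  have : ‖l ξ‖ₑ ≤ 1 := by
    rw [← ofReal_norm]; simpa using ENNReal.ofReal_le_ofReal (hl1 ξ)
  calc ENNReal.ofReal (w ξ) * (‖l ξ‖ₑ * ‖f ξ‖ₑ) ≤ ENNReal.ofReal (w ξ) * (1 * ‖f ξ‖ₑ) := by gcongr
    _ = _ := by rw [one_mul]

/-- The kernel of the commutator is the increment of the symbols times `f (a - b)`. A Lipschitz
bound on the symbols puts one derivative on `f`, and Young's inequality does the rest. -/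
lemma norm_comm_convOp_le {f : ComplexL2} {A : ℝ} (hA : 0 ≤ A) (hf : L1Le (bracket 1) f A)
    {m m' n' : ℝ → ℂ} (hm : BddMeas m) (hm' : BddMeas m') (hn' : BddMeas n')
    (hL : ∀ a b, ‖m a - m' a * n' b‖ ≤ 4 * |freq (a - b)|) (g : ComplexL2) :
    ‖mulOp m (convOp f g) - mulOp m' (convOp f (mulOp n' g))‖ ≤ 4 * A * ‖g‖ := by
  have h := norm_bilin_le (f := f) (g := g) (l := fun _ => 1) (n := fun _ => 1) (n' := n')
    (m := m) (m' := m') bddMeas_one bddMeas_one hn' hm hm'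
    (by rw [mulOp_one]; exact hf.one.integrable)
    (p₁ := fun ξ => 4 * bracket 1 ξ) (q₁ := fun _ => 1) (p₂ := fun _ => 0) (q₂ := fun _ => 0)
    ((measurable_bracket 1).const_mul 4) measurable_const measurable_const measurable_const
    (fun ξ => mul_nonneg (by norm_num) (bracket_pos 1 ξ).le) (fun _ => le_rfl)
    (fun _ => zero_le_one) (fun _ => le_rfl)
    (fun a b => by
      have := abs_freq_le_bracket (a - b)
      have := hL a b
      simp only [norm_one, one_mul, mul_one, mul_zero, add_zero]
      linarith)
    (A₁ := 4 * A) (B₁ := ‖g‖) (A₂ := 0) (B₂ := 0)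
    (by positivity) (norm_nonneg _) le_rfl le_rfl
    (hf.const_mul (by norm_num) (measurable_bracket 1)) (L2Le_one g) (L2Le_zero f) (L1Le_zero g)
  simpa only [mulOp_one, mul_zero, add_zero] using h

lemma mulOp_comm {m n : ℝ → ℂ} (hm : BddMeas m) (hn : BddMeas n) (f : ComplexL2) :
    mulOp m (mulOp n f) = mulOp n (mulOp m f) := by
  rw [mulOp_mulOp hm hn, mulOp_mulOp hn hm]
  congr 2
  ext ξ
  ring

lemma norm_mulOp_le_of_one {m : ℝ → ℂ} (hm : BddMeas m) (h1 : ∀ ξ, ‖m ξ‖ ≤ 1) (f : ComplexL2) :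
    ‖mulOp m f‖ ≤ ‖f‖ := by
  simpa using norm_mulOp_le hm.meas h1 f

/-- The symmetrizer `1 + ζ`. -/
def symmOp (ζ : ComplexL2) : ComplexL2 →L[ℝ] ComplexL2 :=
  ContinuousLinearMap.id ℝ ComplexL2 + convOp ζ

lemma symmOp_apply (ζ g : ComplexL2) : symmOp ζ g = g + convOp ζ g := rfl

/-- The energy inequality for the regularised linear system with coefficients `ζ` and `v`. -/
lemma energy_inequality {δ : ℝ} (hδ : 0 < δ) (μ : ℝ) {ζ v : ComplexL2} (hζ : Herm ζ)
    (hv : Herm v) {A : ℝ} (hA : 0 ≤ A) (aζ : L1Le (bracket 1) ζ A) (av : L1Le (bracket 1) v A)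
    {Z y Zt yt F G : ComplexL2}
    (eZ : Zt = -(mulOp (symK δ) (symmOp ζ (mulOp (symP δ μ) y)))
      - mulOp (symK δ) (convOp v (mulOp (symB δ) Z)) + F)
    (ey : yt = -(mulOp (symK δ) (mulOp (symP δ μ) Z))
      - mulOp (symK δ) (convOp v (mulOp (symB δ) y)) + G) :
    2 * inner ℝ Zt Z + 2 * inner ℝ (symmOp ζ yt) y ≤
      224 * (A * (1 + A)) * (‖Z‖ ^ 2 + ‖y‖ ^ 2) + 2 * (‖F‖ * ‖Z‖)
        + 2 * ((1 + 4 * A) * ‖G‖ * ‖y‖) := by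
  have bK := bddMeas_symK hδ
  have bB := bddMeas_symB hδ
  have bP := bddMeas_symP hδ μ
  have iζ := aζ.one.integrable
  have iv := av.one.integrable
  have hI : ∀ r : ℝ, (starRingEnd ℂ) (Complex.I * (r : ℂ)) = -(Complex.I * (r : ℂ)) := fun r => by
    simp
  have comm1 : ∀ {f : ComplexL2}, L1Le (bracket 1) f A → ∀ x,
      ‖mulOp (symP δ μ) (convOp f x) - convOp f (mulOp (symP δ μ) x)‖ ≤ 4 * A * ‖x‖ := by
    intro f hf x
    simpa only [mulOp_one] using norm_comm_convOp_le hA hf bP bddMeas_one bP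
      (fun a b => by simpa using norm_symP_sub_le hδ μ a b) x
  have comm2 : ∀ {f : ComplexL2}, L1Le (bracket 1) f A → ∀ x,
      ‖mulOp (symB δ) (convOp f x) - convOp f (mulOp (symB δ) x)‖ ≤ 4 * A * ‖x‖ := by
    intro f hf x
    simpa only [mulOp_one] using norm_comm_convOp_le hA hf bB bddMeas_one bB
      (fun a b => by simpa using norm_symB_sub_le hδ a b) x
  have comm3 : ∀ {f : ComplexL2}, L1Le (bracket 1) f A → ∀ x,
      ‖mulOp (symB δ) (mulOp (symK δ) (convOp f x) - convOp f (mulOp (symK δ) x))‖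
        ≤ 4 * A * ‖x‖ := by
    intro f hf x
    rw [map_sub, mulOp_mulOp bB bK]
    exact norm_comm_convOp_le hA hf (bB.mul bK) bB bK (norm_symB_mul_sub_le hδ) x
  have nC : ∀ {f : ComplexL2}, L1Le (bracket 1) f A → ∀ x, ‖convOp f x‖ ≤ 4 * A * ‖x‖ := by
    intro f hf x
    refine (norm_convOp_apply_le hA hf.one x).trans ?_
    gcongr
    linarith
  have h := abstract_energy_inequality (mulOp (symK δ)) (mulOp (symB δ)) (mulOp (symP δ μ))
    (symmOp ζ) (convOp v)
    (inner_mulOp_left bK fun ξ => Complex.conj_ofReal _)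
    (inner_mulOp_left_skew bB fun ξ => hI _)
    (inner_mulOp_left_skew bP fun ξ => hI _)
    (fun x y => by
      rw [symmOp_apply, symmOp_apply, inner_add_left, inner_add_right, inner_convOp_left iζ hζ])
    (inner_convOp_left iv hv)
    (fun x => by rw [symmOp_apply, symmOp_apply, map_add, convOp_comm iζ iv])
    (mulOp_comm bK bB) (mulOp_comm bK bP)
    (norm_mulOp_le_of_one bK fun ξ => by rw [norm_symK]; exact cut_le_one hδ ξ)
    (a := 4 * A) (c := 4 * A) (by positivity) (by positivity)
    (fun x => by
      rw [symmOp_apply]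
      refine (norm_add_le _ _).trans ?_
      have := nC aζ x
      linarith)
    (nC av)
    (fun x => by
      rw [symmOp_apply, symmOp_apply, map_add, add_sub_add_left_eq_sub]
      exact comm1 aζ x)
    (fun x => by
      rw [symmOp_apply, symmOp_apply, map_add, add_sub_add_left_eq_sub]
      exact comm2 aζ x)
    (fun x => by
      rw [symmOp_apply, symmOp_apply, map_add (mulOp (symK δ)), add_sub_add_left_eq_sub]
      exact comm3 aζ x)
    (comm2 av) (comm3 av) eZ ey
  refine h.trans ?_
  -- The left side is `36 A + 224 A²`.
  have : 4 * A + 8 * (4 * A) + 14 * (4 * A * (4 * A)) ≤ 224 * (A * (1 + A)) := by nlinarith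
  gcongr

/-- First component of the regularised vector field. -/
def rhs1 (δ μ : ℝ) (ζ y : ComplexL2) : ComplexL2 :=
  -(mulOp (symK δ) (mulOp (symP δ μ) y + convOp ζ (mulOp (symP δ μ) y)
    + convOp (mulOp (symPhi μ) y) (mulOp (symB δ) ζ)))

/-- Second component of the regularised vector field. -/
def rhs2 (δ μ : ℝ) (ζ y : ComplexL2) : ComplexL2 :=
  -(mulOp (symK δ) (mulOp (symP δ μ) ζ)
    + mulOp (symKPsi δ μ) (convOp (mulOp (symPhi μ) y) (mulOp (symP δ μ) y)))

lemma herm_mulOp {m : ℝ → ℂ} (hm : BddMeas m) (hs : ∀ ξ, (starRingEnd ℂ) (m (-ξ)) = m ξ)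
    {f : ComplexL2} (hf : Herm f) : Herm (mulOp m f) := by
  rw [Herm, reflConj_mulOp hm hs, hf]

lemma herm_symPhi {μ : ℝ} {f : ComplexL2} (hf : Herm f) : Herm (mulOp (symPhi μ) f) :=
  herm_mulOp (bddMeas_symPhi μ) (fun ξ => by
    rw [symPhi, symPhi, phi_neg, Complex.conj_ofReal]) hf

lemma norm_symPhi_le_one (μ ξ : ℝ) : ‖symPhi μ ξ‖ ≤ 1 := by
  rw [norm_symPhi]; exact phi_le_one μ ξ

/-- This keeps `T_μ(D)^{-1/2}`, of order one half, from costing regularity in the quadratic term: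
both factors of the product carry `T_μ(D)^{1/2}`. -/
lemma psi_mul_phi_mul_phi_le (μ a b : ℝ) : psi μ a * (phi μ (a - b) * phi μ b) ≤ 2 := by
  have h := psi_le_mul μ a b
  have h1 := psi_mul_phi μ (a - b)
  have h2 := psi_mul_phi μ b
  have p1 := phi_pos μ (a - b)
  have p2 := phi_pos μ b
  calc psi μ a * (phi μ (a - b) * phi μ b)
      ≤ (2 * (psi μ (a - b) * psi μ b)) * (phi μ (a - b) * phi μ b) := by gcongr
    _ = 2 * ((psi μ (a - b) * phi μ (a - b)) * (psi μ b * phi μ b)) := by ring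
    _ = 2 := by rw [h1, h2]; norm_num

/-- Kernel bound for the commutator with `w ψ`. -/
lemma kernel_psi_le {w : ℝ → ℝ} {δ : ℝ} (hδ : 0 < δ) (μ : ℝ) {c : ℝ}
    (hw0 : ∀ ξ, 0 ≤ w ξ) (a b : ℝ)
    (hw : |w a - w b| * |freq b| ≤ c * (|freq (a - b)| * w b + w (a - b) * |freq b|)) :
    ‖symPhi μ (a - b)‖ * ‖symKPsi δ μ a * (w a * symP δ μ b) - symK δ a * (w b * symB δ b)‖ ≤
      (2 * c + 1) * (|freq (a - b)| * w b) + 2 * c * (w (a - b) * |freq b|) := by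
  -- Since `ψ(b) φ(b) = 1`, the difference splits into an increment of the weight and an increment
  -- of `ψ`.
  have e : symKPsi δ μ a * (w a * symP δ μ b) - symK δ a * (w b * symB δ b)
      = symK δ a * symB δ b * ((psi μ a * phi μ b * (w a - w b)
        + (psi μ a - psi μ b) * phi μ b * w b : ℝ) : ℂ) := by
    have h := psi_mul_phi μ b
    have h' : (psi μ b : ℂ) * (phi μ b : ℂ) = 1 := by rw [← Complex.ofReal_mul, h]; simp
    simp only [symKPsi, symP, symK, symB]
    push_cast
    linear_combination ((cut δ a : ℂ) * (Complex.I * ((freq b : ℂ) * (cut δ b : ℂ))) * (w b : ℂ)) * h'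
  rw [e, norm_mul, norm_mul, norm_symK, Complex.norm_real, norm_symPhi, Real.norm_eq_abs]
  have k1 := cut_le_one hδ a
  have k0 := cut_nonneg δ a
  have k2 := norm_symB_le hδ b
  have p0 := phi_pos μ (a - b)
  have p1 := phi_le_one μ (a - b)
  have p2 := phi_pos μ b
  have s0 := psi_pos μ a
  have key1 := psi_mul_phi_mul_phi_le μ a b
  have key2 := abs_psi_sub_mul_le μ a b
  have wb := hw0 b
  have hwr : 0 ≤ c * (|freq (a - b)| * w b + w (a - b) * |freq b|) := le_trans (by positivity) hw
  calc phi μ (a - b) * (cut δ a * ‖symB δ b‖ *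
        |psi μ a * phi μ b * (w a - w b) + (psi μ a - psi μ b) * phi μ b * w b|)
      ≤ phi μ (a - b) * (1 * |freq b| *
        (psi μ a * phi μ b * |w a - w b| + |psi μ a - psi μ b| * phi μ b * w b)) := by
        gcongr
        refine (abs_add_le _ _).trans (le_of_eq ?_)
        simp only [abs_mul, abs_of_pos s0, abs_of_pos p2, abs_of_nonneg wb]
    _ = (psi μ a * (phi μ (a - b) * phi μ b)) * (|w a - w b| * |freq b|)
        + phi μ (a - b) * ((|psi μ a - psi μ b| * |freq b|) * phi μ b * w b) := by ring
    _ ≤ 2 * (c * (|freq (a - b)| * w b + w (a - b) * |freq b|))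
        + 1 * ((|freq (a - b)| * psi μ b) * phi μ b * w b) := by gcongr
    _ = 2 * (c * (|freq (a - b)| * w b + w (a - b) * |freq b|))
        + |freq (a - b)| * w b * (psi μ b * phi μ b) := by ring
    _ = _ := by rw [psi_mul_phi]; ring

/-- The constant in the weighted energy inequality. -/
def energyConst (n : ℕ) : ℝ := 240 + 160 * 3 ^ n

lemma energyConst_pos (n : ℕ) : 0 < energyConst n := by unfold energyConst; positivity

/-- The weighted functions `W ζ` and `W y` solve the linear system with coefficients `ζ` and `v`,
with commutators as sources. The sources are bounded by the same weighted norms times the `L¹`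
quantity `A`. The constant depends on the weight only through its order, and the bound implicit in
`hwb` does not enter it, so truncated weights may be used and removed later. -/
lemma weighted_energy_inequality {δ : ℝ} (hδ : 0 < δ) (μ : ℝ) {n : ℕ} {w : ℝ → ℝ}
    (hw : IsWeight n w) (hwb : BddMeas (fun ξ => (w ξ : ℂ))) {ζ y : ComplexL2} (hζ : Herm ζ)
    (hy : Herm y) {A : ℝ} (hA : 0 ≤ A) (aζ : L1Le (bracket 1) ζ A) (ay : L1Le (bracket 1) y A) :
    2 * inner ℝ (mulOp (fun ξ => (w ξ : ℂ)) (rhs1 δ μ ζ y)) (mulOp (fun ξ => (w ξ : ℂ)) ζ)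
      + 2 * inner ℝ (symmOp ζ (mulOp (fun ξ => (w ξ : ℂ)) (rhs2 δ μ ζ y)))
        (mulOp (fun ξ => (w ξ : ℂ)) y)
      ≤ energyConst n * (A * (1 + A)) *
        (‖mulOp (fun ξ => (w ξ : ℂ)) ζ‖ ^ 2 + ‖mulOp (fun ξ => (w ξ : ℂ)) y‖ ^ 2) := by
  have bK := bddMeas_symK hδ
  have bB := bddMeas_symB hδ
  have bP := bddMeas_symP hδ μ
  have bF := bddMeas_symPhi μ
  have bKP := bddMeas_symKPsi hδ μ
  have iζ := aζ.one.integrable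
  have av : L1Le (bracket 1) (mulOp (symPhi μ) y) A := L1Le_mulOp ay bF (norm_symPhi_le_one μ)
  have iv := av.one.integrable
  set W := mulOp (fun ξ => (w ξ : ℂ)) with hW
  set v := mulOp (symPhi μ) y with hv
  set c : ℝ := 4 * 3 ^ n with hc
  have c0 : 0 ≤ c := by positivity
  set h₁ := W (convOp ζ (mulOp (symP δ μ) y)) - convOp ζ (W (mulOp (symP δ μ) y)) with hh₁
  set h₂ := W (convOp v (mulOp (symB δ) ζ)) - convOp v (W (mulOp (symB δ) ζ)) with hh₂
  -- The weight and `T_μ(D)^{-1/2}` are commuted past `v` in one step: this is the passage from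
  -- `T_μ(D)^{-1/2} (v P y)` to `v ∂ₓ y`.
  set h₃ := mulOp (symKPsi δ μ) (W (convOp v (mulOp (symP δ μ) y)))
    - mulOp (symK δ) (convOp v (W (mulOp (symB δ) y))) with hh₃
  have mfb : Measurable (fun ξ => c * bracket 1 ξ) := (measurable_bracket 1).const_mul c
  have mfp : ∀ ξ, 0 ≤ c * bracket 1 ξ := fun ξ => mul_nonneg c0 (bracket_pos 1 ξ).le
  have hker : ∀ a b, |w a - w b| * |freq b| ≤ c * bracket 1 (a - b) * w b
      + w (a - b) * (c * bracket 1 b) := fun a b => by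
    refine (hw.abs_sub_mul_le a b).trans ?_
    have h1 := abs_freq_le_bracket (a - b)
    have h2 := abs_freq_le_bracket b
    have h3 := hw.nonneg b
    have h4 := hw.nonneg (a - b)
    calc 4 * 3 ^ n * (|freq (a - b)| * w b + w (a - b) * |freq b|)
        ≤ c * (bracket 1 (a - b) * w b + w (a - b) * bracket 1 b) := by gcongr
      _ = _ := by ring
  have e₁ : ‖h₁‖ ≤ (c * A) * ‖W y‖ + ‖W ζ‖ * (c * A) := by
    have h := norm_bilin_le (f := ζ) (g := y) (l := fun _ => 1) (n := symP δ μ)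
      (n' := fun ξ => (w ξ : ℂ) * symP δ μ ξ) (m := fun ξ => (w ξ : ℂ)) (m' := fun _ => 1)
      bddMeas_one bP (hwb.mul bP) hwb bddMeas_one (by rw [mulOp_one]; exact iζ)
      mfb hw.meas hw.meas mfb mfp hw.nonneg hw.nonneg mfp
      (fun a b => by
        refine le_trans ?_ (hker a b)
        rw [norm_one, one_mul, one_mul, ← sub_mul, norm_mul, ← Complex.ofReal_sub,
          Complex.norm_real, Real.norm_eq_abs]
        gcongr
        exact norm_symP_le hδ μ b)
      (by positivity) (norm_nonneg _) (norm_nonneg _) (by positivity)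
      (aζ.const_mul c0 (measurable_bracket 1)) (L2Le_mulOp hw.nonneg hwb y)
      (L2Le_mulOp hw.nonneg hwb ζ) (ay.const_mul c0 (measurable_bracket 1))
    simpa only [mulOp_one, ← mulOp_mulOp hwb bP] using h
  have e₂ : ‖h₂‖ ≤ (c * A) * ‖W ζ‖ + ‖W y‖ * (c * A) := by
    have h := norm_bilin_le (f := y) (g := ζ) (l := symPhi μ) (n := symB δ)
      (n' := fun ξ => (w ξ : ℂ) * symB δ ξ) (m := fun ξ => (w ξ : ℂ)) (m' := fun _ => 1)
      bF bB (hwb.mul bB) hwb bddMeas_one iv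
      mfb hw.meas hw.meas mfb mfp hw.nonneg hw.nonneg mfp
      (fun a b => by
        refine le_trans ?_ (hker a b)
        rw [one_mul, ← sub_mul, norm_mul (_ - _), ← Complex.ofReal_sub,
          Complex.norm_real, Real.norm_eq_abs]
        refine (mul_le_of_le_one_left (by positivity) (norm_symPhi_le_one μ _)).trans ?_
        gcongr
        exact norm_symB_le hδ b)
      (by positivity) (norm_nonneg _) (norm_nonneg _) (by positivity)
      (ay.const_mul c0 (measurable_bracket 1)) (L2Le_mulOp hw.nonneg hwb ζ)
      (L2Le_mulOp hw.nonneg hwb y) (aζ.const_mul c0 (measurable_bracket 1))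
    simpa only [mulOp_one, ← mulOp_mulOp hwb bB] using h
  have e₃ : ‖h₃‖ ≤ ((2 * c + 1) * A) * ‖W y‖ + ‖W y‖ * (2 * c * A) := by
    have h := norm_bilin_le (f := y) (g := y) (l := symPhi μ) (n := symP δ μ)
      (n' := fun ξ => (w ξ : ℂ) * symB δ ξ) (m := fun ξ => symKPsi δ μ ξ * (w ξ : ℂ))
      (m' := symK δ)
      bF bP (hwb.mul bB) (bKP.mul hwb) bK iv
      (p₁ := fun ξ => (2 * c + 1) * bracket 1 ξ) (q₁ := w) (p₂ := w)
      (q₂ := fun ξ => 2 * c * bracket 1 ξ)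
      ((measurable_bracket 1).const_mul _) hw.meas hw.meas ((measurable_bracket 1).const_mul _)
      (fun ξ => mul_nonneg (by positivity) (bracket_pos 1 ξ).le) hw.nonneg hw.nonneg
      (fun ξ => mul_nonneg (by positivity) (bracket_pos 1 ξ).le)
      (fun a b => by
        have h0 := kernel_psi_le hδ μ (w := w) hw.nonneg a b (hw.abs_sub_mul_le a b)
        rw [mul_assoc (symKPsi δ μ a)]
        refine h0.trans ?_
        have h1 := abs_freq_le_bracket (a - b)
        have h2 := abs_freq_le_bracket b
        have h3 := hw.nonneg b
        have h4 := hw.nonneg (a - b)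
        calc (2 * c + 1) * (|freq (a - b)| * w b) + 2 * c * (w (a - b) * |freq b|)
            ≤ (2 * c + 1) * (bracket 1 (a - b) * w b) + 2 * c * (w (a - b) * bracket 1 b) := by
              gcongr
          _ = _ := by ring)
      (by positivity) (norm_nonneg _) (norm_nonneg _) (by positivity)
      (ay.const_mul (by positivity) (measurable_bracket 1)) (L2Le_mulOp hw.nonneg hwb y)
      (L2Le_mulOp hw.nonneg hwb y) (ay.const_mul (by positivity) (measurable_bracket 1))
    simpa only [← mulOp_mulOp hwb bB, ← mulOp_mulOp bKP hwb] using h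
  have hE := energy_inequality hδ μ hζ (herm_symPhi hy) hA aζ av
    (Z := W ζ) (y := W y) (Zt := W (rhs1 δ μ ζ y)) (yt := W (rhs2 δ μ ζ y))
    (F := -(mulOp (symK δ) h₁) - mulOp (symK δ) h₂) (G := -h₃)
    (by
      rw [rhs1, hh₁, hh₂, symmOp_apply, hW, mulOp_comm bP hwb, mulOp_comm bB hwb, map_neg,
        mulOp_comm hwb bK]
      simp only [map_add, map_sub]
      abel)
    (by
      rw [rhs2, hh₃, hW, mulOp_comm bP hwb, mulOp_comm bB hwb, map_neg, map_add,
        mulOp_comm hwb bK, mulOp_comm hwb bKP]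
      abel)
  refine hE.trans ?_
  have nK := norm_mulOp_le_of_one bK fun ξ => by rw [norm_symK]; exact cut_le_one hδ ξ
  set p := ‖W ζ‖ with hp
  set q := ‖W y‖ with hq
  have p0 : 0 ≤ p := norm_nonneg _
  have q0 : 0 ≤ q := norm_nonneg _
  have nF : ‖-(mulOp (symK δ) h₁) - mulOp (symK δ) h₂‖ ≤ 2 * (c * A) * (p + q) := by
    calc _ ≤ ‖-(mulOp (symK δ) h₁)‖ + ‖mulOp (symK δ) h₂‖ := norm_sub_le _ _
      _ ≤ ‖h₁‖ + ‖h₂‖ := by rw [norm_neg]; exact add_le_add (nK _) (nK _)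
      _ ≤ _ := by linarith
  have nG : ‖-h₃‖ ≤ (4 * c + 1) * A * q := by rw [norm_neg]; linarith
  have f1 : 2 * (‖-(mulOp (symK δ) h₁) - mulOp (symK δ) h₂‖ * p)
      ≤ 8 * c * A * (p ^ 2 + q ^ 2) := by
    calc _ ≤ 2 * ((2 * (c * A) * (p + q)) * p) := by gcongr
      _ = (c * A) * (4 * (p ^ 2 + q * p)) := by ring
      _ ≤ (c * A) * (8 * (p ^ 2 + q ^ 2)) :=
        mul_le_mul_of_nonneg_left (by nlinarith [sq_nonneg (p - q)]) (by positivity)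
      _ = _ := by ring
  have f2 : 2 * ((1 + 4 * A) * ‖-h₃‖ * q) ≤ 8 * (4 * c + 1) * (A * (1 + A)) * (p ^ 2 + q ^ 2) := by
    calc _ ≤ 2 * ((1 + 4 * A) * ((4 * c + 1) * A * q) * q) := by gcongr
      _ = (4 * c + 1) * A * (2 * (1 + 4 * A)) * q ^ 2 := by ring
      _ ≤ (4 * c + 1) * A * (8 * (1 + A)) * (p ^ 2 + q ^ 2) :=
        mul_le_mul (mul_le_mul_of_nonneg_left (by linarith) (by positivity))
          (by nlinarith [sq_nonneg p]) (by positivity) (by positivity)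
      _ = _ := by ring
  have f3 : 8 * c * A * (p ^ 2 + q ^ 2) ≤ 8 * c * (A * (1 + A)) * (p ^ 2 + q ^ 2) := by
    have : A ≤ A * (1 + A) := by nlinarith
    calc _ = 8 * c * (A) * (p ^ 2 + q ^ 2) := rfl
      _ ≤ _ := by gcongr
  have f4 : energyConst n = 240 + 40 * c := by rw [energyConst, hc]; ring
  have f5 : 0 ≤ (A * (1 + A)) * (p ^ 2 + q ^ 2) := by positivity
  rw [f4]
  nlinarith

/-! ### The difference of two solutions -/

lemma convOp_sub_left {f g : ComplexL2} (hf : Integrable f) (hg : Integrable g) (h : ComplexL2) :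
    convOp (f - g) h = convOp f h - convOp g h := by
  rw [sub_eq_add_neg, convOp_add hf (by
    simpa only [neg_smul, one_smul] using (hg.neg.congr (Lp.coeFn_neg g).symm))]
  rw [← neg_one_smul ℝ g, convOp_smul hg, neg_one_smul, sub_eq_add_neg]

lemma integrable_sub_coe {f g : ComplexL2} (hf : Integrable f) (hg : Integrable g) :
    Integrable (f - g : ComplexL2) := (hf.sub hg).congr (Lp.coeFn_sub f g).symm

lemma norm_convOp_le_of_kernel {f g : ComplexL2} {l n m : ℝ → ℂ} (hl : BddMeas l)
    (hn : BddMeas n) (hm : BddMeas m) (hf : Integrable (mulOp l f)) {c A : ℝ} (hc : 0 ≤ c)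
    (hA : 0 ≤ A) (hk : ∀ a b, ‖l (a - b)‖ * ‖m a * n b‖ ≤ c * bracket 1 b)
    (hg : L1Le (bracket 1) g A) :
    ‖mulOp m (convOp (mulOp l f) (mulOp n g))‖ ≤ c * A * ‖f‖ := by
  have h := norm_bilin_le (f := f) (g := g) (l := l) (n := n) (n' := fun _ => 0) (m := m)
    (m' := fun _ => 0) hl hn ⟨measurable_const, 0, by simp⟩ hm ⟨measurable_const, 0, by simp⟩ hf
    (p₁ := fun _ => 0) (q₁ := fun _ => 0) (p₂ := fun _ => 1) (q₂ := fun ξ => c * bracket 1 ξ)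
    measurable_const measurable_const measurable_const ((measurable_bracket 1).const_mul c)
    (fun _ => le_rfl) (fun _ => zero_le_one) (fun _ => le_rfl)
    (fun ξ => mul_nonneg hc (bracket_pos 1 ξ).le)
    (fun a b => by simpa using hk a b)
    (A₁ := 0) (B₁ := 0) (A₂ := ‖f‖) (B₂ := c * A) le_rfl le_rfl (norm_nonneg _)
    (mul_nonneg hc hA)
    (L1Le_zero f) (L2Le_zero g) (L2Le_one f) (hg.const_mul hc (measurable_bracket 1))
  have e : mulOp (fun _ => (0 : ℂ)) (convOp (mulOp l f) (mulOp (fun _ => (0 : ℂ)) g)) = 0 := by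
    have := norm_mulOp_le (m := fun _ => (0 : ℂ)) measurable_const (C := 0) (by simp)
      (convOp (mulOp l f) (mulOp (fun _ => (0 : ℂ)) g))
    simpa using this
  rw [e, sub_zero] at h
  linarith

lemma absorb_remainders {A p q e e' F G : ℝ} (hA : 0 ≤ A) (p0 : 0 ≤ p) (q0 : 0 ≤ q)
    (mF : F ≤ A * p + A * q + e) (mG : G ≤ 3 * A * q + e') :
    224 * (A * (1 + A)) * (p ^ 2 + q ^ 2) + 2 * (F * p) + 2 * ((1 + 4 * A) * G * q)
      ≤ 300 * (1 + A) ^ 2 * (p ^ 2 + q ^ 2) + 300 * (1 + A) ^ 2 * (e ^ 2 + e' ^ 2) := by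
  have f1 : 2 * (F * p) ≤ (3 * A + 1) * (p ^ 2 + q ^ 2) + e ^ 2 := by
    calc _ ≤ 2 * ((A * p + A * q + e) * p) := by gcongr
      _ = A * (2 * p ^ 2 + 2 * (p * q)) + 2 * (e * p) := by ring
      _ ≤ A * (3 * (p ^ 2 + q ^ 2)) + (e ^ 2 + p ^ 2) :=
        add_le_add (mul_le_mul_of_nonneg_left (by nlinarith [sq_nonneg (p - q)]) hA)
          (by nlinarith [sq_nonneg (e - p)])
      _ ≤ _ := by linarith [sq_nonneg q]
  have f2 : 2 * ((1 + 4 * A) * G * q) ≤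
      (1 + 4 * A) * ((6 * A + 1) * (p ^ 2 + q ^ 2) + e' ^ 2) := by
    have h1 : 2 * (e' * q) ≤ e' ^ 2 + q ^ 2 := by nlinarith [sq_nonneg (e' - q)]
    have h2 := mul_nonneg hA (sq_nonneg p)
    calc _ ≤ 2 * ((1 + 4 * A) * (3 * A * q + e') * q) := by gcongr
      _ = (1 + 4 * A) * (6 * A * q ^ 2 + 2 * (e' * q)) := by ring
      _ ≤ (1 + 4 * A) * ((6 * A + 1) * (p ^ 2 + q ^ 2) + e' ^ 2) :=
        mul_le_mul_of_nonneg_left (by linarith [sq_nonneg p]) (by positivity)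
  have hA2 := sq_nonneg A
  have c1 : 224 * (A * (1 + A)) + (3 * A + 1) + (1 + 4 * A) * (6 * A + 1) ≤ 300 * (1 + A) ^ 2 := by
    linarith
  have c2 : 1 ≤ 300 * (1 + A) ^ 2 := by linarith
  have c3 : 1 + 4 * A ≤ 300 * (1 + A) ^ 2 := by linarith
  calc _ ≤ 224 * (A * (1 + A)) * (p ^ 2 + q ^ 2) + ((3 * A + 1) * (p ^ 2 + q ^ 2) + e ^ 2)
        + (1 + 4 * A) * ((6 * A + 1) * (p ^ 2 + q ^ 2) + e' ^ 2) := by linarith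
    _ = (224 * (A * (1 + A)) + (3 * A + 1) + (1 + 4 * A) * (6 * A + 1)) * (p ^ 2 + q ^ 2)
        + (1 * e ^ 2 + (1 + 4 * A) * e' ^ 2) := by ring
    _ ≤ 300 * (1 + A) ^ 2 * (p ^ 2 + q ^ 2)
        + (300 * (1 + A) ^ 2 * e ^ 2 + 300 * (1 + A) ^ 2 * e' ^ 2) := by gcongr
    _ = _ := by ring

/-- The difference is treated as a solution of the linear system whose symmetrizer comes from `ζ₁`
and whose velocity comes from `y₂`. In the remaining terms the derivative falls on one of the given
solutions, so `L²` norms of the difference suffice. The functions `E₁`, `E₂` let the second pair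
solve the equation only approximately, for instance with another cut-off. -/
lemma difference_energy_inequality {δ : ℝ} (hδ : 0 < δ) (μ : ℝ) {ζ₁ y₁ ζ₂ y₂ E₁ E₂ : ComplexL2}
    (hζ₁ : Herm ζ₁) (hy₂ : Herm y₂) {A : ℝ} (hA : 0 ≤ A)
    (aζ₁ : L1Le (bracket 1) ζ₁ A) (ay₁ : L1Le (bracket 1) y₁ A)
    (aζ₂ : L1Le (bracket 1) ζ₂ A) (ay₂ : L1Le (bracket 1) y₂ A) :
    2 * inner ℝ (rhs1 δ μ ζ₁ y₁ - (rhs1 δ μ ζ₂ y₂ + E₁)) (ζ₁ - ζ₂)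
      + 2 * inner ℝ (symmOp ζ₁ (rhs2 δ μ ζ₁ y₁ - (rhs2 δ μ ζ₂ y₂ + E₂))) (y₁ - y₂)
      ≤ 300 * (1 + A) ^ 2 * (‖ζ₁ - ζ₂‖ ^ 2 + ‖y₁ - y₂‖ ^ 2) +
        300 * (1 + A) ^ 2 * (‖E₁‖ ^ 2 + ‖E₂‖ ^ 2) := by
  have bK := bddMeas_symK hδ
  have bB := bddMeas_symB hδ
  have bP := bddMeas_symP hδ μ
  have bF := bddMeas_symPhi μ
  have bKP := bddMeas_symKPsi hδ μ
  have nF := norm_symPhi_le_one μ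
  have iζ₁ := aζ₁.one.integrable
  have iζ₂ := aζ₂.one.integrable
  have av₁ : L1Le (bracket 1) (mulOp (symPhi μ) y₁) A := L1Le_mulOp ay₁ bF nF
  have av₂ : L1Le (bracket 1) (mulOp (symPhi μ) y₂) A := L1Le_mulOp ay₂ bF nF
  have iv₁ := av₁.one.integrable
  have iv₂ := av₂.one.integrable
  set Z := ζ₁ - ζ₂ with hZ
  set y := y₁ - y₂ with hy
  have iZ : Integrable Z := integrable_sub_coe iζ₁ iζ₂
  have iv : Integrable (mulOp (symPhi μ) y) := by
    rw [hy, map_sub]; exact integrable_sub_coe iv₁ iv₂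
  set f₁ := convOp Z (mulOp (symP δ μ) y₂) with hf₁
  set f₂ := mulOp (symK δ) (convOp (mulOp (symPhi μ) y) (mulOp (symB δ) ζ₁)) with hf₂
  -- This is the kernel of `kernel_psi_le` with weight `1`, for which the increment of the weight
  -- vanishes.
  set g₁ := mulOp (symKPsi δ μ) (convOp (mulOp (symPhi μ) y₂) (mulOp (symP δ μ) y))
    - mulOp (symK δ) (convOp (mulOp (symPhi μ) y₂) (mulOp (symB δ) y)) with hg₁
  set g₂ := mulOp (symKPsi δ μ) (convOp (mulOp (symPhi μ) y) (mulOp (symP δ μ) y₁)) with hg₂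
  have hK1 : ∀ ξ, ‖symK δ ξ‖ ≤ 1 := fun ξ => by rw [norm_symK]; exact cut_le_one hδ ξ
  have nK := norm_mulOp_le_of_one bK hK1
  have n₁ : ‖f₁‖ ≤ A * ‖Z‖ := by
    have h := norm_convOp_le_of_kernel (l := fun _ => 1) (m := fun _ => 1) (f := Z) bddMeas_one
      bP bddMeas_one (by rw [mulOp_one]; exact iZ) zero_le_one hA (fun a b => by
        simpa using (norm_symP_le hδ μ b).trans (abs_freq_le_bracket b)) ay₂
    simpa only [mulOp_one, one_mul] using h
  have n₂ : ‖f₂‖ ≤ A * ‖y‖ := by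
    have h := norm_convOp_le_of_kernel (f := y) bF bB bK iv zero_le_one hA (fun a b => by
        rw [norm_mul, one_mul]
        have h1 := (norm_symB_le hδ b).trans (abs_freq_le_bracket b)
        calc _ ≤ 1 * (1 * bracket 1 b) := by
              gcongr
              · exact nF _
              · exact hK1 _
          _ = _ := by ring) aζ₁
    simpa only [one_mul] using h
  have n₃ : ‖g₁‖ ≤ A * ‖y‖ := by
    have h := norm_bilin_le (f := y₂) (g := y) (l := symPhi μ) (n := symP δ μ)
      (n' := symB δ) (m := symKPsi δ μ) (m' := symK δ) bF bP bB bKP bK iv₂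
      (p₁ := bracket 1) (q₁ := fun _ => 1) (p₂ := fun _ => 0) (q₂ := fun _ => 0)
      (measurable_bracket 1) measurable_const measurable_const measurable_const
      (fun ξ => (bracket_pos 1 ξ).le) (fun _ => le_rfl) (fun _ => zero_le_one) (fun _ => le_rfl)
      (fun a b => by
        have h0 := kernel_psi_le hδ μ (w := fun _ => 1) (c := 0) (fun _ => zero_le_one) a b
          (by simp)
        simp only [Complex.ofReal_one, one_mul, mul_one, mul_zero, zero_add, zero_mul,
          add_zero] at h0 ⊢
        exact h0.trans (abs_freq_le_bracket _))
      hA (norm_nonneg y) le_rfl le_rfl ay₂ (L2Le_one y) (L2Le_zero _) (L1Le_zero _)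
    simpa only [mul_zero, add_zero] using h
  have n₄ : ‖g₂‖ ≤ 2 * A * ‖y‖ := by
    refine norm_convOp_le_of_kernel (f := y) bF bP bKP iv zero_le_two hA (fun a b => ?_) ay₁
    have h1 := psi_mul_phi_mul_phi_le μ a b
    have k0 := cut_nonneg δ a
    have k1 := cut_le_one hδ a
    have k2 := cut_nonneg δ b
    have k3 := cut_le_one hδ b
    have p0 := phi_pos μ (a - b)
    have p1 := phi_pos μ b
    have p2 := psi_pos μ a
    rw [norm_mul, norm_symP, norm_symPhi, symKPsi, Complex.norm_real, Real.norm_eq_abs,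
      abs_mul, abs_of_nonneg k0, abs_of_pos p2]
    calc _ = (psi μ a * (phi μ (a - b) * phi μ b)) * (cut δ a * (|freq b| * cut δ b)) := by ring
      _ ≤ 2 * (1 * (bracket 1 b * 1)) := by
        have := abs_freq_le_bracket b
        have := (bracket_pos 1 b).le
        gcongr
      _ = _ := by ring
  have hE := energy_inequality hδ μ hζ₁ (herm_symPhi hy₂) hA aζ₁ av₂
    (Z := Z) (y := y) (Zt := rhs1 δ μ ζ₁ y₁ - (rhs1 δ μ ζ₂ y₂ + E₁))
    (yt := rhs2 δ μ ζ₁ y₁ - (rhs2 δ μ ζ₂ y₂ + E₂))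
    (F := -(mulOp (symK δ) f₁) - f₂ - E₁) (G := -g₁ - g₂ - E₂)
    (by
      have e1 : y₁ = y + y₂ := by rw [hy]; abel
      have e2 : ζ₂ = ζ₁ - Z := by rw [hZ]; abel
      rw [rhs1, rhs1, hf₁, hf₂, symmOp_apply, hZ, convOp_sub_left iζ₁ iζ₂, ← hZ, e1,
        map_add (mulOp (symPhi μ)), convOp_add iv iv₂, e2]
      simp only [map_add, map_sub]
      abel)
    (by
      have e1 : y₁ = y + y₂ := by rw [hy]; abel
      have e2 : ζ₁ = Z + ζ₂ := by rw [hZ]; abel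
      rw [rhs2, rhs2, hg₁, hg₂, e2, e1, map_add (mulOp (symPhi μ)), convOp_add iv iv₂]
      simp only [map_add]
      abel)
  refine hE.trans ?_
  have mF : ‖-(mulOp (symK δ) f₁) - f₂ - E₁‖ ≤ A * ‖Z‖ + A * ‖y‖ + ‖E₁‖ := by
    have := nK f₁
    calc _ ≤ ‖-(mulOp (symK δ) f₁)‖ + ‖f₂‖ + ‖E₁‖ :=
          (norm_sub_le _ _).trans (by gcongr; exact norm_sub_le _ _)
      _ ≤ _ := by rw [norm_neg]; linarith
  have mG : ‖-g₁ - g₂ - E₂‖ ≤ 3 * A * ‖y‖ + ‖E₂‖ := by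
    calc _ ≤ ‖-g₁‖ + ‖g₂‖ + ‖E₂‖ :=
          (norm_sub_le _ _).trans (by gcongr; exact norm_sub_le _ _)
      _ ≤ _ := by rw [norm_neg]; linarith
  exact absorb_remainders hA (norm_nonneg _) (norm_nonneg _)
    mF mG

/-! ### Bilinear Fourier multipliers in Sobolev coordinates -/

/-- The `L²` norm of the weight `(1 + k²)^{(1-s)/2}`. -/
def decayConst (s : ℝ) : ℝ := Real.sqrt (∫ ξ, bracket (1 - s) ξ ^ 2)

lemma decayConst_nonneg (s : ℝ) : 0 ≤ decayConst s := Real.sqrt_nonneg _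

lemma integrable_bracket_sq {s : ℝ} (hs : 3 / 2 < s) :
    Integrable (fun ξ => bracket (1 - s) ξ ^ 2) := by
  -- The exponent `2 (s - 1)` exceeds the dimension precisely when `s > 3/2`.
  have h := integrable_rpow_neg_one_add_norm_sq (E := ℝ) (μ := volume) (r := 2 * (s - 1))
    (by simp; linarith)
  have h' := h.comp_mul_left' (R := 2 * Real.pi) (by positivity)
  refine h'.congr (ae_of_all _ fun ξ => ?_)
  simp only [bracket_sq, freq, Real.norm_eq_abs, sq_abs]
  congr 1
  ring

lemma lintegral_mul_enorm_le {w : ℝ → ℝ} (hw0 : ∀ ξ, 0 ≤ w ξ) (hw : Measurable w)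
    (hi : Integrable (fun ξ => w ξ ^ 2)) (f : ComplexL2) :
    L1Le w f (Real.sqrt (∫ ξ, w ξ ^ 2) * ‖f‖) := by
  unfold L1Le
  refine (ENNReal.lintegral_mul_le_Lp_mul_Lq (volume : Measure ℝ) Real.HolderConjugate.two_two
    hw.ennreal_ofReal.aemeasurable (measurable_enorm_coe f).aemeasurable).trans ?_
  have e1 : ∫⁻ ξ, ENNReal.ofReal (w ξ) ^ (2 : ℝ) = ENNReal.ofReal (∫ ξ, w ξ ^ 2) := by
    rw [ofReal_integral_eq_lintegral_ofReal hi (ae_of_all _ fun ξ => sq_nonneg _)]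
    congr 1
    ext ξ
    rw [ENNReal.rpow_two, ENNReal.ofReal_pow (hw0 ξ)]
  have e2 : ∫⁻ ξ, ‖f ξ‖ₑ ^ (2 : ℝ) = ENNReal.ofReal (‖f‖ ^ 2) := by
    rw [ENNReal.ofReal_pow (norm_nonneg _), ofReal_norm, enorm_sq_eq_lintegral]
    simp only [ENNReal.rpow_two]
  rw [e1, e2, ENNReal.ofReal_rpow_of_nonneg (integral_nonneg fun ξ => sq_nonneg _) (by norm_num),
    ENNReal.ofReal_rpow_of_nonneg (sq_nonneg _) (by norm_num), ← Real.sqrt_eq_rpow,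
    ← Real.sqrt_eq_rpow, Real.sqrt_sq (norm_nonneg _), ENNReal.ofReal_mul (Real.sqrt_nonneg _)]

lemma L1Le_decay {s : ℝ} (hs : 3 / 2 < s) (f : ComplexL2) :
    L1Le (bracket (1 - s)) f (decayConst s * ‖f‖) :=
  lintegral_mul_enorm_le (fun ξ => (bracket_pos _ ξ).le) (measurable_bracket _)
    (integrable_bracket_sq hs) f

/-- The function `a ↦ m(a) ∫ l(a-b) f(a-b) n(b) g(b) db`, as an element of `L²`. -/
def bil (m l n : ℝ → ℂ) (f g : ComplexL2) : ComplexL2 :=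
  open Classical in
  -- The outer symbol may be unbounded, so it cannot be applied as a bounded multiplier after the
  -- convolution. Only the combined kernel has to be bounded, as recorded by `Tame`. Outside `L²`
  -- the value is the junk value `0`.
  if h : MemLp (fun a => m a * conv (fun ξ => l ξ * f ξ) (fun ξ => n ξ * g ξ) a) 2 then
    h.toLp _ else 0

/-- The symbols of a bilinear multiplier which is bounded on `L²`. -/
structure Tame (s c : ℝ) (m l n : ℝ → ℂ) : Prop where
  lt : 3 / 2 < s
  nonneg : 0 ≤ c
  meas : Measurable m
  left : BddMeas l
  right : BddMeas n
  bound : ∀ a b, ‖l (a - b)‖ * ‖m a * n b‖ ≤ c * (bracket (1 - s) (a - b) + bracket (1 - s) b)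

section Bil

variable {s c : ℝ} {m l n : ℝ → ℂ}

lemma BddMeas.stronglyMeasurable_mul (hl : BddMeas l) (f : ComplexL2) :
    StronglyMeasurable (fun ξ => l ξ * f ξ) :=
  hl.meas.stronglyMeasurable.mul (Lp.stronglyMeasurable f)

/-- The kernel bound places the decay `(1 + k²)^{(1-s)/2}` on one of the factors, which thereby
becomes integrable, while the other stays in `L²`. -/
lemma memLp_bil (h : Tame s c m l n) (f g : ComplexL2) :
    MemLp (fun a => m a * conv (fun ξ => l ξ * f ξ) (fun ξ => n ξ * g ξ) a) 2 := by
  refine ⟨(h.meas.stronglyMeasurable.mul (stronglyMeasurable_conv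
    (h.left.stronglyMeasurable_mul f) (h.right.stronglyMeasurable_mul g))).aestronglyMeasurable, ?_⟩
  rw [eLpNorm_eq_lintegral_rpow_enorm_toReal (by norm_num) (by norm_num)]
  simp only [ENNReal.toReal_ofNat]
  refine ENNReal.rpow_lt_top_of_nonneg (by norm_num) (ne_of_lt ?_)
  have mf := measurable_enorm_coe f
  have mg := measurable_enorm_coe g
  have mb : Measurable (fun ξ => c * bracket (1 - s) ξ) := (measurable_bracket _).const_mul c
  have hb : ∀ ξ, 0 ≤ c * bracket (1 - s) ξ := fun ξ => mul_nonneg h.nonneg (bracket_pos _ ξ).le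
  set F : ℝ → ℝ≥0∞ := fun ξ => ENNReal.ofReal (c * bracket (1 - s) ξ) * ‖f ξ‖ₑ with hF
  set G : ℝ → ℝ≥0∞ := fun ξ => ENNReal.ofReal (c * bracket (1 - s) ξ) * ‖g ξ‖ₑ with hG
  have mF : Measurable F := mb.ennreal_ofReal.mul mf
  have mG : Measurable G := mb.ennreal_ofReal.mul mg
  have iF : ∫⁻ ξ, F ξ < ∞ :=
    ((L1Le_decay h.lt f).const_mul h.nonneg (measurable_bracket _)).trans_lt ENNReal.ofReal_lt_top
  have iG : ∫⁻ ξ, G ξ < ∞ :=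
    ((L1Le_decay h.lt g).const_mul h.nonneg (measurable_bracket _)).trans_lt ENNReal.ofReal_lt_top
  have jf : ∀ f : ComplexL2, ∫⁻ ξ, ‖f ξ‖ₑ ^ 2 < ∞ := fun f => by
    rw [← enorm_sq_eq_lintegral]; exact ENNReal.pow_lt_top enorm_lt_top
  have hconv : ∀ {F G : ℝ → ℝ≥0∞}, Measurable F → Measurable G →
      Measurable (fun a => ∫⁻ b, F (a - b) * G b) := fun hF hG =>
    ((hF.comp (measurable_fst.sub measurable_snd)).mul
      (hG.comp measurable_snd)).lintegral_prod_right'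
  calc ∫⁻ a, ‖m a * conv (fun ξ => l ξ * f ξ) (fun ξ => n ξ * g ξ) a‖ₑ ^ (2 : ℝ)
      ≤ ∫⁻ a, 2 ^ ((2 : ℝ) - 1) * ((∫⁻ b, F (a - b) * ‖g b‖ₑ) ^ (2 : ℝ)
          + (∫⁻ b, G (a - b) * ‖f b‖ₑ) ^ (2 : ℝ)) := by
        refine lintegral_mono fun a => ?_
        refine le_trans ?_ (ENNReal.rpow_add_le_mul_rpow_add_rpow _ _ (by norm_num))
        refine ENNReal.rpow_le_rpow ?_ (by norm_num)
        rw [conv, ← integral_const_mul, lintegral_convol_comm G]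
        refine (enorm_integral_le_lintegral_enorm _).trans ?_
        rw [← lintegral_add_left]
        · refine lintegral_mono fun b => ?_
          have e : m a * (l (a - b) * f (a - b) * (n b * g b))
              = (l (a - b) * (m a * n b)) * (f (a - b) * g b) := by ring
          rw [e, enorm_mul, enorm_mul (f (a - b)), ← ofReal_norm (l (a - b) * _), norm_mul]
          calc ENNReal.ofReal (‖l (a - b)‖ * ‖m a * n b‖) * (‖f (a - b)‖ₑ * ‖g b‖ₑ)
              ≤ ENNReal.ofReal (c * bracket (1 - s) (a - b) + c * bracket (1 - s) b)
                * (‖f (a - b)‖ₑ * ‖g b‖ₑ) := by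
                  gcongr; exact (h.bound a b).trans (le_of_eq (mul_add _ _ _))
            _ = _ := by
              rw [ENNReal.ofReal_add (hb _) (hb _)]
              simp only [hF, hG]
              ring
        · exact (mF.comp (measurable_const.sub measurable_id)).mul mg
    _ = 2 ^ ((2 : ℝ) - 1) * ((∫⁻ a, (∫⁻ b, F (a - b) * ‖g b‖ₑ) ^ 2)
          + ∫⁻ a, (∫⁻ b, G (a - b) * ‖f b‖ₑ) ^ 2) := by
        simp only [ENNReal.rpow_two]
        rw [lintegral_const_mul, lintegral_add_left]
        · exact (hconv mF mg).pow_const 2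
        · exact ((hconv mF mg).pow_const 2).add ((hconv mG mf).pow_const 2)
    _ < ∞ := by
        refine ENNReal.mul_lt_top (by norm_num) (ENNReal.add_lt_top.2 ⟨?_, ?_⟩)
        · exact (lintegral_young F _ mF mg).trans_lt
            (ENNReal.mul_lt_top (ENNReal.pow_lt_top iF) (jf g))
        · exact (lintegral_young G _ mG mf).trans_lt
            (ENNReal.mul_lt_top (ENNReal.pow_lt_top iG) (jf f))

lemma bil_ae (h : Tame s c m l n) (f g : ComplexL2) : bil m l n f g =ᵐ[volume]
    fun a => m a * conv (fun ξ => l ξ * f ξ) (fun ξ => n ξ * g ξ) a := by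
  rw [bil, dif_pos (memLp_bil h f g)]
  exact (memLp_bil h f g).coeFn_toLp

lemma bil_add_left (h : Tame s c m l n) (f f' g : ComplexL2) :
    bil m l n (f + f') g = bil m l n f g + bil m l n f' g := by
  apply Lp.ext
  filter_upwards [bil_ae h (f + f') g, bil_ae h f g, bil_ae h f' g,
    Lp.coeFn_add (bil m l n f g) (bil m l n f' g)] with a h1 h2 h3 h4
  rw [h1, h4, Pi.add_apply, h2, h3, ← mul_add,
    ← conv_add_left (h.left.memLp f) (h.left.memLp f') (h.right.memLp g)]
  congr 1
  refine conv_congr ?_ (ae_eq_refl _) a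
  filter_upwards [Lp.coeFn_add f f'] with ξ h5
  rw [h5, Pi.add_apply, mul_add]

lemma bil_add_right (h : Tame s c m l n) (f g g' : ComplexL2) :
    bil m l n f (g + g') = bil m l n f g + bil m l n f g' := by
  apply Lp.ext
  filter_upwards [bil_ae h f (g + g'), bil_ae h f g, bil_ae h f g',
    Lp.coeFn_add (bil m l n f g) (bil m l n f g')] with a h1 h2 h3 h4
  rw [h1, h4, Pi.add_apply, h2, h3, ← mul_add,
    ← conv_add_right (h.left.memLp f) (h.right.memLp g) (h.right.memLp g')]
  congr 1
  refine conv_congr (ae_eq_refl _) ?_ a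
  filter_upwards [Lp.coeFn_add g g'] with ξ h5
  rw [h5, Pi.add_apply, mul_add]

lemma mulOp_bil (h : Tame s c m l n) {k : ℝ → ℂ} (hk : BddMeas k) {c' : ℝ}
    (h' : Tame s c' (fun ξ => k ξ * m ξ) l n) (f g : ComplexL2) :
    mulOp k (bil m l n f g) = bil (fun ξ => k ξ * m ξ) l n f g := by
  apply Lp.ext
  filter_upwards [mulOp_ae hk (bil m l n f g), bil_ae h f g, bil_ae h' f g] with a h1 h2 h3
  rw [h1, h2, h3, mul_assoc]

lemma bil_eq_convOp (h : Tame s c m l n) (hm : BddMeas m) (f g : ComplexL2)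
    (hf : Integrable (mulOp l f)) :
    bil m l n f g = mulOp m (convOp (mulOp l f) (mulOp n g)) := by
  apply Lp.ext
  filter_upwards [bil_ae h f g, mulOp_ae hm (convOp (mulOp l f) (mulOp n g)),
    convOp_mulOp_ae h.left h.right hf g] with a h1 h2 h3
  rw [h1, h2, h3]

lemma norm_bil_sub_bil_le {m' n' : ℝ → ℂ} {c' e : ℝ} (h : Tame s c m l n)
    (h' : Tame s c' m' l n') (he : 0 ≤ e)
    (hk : ∀ a b, ‖l (a - b)‖ * ‖m a * n b - m' a * n' b‖ ≤
      e * (bracket (1 - s) (a - b) + bracket (1 - s) b)) (f g : ComplexL2) :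
    ‖bil m l n f g - bil m' l n' f g‖ ≤ 2 * e * decayConst s * (‖f‖ * ‖g‖) := by
  have hD := decayConst_nonneg s
  have hb : ∀ ξ, 0 ≤ e * bracket (1 - s) ξ := fun ξ => mul_nonneg he (bracket_pos _ ξ).le
  have h1 := norm_le_of_kernel (h := bil m l n f g - bil m' l n' f g) (f := f) (g := g) (l := l)
    (n := n) (n' := n') (m := m) (m' := m') h.left h.right h'.right
    (by filter_upwards [Lp.coeFn_sub (bil m l n f g) (bil m' l n' f g), bil_ae h f g,
          bil_ae h' f g] with a h1 h2 h3
        rw [h1, Pi.sub_apply, h2, h3])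
    (p₁ := fun ξ => e * bracket (1 - s) ξ) (q₁ := fun _ => 1) (p₂ := fun _ => 1)
    (q₂ := fun ξ => e * bracket (1 - s) ξ) ((measurable_bracket _).const_mul e) measurable_const
    measurable_const ((measurable_bracket _).const_mul e) hb (fun _ => zero_le_one)
    (fun _ => zero_le_one) hb
    (fun a b => (hk a b).trans (le_of_eq (by ring)))
    (A₁ := e * (decayConst s * ‖f‖)) (B₁ := ‖g‖) (A₂ := ‖f‖) (B₂ := e * (decayConst s * ‖g‖))
    (by positivity) (norm_nonneg _) (norm_nonneg _) (by positivity)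
    ((L1Le_decay h.lt f).const_mul he (measurable_bracket _)) (L2Le_one g) (L2Le_one f)
    ((L1Le_decay h.lt g).const_mul he (measurable_bracket _))
  exact h1.trans (le_of_eq (by ring))

lemma norm_bil_le (h : Tame s c m l n) (f g : ComplexL2) :
    ‖bil m l n f g‖ ≤ 2 * c * decayConst s * (‖f‖ * ‖g‖) := by
  have b0 : BddMeas (fun _ => 0) := ⟨measurable_const, 0, by simp⟩
  have h0 : Tame s c (fun _ => 0) l (fun _ => 0) :=
    ⟨h.lt, h.nonneg, measurable_const, h.left, b0, fun a b => by
      simpa using mul_nonneg h.nonneg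
        (add_nonneg (bracket_pos (1 - s) (a - b)).le (bracket_pos (1 - s) b).le)⟩
  have e0 : bil (fun _ => 0) l (fun _ => 0) f g = 0 := by
    apply Lp.ext
    filter_upwards [bil_ae h0 f g, Lp.coeFn_zero ℂ 2 (volume : Measure ℝ)] with a h1 h2
    rw [h1, h2, zero_mul, Pi.zero_apply]
  have := norm_bil_sub_bil_le h h0 h.nonneg (fun a b => by simpa using h.bound a b) f g
  rwa [e0, sub_zero] at this

lemma norm_bil_sub_le (h : Tame s c m l n) (f g f' g' : ComplexL2) :
    ‖bil m l n f g - bil m l n f' g'‖ ≤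
      2 * c * decayConst s * (‖f - f'‖ * ‖g‖ + ‖f'‖ * ‖g - g'‖) := by
  have e : bil m l n f g - bil m l n f' g' = bil m l n (f - f') g + bil m l n f' (g - g') := by
    have h1 := bil_add_left h (f - f') f' g
    have h2 := bil_add_right h f' (g - g') g'
    rw [sub_add_cancel] at h1 h2
    rw [h1, h2]
    abel
  rw [e]
  refine (norm_add_le _ _).trans ((add_le_add (norm_bil_le h _ _) (norm_bil_le h _ _)).trans ?_)
  exact le_of_eq (by ring)

end Bil

/-! ### The vector field in Sobolev coordinates -/

lemma bracket_neg_le_one {σ : ℝ} (hσ : σ ≤ 0) (ξ : ℝ) : bracket σ ξ ≤ 1 :=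
  (bracket_mono hσ ξ).trans (bracket_zero ξ).le

lemma cut_le_one_of_nonneg {δ : ℝ} (hδ : 0 ≤ δ) (ξ : ℝ) : cut δ ξ ≤ 1 :=
  max_le zero_le_one (by have := mul_nonneg hδ (abs_nonneg (freq ξ)); linarith)

lemma cut_zero (ξ : ℝ) : cut 0 ξ = 1 := by simp [cut]

lemma abs_freq_mul_bracket_le (σ ξ : ℝ) : |freq ξ| * bracket σ ξ ≤ bracket (1 + σ) ξ := by
  rw [bracket_add]
  exact mul_le_mul_of_nonneg_right (abs_freq_le_bracket ξ) (bracket_pos σ ξ).le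

lemma sqrt_freq_le_bracket (ξ : ℝ) : Real.sqrt |freq ξ| ≤ bracket (1 / 2) ξ := by
  refine Real.sqrt_le_iff.2 ⟨(bracket_pos _ ξ).le, (abs_freq_le_bracket ξ).trans (le_of_eq ?_)⟩
  rw [sq, ← bracket_add]
  norm_num

lemma sqrt_freq_mul_bracket_le (σ ξ : ℝ) :
    Real.sqrt |freq ξ| * bracket σ ξ ≤ bracket (1 / 2 + σ) ξ := by
  rw [bracket_add]
  exact mul_le_mul_of_nonneg_right (sqrt_freq_le_bracket ξ) (bracket_pos σ ξ).le

/-- Outer symbol of order `σ`. -/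
def symM (σ δ : ℝ) (p : ℝ → ℝ) (ξ : ℝ) : ℂ := ((bracket σ ξ * cut δ ξ * p ξ : ℝ) : ℂ)

/-- Symbol of the undifferentiated factor. -/
def symL (s : ℝ) (q : ℝ → ℝ) (ξ : ℝ) : ℂ := ((bracket (-s) ξ * q ξ : ℝ) : ℂ)

/-- Symbol of the differentiated factor. -/
def symN (s δ : ℝ) (r : ℝ → ℝ) (ξ : ℝ) : ℂ :=
  Complex.I * ((freq ξ * cut δ ξ * (bracket (-s) ξ * r ξ) : ℝ) : ℂ)

/-- The bounds that make the vector field of order `σ` bounded, with constant `c`. -/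
structure OrderBound (s σ δ c : ℝ) : Prop where
  lt : 3 / 2 < s
  cutoff_nonneg : 0 ≤ δ
  nonneg : 0 ≤ c
  lin : ∀ ξ, bracket σ ξ * cut δ ξ * (|freq ξ| * bracket (-s) ξ) ≤ c
  bil : ∀ a b, bracket σ a * cut δ a * (bracket (-s) (a - b) * bracket (1 - s) b) ≤
    c * (bracket (1 - s) (a - b) + bracket (1 - s) b)

/-- Triples of symbols of order zero allowed in the bilinear terms. -/
structure SymbolTriple (p q r : ℝ → ℝ) : Prop where
  meas₁ : Measurable p
  meas₂ : Measurable q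
  meas₃ : Measurable r
  nonneg₁ : ∀ ξ, 0 ≤ p ξ
  nonneg₂ : ∀ ξ, 0 ≤ q ξ
  nonneg₃ : ∀ ξ, 0 ≤ r ξ
  le_one₂ : ∀ ξ, q ξ ≤ 1
  le_one₃ : ∀ ξ, r ξ ≤ 1
  mul_le : ∀ a b, p a * (q (a - b) * r b) ≤ 2

lemma symbolTriple_one_one_phi (μ : ℝ) : SymbolTriple (fun _ => 1) (fun _ => 1) (phi μ) where
  meas₁ := measurable_const
  meas₂ := measurable_const
  meas₃ := measurable_phi μ
  nonneg₁ _ := zero_le_one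
  nonneg₂ _ := zero_le_one
  nonneg₃ ξ := (phi_pos μ ξ).le
  le_one₂ _ := le_rfl
  le_one₃ := phi_le_one μ
  mul_le a b := by have := phi_le_one μ b; linarith

lemma symbolTriple_one_phi_one (μ : ℝ) : SymbolTriple (fun _ => 1) (phi μ) (fun _ => 1) where
  meas₁ := measurable_const
  meas₂ := measurable_phi μ
  meas₃ := measurable_const
  nonneg₁ _ := zero_le_one
  nonneg₂ ξ := (phi_pos μ ξ).le
  nonneg₃ _ := zero_le_one
  le_one₂ := phi_le_one μ
  le_one₃ _ := le_rfl
  mul_le a b := by have := phi_le_one μ (a - b); linarith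

lemma symbolTriple_psi_phi_phi (μ : ℝ) : SymbolTriple (psi μ) (phi μ) (phi μ) where
  meas₁ := measurable_psi μ
  meas₂ := measurable_phi μ
  meas₃ := measurable_phi μ
  nonneg₁ ξ := (psi_pos μ ξ).le
  nonneg₂ ξ := (phi_pos μ ξ).le
  nonneg₃ ξ := (phi_pos μ ξ).le
  le_one₂ := phi_le_one μ
  le_one₃ := phi_le_one μ
  mul_le := psi_mul_phi_mul_phi_le μ

lemma measurable_symM (σ δ : ℝ) {p : ℝ → ℝ} (hp : Measurable p) : Measurable (symM σ δ p) :=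
  Complex.measurable_ofReal.comp (((measurable_bracket σ).mul (measurable_cut δ)).mul hp)

lemma bddMeas_symL {s : ℝ} (hs : 0 ≤ s) {q : ℝ → ℝ} (hq : Measurable q) (h0 : ∀ ξ, 0 ≤ q ξ)
    (h1 : ∀ ξ, q ξ ≤ 1) : BddMeas (symL s q) :=
  BddMeas.of_real ((measurable_bracket _).mul hq) (C := 1) fun ξ => by
    have hb := bracket_pos (-s) ξ
    rw [abs_of_nonneg (mul_nonneg hb.le (h0 ξ))]
    exact mul_le_one₀ (bracket_neg_le_one (by linarith) ξ) (h0 ξ) (h1 ξ)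

lemma norm_symN_le {s δ : ℝ} (hδ : 0 ≤ δ) {r : ℝ → ℝ} (h0 : ∀ ξ, 0 ≤ r ξ) (ξ : ℝ) :
    ‖symN s δ r ξ‖ ≤ |freq ξ| * bracket (-s) ξ * r ξ := by
  rw [symN, norm_mul, Complex.norm_I, one_mul, Complex.norm_real, Real.norm_eq_abs, abs_mul,
    abs_mul, abs_mul, abs_of_nonneg (cut_nonneg δ ξ), abs_of_pos (bracket_pos (-s) ξ),
    abs_of_nonneg (h0 ξ)]
  have h1 := (bracket_pos (-s) ξ).le
  have h2 := h0 ξ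
  have h3 := cut_nonneg δ ξ
  have h4 := cut_le_one_of_nonneg hδ ξ
  calc |freq ξ| * cut δ ξ * (bracket (-s) ξ * r ξ) ≤ |freq ξ| * 1 * (bracket (-s) ξ * r ξ) := by
        gcongr
    _ = _ := by ring

lemma bddMeas_symN {s δ : ℝ} (hs : 1 ≤ s) (hδ : 0 ≤ δ) {r : ℝ → ℝ} (hr : Measurable r)
    (h0 : ∀ ξ, 0 ≤ r ξ) (h1 : ∀ ξ, r ξ ≤ 1) : BddMeas (symN s δ r) := by
  refine ⟨(Complex.measurable_ofReal.comp ((measurable_freq.mul (measurable_cut δ)).mul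
    ((measurable_bracket _).mul hr))).const_mul _, 1, fun ξ => ?_⟩
  refine (norm_symN_le hδ h0 ξ).trans (mul_le_one₀ ?_ (h0 ξ) (h1 ξ))
  exact (abs_freq_mul_bracket_le _ ξ).trans (bracket_neg_le_one (by linarith) ξ)

lemma OrderBound.tame {s σ δ c : ℝ} (O : OrderBound s σ δ c) {p q r : ℝ → ℝ}
    (S : SymbolTriple p q r) : Tame s (2 * c) (symM σ δ p) (symL s q) (symN s δ r) where
  lt := O.lt
  nonneg := by have := O.nonneg; positivity
  meas := measurable_symM σ δ S.meas₁
  left := bddMeas_symL (by linarith [O.lt]) S.meas₂ S.nonneg₂ S.le_one₂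
  right := bddMeas_symN (by linarith [O.lt]) O.cutoff_nonneg S.meas₃ S.nonneg₃ S.le_one₃
  bound a b := by
    have h1 := norm_symN_le (s := s) O.cutoff_nonneg S.nonneg₃ b
    have h2 := abs_freq_mul_bracket_le (-s) b
    rw [← sub_eq_add_neg] at h2
    have b1 := (bracket_pos σ a).le
    have b2 := (bracket_pos (-s) (a - b)).le
    have b3 := (bracket_pos (1 - s) b).le
    have k1 := cut_nonneg δ a
    have p0 := S.nonneg₁ a
    have q0 := S.nonneg₂ (a - b)
    have r0 := S.nonneg₃ b
    rw [norm_mul, symL, symM, Complex.norm_real, Complex.norm_real,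
      Real.norm_of_nonneg (by positivity), Real.norm_of_nonneg (by positivity)]
    calc bracket (-s) (a - b) * q (a - b) * (bracket σ a * cut δ a * p a * ‖symN s δ r b‖)
        ≤ bracket (-s) (a - b) * q (a - b) *
          (bracket σ a * cut δ a * p a * (bracket (1 - s) b * r b)) := by
          gcongr
          exact h1.trans (by gcongr)
      _ = (p a * (q (a - b) * r b)) *
          (bracket σ a * cut δ a * (bracket (-s) (a - b) * bracket (1 - s) b)) := by ring
      _ ≤ 2 * (c * (bracket (1 - s) (a - b) + bracket (1 - s) b)) :=
          mul_le_mul (S.mul_le a b) (O.bil a b) (by positivity) zero_le_two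
      _ = _ := by ring

/-- One derivative is lost, so up to order `s - 1` no help from the cut-off is needed and the
constant is uniform in `δ ≥ 0`. The weight at `a` is split between `a - b` and `b`, and each half is
compensated by the decay of the factor at that frequency. -/
lemma orderBound_of_le {s σ δ : ℝ} (hs : 3 / 2 < s) (hδ : 0 ≤ δ) (hσ : 0 ≤ σ) (hσs : σ ≤ s - 1)
    {n : ℕ} (hn : σ ≤ n) : OrderBound s σ δ (2 ^ n) where
  lt := hs
  cutoff_nonneg := hδ
  nonneg := by positivity
  lin ξ := by
    have h1 := abs_freq_mul_bracket_le (-s) ξ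
    have h2 := (bracket_pos σ ξ).le
    have h3 := cut_le_one_of_nonneg hδ ξ
    have h4 : bracket σ ξ * 1 * bracket (1 + -s) ξ ≤ 1 := by
      rw [mul_one, ← bracket_add]
      exact bracket_neg_le_one (by linarith) ξ
    calc _ ≤ bracket σ ξ * 1 * bracket (1 + -s) ξ := by
          have h5 := (bracket_pos (-s) ξ).le
          gcongr
      _ ≤ 1 := h4
      _ ≤ _ := one_le_pow₀ (by norm_num)
  bil a b := by
    have h1 := (isWeight_bracket hσ hn).le_add a b
    have h2 := cut_le_one_of_nonneg hδ a
    have h3 := (bracket_pos (-s) (a - b)).le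
    have h4 := (bracket_pos (1 - s) b).le
    have h5 := (bracket_pos σ (a - b)).le
    have h6 := (bracket_pos σ b).le
    have e1 : bracket σ (a - b) * bracket (-s) (a - b) ≤ 1 := by
      rw [← bracket_add]; exact bracket_neg_le_one (by linarith) _
    have e2 : bracket σ b * bracket (1 - s) b ≤ 1 := by
      rw [← bracket_add]; exact bracket_neg_le_one (by linarith) _
    have e3 : bracket (-s) (a - b) ≤ bracket (1 - s) (a - b) := bracket_mono (by linarith) _
    have h7 := (bracket_pos (1 - s) (a - b)).le
    calc _ ≤ 2 ^ n * (bracket σ (a - b) + bracket σ b) * 1 *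
          (bracket (-s) (a - b) * bracket (1 - s) b) := by
          have := cut_nonneg δ a
          gcongr
      _ = 2 ^ n * ((bracket σ (a - b) * bracket (-s) (a - b)) * bracket (1 - s) b
          + bracket (-s) (a - b) * (bracket σ b * bracket (1 - s) b)) := by ring
      _ ≤ 2 ^ n * (1 * bracket (1 - s) b + bracket (1 - s) (a - b) * 1) := by gcongr
      _ = _ := by ring

/-- The cut-off vanishes for `|freq| > 1/δ`, so every order is allowed, with a constant that blows
up as `δ → 0`. Order `s` is what the ordinary differential equation in `H^s` needs. -/
lemma orderBound_of_pos {s δ : ℝ} (hs : 3 / 2 < s) (hδ : 0 < δ) {σ : ℝ} (hσ : 0 ≤ σ) :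
    ∃ c, OrderBound s σ δ c := by
  set K : ℝ := (1 + (1 / δ) ^ 2) ^ (σ / 2) with hK
  have K0 : 0 ≤ K := by positivity
  have hbc : ∀ ξ, bracket σ ξ * cut δ ξ ≤ K := fun ξ => by
    by_cases h : δ * |freq ξ| ≤ 1
    · have h1 : |freq ξ| ≤ 1 / δ := by rw [le_div_iff₀ hδ]; linarith
      have h2 : bracket σ ξ ≤ K := by
        refine Real.rpow_le_rpow (by positivity) ?_ (by positivity)
        rw [← sq_abs (freq ξ)]
        gcongr
      calc _ ≤ bracket σ ξ * 1 := by
            have := (bracket_pos σ ξ).le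
            gcongr
            exact cut_le_one hδ ξ
        _ ≤ K := by rwa [mul_one]
    · have : cut δ ξ = 0 := max_eq_left (by linarith)
      rw [this, mul_zero]
      exact K0
  refine ⟨K, hs, hδ.le, K0, fun ξ => ?_, fun a b => ?_⟩
  · have h1 := abs_freq_mul_bracket_le (-s) ξ
    have h2 : bracket (1 + -s) ξ ≤ 1 := bracket_neg_le_one (by linarith) ξ
    have h3 := (bracket_pos (-s) ξ).le
    calc _ ≤ K * 1 := by
          gcongr
          · exact hbc ξ
          · exact h1.trans h2
      _ = K := mul_one K
  · have h1 : bracket (-s) (a - b) ≤ 1 := bracket_neg_le_one (by linarith) _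
    have h2 := (bracket_pos (1 - s) b).le
    have h3 := (bracket_pos (-s) (a - b)).le
    have h4 := (bracket_pos (1 - s) (a - b)).le
    calc _ ≤ K * (1 * bracket (1 - s) b) := by
          gcongr
          exact hbc a
      _ ≤ _ := by rw [one_mul]; gcongr; linarith

/-- Symbol of the linear part. -/
def symLin (s σ δ μ : ℝ) (ξ : ℝ) : ℂ := symM σ δ (fun _ => 1) ξ * symN s δ (phi μ) ξ

/-- First component of the vector field of order `σ` in `H^s` coordinates. -/
def field1 (s σ δ μ : ℝ) (f g : ComplexL2) : ComplexL2 :=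
  -(mulOp (symLin s σ δ μ) g
    + bil (symM σ δ fun _ => 1) (symL s fun _ => 1) (symN s δ (phi μ)) f g
    + bil (symM σ δ fun _ => 1) (symL s (phi μ)) (symN s δ fun _ => 1) g f)

/-- Second component of the vector field of order `σ` in `H^s` coordinates. -/
def field2 (s σ δ μ : ℝ) (f g : ComplexL2) : ComplexL2 :=
  -(mulOp (symLin s σ δ μ) f + bil (symM σ δ (psi μ)) (symL s (phi μ)) (symN s δ (phi μ)) g g)

/-! ### Boundedness and Lipschitz bounds of the vector field. -/

section Field

variable {s σ δ c : ℝ} (μ : ℝ) (O : OrderBound s σ δ c)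
include O

lemma norm_symLin_le (ξ : ℝ) : ‖symLin s σ δ μ ξ‖ ≤ c := by
  have h1 := norm_symN_le (s := s) O.cutoff_nonneg (fun ξ => (phi_pos μ ξ).le) ξ
  have h2 := (bracket_pos (-s) ξ).le
  have h3 := (bracket_pos σ ξ).le
  have h4 := cut_nonneg δ ξ
  rw [symLin, norm_mul, symM, Complex.norm_real, mul_one, Real.norm_of_nonneg (by positivity)]
  calc _ ≤ bracket σ ξ * cut δ ξ * (|freq ξ| * bracket (-s) ξ * 1) := by
        gcongr
        exact h1.trans (by gcongr; exact phi_le_one μ ξ)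
    _ ≤ c := by rw [mul_one]; exact O.lin ξ

lemma bddMeas_symLin : BddMeas (symLin s σ δ μ) :=
  ⟨(measurable_symM σ δ measurable_const).mul
    (bddMeas_symN (by linarith [O.lt]) O.cutoff_nonneg (measurable_phi μ)
      (fun ξ => (phi_pos μ ξ).le) (phi_le_one μ)).meas, c, norm_symLin_le μ O⟩

lemma norm_field_sub_le {f g f' g' : ComplexL2} {ρ d : ℝ} (hg : ‖g‖ ≤ ρ)
    (hf : ‖f‖ ≤ ρ) (hf' : ‖f'‖ ≤ ρ) (hg' : ‖g'‖ ≤ ρ) (df : ‖f - f'‖ ≤ d) (dg : ‖g - g'‖ ≤ d) :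
    ‖field1 s σ δ μ f g - field1 s σ δ μ f' g'‖ ≤ c * (1 + 16 * decayConst s * ρ) * d ∧
    ‖field2 s σ δ μ f g - field2 s σ δ μ f' g'‖ ≤ c * (1 + 16 * decayConst s * ρ) * d := by
  have hc := O.nonneg
  have hD := decayConst_nonneg s
  have hρ : 0 ≤ ρ := (norm_nonneg f).trans hf
  have hd : 0 ≤ d := (norm_nonneg _).trans df
  have L : ∀ h h' : ComplexL2, ‖h - h'‖ ≤ d →
      ‖mulOp (symLin s σ δ μ) h - mulOp (symLin s σ δ μ) h'‖ ≤ c * d := fun h h' hh => by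
    rw [← map_sub]
    refine (norm_mulOp_le (bddMeas_symLin μ O).meas (norm_symLin_le μ O) _).trans ?_
    gcongr
  have Q : ∀ {p q r : ℝ → ℝ}, SymbolTriple p q r → ∀ u v u' v' : ComplexL2, ‖u - u'‖ ≤ d →
      ‖v - v'‖ ≤ d → ‖v‖ ≤ ρ → ‖u'‖ ≤ ρ →
      ‖bil (symM σ δ p) (symL s q) (symN s δ r) u v - bil (symM σ δ p) (symL s q) (symN s δ r) u' v'‖
        ≤ 8 * c * decayConst s * ρ * d := by
    intro p q r S u v u' v' h1 h2 h3 h4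
    refine (norm_bil_sub_le (O.tame S) u v u' v').trans ?_
    calc _ ≤ 2 * (2 * c) * decayConst s * (d * ρ + ρ * d) := by gcongr
      _ = _ := by ring
  constructor
  · have e : field1 s σ δ μ f g - field1 s σ δ μ f' g' =
        -((mulOp (symLin s σ δ μ) g - mulOp (symLin s σ δ μ) g')
        + (bil (symM σ δ fun _ => 1) (symL s fun _ => 1) (symN s δ (phi μ)) f g
          - bil (symM σ δ fun _ => 1) (symL s fun _ => 1) (symN s δ (phi μ)) f' g')
        + (bil (symM σ δ fun _ => 1) (symL s (phi μ)) (symN s δ fun _ => 1) g f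
          - bil (symM σ δ fun _ => 1) (symL s (phi μ)) (symN s δ fun _ => 1) g' f')) := by
      unfold field1; abel
    rw [e, norm_neg]
    have h1 := L g g' dg
    have h2 := Q (symbolTriple_one_one_phi μ) f g f' g' df dg hg hf'
    have h3 := Q (symbolTriple_one_phi_one μ) g f g' f' dg df hf hg'
    refine (norm_add₃_le).trans ?_
    linarith
  · have e : field2 s σ δ μ f g - field2 s σ δ μ f' g' =
        -((mulOp (symLin s σ δ μ) f - mulOp (symLin s σ δ μ) f')
        + (bil (symM σ δ (psi μ)) (symL s (phi μ)) (symN s δ (phi μ)) g g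
          - bil (symM σ δ (psi μ)) (symL s (phi μ)) (symN s δ (phi μ)) g' g')) := by
      unfold field2; abel
    rw [e, norm_neg]
    have h1 := L f f' df
    have h2 := Q (symbolTriple_psi_phi_phi μ) g g g' g' dg dg hg hg'
    refine (norm_add_le _ _).trans ?_
    have : 0 ≤ 8 * c * decayConst s * ρ * d := by positivity
    linarith

lemma field_zero : field1 s σ δ μ 0 0 = 0 ∧ field2 s σ δ μ 0 0 = 0 := by
  have Q : ∀ {p q r : ℝ → ℝ}, SymbolTriple p q r →
      bil (symM σ δ p) (symL s q) (symN s δ r) 0 0 = 0 := fun S => by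
    have := norm_bil_le (O.tame S) 0 0
    simpa using this
  rw [field1, field2, Q (symbolTriple_one_one_phi μ), Q (symbolTriple_one_phi_one μ),
    Q (symbolTriple_psi_phi_phi μ)]
  simp

lemma norm_field_le {f g : ComplexL2} {ρ : ℝ} (hf : ‖f‖ ≤ ρ) (hg : ‖g‖ ≤ ρ) :
    ‖field1 s σ δ μ f g‖ ≤ c * (1 + 16 * decayConst s * ρ) * ρ ∧
    ‖field2 s σ δ μ f g‖ ≤ c * (1 + 16 * decayConst s * ρ) * ρ := by
  have hρ : 0 ≤ ρ := (norm_nonneg f).trans hf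
  have := norm_field_sub_le μ O (f' := 0) (g' := 0) hg hf (by simpa) (by simpa)
    (d := ρ) (by simpa) (by simpa)
  rwa [(field_zero μ O).1, (field_zero μ O).2, sub_zero, sub_zero] at this

end Field

/-- The operator with symbol `(1 + k²)^{σ/2}`, for `σ ≤ 0`. -/
def sob (σ : ℝ) : ComplexL2 →L[ℝ] ComplexL2 := mulOp (fun ξ => ((bracket σ ξ : ℝ) : ℂ))

lemma bddMeas_bracket {σ : ℝ} (hσ : σ ≤ 0) : BddMeas (fun ξ => ((bracket σ ξ : ℝ) : ℂ)) :=
  BddMeas.of_real (measurable_bracket σ) (C := 1) fun ξ => by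
    rw [abs_of_pos (bracket_pos σ ξ)]; exact bracket_neg_le_one hσ ξ

lemma sob_ae {σ : ℝ} (hσ : σ ≤ 0) (f : ComplexL2) :
    sob σ f =ᵐ[volume] fun ξ => ((bracket σ ξ : ℝ) : ℂ) * f ξ := mulOp_ae (bddMeas_bracket hσ) f

lemma sob_sob {σ τ : ℝ} (hσ : σ ≤ 0) (hτ : τ ≤ 0) (f : ComplexL2) :
    sob σ (sob τ f) = sob (σ + τ) f := by
  rw [sob, sob, mulOp_mulOp (bddMeas_bracket hσ) (bddMeas_bracket hτ), sob]
  congr 2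
  ext ξ
  rw [bracket_add, Complex.ofReal_mul]

lemma sob_injective {σ : ℝ} (hσ : σ ≤ 0) {f g : ComplexL2} (h : sob σ f = sob σ g) : f = g := by
  apply Lp.ext
  have h1 := sob_ae hσ f
  rw [h] at h1
  filter_upwards [h1, sob_ae hσ g] with ξ h2 h3
  rw [h3] at h2
  have : ((bracket σ ξ : ℝ) : ℂ) ≠ 0 := Complex.ofReal_ne_zero.2 (bracket_pos σ ξ).ne'
  exact (mul_left_cancel₀ this h2).symm

lemma norm_sob_le {σ : ℝ} (hσ : σ ≤ 0) (f : ComplexL2) : ‖sob σ f‖ ≤ ‖f‖ :=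
  norm_mulOp_le_of_one (bddMeas_bracket hσ) (fun ξ => by
    rw [Complex.norm_real, Real.norm_of_nonneg (bracket_pos σ ξ).le]
    exact bracket_neg_le_one hσ ξ) f

lemma reflConj_sob {σ : ℝ} (hσ : σ ≤ 0) (f : ComplexL2) : reflConj (sob σ f) = sob σ (reflConj f) :=
  reflConj_mulOp (bddMeas_bracket hσ) (fun ξ => by rw [bracket_neg, Complex.conj_ofReal]) f

lemma herm_sob {σ : ℝ} (hσ : σ ≤ 0) {f : ComplexL2} : Herm (sob σ f) ↔ Herm f := by
  refine ⟨fun h => sob_injective hσ ?_, fun h => ?_⟩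
  · rw [← reflConj_sob hσ]; exact h
  · rw [Herm, reflConj_sob hσ, h]

lemma L1Le_sob {s : ℝ} (hs : 3 / 2 < s) (f : ComplexL2) :
    L1Le (bracket 1) (sob (-s) f) (decayConst s * ‖f‖) := by
  refine le_trans (le_of_eq ?_) (L1Le_decay hs f)
  refine lintegral_congr_ae ?_
  filter_upwards [sob_ae (by linarith : -s ≤ 0) f] with ξ h
  rw [h, enorm_mul, ← ofReal_norm ((bracket (-s) ξ : ℝ) : ℂ), Complex.norm_real,
    Real.norm_of_nonneg (bracket_pos _ ξ).le, ← mul_assoc,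
    ← ENNReal.ofReal_mul (bracket_pos _ ξ).le, ← bracket_add, sub_eq_add_neg]

/-- The outer symbol absorbs `(1 + k²)^{τ/2}`. In this way the field of order `s`, whose bounds
depend on `δ`, is replaced by the field of order `s - 1` or `0`, whose bounds do not. -/
lemma sob_field {s σ δ c τ c' : ℝ} (μ : ℝ) (O : OrderBound s σ δ c) (hτ : τ ≤ 0)
    (O' : OrderBound s (τ + σ) δ c') (f g : ComplexL2) :
    sob τ (field1 s σ δ μ f g) = field1 s (τ + σ) δ μ f g ∧
    sob τ (field2 s σ δ μ f g) = field2 s (τ + σ) δ μ f g := by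
  have eM : ∀ p : ℝ → ℝ, (fun ξ => ((bracket τ ξ : ℝ) : ℂ) * symM σ δ p ξ) = symM (τ + σ) δ p := by
    intro p
    ext ξ
    rw [symM, symM, bracket_add]
    push_cast
    ring
  have Q : ∀ {p q r : ℝ → ℝ}, SymbolTriple p q r → ∀ u v : ComplexL2,
      sob τ (bil (symM σ δ p) (symL s q) (symN s δ r) u v)
        = bil (symM (τ + σ) δ p) (symL s q) (symN s δ r) u v := by
    intro p q r S u v
    have h' := O'.tame S
    rw [← eM p] at h' ⊢
    exact mulOp_bil (O.tame S) (bddMeas_bracket hτ) h' u v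
  have L : ∀ u, sob τ (mulOp (symLin s σ δ μ) u) = mulOp (symLin s (τ + σ) δ μ) u := by
    intro u
    rw [sob, mulOp_mulOp (bddMeas_bracket hτ) (bddMeas_symLin μ O)]
    congr 2
    ext ξ
    rw [symLin, symLin, ← eM]
    ring
  rw [field1, field2, field1, field2, map_neg, map_neg, map_add, map_add, map_add, L, L,
    Q (symbolTriple_one_one_phi μ), Q (symbolTriple_one_phi_one μ), Q (symbolTriple_psi_phi_phi μ)]
  exact ⟨rfl, rfl⟩

/-- In `H^s` coordinates the vector field of order zero is the regularised one. -/
lemma field_eq_rhs {s δ : ℝ} (hs : 3 / 2 < s) (hδ : 0 < δ) (μ : ℝ) (f g : ComplexL2) :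
    field1 s 0 δ μ f g = rhs1 δ μ (sob (-s) f) (sob (-s) g) ∧
    field2 s 0 δ μ f g = rhs2 δ μ (sob (-s) f) (sob (-s) g) := by
  have bK := bddMeas_symK hδ
  have bB := bddMeas_symB hδ
  have bP := bddMeas_symP hδ μ
  have bF := bddMeas_symPhi μ
  have bKP := bddMeas_symKPsi hδ μ
  have bJ := bddMeas_bracket (show -s ≤ 0 by linarith)
  have O : OrderBound s 0 δ (2 ^ 0) :=
    orderBound_of_le hs hδ.le le_rfl (by linarith) (by simp)
  have e1 : symM 0 δ (fun _ => 1) = symK δ := by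
    ext ξ; simp [symM, symK, bracket_zero]
  have e2 : symM 0 δ (psi μ) = symKPsi δ μ := by
    ext ξ; simp [symM, symKPsi, bracket_zero]
  have e3 : symN s δ (phi μ) = fun ξ => symP δ μ ξ * ((bracket (-s) ξ : ℝ) : ℂ) := by
    ext ξ; simp only [symN, symP]; push_cast; ring
  have e4 : symN s δ (fun _ => 1) = fun ξ => symB δ ξ * ((bracket (-s) ξ : ℝ) : ℂ) := by
    ext ξ; simp only [symN, symB]; push_cast; ring
  have e5 : symL s (fun _ => 1) = fun ξ => ((bracket (-s) ξ : ℝ) : ℂ) := by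
    ext ξ; simp [symL]
  have e6 : symL s (phi μ) = fun ξ => symPhi μ ξ * ((bracket (-s) ξ : ℝ) : ℂ) := by
    ext ξ; simp only [symL, symPhi]; push_cast; ring
  have a1 : ∀ u, mulOp (symN s δ (phi μ)) u = mulOp (symP δ μ) (sob (-s) u) := fun u => by
    rw [e3, sob, mulOp_mulOp bP bJ]
  have a2 : ∀ u, mulOp (symN s δ fun _ => 1) u = mulOp (symB δ) (sob (-s) u) := fun u => by
    rw [e4, sob, mulOp_mulOp bB bJ]
  have a3 : ∀ u, mulOp (symL s fun _ => 1) u = sob (-s) u := fun u => by rw [e5, sob]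
  have a4 : ∀ u, mulOp (symL s (phi μ)) u = mulOp (symPhi μ) (sob (-s) u) := fun u => by
    rw [e6, sob, mulOp_mulOp bF bJ]
  have i3 : ∀ u, Integrable (sob (-s) u) := fun u => (L1Le_sob hs u).one.integrable
  have i4 : ∀ u, Integrable (mulOp (symPhi μ) (sob (-s) u)) := fun u =>
    (L1Le_mulOp (L1Le_sob hs u) bF (norm_symPhi_le_one μ)).one.integrable
  have bN : BddMeas (symN s δ (phi μ)) := (O.tame (symbolTriple_one_one_phi μ)).right
  have aL : ∀ u, mulOp (symLin s 0 δ μ) u = mulOp (symK δ) (mulOp (symP δ μ) (sob (-s) u)) := by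
    intro u
    rw [← a1, mulOp_mulOp bK bN]
    congr 2
    ext ξ
    rw [symLin, e1]
  have t1 := O.tame (symbolTriple_one_one_phi μ)
  have t2 := O.tame (symbolTriple_one_phi_one μ)
  have t3 := O.tame (symbolTriple_psi_phi_phi μ)
  rw [field1, field2, rhs1, rhs2, aL, aL, bil_eq_convOp t1 (by rw [e1]; exact bK) f g (by
      rw [a3]; exact i3 f), bil_eq_convOp t2 (by rw [e1]; exact bK) g f (by rw [a4]; exact i4 g),
    bil_eq_convOp t3 (by rw [e2]; exact bKP) g g (by rw [a4]; exact i4 g), a1, a2, a3, a4, e1, e2,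
    map_add, map_add]
  exact ⟨rfl, rfl⟩

/-- Removing the cut-off costs `√δ` in the vector field of order zero. -/
lemma norm_field_sub_field_zero_le {s δ : ℝ} (hs : 3 / 2 < s) (hδ : 0 < δ) (μ : ℝ)
    {f g : ComplexL2} {ρ : ℝ} (hf : ‖f‖ ≤ ρ) (hg : ‖g‖ ≤ ρ) :
    ‖field1 s 0 δ μ f g - field1 s 0 0 μ f g‖ ≤
      2 * Real.sqrt δ * (1 + 12 * decayConst s * ρ) * ρ ∧
    ‖field2 s 0 δ μ f g - field2 s 0 0 μ f g‖ ≤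
      2 * Real.sqrt δ * (1 + 12 * decayConst s * ρ) * ρ := by
  have O : OrderBound s 0 δ (2 ^ 0) :=
    orderBound_of_le hs hδ.le le_rfl (by linarith) (by simp)
  have O' : OrderBound s 0 0 (2 ^ 0) :=
    orderBound_of_le hs le_rfl le_rfl (by linarith) (by simp)
  have hρ : 0 ≤ ρ := (norm_nonneg f).trans hf
  have hD := decayConst_nonneg s
  have hsd := Real.sqrt_nonneg δ
  have hcut : ∀ a b, |cut δ a * cut δ b - 1| ≤
      Real.sqrt δ * (Real.sqrt |freq a| + Real.sqrt |freq b|) := fun a b => by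
    have h1 := one_sub_cut_le hδ a
    have h2 := one_sub_cut_le hδ b
    have h3 := cut_nonneg δ a
    have h4 := cut_nonneg δ b
    have h5 := cut_le_one hδ a
    have h6 := cut_le_one hδ b
    rw [abs_sub_comm, abs_of_nonneg (by nlinarith)]
    nlinarith
  have Q : ∀ {p q r : ℝ → ℝ}, SymbolTriple p q r → ∀ u v : ComplexL2, ‖u‖ ≤ ρ → ‖v‖ ≤ ρ →
      ‖bil (symM 0 δ p) (symL s q) (symN s δ r) u v - bil (symM 0 0 p) (symL s q) (symN s 0 r) u v‖
        ≤ 12 * Real.sqrt δ * decayConst s * (ρ * ρ) := by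
    intro p q r S u v hu hv
    -- The factor `2` comes from the symbol triple. The factor `3` arises because the square root of
    -- the output frequency is split over `a - b` and `b`, and the one at `b` occurs once more.
    refine (norm_bil_sub_bil_le (e := 6 * Real.sqrt δ) (O.tame S) (O'.tame S) (by positivity)
      (fun a b => ?_) u v).trans ?_
    · have e : symM 0 δ p a * symN s δ r b - symM 0 0 p a * symN s 0 r b
          = Complex.I * ((p a * r b * (freq b * bracket (-s) b) * (cut δ a * cut δ b - 1) : ℝ) : ℂ) := by
        simp only [symM, symN, bracket_zero, cut_zero]
        push_cast
        ring
      have b1 := (bracket_pos (-s) (a - b)).le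
      have b2 := (bracket_pos (-s) b).le
      have p0 := S.nonneg₁ a
      have q0 := S.nonneg₂ (a - b)
      have r0 := S.nonneg₃ b
      rw [e, norm_mul, Complex.norm_I, one_mul, symL, Complex.norm_real, Complex.norm_real,
        Real.norm_of_nonneg (by positivity), Real.norm_eq_abs, abs_mul, abs_mul, abs_mul, abs_mul,
        abs_of_nonneg p0, abs_of_nonneg r0, abs_of_nonneg b2]
      have s1 : Real.sqrt |freq a| ≤ Real.sqrt |freq (a - b)| + Real.sqrt |freq b| := by
        refine (Real.sqrt_le_sqrt (abs_freq_le_add a b)).trans ?_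
        refine Real.sqrt_le_iff.2 ⟨by positivity, ?_⟩
        have h1 := Real.sq_sqrt (abs_nonneg (freq (a - b)))
        have h2 := Real.sq_sqrt (abs_nonneg (freq b))
        nlinarith [mul_nonneg (Real.sqrt_nonneg |freq (a - b)|) (Real.sqrt_nonneg |freq b|)]
      have s2 : Real.sqrt |freq (a - b)| * bracket (-s) (a - b) ≤ bracket (1 - s) (a - b) :=
        (sqrt_freq_mul_bracket_le _ _).trans (bracket_mono (by linarith) _)
      have s3 : bracket (-s) (a - b) ≤ bracket (1 - s) (a - b) := bracket_mono (by linarith) _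
      have s4 : |freq b| * bracket (-s) b ≤ bracket (1 - s) b :=
        (abs_freq_mul_bracket_le _ _).trans (by rw [sub_eq_add_neg])
      have s5 : bracket (1 - s) b ≤ 1 := bracket_neg_le_one (by linarith) b
      have s6 : Real.sqrt |freq b| * bracket (1 - s) b ≤ 1 :=
        (sqrt_freq_mul_bracket_le _ _).trans (bracket_neg_le_one (by linarith) b)
      have b3 := (bracket_pos (1 - s) b).le
      have b4 := (bracket_pos (1 - s) (a - b)).le
      calc bracket (-s) (a - b) * q (a - b) *
            (p a * r b * (|freq b| * bracket (-s) b) * |cut δ a * cut δ b - 1|)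
          = (p a * (q (a - b) * r b)) * (bracket (-s) (a - b) * (|freq b| * bracket (-s) b) *
            |cut δ a * cut δ b - 1|) := by ring
        _ ≤ 2 * (bracket (-s) (a - b) * bracket (1 - s) b *
            (Real.sqrt δ * ((Real.sqrt |freq (a - b)| + Real.sqrt |freq b|) + Real.sqrt |freq b|))) := by
          gcongr
          · exact S.mul_le a b
          · exact (hcut a b).trans (by gcongr)
        _ = 2 * Real.sqrt δ * ((Real.sqrt |freq (a - b)| * bracket (-s) (a - b)) * bracket (1 - s) b
            + 2 * (bracket (-s) (a - b) * (Real.sqrt |freq b| * bracket (1 - s) b))) := by ring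
        _ ≤ 2 * Real.sqrt δ * (bracket (1 - s) (a - b) * 1
            + 2 * (bracket (1 - s) (a - b) * 1)) := by gcongr
        _ = 6 * Real.sqrt δ * bracket (1 - s) (a - b) := by ring
        _ ≤ _ := by gcongr; linarith
    · calc _ ≤ 2 * (6 * Real.sqrt δ) * decayConst s * (ρ * ρ) := by gcongr
        _ = _ := by ring
  have L : ∀ u : ComplexL2, ‖u‖ ≤ ρ →
      ‖mulOp (symLin s 0 δ μ) u - mulOp (symLin s 0 0 μ) u‖ ≤ 2 * Real.sqrt δ * ρ := by
    intro u hu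
    have h1 : mulOp (symLin s 0 δ μ) u - mulOp (symLin s 0 0 μ) u
        = mulOp (fun ξ => symLin s 0 δ μ ξ - symLin s 0 0 μ ξ) u := by
      have hb : BddMeas (fun ξ => symLin s 0 δ μ ξ - symLin s 0 0 μ ξ) :=
        ⟨(bddMeas_symLin μ O).meas.sub (bddMeas_symLin μ O').meas, 2 ^ 0 + 2 ^ 0, fun ξ =>
          (norm_sub_le _ _).trans (add_le_add (norm_symLin_le μ O ξ) (norm_symLin_le μ O' ξ))⟩
      apply Lp.ext
      filter_upwards [Lp.coeFn_sub (mulOp (symLin s 0 δ μ) u) (mulOp (symLin s 0 0 μ) u),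
        mulOp_ae (bddMeas_symLin μ O) u, mulOp_ae (bddMeas_symLin μ O') u, mulOp_ae hb u]
        with ξ h1 h2 h3 h4
      rw [h1, Pi.sub_apply, h2, h3, h4, sub_mul]
    rw [h1]
    refine (norm_mulOp_le (C := 2 * Real.sqrt δ)
      ((bddMeas_symLin μ O).meas.sub (bddMeas_symLin μ O').meas) (fun ξ => ?_) u).trans (by gcongr)
    have e : symLin s 0 δ μ ξ - symLin s 0 0 μ ξ
        = Complex.I * ((freq ξ * bracket (-s) ξ * phi μ ξ * (cut δ ξ * cut δ ξ - 1) : ℝ) : ℂ) := by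
      simp only [symLin, symM, symN, bracket_zero, cut_zero]
      push_cast
      ring
    have b1 := (bracket_pos (-s) ξ).le
    have b2 := (phi_pos μ ξ).le
    have s6 : Real.sqrt |freq ξ| * bracket (1 - s) ξ ≤ 1 :=
      (sqrt_freq_mul_bracket_le _ _).trans (bracket_neg_le_one (by linarith) ξ)
    have s4 : |freq ξ| * bracket (-s) ξ ≤ bracket (1 - s) ξ :=
      (abs_freq_mul_bracket_le _ _).trans (by rw [sub_eq_add_neg])
    have b3 := (bracket_pos (1 - s) ξ).le
    rw [Pi.sub_apply, e, norm_mul, Complex.norm_I, one_mul, Complex.norm_real, Real.norm_eq_abs,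
      abs_mul, abs_mul, abs_mul, abs_of_nonneg b1, abs_of_nonneg b2]
    calc _ ≤ bracket (1 - s) ξ * 1 *
          (Real.sqrt δ * (Real.sqrt |freq ξ| + Real.sqrt |freq ξ|)) := by
          gcongr
          · exact phi_le_one μ ξ
          · exact hcut ξ ξ
      _ = 2 * Real.sqrt δ * (Real.sqrt |freq ξ| * bracket (1 - s) ξ) := by ring
      _ ≤ 2 * Real.sqrt δ * 1 := by gcongr
      _ = _ := mul_one _
  constructor
  · have e : field1 s 0 δ μ f g - field1 s 0 0 μ f g =
        -((mulOp (symLin s 0 δ μ) g - mulOp (symLin s 0 0 μ) g)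
        + (bil (symM 0 δ fun _ => 1) (symL s fun _ => 1) (symN s δ (phi μ)) f g
          - bil (symM 0 0 fun _ => 1) (symL s fun _ => 1) (symN s 0 (phi μ)) f g)
        + (bil (symM 0 δ fun _ => 1) (symL s (phi μ)) (symN s δ fun _ => 1) g f
          - bil (symM 0 0 fun _ => 1) (symL s (phi μ)) (symN s 0 fun _ => 1) g f)) := by
      unfold field1; abel
    rw [e, norm_neg]
    have h1 := L g hg
    have h2 := Q (symbolTriple_one_one_phi μ) f g hf hg
    have h3 := Q (symbolTriple_one_phi_one μ) g f hg hf
    refine (norm_add₃_le).trans ?_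
    linarith
  · have e : field2 s 0 δ μ f g - field2 s 0 0 μ f g =
        -((mulOp (symLin s 0 δ μ) f - mulOp (symLin s 0 0 μ) f)
        + (bil (symM 0 δ (psi μ)) (symL s (phi μ)) (symN s δ (phi μ)) g g
          - bil (symM 0 0 (psi μ)) (symL s (phi μ)) (symN s 0 (phi μ)) g g)) := by
      unfold field2; abel
    rw [e, norm_neg]
    have h1 := L f hf
    have h2 := Q (symbolTriple_psi_phi_phi μ) g g hg hg
    refine (norm_add_le _ _).trans ?_
    have : 0 ≤ 12 * Real.sqrt δ * decayConst s * (ρ * ρ) := by positivity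
    linarith

lemma Herm.add {f g : ComplexL2} (hf : Herm f) (hg : Herm g) : Herm (f + g) := by
  rw [Herm, map_add, hf, hg]

lemma Herm.neg {f : ComplexL2} (hf : Herm f) : Herm (-f) := by rw [Herm, map_neg, hf]

lemma Herm.smul {f : ComplexL2} (hf : Herm f) (c : ℝ) : Herm (c • f) := by rw [Herm, map_smul, hf]

/-- The regularised vector field preserves reality. -/
lemma herm_field {s δ : ℝ} (hs : 3 / 2 < s) (hδ : 0 < δ) (μ : ℝ) {f g : ComplexL2} (hf : Herm f)
    (hg : Herm g) : Herm (field1 s s δ μ f g) ∧ Herm (field2 s s δ μ f g) := by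
  obtain ⟨c, O⟩ := orderBound_of_pos hs hδ (by linarith : 0 ≤ s)
  have O' : OrderBound s (-s + s) δ (2 ^ 0) := by
    rw [neg_add_cancel]
    exact orderBound_of_le hs hδ.le le_rfl (by linarith) (by simp)
  have hJ : -s ≤ 0 := by linarith
  have bK := bddMeas_symK hδ
  have bB := bddMeas_symB hδ
  have bP := bddMeas_symP hδ μ
  have bKP := bddMeas_symKPsi hδ μ
  have hI : ∀ r : ℝ, (starRingEnd ℂ) (Complex.I * ((-r : ℝ) : ℂ)) = Complex.I * (r : ℂ) := fun r => by
    simp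
  have hK : ∀ {u}, Herm u → Herm (mulOp (symK δ) u) := fun hu =>
    herm_mulOp bK (fun ξ => by rw [symK, symK, cut_neg, Complex.conj_ofReal]) hu
  have hKP : ∀ {u}, Herm u → Herm (mulOp (symKPsi δ μ) u) := fun hu =>
    herm_mulOp bKP (fun ξ => by rw [symKPsi, symKPsi, cut_neg, psi_neg, Complex.conj_ofReal]) hu
  have hP : ∀ {u}, Herm u → Herm (mulOp (symP δ μ) u) := fun hu =>
    herm_mulOp bP (fun ξ => by
      rw [symP, symP, cut_neg, phi_neg, freq_neg, neg_mul, neg_mul, hI]) hu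
  have hB : ∀ {u}, Herm u → Herm (mulOp (symB δ) u) := fun hu =>
    herm_mulOp bB (fun ξ => by rw [symB, symB, cut_neg, freq_neg, neg_mul, hI]) hu
  have hC : ∀ {u v : ComplexL2}, Integrable u → Herm u → Herm v → Herm (convOp u v) := fun iu hu hv => by
    rw [Herm, reflConj_convOp iu, hu, hv]
  have hf' := (herm_sob hJ).2 hf
  have hg' := (herm_sob hJ).2 hg
  have i1 := (L1Le_sob hs f).one.integrable
  have i2 := (L1Le_mulOp (L1Le_sob hs g) (bddMeas_symPhi μ) (norm_symPhi_le_one μ)).one.integrable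
  -- Reality is checked at order zero, where the field is made of convolutions, and transferred back
  -- since `sob (-s)` preserves and detects Hermitian functions.
  have e := sob_field μ O hJ O' f g
  rw [neg_add_cancel, (field_eq_rhs hs hδ μ f g).1, (field_eq_rhs hs hδ μ f g).2] at e
  rw [← herm_sob hJ, ← herm_sob (f := field2 s s δ μ f g) hJ, e.1, e.2, rhs1, rhs2]
  exact ⟨(hK (((hP hg').add (hC i1 hf' (hP hg'))).add
      (hC i2 (herm_symPhi hg') (hB hf')))).neg,
    ((hK (hP hf')).add (hKP (hC i2 (herm_symPhi hg') (hP hg')))).neg⟩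

/-! ### Differential inequalities and differential equations -/

section Abstract

variable {E : Type*} [NormedAddCommGroup E] [InnerProductSpace ℝ E]

/-- Growth of the energy `‖Z‖² + ⟨(1 + C) y, y⟩`. -/
lemma energy_growth {Z y Z' y' : ℝ → E} {C C' : ℝ → E →L[ℝ] E} {τ h a b κ d : ℝ}
    (hZ : ∀ t ∈ Icc 0 τ, HasDerivWithinAt Z (Z' t) (Icc 0 τ) t)
    (hy : ∀ t ∈ Icc 0 τ, HasDerivWithinAt y (y' t) (Icc 0 τ) t)
    (hC : ∀ t ∈ Icc 0 τ, HasDerivWithinAt C (C' t) (Icc 0 τ) t)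
    (hsymm : ∀ t ∈ Icc 0 τ, ∀ x z, inner ℝ (C t x) z = inner ℝ x (C t z))
    (hcoer : ∀ t ∈ Icc 0 τ, ∀ x, h * ‖x‖ ^ 2 ≤ inner ℝ (x + C t x) x) (h0 : 0 < h) (h1 : h ≤ 1)
    (hC' : ∀ t ∈ Icc 0 τ, ∀ x, ‖C' t x‖ ≤ b * ‖x‖) (hC0 : ∀ x, ‖C 0 x‖ ≤ a * ‖x‖)
    (ha : 0 ≤ a) (hb : 0 ≤ b) (hκ : 0 ≤ κ) (hd : 0 ≤ d)
    (hdiff : ∀ t ∈ Icc 0 τ, 2 * inner ℝ (Z' t) (Z t) + 2 * inner ℝ (y' t + C t (y' t)) (y t)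
      ≤ κ * (‖Z t‖ ^ 2 + ‖y t‖ ^ 2) + d) {t : ℝ} (ht : t ∈ Icc 0 τ) :
    h * (‖Z t‖ ^ 2 + ‖y t‖ ^ 2) ≤
      Real.exp ((κ + b) / h * t) * ((1 + a) * (‖Z 0‖ ^ 2 + ‖y 0‖ ^ 2) + d * t) := by
  have hτ : 0 ≤ τ := ht.1.trans ht.2
  set e : ℝ → ℝ := fun r => inner ℝ (Z r) (Z r) + inner ℝ (y r + C r (y r)) (y r) with he
  set e' : ℝ → ℝ := fun r => 2 * inner ℝ (Z' r) (Z r) + 2 * inner ℝ (y' r + C r (y' r)) (y r)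
    + inner ℝ (C' r (y r)) (y r) with he'
  set K := (κ + b) / h with hK
  have K0 : 0 ≤ K := by positivity
  have hde : ∀ r ∈ Icc 0 τ, HasDerivWithinAt e (e' r) (Icc 0 τ) r := fun r hr => by
    have d1 := (hZ r hr).inner ℝ (hZ r hr)
    have d2 := ((hy r hr).add ((hC r hr).clm_apply (hy r hr))).inner ℝ (hy r hr)
    refine (d1.add d2).congr_deriv ?_
    simp only [he', inner_add_left, hsymm r hr, real_inner_comm (Z r), Pi.add_apply]
    rw [real_inner_comm (y r) (y' r), real_inner_comm (C r (y r)) (y' r), hsymm r hr (y r) (y' r)]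
    ring
  have lower : ∀ r ∈ Icc 0 τ, h * (‖Z r‖ ^ 2 + ‖y r‖ ^ 2) ≤ e r := fun r hr => by
    have h2 := hcoer r hr (y r)
    simp only [he, real_inner_self_eq_norm_sq]
    nlinarith [sq_nonneg ‖Z r‖]
  have bound : ∀ r ∈ Icc 0 τ, e' r ≤ K * e r + d := fun r hr => by
    have h2 := hdiff r hr
    have h3 : inner ℝ (C' r (y r)) (y r) ≤ b * ‖y r‖ ^ 2 := by
      refine (real_inner_le_norm _ _).trans ?_
      calc _ ≤ (b * ‖y r‖) * ‖y r‖ := by gcongr; exact hC' r hr _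
        _ = _ := by ring
    have h4 : (κ + b) * (‖Z r‖ ^ 2 + ‖y r‖ ^ 2) ≤ K * e r := by
      calc _ = K * (h * (‖Z r‖ ^ 2 + ‖y r‖ ^ 2)) := by rw [hK]; field_simp
        _ ≤ _ := by gcongr; exact lower r hr
    have h5 : 0 ≤ b * ‖Z r‖ ^ 2 := by positivity
    simp only [he']
    linarith
  -- Gronwall by an integrating factor. The source `d` would acquire the factor `exp (-(K * r)) ≤
  -- 1`, so subtracting `d * r` is enough to make `g` nonincreasing.
  set g : ℝ → ℝ := fun r => Real.exp (-(K * r)) * e r - d * r with hg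
  have hdg : ∀ r ∈ Icc 0 τ, HasDerivWithinAt g
      (Real.exp (-(K * r)) * (e' r - K * e r) - d) (Icc 0 τ) r := fun r hr => by
    have d1 : HasDerivWithinAt (fun r : ℝ => Real.exp (-(K * r)))
        (Real.exp (-(K * r)) * (-(K * 1))) (Icc 0 τ) r :=
      (((hasDerivAt_id r).const_mul K).neg.exp).hasDerivWithinAt
    refine ((d1.mul (hde r hr)).sub ((hasDerivAt_id r).const_mul d).hasDerivWithinAt).congr_deriv ?_
    ring
  have anti : AntitoneOn g (Icc 0 τ) := by
    refine antitoneOn_of_hasDerivWithinAt_nonpos (convex_Icc 0 τ)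
      (f' := fun r => Real.exp (-(K * r)) * (e' r - K * e r) - d)
      (fun r hr => (hdg r hr).continuousWithinAt)
      (fun r hr => (hdg r (interior_subset hr)).mono interior_subset) fun r hr => ?_
    have hr' := interior_subset hr
    have h2 := bound r hr'
    have h3 : Real.exp (-(K * r)) ≤ 1 := Real.exp_le_one_iff.2 (by
      have := mul_nonneg K0 hr'.1; linarith)
    have h4 := Real.exp_pos (-(K * r))
    nlinarith
  have hfin := anti (left_mem_Icc.2 hτ) ht ht.1
  have e0 : e 0 ≤ (1 + a) * (‖Z 0‖ ^ 2 + ‖y 0‖ ^ 2) := by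
    have h2 : inner ℝ (C 0 (y 0)) (y 0) ≤ a * ‖y 0‖ ^ 2 := by
      refine (real_inner_le_norm _ _).trans ?_
      calc _ ≤ (a * ‖y 0‖) * ‖y 0‖ := by gcongr; exact hC0 _
        _ = _ := by ring
    have h5 : 0 ≤ a * ‖Z 0‖ ^ 2 := by positivity
    simp only [he, real_inner_self_eq_norm_sq, inner_add_left]
    linarith
  simp only [hg, mul_zero, neg_zero, Real.exp_zero, one_mul, sub_zero] at hfin
  refine (lower t ht).trans ?_
  have h6 : Real.exp (K * t) * Real.exp (-(K * t)) = 1 := by rw [← Real.exp_add]; simp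
  calc e t = Real.exp (K * t) * (Real.exp (-(K * t)) * e t) := by rw [← mul_assoc, h6, one_mul]
    _ ≤ _ := by gcongr; linarith

end Abstract

/-- A continuity argument. -/
lemma continuity_bootstrap {f : ℝ → ℝ} {τ a b : ℝ} (hf : ContinuousOn f (Icc 0 τ)) (hab : a < b)
    (h0 : f 0 < b) (hstep : ∀ t ∈ Icc 0 τ, (∀ r ∈ Icc 0 t, f r ≤ b) → f t ≤ a) :
    ∀ t ∈ Icc 0 τ, f t ≤ a := by
  -- By the intermediate value theorem a function starting below `b` cannot exceed `b` without
  -- taking the value `b`.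
  have key : ∀ t ∈ Icc 0 τ, (∀ r ∈ Icc 0 t, f r ≠ b) → f t < b := fun t ht hne => by
    by_contra! hcon
    obtain ⟨r, hr, hr'⟩ := intermediate_value_Icc ht.1 (hf.mono (Icc_subset_Icc_right ht.2))
      ⟨h0.le, hcon⟩
    exact hne r hr hr'
  have hne : ∀ t ∈ Icc 0 τ, f t ≠ b := by
    by_contra! hcon
    have hcl : IsCompact (Icc 0 τ ∩ f ⁻¹' {b}) :=
      isCompact_Icc.of_isClosed_subset
        (hf.preimage_isClosed_of_isClosed isClosed_Icc isClosed_singleton) inter_subset_left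
    -- At the first time where the value `b` is taken, the step hypothesis applies and forces the
    -- value down to `a < b`.
    obtain ⟨t, ht, hmin⟩ := hcl.exists_isLeast (by
      obtain ⟨t, ht, hb⟩ := hcon
      exact ⟨t, ht, hb⟩)
    have h1 : f t ≤ a := hstep t ht.1 fun r hr => by
      rcases hr.2.eq_or_lt with rfl | hlt
      · exact (show f r = b from ht.2).le
      · refine (key r ⟨hr.1, hlt.le.trans ht.1.2⟩ fun q hq hqb => ?_).le
        exact absurd (hmin ⟨⟨hq.1, hq.2.trans (hlt.le.trans ht.1.2)⟩, hqb⟩)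
          (not_le.2 (hq.2.trans_lt hlt))
    have h2 : f t = b := ht.2
    linarith
  intro t ht
  exact hstep t ht fun r hr =>
    (key r ⟨hr.1, hr.2.trans ht.2⟩ fun q hq => hne q ⟨hq.1, hq.2.trans (hr.2.trans ht.2)⟩).le

section Banach

variable {X : Type*} [NormedAddCommGroup X] [NormedSpace ℝ X]

/-- The radial retraction onto the ball of radius `R`. -/
def retr (R : ℝ) (x : X) : X := (R / max R ‖x‖) • x

lemma retr_eq {R : ℝ} (hR : 0 < R) {x : X} (hx : ‖x‖ ≤ R) : retr R x = x := by
  rw [retr, max_eq_left hx, div_self hR.ne', one_smul]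

lemma norm_retr_le {R : ℝ} (hR : 0 < R) (x : X) : ‖retr R x‖ ≤ R := by
  have h : 0 < max R ‖x‖ := hR.trans_le (le_max_left _ _)
  rw [retr, norm_smul, Real.norm_of_nonneg (by positivity), div_mul_eq_mul_div, div_le_iff₀ h]
  gcongr
  exact le_max_right _ _

lemma norm_retr_sub_le {R : ℝ} (hR : 0 < R) (x y : X) :
    ‖retr R x - retr R y‖ ≤ 2 * ‖x - y‖ := by
  set a := max R ‖x‖ with ha
  set b := max R ‖y‖ with hb
  have a0 : 0 < a := hR.trans_le (le_max_left _ _)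
  have b0 : 0 < b := hR.trans_le (le_max_left _ _)
  have e : retr R x - retr R y = (R / a) • (x - y) + (R / a - R / b) • y := by
    rw [retr, retr, ← ha, ← hb, smul_sub, sub_smul]; abel
  have h1 : |b - a| ≤ ‖x - y‖ := by
    rw [ha, hb]
    refine (abs_max_sub_max_le_max _ _ _ _).trans ?_
    rw [sub_self, abs_zero, max_eq_right (abs_nonneg _), norm_sub_rev]
    exact abs_norm_sub_norm_le y x
  have h2 : |R / a - R / b| * ‖y‖ ≤ |b - a| := by
    rw [div_sub_div _ _ a0.ne' b0.ne', abs_div, abs_of_pos (mul_pos a0 b0), div_mul_eq_mul_div,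
      div_le_iff₀ (mul_pos a0 b0), mul_comm a R, ← mul_sub, abs_mul, abs_of_pos hR]
    have h3 : ‖y‖ ≤ b := le_max_right _ _
    have h4 : R ≤ a := le_max_left _ _
    calc R * |b - a| * ‖y‖ ≤ a * |b - a| * b := by gcongr
      _ = _ := by ring
  have h3 : R / a ≤ 1 := (div_le_one a0).2 (le_max_left _ _)
  rw [e]
  refine (norm_add_le _ _).trans ?_
  rw [norm_smul, norm_smul, Real.norm_of_nonneg (by positivity), Real.norm_eq_abs]
  have h4 : R / a * ‖x - y‖ ≤ 1 * ‖x - y‖ := by gcongr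
  linarith

/-- Global solvability of an autonomous equation with a bounded Lipschitz vector field. -/
lemma exists_solution_of_bounded_lipschitz [CompleteSpace X] {G : X → X} {K L : ℝ} (hK : 0 ≤ K)
    (hL : 0 ≤ L) (hLip : ∀ x y, ‖G x - G y‖ ≤ K * ‖x - y‖) (hbd : ∀ x, ‖G x‖ ≤ L) (x₀ : X)
    {τ : ℝ} (hτ : 0 ≤ τ) :
    ∃ U : ℝ → X, U 0 = x₀ ∧ ∀ t ∈ Icc 0 τ, HasDerivWithinAt U (G (U t)) (Icc 0 τ) t := by
  -- The field is bounded by `L`, so in time `τ` the solution stays in the ball of radius `L τ`.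
  -- With this radius the local theorem covers the whole interval.
  have h : IsPicardLindelof (fun _ : ℝ => G) (tmin := 0) (tmax := τ) ⟨0, left_mem_Icc.2 hτ⟩ x₀
      (L.toNNReal * τ.toNNReal) 0 L.toNNReal K.toNNReal := by
    refine ⟨fun t _ => ?_, fun x _ => continuousOn_const, fun t _ x _ => ?_, ?_⟩
    · refine LipschitzWith.lipschitzOnWith (LipschitzWith.of_dist_le_mul fun x y => ?_)
      rw [dist_eq_norm, dist_eq_norm, Real.coe_toNNReal K hK]
      exact hLip x y
    · rw [Real.coe_toNNReal L hL]; exact hbd x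
    · simp [hτ]
  obtain ⟨U, h1, h2⟩ := h.exists_eq_forall_mem_Icc_hasDerivWithinAt₀
  exact ⟨U, h1, h2⟩

end Banach

/-! ### Multipliers converging pointwise -/

lemma tendsto_mulOp {m : ℕ → ℝ → ℂ} {m₀ : ℝ → ℂ} {C : ℝ} (hm : ∀ k, Measurable (m k))
    (hm₀ : Measurable m₀) (hC : ∀ k ξ, ‖m k ξ‖ ≤ C)
    (hlim : ∀ ξ, Tendsto (fun k => m k ξ) atTop (𝓝 (m₀ ξ))) (f : ComplexL2) :
    Tendsto (fun k => mulOp (m k) f) atTop (𝓝 (mulOp m₀ f)) := by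
  have hC₀ : ∀ ξ, ‖m₀ ξ‖ ≤ C := fun ξ =>
    le_of_tendsto (hlim ξ).norm (Eventually.of_forall fun k => hC k ξ)
  have key : Tendsto (fun k => ∫⁻ ξ, ‖(m k ξ - m₀ ξ) * f ξ‖ₑ ^ 2) atTop (𝓝 0) := by
    have h0 : ∫⁻ ξ : ℝ, (0 : ℝ≥0∞) = 0 := lintegral_zero
    rw [← h0]
    refine tendsto_lintegral_of_dominated_convergence
      (fun ξ => ENNReal.ofReal (2 * C) ^ 2 * ‖f ξ‖ₑ ^ 2) (fun k => ?_) (fun k => ?_) ?_ ?_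
    · exact ((((hm k).sub hm₀).mul (Lp.stronglyMeasurable f).measurable).enorm).pow_const 2
    · refine ae_of_all _ fun ξ => ?_
      simp only
      rw [enorm_mul, mul_pow]
      gcongr
      rw [← ofReal_norm]
      refine ENNReal.ofReal_le_ofReal ((norm_sub_le _ _).trans ?_)
      linarith [hC k ξ, hC₀ ξ]
    · rw [lintegral_const_mul _ ((measurable_enorm_coe f).pow_const 2), ← enorm_sq_eq_lintegral]
      exact ENNReal.mul_ne_top (ENNReal.pow_ne_top ENNReal.ofReal_ne_top)
        (ENNReal.pow_ne_top enorm_ne_top)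
    · refine ae_of_all _ fun ξ => ?_
      have h1 : Tendsto (fun k => (m k ξ - m₀ ξ) * f ξ) atTop (𝓝 0) := by
        have := ((hlim ξ).sub_const (m₀ ξ)).mul_const (f ξ)
        simpa using this
      have h2 : Tendsto (fun k => ‖(m k ξ - m₀ ξ) * f ξ‖ₑ ^ 2) atTop (𝓝 (‖(0 : ℂ)‖ₑ ^ 2)) :=
        ((ENNReal.continuous_pow 2).tendsto (‖(0 : ℂ)‖ₑ)).comp
          ((continuous_enorm.tendsto (0 : ℂ)).comp h1)
      rwa [enorm_zero, zero_pow two_ne_zero] at h2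
  have e : ∀ k, ∫⁻ ξ, ‖(m k ξ - m₀ ξ) * f ξ‖ₑ ^ 2 = ‖mulOp (m k) f - mulOp m₀ f‖ₑ ^ 2 := by
    intro k
    rw [enorm_sq_eq_lintegral]
    refine lintegral_congr_ae ?_
    filter_upwards [Lp.coeFn_sub (mulOp (m k) f) (mulOp m₀ f), mulOp_ae ⟨hm k, C, hC k⟩ f,
      mulOp_ae ⟨hm₀, C, hC₀⟩ f] with ξ h1 h2 h3
    rw [h1, Pi.sub_apply, h2, h3, sub_mul]
  simp only [e] at key
  rw [tendsto_iff_norm_sub_tendsto_zero]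
  have h3 := (ENNReal.tendsto_toReal (ENNReal.zero_ne_top)).comp key
  have h4 := (Real.continuous_sqrt.tendsto _).comp h3
  refine (h4.congr fun k => ?_).trans (by simp)
  simp only [Function.comp_apply, ENNReal.toReal_pow, toReal_enorm]
  exact Real.sqrt_sq (norm_nonneg _)

/-- The high-frequency part of a function. -/
def tailOp (R : ℝ) : ComplexL2 →L[ℝ] ComplexL2 := mulOp (fun ξ => ((tailWeight R ξ : ℝ) : ℂ))

lemma norm_tailWeight_le {R : ℝ} (hR : 0 < R) (ξ : ℝ) : ‖((tailWeight R ξ : ℝ) : ℂ)‖ ≤ 1 := by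
  rw [Complex.norm_real, Real.norm_of_nonneg ((isWeight_tailWeight hR).nonneg ξ)]
  exact tailWeight_le_one R ξ

lemma bddMeas_tailWeight {R : ℝ} (hR : 0 < R) : BddMeas (fun ξ => ((tailWeight R ξ : ℝ) : ℂ)) :=
  ⟨Complex.measurable_ofReal.comp (isWeight_tailWeight hR).meas, 1, norm_tailWeight_le hR⟩

lemma norm_tailOp_le {R : ℝ} (hR : 0 < R) (f : ComplexL2) : ‖tailOp R f‖ ≤ ‖f‖ :=
  norm_mulOp_le_of_one (bddMeas_tailWeight hR) (norm_tailWeight_le hR) f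

lemma tendsto_tailOp (f : ComplexL2) :
    Tendsto (fun k : ℕ => tailOp ((k : ℝ) + 1) f) atTop (𝓝 0) := by
  have h := tendsto_mulOp (m := fun k ξ => ((tailWeight ((k : ℝ) + 1) ξ : ℝ) : ℂ))
    (m₀ := fun _ => 0) (C := 1) (fun k => (bddMeas_tailWeight (by positivity)).meas)
    measurable_const (fun k => norm_tailWeight_le (by positivity)) (fun ξ => ?_) f
  · have e : mulOp (fun _ => (0 : ℂ)) f = 0 := by
      have := norm_mulOp_le (m := fun _ => (0 : ℂ)) measurable_const (C := 0) (by simp) f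
      simpa using this
    rw [e] at h
    exact h
  · rw [← Complex.ofReal_zero]
    refine (Complex.continuous_ofReal.tendsto 0).comp ?_
    refine tendsto_of_tendsto_of_tendsto_of_le_of_le tendsto_const_nhds
      (h := fun k : ℕ => |freq ξ| * (1 / ((k : ℝ) + 1))) ?_
      (fun k => (isWeight_tailWeight (by positivity)).nonneg ξ) (fun k => ?_)
    · simpa using tendsto_one_div_add_atTop_nhds_zero_nat.const_mul |freq ξ|
    · refine (min_le_right _ _).trans (le_of_eq ?_)
      rw [div_eq_mul_one_div]

/-- Splitting of the norm into a tail and a weaker norm. -/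
lemma norm_le_tailOp_add {s R : ℝ} (hs : 0 ≤ s) (hR : 0 < R) (f : ComplexL2) :
    ‖f‖ ≤ ‖tailOp R f‖ + (1 + R ^ 2) ^ (s / 2) * ‖sob (-s) f‖ := by
  have hJ : -s ≤ 0 := by linarith
  set B : ℝ := (1 + R ^ 2) ^ (s / 2) with hB
  have B0 : 0 ≤ B := by positivity
  have hbt := bddMeas_tailWeight hR
  have hm : BddMeas (fun ξ => 1 - ((tailWeight R ξ : ℝ) : ℂ)) :=
    ⟨measurable_const.sub hbt.meas, 1 + 1, fun ξ =>
      (norm_sub_le _ _).trans (add_le_add (by simp) (norm_tailWeight_le hR ξ))⟩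
  have e : f = tailOp R f + mulOp (fun ξ => 1 - ((tailWeight R ξ : ℝ) : ℂ)) f := by
    apply Lp.ext
    filter_upwards [Lp.coeFn_add (tailOp R f) (mulOp (fun ξ => 1 - ((tailWeight R ξ : ℝ) : ℂ)) f),
      mulOp_ae hbt f, mulOp_ae hm f] with ξ h1 h2 h3
    rw [h1, Pi.add_apply, tailOp, h2, h3]
    ring
  have h2 : ‖mulOp (fun ξ => 1 - ((tailWeight R ξ : ℝ) : ℂ)) f‖ ≤ B * ‖sob (-s) f‖ := by
    apply Lp.norm_le_mul_norm_of_ae_le_mul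
    filter_upwards [mulOp_ae hm f, sob_ae hJ f] with ξ h1 h2
    rw [h1, h2, norm_mul, norm_mul, ← mul_assoc]
    gcongr
    rw [← Complex.ofReal_one, ← Complex.ofReal_sub, Complex.norm_real, Complex.norm_real,
      Real.norm_of_nonneg (sub_nonneg.2 (tailWeight_le_one R ξ)),
      Real.norm_of_nonneg (bracket_pos _ _).le]
    have ht := (isWeight_tailWeight hR).nonneg ξ
    -- Below `R` the Sobolev weight is at most the constant. Above `R` the tail weight equals `1`
    -- and nothing is left.
    by_cases h : |freq ξ| ≤ R
    · have h3 : bracket s ξ ≤ B := by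
        refine Real.rpow_le_rpow (by positivity) ?_ (by positivity)
        rw [← sq_abs (freq ξ)]
        gcongr
      calc 1 - tailWeight R ξ ≤ 1 := by linarith
        _ = bracket s ξ * bracket (-s) ξ := by rw [mul_comm, bracket_neg_mul]
        _ ≤ _ := by
          have := (bracket_pos (-s) ξ).le
          gcongr
    · have h3 : tailWeight R ξ = 1 := min_eq_left ((one_le_div hR).2 (by linarith))
      rw [h3, sub_self]
      exact mul_nonneg B0 (bracket_pos _ _).le
  calc ‖f‖ = ‖tailOp R f + mulOp (fun ξ => 1 - ((tailWeight R ξ : ℝ) : ℂ)) f‖ := by rw [← e]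
    _ ≤ _ := (norm_add_le _ _).trans (by gcongr)

/-! ### The multiplication operator as a function of the coordinates -/

/-- Without the extra derivative, the `L¹` norm costs only `H^{s-1}`. This is what is available for
time derivatives uniformly in `δ`, so the motion of the symmetrizer can be controlled. -/
lemma L1Le_one_sob {s : ℝ} (hs : 3 / 2 < s) (f : ComplexL2) :
    L1Le (fun _ => 1) (sob (-s) f) (decayConst s * ‖sob (-1) f‖) := by
  have e : sob (-s) f = sob (1 - s) (sob (-1) f) := by
    rw [sob_sob (by linarith) (by norm_num)]
    congr 2
    ring
  rw [e]
  refine le_trans (le_of_eq ?_) (L1Le_decay hs (sob (-1) f))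
  refine lintegral_congr_ae ?_
  filter_upwards [sob_ae (by linarith : 1 - s ≤ 0) (sob (-1) f)] with ξ h
  rw [h, enorm_mul, ← ofReal_norm ((bracket (1 - s) ξ : ℝ) : ℂ), Complex.norm_real,
    Real.norm_of_nonneg (bracket_pos _ ξ).le, ENNReal.ofReal_one, one_mul]

lemma integrable_sob {s : ℝ} (hs : 3 / 2 < s) (f : ComplexL2) : Integrable (sob (-s) f) :=
  (L1Le_one_sob hs f).integrable

lemma norm_convOp_sob_le {s : ℝ} (hs : 3 / 2 < s) (f g : ComplexL2) :
    ‖convOp (sob (-s) f) g‖ ≤ decayConst s * ‖sob (-1) f‖ * ‖g‖ :=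
  norm_convOp_apply_le (mul_nonneg (decayConst_nonneg s) (norm_nonneg _)) (L1Le_one_sob hs f) g

/-- Convolution with `sob (-s) f` as a function of `f`. -/
def convSob {s : ℝ} (hs : 3 / 2 < s) : ComplexL2 →L[ℝ] ComplexL2 →L[ℝ] ComplexL2 :=
  LinearMap.mkContinuous
    { toFun := fun f => convOp (sob (-s) f)
      map_add' := fun f f' => by
        ext1 g
        rw [map_add, convOp_add (integrable_sob hs f) (integrable_sob hs f')]
        rfl
      map_smul' := fun c f => by
        ext1 g
        rw [map_smul, convOp_smul (integrable_sob hs f)]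
        rfl }
    (decayConst s) (fun f => by
      refine ContinuousLinearMap.opNorm_le_bound _
        (mul_nonneg (decayConst_nonneg s) (norm_nonneg _)) fun g => ?_
      refine (norm_convOp_sob_le hs f g).trans ?_
      have h1 := norm_sob_le (by norm_num : (-1 : ℝ) ≤ 0) f
      have h2 := decayConst_nonneg s
      gcongr)

/-! ### Solvability of the truncated regularised system -/

/-- Projection onto the transforms of real functions. -/
def hermProj : ComplexL2 →L[ℝ] ComplexL2 :=
  (1 / 2 : ℝ) • (ContinuousLinearMap.id ℝ ComplexL2 + reflConj)

lemma hermProj_apply (f : ComplexL2) : hermProj f = (1 / 2 : ℝ) • (f + reflConj f) := rfl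

lemma herm_hermProj (f : ComplexL2) : Herm (hermProj f) := by
  rw [Herm, hermProj_apply, map_smul, map_add, reflConj_reflConj, add_comm]

lemma hermProj_eq {f : ComplexL2} (hf : Herm f) : hermProj f = f := by
  rw [hermProj_apply, hf, ← two_smul ℝ f, smul_smul]
  norm_num

lemma norm_hermProj_le (f : ComplexL2) : ‖hermProj f‖ ≤ ‖f‖ := by
  rw [hermProj_apply, norm_smul]
  have h1 := norm_add_le f (reflConj f)
  have h2 := norm_reflConj_le f
  norm_num
  linarith

/-- The vector field in `H^s` coordinates on the product space. -/
def vecField (s σ δ μ : ℝ) (x : ComplexL2 × ComplexL2) : ComplexL2 × ComplexL2 :=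
  (field1 s σ δ μ x.1 x.2, field2 s σ δ μ x.1 x.2)

lemma norm_vecField_sub_le {s σ δ c : ℝ} (μ : ℝ) (O : OrderBound s σ δ c) {ρ : ℝ}
    {x y : ComplexL2 × ComplexL2} (hx : ‖x‖ ≤ ρ) (hy : ‖y‖ ≤ ρ) :
    ‖vecField s σ δ μ x - vecField s σ δ μ y‖ ≤ c * (1 + 16 * decayConst s * ρ) * ‖x - y‖ := by
  have h := norm_field_sub_le μ O (f := x.1) (g := x.2) (f' := y.1) (g' := y.2) (ρ := ρ)
    (d := ‖x - y‖) ((norm_snd_le x).trans hx) ((norm_fst_le x).trans hx)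
    ((norm_fst_le y).trans hy) ((norm_snd_le y).trans hy) (norm_fst_le (x - y)) (norm_snd_le (x - y))
  exact max_le h.1 h.2

lemma norm_vecField_le {s σ δ c : ℝ} (μ : ℝ) (O : OrderBound s σ δ c) {ρ : ℝ}
    {x : ComplexL2 × ComplexL2} (hx : ‖x‖ ≤ ρ) :
    ‖vecField s σ δ μ x‖ ≤ c * (1 + 16 * decayConst s * ρ) * ρ := by
  have h := norm_field_le μ O ((norm_fst_le x).trans hx) ((norm_snd_le x).trans hx)
  exact max_le h.1 h.2

/-- Composing the field with the retraction onto a ball makes it globally bounded and Lipschitz, so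
the solution exists on any interval. The truncation is shown to be inactive afterwards, by the
energy bound. -/
lemma exists_truncated_solution {s δ : ℝ} (hs : 3 / 2 < s) (hδ : 0 < δ) (μ : ℝ)
    {x₀ : ComplexL2 × ComplexL2} (h₁ : Herm x₀.1) (h₂ : Herm x₀.2) {R τ : ℝ} (hR : 0 < R)
    (hτ : 0 ≤ τ) :
    ∃ V : ℝ → ComplexL2 × ComplexL2, V 0 = x₀ ∧ (∀ t, Herm (V t).1 ∧ Herm (V t).2) ∧
      ∀ t ∈ Icc 0 τ, HasDerivWithinAt V (vecField s s δ μ (retr R (V t))) (Icc 0 τ) t := by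
  obtain ⟨c, O⟩ := orderBound_of_pos hs hδ (by linarith : 0 ≤ s)
  have hc := O.nonneg
  have hD := decayConst_nonneg s
  set P : (ComplexL2 × ComplexL2) →L[ℝ] (ComplexL2 × ComplexL2) := hermProj.prodMap hermProj with hP
  have nP : ∀ x, ‖P x‖ ≤ ‖x‖ := fun x =>
    max_le ((norm_hermProj_le _).trans (norm_fst_le x)) ((norm_hermProj_le _).trans (norm_snd_le x))
  set G : ComplexL2 × ComplexL2 → ComplexL2 × ComplexL2 :=
    fun x => vecField s s δ μ (retr R (P x)) with hG
  set C : ℝ := c * (1 + 16 * decayConst s * R) with hC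
  have C0 : 0 ≤ C := by positivity
  obtain ⟨U, hU0, hU⟩ := exists_solution_of_bounded_lipschitz (G := G) (K := C * 2) (L := C * R)
    (by positivity) (by positivity)
    (fun x y => by
      refine (norm_vecField_sub_le μ O (norm_retr_le hR _) (norm_retr_le hR _)).trans ?_
      have h3 := norm_retr_sub_le hR (P x) (P y)
      have h4 : ‖P x - P y‖ ≤ ‖x - y‖ := by rw [← map_sub]; exact nP _
      rw [mul_assoc C]
      gcongr
      linarith)
    (fun x => norm_vecField_le μ O (norm_retr_le hR _)) x₀ hτ
  have hPH : ∀ x, Herm (P x).1 ∧ Herm (P x).2 := fun x => ⟨herm_hermProj _, herm_hermProj _⟩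
  have hPeq : ∀ x : ComplexL2 × ComplexL2, Herm x.1 → Herm x.2 → P x = x := fun x h h' =>
    Prod.ext (hermProj_eq h) (hermProj_eq h')
  -- The right-hand side is evaluated at projected arguments and is then itself Hermitian, so the
  -- projection of the solution satisfies the same equation.
  refine ⟨fun t => P (U t), by
    show P (U 0) = x₀
    rw [hU0]; exact hPeq _ h₁ h₂, fun t => hPH _, fun t ht => ?_⟩
  have h5 := P.hasFDerivAt.comp_hasDerivWithinAt t (hU t ht)
  refine h5.congr_deriv ?_
  have h6 := herm_field hs hδ μ ((hPH (U t)).1.smul (R / max R ‖P (U t)‖))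
    ((hPH (U t)).2.smul (R / max R ‖P (U t)‖))
  exact hPeq _ h6.1 h6.2

/-! ### Uniform bounds for the regularised system -/

/-- The symmetrizer `1 + f` is bounded below by `h`. -/
def Coercive (h : ℝ) (f : ComplexL2) : Prop :=
  ∀ x : ComplexL2, h * ‖x‖ ^ 2 ≤ inner ℝ (x + convOp f x) x

/-- Bound of the time derivative in `H^{s-1}` when the solution is bounded by `ρ` in `H^s`. -/
def fieldBound (s ρ : ℝ) : ℝ := 2 ^ ⌈s⌉₊ * (1 + 16 * decayConst s * ρ) * ρ

/-- Solutions of the regularised system in `H^s` coordinates. -/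
structure RegSol (s δ μ τ : ℝ) (f g : ℝ → ComplexL2) : Prop where
  herm₁ : ∀ t ∈ Icc 0 τ, Herm (f t)
  herm₂ : ∀ t ∈ Icc 0 τ, Herm (g t)
  deriv₁ : ∀ t ∈ Icc 0 τ, HasDerivWithinAt f (field1 s s δ μ (f t) (g t)) (Icc 0 τ) t
  deriv₂ : ∀ t ∈ Icc 0 τ, HasDerivWithinAt g (field2 s s δ μ (f t) (g t)) (Icc 0 τ) t

lemma fieldBound_nonneg (s : ℝ) {ρ : ℝ} (hρ : 0 ≤ ρ) : 0 ≤ fieldBound s ρ := by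
  have := decayConst_nonneg s
  unfold fieldBound
  positivity

/-- One derivative below the top, the field is bounded independently of `δ`. -/
lemma norm_sob_field_le {s δ : ℝ} (hs : 3 / 2 < s) (hδ : 0 < δ) (μ : ℝ) {f g : ComplexL2} {ρ : ℝ}
    (hf : ‖f‖ ≤ ρ) (hg : ‖g‖ ≤ ρ) :
    ‖sob (-1) (field1 s s δ μ f g)‖ ≤ fieldBound s ρ ∧
    ‖sob (-1) (field2 s s δ μ f g)‖ ≤ fieldBound s ρ := by
  obtain ⟨c, O⟩ := orderBound_of_pos hs hδ (by linarith : 0 ≤ s)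
  have O' : OrderBound s (-1 + s) δ (2 ^ ⌈s⌉₊) :=
    orderBound_of_le hs hδ.le (by linarith) (by linarith) (by linarith [Nat.le_ceil s])
  have e := sob_field μ O (by norm_num) O' f g
  rw [e.1, e.2]
  exact norm_field_le μ O' hf hg

/-! ### Coercivity and weighted norms along a regularised solution. -/

section Growth

variable {s δ μ τ : ℝ} {f g : ℝ → ComplexL2} (hs : 3 / 2 < s) (hδ : 0 < δ)
  (S : RegSol s δ μ τ f g) {ρ : ℝ} (hf : ∀ t ∈ Icc 0 τ, ‖f t‖ ≤ ρ) (hg : ∀ t ∈ Icc 0 τ, ‖g t‖ ≤ ρ)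
include hs hδ S hf hg

/-- In `H^{s-1}` the elevation moves by at most `fieldBound s ρ * τ`, and this norm controls the
operator norm of the convolution. On a short interval half of the coercivity survives. -/
lemma RegSol.coercive {h : ℝ} (h0 : Coercive h (sob (-s) (f 0)))
    (hτ : decayConst s * fieldBound s ρ * τ ≤ h / 2) {t : ℝ} (ht : t ∈ Icc 0 τ) :
    Coercive (h / 2) (sob (-s) (f t)) := by
  intro x
  have h1 : ‖sob (-1) (f t) - sob (-1) (f 0)‖ ≤ fieldBound s ρ * (t - 0) :=
    norm_image_sub_le_of_norm_deriv_le_segment' (f := fun t => sob (-1) (f t))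
      (f' := fun t => sob (-1) (field1 s s δ μ (f t) (g t)))
      (fun r hr => (sob (-1)).hasFDerivAt.comp_hasDerivWithinAt r (S.deriv₁ r hr))
      (fun r hr => (norm_sob_field_le hs hδ μ (hf r (Ico_subset_Icc_self hr))
        (hg r (Ico_subset_Icc_self hr))).1) t ht
  have hD := decayConst_nonneg s
  have hρ : 0 ≤ ρ := (norm_nonneg _).trans (hf t ht)
  have h2 : ‖convOp (sob (-s) (f t)) x - convOp (sob (-s) (f 0)) x‖ ≤ h / 2 * ‖x‖ := by
    rw [← convOp_sub_left (integrable_sob hs _) (integrable_sob hs _), ← map_sub]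
    refine (norm_convOp_sob_le hs _ x).trans ?_
    rw [map_sub]
    gcongr
    refine le_trans ?_ hτ
    rw [mul_assoc]
    refine mul_le_mul_of_nonneg_left (h1.trans ?_) hD
    rw [sub_zero]
    exact mul_le_mul_of_nonneg_left ht.2 (fieldBound_nonneg s hρ)
  have h3 := h0 x
  have h4 : x + convOp (sob (-s) (f t)) x = (x + convOp (sob (-s) (f 0)) x)
      + (convOp (sob (-s) (f t)) x - convOp (sob (-s) (f 0)) x) := by abel
  rw [h4, inner_add_left]
  have h5 := abs_le.1 (abs_real_inner_le_norm
    (convOp (sob (-s) (f t)) x - convOp (sob (-s) (f 0)) x) x)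
  have h6 : ‖convOp (sob (-s) (f t)) x - convOp (sob (-s) (f 0)) x‖ * ‖x‖ ≤ h / 2 * ‖x‖ ^ 2 := by
    calc _ ≤ (h / 2 * ‖x‖) * ‖x‖ := by gcongr
      _ = _ := by ring
  linarith [h5.1]

/-- This is Gronwall for the energy of `W J^{-s} f`, `W J^{-s} g`. Applying `sob (-s)` to the
equation produces the field of order zero, to which `weighted_energy_inequality` applies. The
boundedness of `w` serves only to make `W` continuous. The rate does not involve `δ` or the bound of
`w`. -/
lemma RegSol.weighted_growth {h : ℝ} (h0 : 0 < h) (h1 : h ≤ 1)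
    (hcoer : ∀ t ∈ Icc 0 τ, Coercive h (sob (-s) (f t))) {ρ₀ : ℝ} (hf0 : ‖f 0‖ ≤ ρ₀) {n : ℕ}
    {w : ℝ → ℝ} (hw : IsWeight n w) (hwb : BddMeas (fun ξ => (w ξ : ℂ))) {t : ℝ}
    (ht : t ∈ Icc 0 τ) :
    h * (‖mulOp (fun ξ => (w ξ : ℂ)) (sob (-s) (f t))‖ ^ 2
        + ‖mulOp (fun ξ => (w ξ : ℂ)) (sob (-s) (g t))‖ ^ 2) ≤
      (Real.exp ((energyConst n * (decayConst s * ρ * (1 + decayConst s * ρ))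
        + decayConst s * fieldBound s ρ) / h * t) * (1 + decayConst s * ρ₀)) *
      (‖mulOp (fun ξ => (w ξ : ℂ)) (sob (-s) (f 0))‖ ^ 2
        + ‖mulOp (fun ξ => (w ξ : ℂ)) (sob (-s) (g 0))‖ ^ 2) := by
  obtain ⟨c, O⟩ := orderBound_of_pos hs hδ (by linarith : 0 ≤ s)
  have O' : OrderBound s (-s + s) δ (2 ^ 0) := by
    rw [neg_add_cancel]
    exact orderBound_of_le hs hδ.le le_rfl (by linarith) (by simp)
  have hJ : -s ≤ 0 := by linarith
  have hD := decayConst_nonneg s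
  have hρ : 0 ≤ ρ := (norm_nonneg _).trans (hf t ht)
  have hρ₀ : 0 ≤ ρ₀ := (norm_nonneg _).trans hf0
  have hA : 0 ≤ decayConst s * ρ := mul_nonneg hD hρ
  set W := mulOp (fun ξ => (w ξ : ℂ)) with hW
  set L : ComplexL2 →L[ℝ] ComplexL2 := W.comp (sob (-s)) with hL
  have key := energy_growth (Z := fun r => L (f r)) (y := fun r => L (g r))
    (Z' := fun r => L (field1 s s δ μ (f r) (g r))) (y' := fun r => L (field2 s s δ μ (f r) (g r)))
    (C := fun r => convSob hs (f r)) (C' := fun r => convSob hs (field1 s s δ μ (f r) (g r)))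
    (τ := τ) (h := h) (a := decayConst s * ρ₀) (b := decayConst s * fieldBound s ρ)
    (κ := energyConst n * (decayConst s * ρ * (1 + decayConst s * ρ))) (d := 0)
    (fun r hr => L.hasFDerivAt.comp_hasDerivWithinAt r (S.deriv₁ r hr))
    (fun r hr => L.hasFDerivAt.comp_hasDerivWithinAt r (S.deriv₂ r hr))
    (fun r hr => (convSob hs).hasFDerivAt.comp_hasDerivWithinAt r (S.deriv₁ r hr))
    (fun r hr x z => inner_convOp_left (integrable_sob hs _) ((herm_sob hJ).2 (S.herm₁ r hr)) x z)
    hcoer h0 h1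
    (fun r hr x => by
      refine (norm_convOp_sob_le hs _ x).trans ?_
      gcongr
      exact (norm_sob_field_le hs hδ μ (hf r hr) (hg r hr)).1)
    (fun x => by
      refine (norm_convOp_sob_le hs _ x).trans ?_
      gcongr
      exact (norm_sob_le (by norm_num) _).trans hf0)
    (by positivity) (mul_nonneg hD (fieldBound_nonneg s hρ))
    (mul_nonneg (energyConst_pos n).le (by positivity)) le_rfl
    (fun r hr => by
      have e := sob_field μ O hJ O' (f r) (g r)
      rw [neg_add_cancel, (field_eq_rhs hs hδ μ _ _).1, (field_eq_rhs hs hδ μ _ _).2] at e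
      have aL : ∀ {u : ComplexL2}, ‖u‖ ≤ ρ → L1Le (bracket 1) (sob (-s) u) (decayConst s * ρ) :=
        fun hu => (L1Le_sob hs _).mono_right (by gcongr)
      have h2 := weighted_energy_inequality hδ μ hw hwb ((herm_sob hJ).2 (S.herm₁ r hr))
        ((herm_sob hJ).2 (S.herm₂ r hr)) hA (aL (hf r hr)) (aL (hg r hr))
      simp only [hL, ContinuousLinearMap.comp_apply, e.1, e.2, add_zero]
      exact h2) ht
  rw [zero_mul, add_zero] at key
  exact key.trans (le_of_eq (by simp only [hL, ContinuousLinearMap.comp_apply]; ring))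

end Growth

/-- Passage from truncated weights to the full weight. -/
lemma weighted_le_of_capWeight {s : ℝ} (hs : 0 ≤ s) {θ : ℝ → ℝ} {n : ℕ} (hθ : Measurable θ)
    (hθ1 : ∀ ξ, θ ξ ≤ 1)
    (hw : IsWeight n (fun ξ => bracket s ξ * θ ξ)) {f g f₀ g₀ : ComplexL2} {a B : ℝ}
    (h : ∀ k : ℕ, a * (‖mulOp (fun ξ => ((capWeight (fun ξ => bracket s ξ * θ ξ) k ξ : ℝ) : ℂ))
        (sob (-s) f)‖ ^ 2
      + ‖mulOp (fun ξ => ((capWeight (fun ξ => bracket s ξ * θ ξ) k ξ : ℝ) : ℂ)) (sob (-s) g)‖ ^ 2)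
      ≤ B * (‖mulOp (fun ξ => ((capWeight (fun ξ => bracket s ξ * θ ξ) k ξ : ℝ) : ℂ))
        (sob (-s) f₀)‖ ^ 2
      + ‖mulOp (fun ξ => ((capWeight (fun ξ => bracket s ξ * θ ξ) k ξ : ℝ) : ℂ))
        (sob (-s) g₀)‖ ^ 2)) :
    a * (‖mulOp (fun ξ => (θ ξ : ℂ)) f‖ ^ 2 + ‖mulOp (fun ξ => (θ ξ : ℂ)) g‖ ^ 2) ≤
      B * (‖mulOp (fun ξ => (θ ξ : ℂ)) f₀‖ ^ 2 + ‖mulOp (fun ξ => (θ ξ : ℂ)) g₀‖ ^ 2) := by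
  have hJ : -s ≤ 0 := by linarith
  set w : ℝ → ℝ := fun ξ => bracket s ξ * θ ξ with hwdef
  have hθ0 : ∀ ξ, 0 ≤ θ ξ := fun ξ => (mul_nonneg_iff_of_pos_left (bracket_pos s ξ)).1 (hw.nonneg ξ)
  have hcb : ∀ k : ℕ, BddMeas (fun ξ => ((capWeight w k ξ : ℝ) : ℂ)) := fun k =>
    BddMeas.of_real (hw.cap (Nat.cast_nonneg k)).meas (hw.cap_bdd (Nat.cast_nonneg k))
  have lim : ∀ u : ComplexL2, Tendsto (fun k : ℕ => mulOp (fun ξ => ((capWeight w k ξ : ℝ) : ℂ))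
      (sob (-s) u)) atTop (𝓝 (mulOp (fun ξ => (θ ξ : ℂ)) u)) := fun u => by
    have h1 := tendsto_mulOp (m := fun k ξ => ((capWeight w k ξ : ℝ) : ℂ) * ((bracket (-s) ξ : ℝ) : ℂ))
      (m₀ := fun ξ => (θ ξ : ℂ)) (C := 1) (fun k => ((hcb k).mul (bddMeas_bracket hJ)).meas)
      (Complex.measurable_ofReal.comp hθ)
      (fun k ξ => by
        have h2 := (hw.cap (Nat.cast_nonneg k)).nonneg ξ
        have h3 := (bracket_pos (-s) ξ).le
        rw [← Complex.ofReal_mul, Complex.norm_real, Real.norm_of_nonneg (mul_nonneg h2 h3)]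
        calc _ ≤ (bracket s ξ * θ ξ) * bracket (-s) ξ := by
              gcongr
              exact hw.cap_le (Nat.cast_nonneg k) ξ
          _ = (bracket (-s) ξ * bracket s ξ) * θ ξ := by ring
          _ ≤ 1 := by rw [bracket_neg_mul, one_mul]; exact hθ1 ξ)
      (fun ξ => by
        refine tendsto_const_nhds.congr' ?_
        filter_upwards [eventually_ge_atTop ⌈|ξ|⌉₊] with k hk
        rw [hw.cap_eq ((Nat.le_ceil _).trans (Nat.cast_le.2 hk)), hwdef, ← Complex.ofReal_mul]
        congr 1
        calc θ ξ = (bracket (-s) ξ * bracket s ξ) * θ ξ := by rw [bracket_neg_mul, one_mul]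
          _ = _ := by ring) u
    refine h1.congr fun k => ?_
    rw [sob, mulOp_mulOp (hcb k) (bddMeas_bracket hJ)]
  have lim2 : ∀ u v : ComplexL2, Tendsto (fun k : ℕ =>
      ‖mulOp (fun ξ => ((capWeight w k ξ : ℝ) : ℂ)) (sob (-s) u)‖ ^ 2
      + ‖mulOp (fun ξ => ((capWeight w k ξ : ℝ) : ℂ)) (sob (-s) v)‖ ^ 2) atTop
      (𝓝 (‖mulOp (fun ξ => (θ ξ : ℂ)) u‖ ^ 2 + ‖mulOp (fun ξ => (θ ξ : ℂ)) v‖ ^ 2)) :=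
    fun u v => ((lim u).norm.pow 2).add ((lim v).norm.pow 2)
  exact le_of_tendsto_of_tendsto' ((lim2 f g).const_mul a) ((lim2 f₀ g₀).const_mul B) h

/-- The rate of the exponential growth per unit size of the solution. -/
def growthSlope (s P : ℝ) : ℝ :=
  energyConst (⌈s⌉₊ + 1) * (decayConst s * (1 + decayConst s * P))
    -- The summand `1` keeps the slope positive, as it is used as a denominator in `lifespan`.
    + decayConst s * (2 ^ ⌈s⌉₊ * (1 + 16 * decayConst s * P)) + 1

lemma growthSlope_pos (s : ℝ) {P : ℝ} (hP : 0 ≤ P) : 0 < growthSlope s P := by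
  have h1 := decayConst_nonneg s
  have h2 := (energyConst_pos (⌈s⌉₊ + 1)).le
  unfold growthSlope
  positivity

/-- Every term of the system with `ε = 1` that contributes to the growth is nonlinear, so the rate
is at most linear in the size `ρ` on a bounded range of `ρ`. This is why the lifespan is
proportional to the inverse of the size. -/
lemma growth_le_growthSlope (s : ℝ) {ρ P : ℝ} (hρ : 0 ≤ ρ) (h : ρ ≤ P) :
    energyConst (⌈s⌉₊ + 1) * (decayConst s * ρ * (1 + decayConst s * ρ))
      + decayConst s * fieldBound s ρ ≤ growthSlope s P * ρ := by
  have h1 := decayConst_nonneg s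
  have h2 := (energyConst_pos (⌈s⌉₊ + 1)).le
  calc _ = (energyConst (⌈s⌉₊ + 1) * (decayConst s * (1 + decayConst s * ρ))
      + decayConst s * (2 ^ ⌈s⌉₊ * (1 + 16 * decayConst s * ρ)) + 0) * ρ := by
        unfold fieldBound; ring
    _ ≤ _ := by
      unfold growthSlope
      gcongr
      exact zero_le_one

lemma exp_half_le_two : Real.exp (1 / 2) ≤ 2 := by
  have h1 := Real.add_one_le_exp (-(1 / 2 : ℝ))
  have h2 : Real.exp (1 / 2) * Real.exp (-(1 / 2)) = 1 := by rw [← Real.exp_add]; simp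
  have h3 := Real.exp_pos (1 / 2)
  nlinarith

/-- Growth factor of the norm on the existence interval. -/
def growthFactor (s h c₁ : ℝ) : ℝ := Real.sqrt (4 * (1 + decayConst s * c₁) / h)

/-- The existence time for data of size one. -/
def lifespan (s h c₁ : ℝ) : ℝ :=
  h / (8 * growthSlope s (2 * growthFactor s h c₁ * c₁) * growthFactor s h c₁)

section Lifespan

variable {s h c₁ : ℝ} (h0 : 0 < h) (h1 : h ≤ 1) (hc₁ : 0 < c₁)
include h0 hc₁

lemma growthFactor_sq : growthFactor s h c₁ ^ 2 = 4 * (1 + decayConst s * c₁) / h := by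
  have := decayConst_nonneg s
  exact Real.sq_sqrt (by positivity)

include h1

lemma one_le_growthFactor : 1 ≤ growthFactor s h c₁ := by
  have h2 := decayConst_nonneg s
  rw [growthFactor, Real.one_le_sqrt, one_le_div h0]
  have : 0 ≤ decayConst s * c₁ := by positivity
  linarith

lemma lifespan_pos : 0 < lifespan s h c₁ := by
  have h2 : 0 < growthFactor s h c₁ := zero_lt_one.trans_le (one_le_growthFactor h0 h1 hc₁)
  have h3 := growthSlope_pos s (P := 2 * growthFactor s h c₁ * c₁) (by positivity)
  unfold lifespan
  positivity

lemma lifespan_mul : growthSlope s (2 * growthFactor s h c₁ * c₁) * growthFactor s h c₁ *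
    lifespan s h c₁ = h / 8 := by
  have h2 : 0 < growthFactor s h c₁ := zero_lt_one.trans_le (one_le_growthFactor h0 h1 hc₁)
  have h3 := growthSlope_pos s (P := 2 * growthFactor s h c₁ * c₁) (by positivity)
  unfold lifespan
  field_simp

end Lifespan

/-- A solution of the regularised system with the bounds that are uniform in `δ`. -/
structure GoodRegSol (s h M δ μ τ : ℝ) (f g : ℝ → ComplexL2) : Prop extends
    RegSol s δ μ τ f g where
  coer : ∀ t ∈ Icc 0 τ, Coercive (h / 2) (sob (-s) (f t))
  bound : ∀ t ∈ Icc 0 τ, ‖f t‖ ^ 2 + ‖g t‖ ^ 2 ≤ M ^ 2 * (‖f 0‖ ^ 2 + ‖g 0‖ ^ 2)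
  tail : ∀ t ∈ Icc 0 τ, ∀ R : ℝ, 0 < R → ‖tailOp R (f t)‖ ^ 2 + ‖tailOp R (g t)‖ ^ 2 ≤
    M ^ 2 * (‖tailOp R (f 0)‖ ^ 2 + ‖tailOp R (g 0)‖ ^ 2)

/-- Bounds on a short interval, for a solution that is known to be bounded. -/
lemma RegSol.good {s h c₁ : ℝ} (hs : 3 / 2 < s) (h0 : 0 < h) (h1 : h ≤ 1) (hc₁ : 0 < c₁)
    {δ : ℝ} (hδ : 0 < δ) {μ N τ : ℝ} (hN : 0 < N) (hNc : N ≤ c₁) {f g : ℝ → ComplexL2}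
    (S : RegSol s δ μ τ f g) (hτ : τ ≤ lifespan s h c₁ / N) (hfN : ‖f 0‖ ≤ N)
    (hcoer : Coercive h (sob (-s) (f 0)))
    (hf : ∀ t ∈ Icc 0 τ, ‖f t‖ ≤ 2 * growthFactor s h c₁ * N)
    (hg : ∀ t ∈ Icc 0 τ, ‖g t‖ ≤ 2 * growthFactor s h c₁ * N) :
    GoodRegSol s h (growthFactor s h c₁) δ μ τ f g := by
  set M := growthFactor s h c₁ with hM
  set ρ := 2 * M * N with hρdef
  have hD := decayConst_nonneg s
  have M1 : 1 ≤ M := one_le_growthFactor h0 h1 hc₁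
  have hρ : 0 ≤ ρ := by positivity
  have hρP : ρ ≤ 2 * M * c₁ := by rw [hρdef]; gcongr
  set k := growthSlope s (2 * M * c₁) with hk
  have hslope := growth_le_growthSlope s hρ hρP
  have hbN : 0 ≤ decayConst s * fieldBound s ρ := mul_nonneg hD (fieldBound_nonneg s hρ)
  have hκ : 0 ≤ energyConst (⌈s⌉₊ + 1) * (decayConst s * ρ * (1 + decayConst s * ρ)) :=
    mul_nonneg (energyConst_pos _).le (by positivity)
  have hk0 : 0 < k := growthSlope_pos s (by positivity)
  have hlm : k * M * lifespan s h c₁ = h / 8 := lifespan_mul h0 h1 hc₁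
  -- The value `h / 4` serves twice: it bounds the loss of coercivity by `h / 2`, and it bounds the
  -- exponent, with denominator `h / 2`, by `1 / 2`.
  have hkτ : k * ρ * τ ≤ h / 4 := by
    calc k * ρ * τ ≤ k * ρ * (lifespan s h c₁ / N) := by gcongr
      _ = 2 * (k * M * lifespan s h c₁) := by rw [hρdef]; field_simp
      _ = h / 4 := by rw [hlm]; ring
  have hco : ∀ t ∈ Icc 0 τ, Coercive (h / 2) (sob (-s) (f t)) := fun t ht => by
    have hτ0 : 0 ≤ τ := ht.1.trans ht.2
    refine S.coercive hs hδ hf hg hcoer ?_ ht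
    have h3 : decayConst s * fieldBound s ρ * τ ≤ k * ρ * τ :=
      mul_le_mul_of_nonneg_right (by linarith) hτ0
    linarith
  have main : ∀ t ∈ Icc 0 τ, ∀ {θ : ℝ → ℝ}, Measurable θ → (∀ ξ, θ ξ ≤ 1) →
      IsWeight (⌈s⌉₊ + 1) (fun ξ => bracket s ξ * θ ξ) →
      ‖mulOp (fun ξ => (θ ξ : ℂ)) (f t)‖ ^ 2 + ‖mulOp (fun ξ => (θ ξ : ℂ)) (g t)‖ ^ 2 ≤
      M ^ 2 * (‖mulOp (fun ξ => (θ ξ : ℂ)) (f 0)‖ ^ 2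
        + ‖mulOp (fun ξ => (θ ξ : ℂ)) (g 0)‖ ^ 2) := by
    intro t ht θ hθ hθ1 hw
    have hcb : ∀ k : ℕ,
        BddMeas (fun ξ => ((capWeight (fun ξ => bracket s ξ * θ ξ) k ξ : ℝ) : ℂ)) := fun k =>
      BddMeas.of_real (hw.cap (Nat.cast_nonneg k)).meas (hw.cap_bdd (Nat.cast_nonneg k))
    have h2 := weighted_le_of_capWeight (by linarith : 0 ≤ s) hθ hθ1 hw fun k =>
      S.weighted_growth hs hδ hf hg (half_pos h0) (by linarith) hco hfN
        (hw.cap (Nat.cast_nonneg k)) (hcb k) ht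
    have hexp : Real.exp ((energyConst (⌈s⌉₊ + 1) * (decayConst s * ρ * (1 + decayConst s * ρ))
        + decayConst s * fieldBound s ρ) / (h / 2) * t) ≤ 2 := by
      refine (Real.exp_le_exp.2 ?_).trans exp_half_le_two
      have h3 : (energyConst (⌈s⌉₊ + 1) * (decayConst s * ρ * (1 + decayConst s * ρ))
          + decayConst s * fieldBound s ρ) * t ≤ k * ρ * τ :=
        mul_le_mul hslope ht.2 ht.1 (by positivity)
      rw [div_mul_eq_mul_div, div_le_iff₀ (half_pos h0)]
      linarith
    set X := ‖mulOp (fun ξ => (θ ξ : ℂ)) (f 0)‖ ^ 2 + ‖mulOp (fun ξ => (θ ξ : ℂ)) (g 0)‖ ^ 2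
    have hX : 0 ≤ X := by positivity
    have h4 : h / 2 * (‖mulOp (fun ξ => (θ ξ : ℂ)) (f t)‖ ^ 2
        + ‖mulOp (fun ξ => (θ ξ : ℂ)) (g t)‖ ^ 2) ≤ (2 * (1 + decayConst s * c₁)) * X :=
      h2.trans (by gcongr)
    -- The growth factor collects the exponential, at most `2`, the initial energy factor `1 +
    -- decayConst s * c₁`, and the remaining coercivity `h / 2`.
    rw [hM, growthFactor_sq h0 hc₁]
    have h5 : 4 * (1 + decayConst s * c₁) / h * X = (2 * (1 + decayConst s * c₁) * X) / (h / 2) := by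
      field_simp; ring
    rw [h5, le_div_iff₀ (half_pos h0)]
    linarith
  refine ⟨S, hco, fun t ht => ?_, fun t ht R hR => ?_⟩
  · have hw : IsWeight (⌈s⌉₊ + 1) (fun ξ => bracket s ξ * 1) := by
      simp only [mul_one]
      exact (isWeight_bracket (by linarith) (Nat.le_ceil s)).mono_order (Nat.le_succ _)
    have h2 := main t ht (θ := fun _ => 1) measurable_const (fun _ => le_rfl) hw
    simpa only [Complex.ofReal_one, mulOp_one] using h2
  · exact main t ht (isWeight_tailWeight hR).meas (tailWeight_le_one R)
      (isWeight_bracket_tail (by linarith) (Nat.le_ceil s) hR)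

/-- Existence and uniform bounds for the regularised system on a time interval independent of the
regularisation. -/
lemma exists_goodRegSol {s h c₁ : ℝ} (hs : 3 / 2 < s) (h0 : 0 < h) (h1 : h ≤ 1) (hc₁ : 0 < c₁)
    {δ : ℝ} (hδ : 0 < δ) (μ : ℝ) {N : ℝ} (hN : 0 < N) (hNc : N ≤ c₁) {f₀ g₀ : ComplexL2}
    (hf₀ : Herm f₀) (hg₀ : Herm g₀) (hsize : ‖f₀‖ ^ 2 + ‖g₀‖ ^ 2 ≤ N ^ 2)
    (hcoer : Coercive h (sob (-s) f₀)) :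
    ∃ f g : ℝ → ComplexL2, f 0 = f₀ ∧ g 0 = g₀ ∧
      GoodRegSol s h (growthFactor s h c₁) δ μ (lifespan s h c₁ / N) f g := by
  set M := growthFactor s h c₁ with hM
  have M1 : 1 ≤ M := one_le_growthFactor h0 h1 hc₁
  have hT : 0 < lifespan s h c₁ / N := div_pos (lifespan_pos h0 h1 hc₁) hN
  set τ := lifespan s h c₁ / N with hτ
  have hρ : 0 < 2 * M * N := by positivity
  -- The truncation radius is twice the bound `M * N` that the energy estimate returns, which leaves
  -- room for the bootstrap.
  obtain ⟨V, hV0, hVh, hV⟩ := exists_truncated_solution hs hδ μ (x₀ := (f₀, g₀)) hf₀ hg₀ hρ hT.le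
  set F : ℝ → ℝ := fun t => ‖(V t).1‖ ^ 2 + ‖(V t).2‖ ^ 2 with hF
  have hcont : ContinuousOn F (Icc 0 τ) := by
    have h2 : ContinuousOn V (Icc 0 τ) := fun t ht => (hV t ht).continuousWithinAt
    exact (h2.fst.norm.pow 2).add (h2.snd.norm.pow 2)
  have e0 : F 0 = ‖f₀‖ ^ 2 + ‖g₀‖ ^ 2 := by simp only [hF, hV0]
  have hsmall : ∀ r, F r ≤ (2 * M * N) ^ 2 → ‖(V r).1‖ ≤ 2 * M * N ∧ ‖(V r).2‖ ≤ 2 * M * N :=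
    fun r hr => ⟨(pow_le_pow_iff_left₀ (norm_nonneg _) hρ.le two_ne_zero).1
        (by nlinarith [sq_nonneg ‖(V r).2‖]),
      (pow_le_pow_iff_left₀ (norm_nonneg _) hρ.le two_ne_zero).1
        (by nlinarith [sq_nonneg ‖(V r).1‖])⟩
  have good : ∀ t ∈ Icc 0 τ, (∀ r ∈ Icc 0 t, F r ≤ (2 * M * N) ^ 2) →
      GoodRegSol s h M δ μ t (fun r => (V r).1) (fun r => (V r).2) := by
    intro t ht hr
    have hd : ∀ r ∈ Icc 0 t, HasDerivWithinAt V (vecField s s δ μ (V r)) (Icc 0 t) r := by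
      intro r hrt
      have h2 := (hV r ⟨hrt.1, hrt.2.trans ht.2⟩).mono (Icc_subset_Icc_right ht.2)
      have h3 := hsmall r (hr r hrt)
      rwa [retr_eq hρ (max_le h3.1 h3.2)] at h2
    refine RegSol.good hs h0 h1 hc₁ hδ hN hNc
      ⟨fun r _ => (hVh r).1, fun r _ => (hVh r).2, fun r hrt => ?_, fun r hrt => ?_⟩ ht.2 ?_ ?_
      (fun r hrt => (hsmall r (hr r hrt)).1) (fun r hrt => (hsmall r (hr r hrt)).2)
    · exact (ContinuousLinearMap.fst ℝ ComplexL2 ComplexL2).hasFDerivAt.comp_hasDerivWithinAt r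
        (hd r hrt)
    · exact (ContinuousLinearMap.snd ℝ ComplexL2 ComplexL2).hasFDerivAt.comp_hasDerivWithinAt r
        (hd r hrt)
    · simp only [hV0]
      exact (pow_le_pow_iff_left₀ (norm_nonneg _) hN.le two_ne_zero).1
        (by nlinarith [sq_nonneg ‖g₀‖])
    · simpa only [hV0] using hcoer
  have hMN : 0 < (M * N) ^ 2 := by positivity
  -- As long as the solution stays below `2 M N` the truncation is inactive and the energy estimate
  -- improves the bound to `M N`.
  have hfin := continuity_bootstrap (a := (M * N) ^ 2) (b := (2 * M * N) ^ 2) hcont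
    (by nlinarith) (by
      rw [e0]
      have : N ^ 2 ≤ (M * N) ^ 2 := by
        rw [mul_pow]; exact le_mul_of_one_le_left (sq_nonneg N) (one_le_pow₀ M1)
      nlinarith)
    (fun t ht hr => by
      refine ((good t ht hr).bound t (right_mem_Icc.2 ht.1)).trans ?_
      simp only [hV0]
      rw [mul_pow]
      gcongr)
  refine ⟨fun r => (V r).1, fun r => (V r).2, by simp only [hV0], by simp only [hV0],
    good τ (right_mem_Icc.2 hT.le) fun r hr => (hfin r hr).trans (by nlinarith)⟩

/-! ### Comparison of solutions in the weak norm -/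

/-- The constant in the comparison of two solutions of size `ρ` on `[0, τ]`. -/
def diffConst (s h ρ τ : ℝ) : ℝ :=
  Real.exp ((300 * (1 + decayConst s * ρ) ^ 2 + decayConst s * fieldBound s ρ) / (h / 2) * τ)
    * ((1 + decayConst s * ρ) + 600 * (1 + decayConst s * ρ) ^ 2 * τ) / (h / 2)

lemma diffConst_nonneg (s : ℝ) {h ρ τ : ℝ} (h0 : 0 < h) (hρ : 0 ≤ ρ) (hτ : 0 ≤ τ) :
    0 ≤ diffConst s h ρ τ := by
  have := decayConst_nonneg s
  unfold diffConst
  positivity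

/-- A regularised solution compared with an approximate solution. -/
lemma GoodRegSol.difference_le {s h M δ μ τ : ℝ} (hs : 3 / 2 < s) (hδ : 0 < δ) (h0 : 0 < h)
    (h1 : h ≤ 1) {f g : ℝ → ComplexL2} (S : GoodRegSol s h M δ μ τ f g) {ρ e : ℝ}
    (hf : ∀ t ∈ Icc 0 τ, ‖f t‖ ≤ ρ) (hg : ∀ t ∈ Icc 0 τ, ‖g t‖ ≤ ρ) {u v E₁ E₂ : ℝ → ComplexL2}
    (hv : ∀ t ∈ Icc 0 τ, Herm (v t)) (nu : ∀ t ∈ Icc 0 τ, ‖u t‖ ≤ ρ) (nv : ∀ t ∈ Icc 0 τ, ‖v t‖ ≤ ρ)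
    (du : ∀ t ∈ Icc 0 τ, HasDerivWithinAt (fun r => sob (-s) (u r))
      (field1 s 0 δ μ (u t) (v t) + E₁ t) (Icc 0 τ) t)
    (dv : ∀ t ∈ Icc 0 τ, HasDerivWithinAt (fun r => sob (-s) (v r))
      (field2 s 0 δ μ (u t) (v t) + E₂ t) (Icc 0 τ) t)
    (nE₁ : ∀ t ∈ Icc 0 τ, ‖E₁ t‖ ≤ e) (nE₂ : ∀ t ∈ Icc 0 τ, ‖E₂ t‖ ≤ e) {t : ℝ}
    (ht : t ∈ Icc 0 τ) :
    ‖sob (-s) (f t - u t)‖ ^ 2 + ‖sob (-s) (g t - v t)‖ ^ 2 ≤ diffConst s h ρ τ *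
      ((‖sob (-s) (f 0 - u 0)‖ ^ 2 + ‖sob (-s) (g 0 - v 0)‖ ^ 2) + e ^ 2) := by
  obtain ⟨c, O⟩ := orderBound_of_pos hs hδ (by linarith : 0 ≤ s)
  have O' : OrderBound s (-s + s) δ (2 ^ 0) := by
    rw [neg_add_cancel]
    exact orderBound_of_le hs hδ.le le_rfl (by linarith) (by simp)
  have hJ : -s ≤ 0 := by linarith
  have hD := decayConst_nonneg s
  have hρ : 0 ≤ ρ := (norm_nonneg _).trans (hf t ht)
  have hτ : 0 ≤ τ := ht.1.trans ht.2
  have hA : 0 ≤ decayConst s * ρ := mul_nonneg hD hρ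
  set J := sob (-s) with hJdef
  set Q : ℝ := 300 * (1 + decayConst s * ρ) ^ 2 with hQ
  have Q0 : 0 ≤ Q := by positivity
  have aL : ∀ {x : ComplexL2}, ‖x‖ ≤ ρ → L1Le (bracket 1) (sob (-s) x) (decayConst s * ρ) :=
    fun hx => (L1Le_sob hs _).mono_right (by gcongr)
  have key := energy_growth (Z := fun r => J (f r) - J (u r)) (y := fun r => J (g r) - J (v r))
    (Z' := fun r => J (field1 s s δ μ (f r) (g r)) - (field1 s 0 δ μ (u r) (v r) + E₁ r))
    (y' := fun r => J (field2 s s δ μ (f r) (g r)) - (field2 s 0 δ μ (u r) (v r) + E₂ r))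
    (C := fun r => convSob hs (f r)) (C' := fun r => convSob hs (field1 s s δ μ (f r) (g r)))
    (τ := τ) (h := h / 2) (a := decayConst s * ρ) (b := decayConst s * fieldBound s ρ)
    (κ := Q) (d := 2 * Q * e ^ 2)
    (fun r hr => (J.hasFDerivAt.comp_hasDerivWithinAt r (S.deriv₁ r hr)).sub (du r hr))
    (fun r hr => (J.hasFDerivAt.comp_hasDerivWithinAt r (S.deriv₂ r hr)).sub (dv r hr))
    (fun r hr => (convSob hs).hasFDerivAt.comp_hasDerivWithinAt r (S.deriv₁ r hr))
    (fun r hr x z => inner_convOp_left (integrable_sob hs _) ((herm_sob hJ).2 (S.herm₁ r hr)) x z)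
    S.coer (half_pos h0) (by linarith)
    (fun r hr x => by
      refine (norm_convOp_sob_le hs _ x).trans ?_
      gcongr
      exact (norm_sob_field_le hs hδ μ (hf r hr) (hg r hr)).1)
    (fun x => by
      refine (norm_convOp_sob_le hs _ x).trans ?_
      gcongr
      exact (norm_sob_le (by norm_num) _).trans (hf 0 (left_mem_Icc.2 hτ)))
    hA (mul_nonneg hD (fieldBound_nonneg s hρ)) Q0 (by positivity)
    (fun r hr => by
      have e1 := sob_field μ O hJ O' (f r) (g r)
      rw [neg_add_cancel, (field_eq_rhs hs hδ μ _ _).1, (field_eq_rhs hs hδ μ _ _).2] at e1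
      have h2 := difference_energy_inequality hδ μ (E₁ := E₁ r) (E₂ := E₂ r)
        ((herm_sob hJ).2 (S.herm₁ r hr))
        ((herm_sob hJ).2 (hv r hr)) hA (aL (hf r hr)) (aL (hg r hr)) (aL (nu r hr)) (aL (nv r hr))
      simp only [hJdef, e1.1, e1.2, (field_eq_rhs hs hδ μ (u r) (v r)).1,
        (field_eq_rhs hs hδ μ (u r) (v r)).2]
      refine h2.trans ?_
      have h3 : ‖E₁ r‖ ^ 2 ≤ e ^ 2 := pow_le_pow_left₀ (norm_nonneg _) (nE₁ r hr) 2
      have h4 : ‖E₂ r‖ ^ 2 ≤ e ^ 2 := pow_le_pow_left₀ (norm_nonneg _) (nE₂ r hr) 2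
      have h5 : Q * (‖E₁ r‖ ^ 2 + ‖E₂ r‖ ^ 2) ≤ Q * (2 * e ^ 2) :=
        mul_le_mul_of_nonneg_left (by linarith) Q0
      linarith) ht
  simp only [← map_sub] at key
  set X := ‖J (f 0 - u 0)‖ ^ 2 + ‖J (g 0 - v 0)‖ ^ 2 with hX
  have X0 : 0 ≤ X := by positivity
  have hb := mul_nonneg hD (fieldBound_nonneg s hρ)
  set Λ := (Q + decayConst s * fieldBound s ρ) / (h / 2) with hΛ
  have hexp : Real.exp (Λ * t) ≤ Real.exp (Λ * τ) :=
    Real.exp_le_exp.2 (mul_le_mul_of_nonneg_left ht.2 (by positivity))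
  have e2 : diffConst s h ρ τ * (X + e ^ 2) =
      (Real.exp (Λ * τ) * (((1 + decayConst s * ρ) + 2 * Q * τ) * (X + e ^ 2))) / (h / 2) := by
    rw [diffConst, ← hQ, ← hΛ, hQ]; ring
  rw [e2, le_div_iff₀ (half_pos h0), mul_comm _ (h / 2)]
  refine key.trans ?_
  have h6 : 2 * Q * e ^ 2 * t ≤ 2 * Q * e ^ 2 * τ := mul_le_mul_of_nonneg_left ht.2 (by positivity)
  have h7 : (1 + decayConst s * ρ) * X + 2 * Q * e ^ 2 * t ≤
      ((1 + decayConst s * ρ) + 2 * Q * τ) * (X + e ^ 2) := by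
    have : 0 ≤ (1 + decayConst s * ρ) * e ^ 2 + 2 * Q * τ * X := by positivity
    linarith
  have h8 : 0 ≤ (1 + decayConst s * ρ) * X + 2 * Q * e ^ 2 * t := by
    have := ht.1
    positivity
  exact mul_le_mul hexp h7 h8 (Real.exp_pos _).le

/-! ### Solutions of the full system -/

/-- Solutions of the system in `H^s` coordinates. -/
structure Sol (s μ τ : ℝ) (u v : ℝ → ComplexL2) : Prop where
  herm₁ : ∀ t ∈ Icc 0 τ, Herm (u t)
  herm₂ : ∀ t ∈ Icc 0 τ, Herm (v t)
  cont₁ : ContinuousOn u (Icc 0 τ)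
  cont₂ : ContinuousOn v (Icc 0 τ)
  deriv₁ : ∀ t ∈ Icc 0 τ, HasDerivWithinAt (fun r => sob (-1) (u r))
    (field1 s (s - 1) 0 μ (u t) (v t)) (Icc 0 τ) t
  deriv₂ : ∀ t ∈ Icc 0 τ, HasDerivWithinAt (fun r => sob (-1) (v r))
    (field2 s (s - 1) 0 μ (u t) (v t)) (Icc 0 τ) t

lemma orderBound_pred {s δ : ℝ} (hs : 3 / 2 < s) (hδ : 0 ≤ δ) :
    OrderBound s (s - 1) δ (2 ^ ⌈s⌉₊) :=
  orderBound_of_le hs hδ (by linarith) le_rfl (by linarith [Nat.le_ceil s])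

lemma orderBound_zero {s δ : ℝ} (hs : 3 / 2 < s) (hδ : 0 ≤ δ) : OrderBound s 0 δ 1 := by
  have := orderBound_of_le hs hδ le_rfl (by linarith) (n := 0) (by simp)
  rwa [pow_zero] at this

lemma sob_neg_eq {s : ℝ} (hs : 3 / 2 < s) (f : ComplexL2) :
    sob (1 - s) (sob (-1) f) = sob (-s) f := by
  rw [sob_sob (by linarith) (by norm_num)]
  congr 2
  ring

lemma sob_field_pred {s : ℝ} (hs : 3 / 2 < s) (μ : ℝ) (f g : ComplexL2) :
    sob (1 - s) (field1 s (s - 1) 0 μ f g) = field1 s 0 0 μ f g ∧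
    sob (1 - s) (field2 s (s - 1) 0 μ f g) = field2 s 0 0 μ f g := by
  have e : 1 - s + (s - 1) = 0 := by ring
  have := sob_field μ (orderBound_pred hs le_rfl) (by linarith : 1 - s ≤ 0)
    (by rw [e]; exact orderBound_zero hs le_rfl) f g
  rwa [e] at this

lemma Sol.weak {s μ τ : ℝ} (hs : 3 / 2 < s) {u v : ℝ → ComplexL2} (S : Sol s μ τ u v) {t : ℝ}
    (ht : t ∈ Icc 0 τ) :
    HasDerivWithinAt (fun r => sob (-s) (u r)) (field1 s 0 0 μ (u t) (v t)) (Icc 0 τ) t ∧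
    HasDerivWithinAt (fun r => sob (-s) (v r)) (field2 s 0 0 μ (u t) (v t)) (Icc 0 τ) t := by
  have h1 := (sob (1 - s)).hasFDerivAt.comp_hasDerivWithinAt t (S.deriv₁ t ht)
  have h2 := (sob (1 - s)).hasFDerivAt.comp_hasDerivWithinAt t (S.deriv₂ t ht)
  simp only [Function.comp_def, sob_neg_eq hs, (sob_field_pred hs μ _ _).1,
    (sob_field_pred hs μ _ _).2] at h1 h2
  exact ⟨h1, h2⟩

lemma continuous_vecField {s σ δ c : ℝ} (μ : ℝ) (O : OrderBound s σ δ c) :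
    Continuous (vecField s σ δ μ) := by
  rw [continuous_iff_continuousAt]
  intro x
  rw [ContinuousAt, tendsto_iff_norm_sub_tendsto_zero]
  have h1 : Tendsto (fun y => c * (1 + 16 * decayConst s * (‖x‖ + 1)) * ‖y - x‖) (𝓝 x) (𝓝 0) := by
    have h2 : Tendsto (fun y => ‖y - x‖) (𝓝 x) (𝓝 0) :=
      tendsto_iff_norm_sub_tendsto_zero.1 tendsto_id
    simpa using h2.const_mul (c * (1 + 16 * decayConst s * (‖x‖ + 1)))
  refine tendsto_of_tendsto_of_tendsto_of_le_of_le' tendsto_const_nhds h1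
    (Eventually.of_forall fun _ => norm_nonneg _) ?_
  filter_upwards [Metric.ball_mem_nhds x one_pos] with y hy
  have h3 : ‖y - x‖ < 1 := by rwa [Metric.mem_ball, dist_eq_norm] at hy
  refine norm_vecField_sub_le μ O ?_ (by linarith [norm_nonneg x])
  have := norm_le_norm_add_norm_sub x y
  rw [norm_sub_rev] at this
  linarith

/-- The size of the error caused by the regularisation. -/
def cutError (s ρ δ : ℝ) : ℝ := 2 * Real.sqrt δ * (1 + 12 * decayConst s * ρ) * ρ

lemma cutError_nonneg (s δ : ℝ) {ρ : ℝ} (hρ : 0 ≤ ρ) : 0 ≤ cutError s ρ δ := by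
  have := decayConst_nonneg s
  unfold cutError
  positivity

lemma tendsto_cutError (s ρ : ℝ) :
    Tendsto (fun k : ℕ => cutError s ρ (1 / ((k : ℝ) + 1))) atTop (𝓝 0) := by
  have h1 := (Real.continuous_sqrt.tendsto 0).comp tendsto_one_div_add_atTop_nhds_zero_nat
  rw [Real.sqrt_zero] at h1
  have h2 := ((h1.const_mul 2).mul_const (1 + 12 * decayConst s * ρ)).mul_const ρ
  simpa [cutError, Function.comp_def] using h2

lemma exists_tendstoUniformlyOn {E : Type*} [NormedAddCommGroup E] [CompleteSpace E]
    {F : ℕ → ℝ → E} {S : Set ℝ} (h : UniformCauchySeqOn F atTop S) :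
    ∃ f : ℝ → E, TendstoUniformlyOn F f atTop S := by
  have h1 : ∀ t, ∃ l, t ∈ S → Tendsto (fun k => F k t) atTop (𝓝 l) := fun t => by
    by_cases ht : t ∈ S
    · obtain ⟨l, hl⟩ := cauchySeq_tendsto_of_complete (h.cauchySeq ht)
      exact ⟨l, fun _ => hl⟩
    · exact ⟨0, fun h => absurd h ht⟩
  choose f hf using h1
  exact ⟨f, h.tendstoUniformlyOn_of_tendsto fun t ht => hf t ht⟩

/-- A solution with the quantitative information obtained from the construction. -/
structure GoodSol (s h M N μ τ : ℝ) (u v : ℝ → ComplexL2) : Prop extends Sol s μ τ u v where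
  bound : ∀ t ∈ Icc 0 τ, ‖u t‖ ^ 2 + ‖v t‖ ^ 2 ≤ M ^ 2 * (‖u 0‖ ^ 2 + ‖v 0‖ ^ 2)
  tail : ∀ t ∈ Icc 0 τ, ∀ R : ℝ, 0 < R → ‖tailOp R (u t)‖ ^ 2 + ‖tailOp R (v t)‖ ^ 2 ≤
    M ^ 2 * (‖tailOp R (u 0)‖ ^ 2 + ‖tailOp R (v 0)‖ ^ 2)
  stable : ∀ (ρ : ℝ) (u' v' : ℝ → ComplexL2), M * N ≤ ρ → Sol s μ τ u' v' →
    (∀ t ∈ Icc 0 τ, ‖u' t‖ ≤ ρ) → (∀ t ∈ Icc 0 τ, ‖v' t‖ ≤ ρ) → ∀ t ∈ Icc 0 τ,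
    ‖sob (-s) (u t - u' t)‖ ^ 2 + ‖sob (-s) (v t - v' t)‖ ^ 2 ≤ diffConst s h ρ τ *
      (‖sob (-s) (u 0 - u' 0)‖ ^ 2 + ‖sob (-s) (v 0 - v' 0)‖ ^ 2)

/-! ### Removal of the regularisation -/

/-- The norm is a tail plus a constant, depending on `R`, times the weak norm. Fixing `R` makes all
tails small at once, and after that the weak Cauchy property takes over. -/
lemma uniformCauchySeqOn_of_tail {s : ℝ} (hs : 0 ≤ s) {S : Set ℝ} {a : ℕ → ℝ → ComplexL2}
    {c : ℕ → ℝ} (htail : ∀ ε : ℝ, 0 < ε → ∃ R : ℝ, 0 < R ∧ ∀ k, ∀ t ∈ S, ‖tailOp R (a k t)‖ ≤ ε)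
    (hc : Tendsto c atTop (𝓝 0))
    (hweak : ∀ k l, ∀ t ∈ S, ‖sob (-s) (a k t - a l t)‖ ≤ c k + c l) :
    UniformCauchySeqOn a atTop S := by
  rw [Metric.uniformCauchySeqOn_iff]
  intro ε hε
  obtain ⟨R, hR, hRt⟩ := htail (ε / 8) (by positivity)
  set B : ℝ := (1 + R ^ 2) ^ (s / 2) with hB
  have B0 : 0 < B := by positivity
  have h1 : ∀ᶠ k in atTop, c k < ε / (4 * B) := hc.eventually_lt_const (by positivity)
  obtain ⟨K, hK⟩ := eventually_atTop.1 h1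
  refine ⟨K, fun k hk l hl t ht => ?_⟩
  rw [dist_eq_norm]
  have h2 := norm_le_tailOp_add hs hR (a k t - a l t)
  have h3 : ‖tailOp R (a k t - a l t)‖ ≤ ε / 8 + ε / 8 := by
    rw [map_sub]
    exact (norm_sub_le _ _).trans (add_le_add (hRt k t ht) (hRt l t ht))
  have h4 : B * ‖sob (-s) (a k t - a l t)‖ ≤ B * (ε / (4 * B) + ε / (4 * B)) :=
    mul_le_mul_of_nonneg_left
      ((hweak k l t ht).trans (add_le_add (hK k hk).le (hK l hl).le)) B0.le
  have h5 : B * (ε / (4 * B) + ε / (4 * B)) = ε / 2 := by field_simp; ring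
  linarith

lemma RegSol.weak {s δ μ τ : ℝ} (hs : 3 / 2 < s) (hδ : 0 < δ) {f g : ℝ → ComplexL2}
    (S : RegSol s δ μ τ f g) {t : ℝ} (ht : t ∈ Icc 0 τ) :
    HasDerivWithinAt (fun r => sob (-s) (f r)) (field1 s 0 δ μ (f t) (g t)) (Icc 0 τ) t ∧
    HasDerivWithinAt (fun r => sob (-s) (g r)) (field2 s 0 δ μ (f t) (g t)) (Icc 0 τ) t := by
  obtain ⟨c, O⟩ := orderBound_of_pos hs hδ (by linarith : 0 ≤ s)
  have O' : OrderBound s (-s + s) δ 1 := by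
    rw [neg_add_cancel]; exact orderBound_zero hs hδ.le
  have e := sob_field μ O (by linarith : -s ≤ 0) O' (f t) (g t)
  rw [neg_add_cancel] at e
  have h1 := (sob (-s)).hasFDerivAt.comp_hasDerivWithinAt t (S.deriv₁ t ht)
  have h2 := (sob (-s)).hasFDerivAt.comp_hasDerivWithinAt t (S.deriv₂ t ht)
  rw [e.1] at h1
  rw [e.2] at h2
  exact ⟨h1, h2⟩

lemma norm_le_of_sq_add_sq_le {a b c : ℝ} (hc : 0 ≤ c) (h : a ^ 2 + b ^ 2 ≤ c ^ 2) :
    a ≤ c ∧ b ≤ c :=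
  ⟨abs_le_of_sq_le_sq' (by nlinarith [sq_nonneg b]) hc |>.2,
    abs_le_of_sq_le_sq' (by nlinarith [sq_nonneg a]) hc |>.2⟩

/-- Integration of the limit equation. -/
lemma hasDerivWithinAt_of_approx {s τ : ℝ} (hs : 3 / 2 < s) {u p : ℝ → ComplexL2}
    (hp : Continuous p) {a q : ℕ → ℝ → ComplexL2}
    (hlim : ∀ t ∈ Icc 0 τ, Tendsto (fun k => a k t) atTop (𝓝 (u t)))
    (h0 : ∀ k, a k 0 = u 0)
    (hderiv : ∀ k, ∀ t ∈ Icc 0 τ, HasDerivWithinAt (fun r => sob (-s) (a k r)) (q k t) (Icc 0 τ) t)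
    (hq : ∀ ε : ℝ, 0 < ε → ∀ᶠ k : ℕ in atTop, ∀ t ∈ Icc 0 τ, ‖q k t - sob (1 - s) (p t)‖ ≤ ε) {t : ℝ}
    (ht : t ∈ Icc 0 τ) :
    HasDerivWithinAt (fun r => sob (-1) (u r)) (p t) (Icc 0 τ) t := by
  have hs1 : 1 - s ≤ 0 := by linarith
  -- The candidate for the solution is the antiderivative of the limit field in `H^{s-1}`, which is
  -- differentiable there because `p` is continuous.
  set V : ℝ → ComplexL2 := fun t => ∫ r in (0 : ℝ)..t, p r with hV
  have dV : ∀ t, HasDerivAt V (p t) t := fun t => (hp.integral_hasStrictDerivAt 0 t).hasDerivAt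
  have V0 : V 0 = 0 := by simp [hV]
  -- The derivatives converge only in the weak norm, so the identity is proved after the injective
  -- operator `sob (1 - s)`, by the mean value inequality along the approximating sequence.
  have key : ∀ r ∈ Icc 0 τ, sob (-1) (u r) = sob (-1) (u 0) + V r := by
    intro r hr
    refine sob_injective hs1 ?_
    rw [map_add, sob_neg_eq hs, sob_neg_eq hs]
    have hτ : 0 ≤ τ := hr.1.trans hr.2
    have hbound : ∀ ε : ℝ, 0 < ε →
        ‖sob (-s) (u r) - (sob (-s) (u 0) + sob (1 - s) (V r))‖ ≤ ε * τ := by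
      intro ε hε
      have hl : Tendsto (fun k => ‖sob (-s) (a k r) - (sob (-s) (u 0) + sob (1 - s) (V r))‖) atTop
          (𝓝 ‖sob (-s) (u r) - (sob (-s) (u 0) + sob (1 - s) (V r))‖) :=
        ((((sob (-s)).continuous.tendsto _).comp (hlim r hr)).sub_const _).norm
      refine le_of_tendsto hl ?_
      filter_upwards [hq ε hε] with k hk
      have h1 := norm_image_sub_le_of_norm_deriv_le_segment'
        (f := fun t => sob (-s) (a k t) - sob (1 - s) (V t))
        (f' := fun t => q k t - sob (1 - s) (p t)) (C := ε)
        (fun t ht => (hderiv k t ht).sub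
          ((sob (1 - s)).hasFDerivAt.comp_hasDerivWithinAt t (dV t).hasDerivWithinAt))
        (fun t ht => hk t (Ico_subset_Icc_self ht)) r hr
      simp only [h0, V0, map_zero, sub_zero] at h1
      have h2 : sob (-s) (a k r) - (sob (-s) (u 0) + sob (1 - s) (V r))
          = sob (-s) (a k r) - sob (1 - s) (V r) - sob (-s) (u 0) := by abel
      rw [h2]
      exact h1.trans (mul_le_mul_of_nonneg_left hr.2 hε.le)
    have hz : ‖sob (-s) (u r) - (sob (-s) (u 0) + sob (1 - s) (V r))‖ ≤ 0 := by
      refine le_of_forall_pos_le_add fun ε hε => ?_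
      refine (hbound (ε / (τ + 1)) (by positivity)).trans ?_
      rw [zero_add, div_mul_eq_mul_div, div_le_iff₀ (by positivity)]
      nlinarith
    exact sub_eq_zero.1 (norm_le_zero_iff.1 hz)
  exact ((dV t).hasDerivWithinAt.const_add (sob (-1) (u 0))).congr key (key t ht)

/-- Existence of solutions in `H^s` coordinates. -/
lemma exists_goodSol {s h c₁ : ℝ} (hs : 3 / 2 < s) (h0 : 0 < h) (h1 : h ≤ 1) (hc₁ : 0 < c₁)
    (μ : ℝ) {N : ℝ} (hN : 0 < N) (hNc : N ≤ c₁) {f₀ g₀ : ComplexL2}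
    (hf₀ : Herm f₀) (hg₀ : Herm g₀) (hsize : ‖f₀‖ ^ 2 + ‖g₀‖ ^ 2 ≤ N ^ 2)
    (hcoer : Coercive h (sob (-s) f₀)) :
    ∃ u v : ℝ → ComplexL2, u 0 = f₀ ∧ v 0 = g₀ ∧
      GoodSol s h (growthFactor s h c₁) N μ (lifespan s h c₁ / N) u v := by
  set M := growthFactor s h c₁ with hM
  have M1 : 1 ≤ M := one_le_growthFactor h0 h1 hc₁
  have hT : 0 < lifespan s h c₁ / N := div_pos (lifespan_pos h0 h1 hc₁) hN
  set τ := lifespan s h c₁ / N with hτ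
  have hs0 : 0 ≤ s := by linarith
  have hδ : ∀ k : ℕ, 0 < 1 / ((k : ℝ) + 1) := fun k => by positivity
  choose f g hf0 hg0 G using fun k : ℕ => exists_goodRegSol hs h0 h1 hc₁ (hδ k) μ hN hNc hf₀ hg₀
    hsize hcoer
  set ρ := M * N with hρdef
  have hρ : 0 ≤ ρ := by positivity
  have nb : ∀ k, ∀ t ∈ Icc 0 τ, ‖f k t‖ ≤ ρ ∧ ‖g k t‖ ≤ ρ := fun k t ht => by
    refine norm_le_of_sq_add_sq_le hρ (((G k).bound t ht).trans ?_)
    rw [hf0, hg0, hρdef, mul_pow]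
    gcongr
  set E : ℕ → ℝ := fun k => cutError s ρ (1 / ((k : ℝ) + 1)) with hE
  have E0 : ∀ k, 0 ≤ E k := fun k => cutError_nonneg s _ hρ
  have Elim : Tendsto E atTop (𝓝 0) := tendsto_cutError s ρ
  set K := diffConst s h ρ τ with hK
  have K0 : 0 ≤ K := diffConst_nonneg s h0 hρ hT.le
  have weakdiff : ∀ k l, ∀ t ∈ Icc 0 τ,
      ‖sob (-s) (f k t - f l t)‖ ^ 2 + ‖sob (-s) (g k t - g l t)‖ ^ 2
        ≤ (Real.sqrt K * E k + Real.sqrt K * E l) ^ 2 := by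
    intro k l t ht
    have cut := fun (m : ℕ) (r : ℝ) (hr : r ∈ Icc 0 τ) =>
      norm_field_sub_field_zero_le hs (hδ m) μ (nb l r hr).1 (nb l r hr).2
    -- The solution with cut-off index `l` is an approximate solution for index `k`. The error is
    -- the difference of the two fields, compared through the field without cut-off.
    have h2 := (G k).difference_le hs (hδ k) h0 h1 (ρ := ρ) (e := E k + E l)
      (fun r hr => (nb k r hr).1) (fun r hr => (nb k r hr).2)
      (u := f l) (v := g l)
      (E₁ := fun r => field1 s 0 (1 / ((l : ℝ) + 1)) μ (f l r) (g l r)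
        - field1 s 0 (1 / ((k : ℝ) + 1)) μ (f l r) (g l r))
      (E₂ := fun r => field2 s 0 (1 / ((l : ℝ) + 1)) μ (f l r) (g l r)
        - field2 s 0 (1 / ((k : ℝ) + 1)) μ (f l r) (g l r))
      (G l).herm₂ (fun r hr => (nb l r hr).1) (fun r hr => (nb l r hr).2)
      (fun r hr => by
        rw [add_sub_cancel]; exact ((G l).weak hs (hδ l) hr).1)
      (fun r hr => by
        rw [add_sub_cancel]; exact ((G l).weak hs (hδ l) hr).2)
      (fun r hr => by
        rw [← sub_sub_sub_cancel_right _ _ (field1 s 0 0 μ (f l r) (g l r))]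
        refine (norm_sub_le _ _).trans ?_
        rw [add_comm]
        exact add_le_add (cut k r hr).1 (cut l r hr).1)
      (fun r hr => by
        rw [← sub_sub_sub_cancel_right _ _ (field2 s 0 0 μ (f l r) (g l r))]
        refine (norm_sub_le _ _).trans ?_
        rw [add_comm]
        exact add_le_add (cut k r hr).2 (cut l r hr).2) ht
    rw [hf0, hf0, hg0, hg0, sub_self, sub_self, map_zero, norm_zero] at h2
    refine h2.trans (le_of_eq ?_)
    rw [← mul_add, mul_pow, Real.sq_sqrt K0]
    ring
  -- The tail at time `t` is bounded by the tail of the datum, which is the same for all `k`. Hence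
  -- one `R` serves all `k` and `t`.
  have htail : ∀ ε : ℝ, 0 < ε → ∃ R : ℝ, 0 < R ∧ ∀ k, ∀ t ∈ Icc 0 τ,
      ‖tailOp R (f k t)‖ ≤ ε ∧ ‖tailOp R (g k t)‖ ≤ ε := by
    intro ε hε
    have h2 : Tendsto (fun j : ℕ => M ^ 2 * (‖tailOp ((j : ℝ) + 1) f₀‖ ^ 2
        + ‖tailOp ((j : ℝ) + 1) g₀‖ ^ 2)) atTop (𝓝 0) := by
      have h3 := (((tendsto_tailOp f₀).norm.pow 2).add ((tendsto_tailOp g₀).norm.pow 2)).const_mul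
        (M ^ 2)
      simpa using h3
    obtain ⟨j, hj⟩ := (h2.eventually_lt_const (show (0 : ℝ) < ε ^ 2 by positivity)).exists
    refine ⟨(j : ℝ) + 1, by positivity, fun k t ht => norm_le_of_sq_add_sq_le hε.le ?_⟩
    have h4 := (G k).tail t ht ((j : ℝ) + 1) (by positivity)
    rw [hf0, hg0] at h4
    exact h4.trans hj.le
  have clim : Tendsto (fun k => Real.sqrt K * E k) atTop (𝓝 0) := by
    simpa using Elim.const_mul (Real.sqrt K)
  have c0 : ∀ k, 0 ≤ Real.sqrt K * E k := fun k => mul_nonneg (Real.sqrt_nonneg _) (E0 k)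
  obtain ⟨u₁, hu₁⟩ := exists_tendstoUniformlyOn (uniformCauchySeqOn_of_tail hs0
    (fun ε hε => by
      obtain ⟨R, hR, h⟩ := htail ε hε
      exact ⟨R, hR, fun k t ht => (h k t ht).1⟩) clim
    (fun k l t ht => (norm_le_of_sq_add_sq_le (add_nonneg (c0 k) (c0 l)) (weakdiff k l t ht)).1))
  obtain ⟨v₁, hv₁⟩ := exists_tendstoUniformlyOn (uniformCauchySeqOn_of_tail hs0
    (fun ε hε => by
      obtain ⟨R, hR, h⟩ := htail ε hε
      exact ⟨R, hR, fun k t ht => (h k t ht).2⟩) clim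
    (fun k l t ht => (norm_le_of_sq_add_sq_le (add_nonneg (c0 k) (c0 l)) (weakdiff k l t ht)).2))
  have cf : ∀ k, ContinuousOn (f k) (Icc 0 τ) := fun k t ht => ((G k).deriv₁ t ht).continuousWithinAt
  have cg : ∀ k, ContinuousOn (g k) (Icc 0 τ) := fun k t ht => ((G k).deriv₂ t ht).continuousWithinAt
  have cu₁ : ContinuousOn u₁ (Icc 0 τ) := hu₁.continuousOn (Frequently.of_forall cf)
  have cv₁ : ContinuousOn v₁ (Icc 0 τ) := hv₁.continuousOn (Frequently.of_forall cg)
  -- The limit is extended by its end values to a continuous function on the line, so that the field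
  -- along it has an antiderivative.
  set u : ℝ → ComplexL2 := fun t => u₁ (projIcc 0 τ hT.le t) with hu
  set v : ℝ → ComplexL2 := fun t => v₁ (projIcc 0 τ hT.le t) with hv
  have cu : Continuous u :=
    cu₁.comp_continuous (continuous_subtype_val.comp continuous_projIcc) fun t => (projIcc 0 τ hT.le t).2
  have cv : Continuous v :=
    cv₁.comp_continuous (continuous_subtype_val.comp continuous_projIcc) fun t => (projIcc 0 τ hT.le t).2
  have eu : ∀ t ∈ Icc 0 τ, u t = u₁ t := fun t ht => by rw [hu]; simp only [projIcc_of_mem hT.le ht]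
  have ev : ∀ t ∈ Icc 0 τ, v t = v₁ t := fun t ht => by rw [hv]; simp only [projIcc_of_mem hT.le ht]
  have lu : ∀ t ∈ Icc 0 τ, Tendsto (fun k => f k t) atTop (𝓝 (u t)) := fun t ht => by
    rw [eu t ht]; exact hu₁.tendsto_at ht
  have lv : ∀ t ∈ Icc 0 τ, Tendsto (fun k => g k t) atTop (𝓝 (v t)) := fun t ht => by
    rw [ev t ht]; exact hv₁.tendsto_at ht
  have z0 : (0 : ℝ) ∈ Icc 0 τ := left_mem_Icc.2 hT.le
  have u0 : u 0 = f₀ := tendsto_nhds_unique (lu 0 z0) (by simp only [hf0]; exact tendsto_const_nhds)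
  have v0 : v 0 = g₀ := tendsto_nhds_unique (lv 0 z0) (by simp only [hg0]; exact tendsto_const_nhds)
  have nu : ∀ t ∈ Icc 0 τ, ‖u t‖ ≤ ρ := fun t ht =>
    le_of_tendsto (lu t ht).norm (Eventually.of_forall fun k => (nb k t ht).1)
  have nv : ∀ t ∈ Icc 0 τ, ‖v t‖ ≤ ρ := fun t ht =>
    le_of_tendsto (lv t ht).norm (Eventually.of_forall fun k => (nb k t ht).2)
  have herm_lim : ∀ {a : ℕ → ComplexL2} {b : ComplexL2}, Tendsto a atTop (𝓝 b) →
      (∀ k, Herm (a k)) → Herm b := fun hab ha =>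
    tendsto_nhds_unique (((reflConj.continuous.tendsto _).comp hab).congr fun k => ha k) hab
  have Lip : ∀ ε : ℝ, 0 < ε → ∀ᶠ k : ℕ in atTop, ∀ t ∈ Icc 0 τ,
      ‖field1 s 0 (1 / ((k : ℝ) + 1)) μ (f k t) (g k t) - field1 s 0 0 μ (u t) (v t)‖ ≤ ε ∧
      ‖field2 s 0 (1 / ((k : ℝ) + 1)) μ (f k t) (g k t) - field2 s 0 0 μ (u t) (v t)‖ ≤ ε := by
    intro ε hε
    have hD := decayConst_nonneg s
    set L : ℝ := 1 * (1 + 16 * decayConst s * ρ) with hL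
    have L0 : 0 < L := by positivity
    have hd : 0 < ε / (2 * L) := by positivity
    filter_upwards [Metric.tendstoUniformlyOn_iff.1 hu₁ _ hd,
      Metric.tendstoUniformlyOn_iff.1 hv₁ _ hd,
      Elim.eventually_lt_const (half_pos hε)] with k h2 h3 h4 t ht
    have h5 := norm_field_sub_field_zero_le hs (hδ k) μ (nb k t ht).1 (nb k t ht).2
    have h6 := norm_field_sub_le μ (orderBound_zero hs le_rfl) (f := f k t) (g := g k t)
      (f' := u t) (g' := v t) (ρ := ρ) (d := ε / (2 * L)) (nb k t ht).2 (nb k t ht).1 (nu t ht)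
      (nv t ht)
      (by rw [← dist_eq_norm, dist_comm, eu t ht]; exact (h2 t ht).le)
      (by rw [← dist_eq_norm, dist_comm, ev t ht]; exact (h3 t ht).le)
    have h7 : L * (ε / (2 * L)) = ε / 2 := by field_simp
    rw [← hL, h7] at h6
    constructor
    · refine (norm_sub_le_norm_sub_add_norm_sub _ (field1 s 0 0 μ (f k t) (g k t)) _).trans ?_
      have : E k = 2 * Real.sqrt (1 / ((k : ℝ) + 1)) * (1 + 12 * decayConst s * ρ) * ρ := rfl
      linarith [h5.1, h6.1]
    · refine (norm_sub_le_norm_sub_add_norm_sub _ (field2 s 0 0 μ (f k t) (g k t)) _).trans ?_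
      have : E k = 2 * Real.sqrt (1 / ((k : ℝ) + 1)) * (1 + 12 * decayConst s * ρ) * ρ := rfl
      linarith [h5.2, h6.2]
  have cp : Continuous fun t => vecField s (s - 1) 0 μ (u t, v t) :=
    (continuous_vecField μ (orderBound_pred hs le_rfl)).comp (cu.prodMk cv)
  have sol : Sol s μ τ u v :=
    { herm₁ := fun t ht => herm_lim (lu t ht) fun k => (G k).herm₁ t ht
      herm₂ := fun t ht => herm_lim (lv t ht) fun k => (G k).herm₂ t ht
      cont₁ := cu.continuousOn
      cont₂ := cv.continuousOn
      deriv₁ := fun t ht => hasDerivWithinAt_of_approx hs (a := f)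
        (p := fun t => field1 s (s - 1) 0 μ (u t) (v t)) (continuous_fst.comp cp) lu
        (fun k => by rw [hf0, u0]) (fun k r hr => ((G k).weak hs (hδ k) hr).1)
        (fun ε hε => (Lip ε hε).mono fun k hk r hr => by
          rw [(sob_field_pred hs μ _ _).1]; exact (hk r hr).1) ht
      deriv₂ := fun t ht => hasDerivWithinAt_of_approx hs (a := g)
        (p := fun t => field2 s (s - 1) 0 μ (u t) (v t)) (continuous_snd.comp cp) lv
        (fun k => by rw [hg0, v0]) (fun k r hr => ((G k).weak hs (hδ k) hr).2)
        (fun ε hε => (Lip ε hε).mono fun k hk r hr => by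
          rw [(sob_field_pred hs μ _ _).2]; exact (hk r hr).2) ht }
  refine ⟨u, v, u0, v0, sol, fun t ht => ?_, fun t ht R hR => ?_, ?_⟩
  · rw [u0, v0]
    refine le_of_tendsto (((lu t ht).norm.pow 2).add ((lv t ht).norm.pow 2))
      (Eventually.of_forall fun k => ?_)
    have := (G k).bound t ht
    rwa [hf0, hg0] at this
  · rw [u0, v0]
    refine le_of_tendsto (((((tailOp R).continuous.tendsto _).comp (lu t ht)).norm.pow 2).add
      ((((tailOp R).continuous.tendsto _).comp (lv t ht)).norm.pow 2))
      (Eventually.of_forall fun k => ?_)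
    have := (G k).tail t ht R hR
    rwa [hf0, hg0] at this
  -- An arbitrary solution of the full system solves the regularised one up to `cutError`. The
  -- comparison is made with the regularised solutions, and the cut-off is then removed.
  · intro ρ' u' v' hρ' S' nu' nv' t ht
    have hρ'0 : 0 ≤ ρ' := hρ.trans hρ'
    have step : ∀ k, ‖sob (-s) (f k t - u' t)‖ ^ 2 + ‖sob (-s) (g k t - v' t)‖ ^ 2 ≤
        diffConst s h ρ' τ * ((‖sob (-s) (u 0 - u' 0)‖ ^ 2 + ‖sob (-s) (v 0 - v' 0)‖ ^ 2)
          + cutError s ρ' (1 / ((k : ℝ) + 1)) ^ 2) := fun k => by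
      have cut := fun (r : ℝ) (hr : r ∈ Icc 0 τ) =>
        norm_field_sub_field_zero_le hs (hδ k) μ (nu' r hr) (nv' r hr)
      have h2 := (G k).difference_le hs (hδ k) h0 h1 (ρ := ρ')
        (e := cutError s ρ' (1 / ((k : ℝ) + 1)))
        (fun r hr => (nb k r hr).1.trans hρ') (fun r hr => (nb k r hr).2.trans hρ')
        (u := u') (v := v')
        (E₁ := fun r => field1 s 0 0 μ (u' r) (v' r)
          - field1 s 0 (1 / ((k : ℝ) + 1)) μ (u' r) (v' r))
        (E₂ := fun r => field2 s 0 0 μ (u' r) (v' r)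
          - field2 s 0 (1 / ((k : ℝ) + 1)) μ (u' r) (v' r))
        S'.herm₂ nu' nv'
        (fun r hr => by
          rw [add_sub_cancel]; exact (S'.weak hs hr).1)
        (fun r hr => by
          rw [add_sub_cancel]; exact (S'.weak hs hr).2)
        (fun r hr => by rw [norm_sub_rev]; exact (cut r hr).1)
        (fun r hr => by rw [norm_sub_rev]; exact (cut r hr).2) ht
      rwa [hf0, hg0, ← u0, ← v0] at h2
    have l1 : Tendsto (fun k => ‖sob (-s) (f k t - u' t)‖ ^ 2 + ‖sob (-s) (g k t - v' t)‖ ^ 2) atTop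
        (𝓝 (‖sob (-s) (u t - u' t)‖ ^ 2 + ‖sob (-s) (v t - v' t)‖ ^ 2)) :=
      ((((sob (-s)).continuous.tendsto _).comp ((lu t ht).sub_const _)).norm.pow 2).add
        ((((sob (-s)).continuous.tendsto _).comp ((lv t ht).sub_const _)).norm.pow 2)
    have l2 := (((tendsto_cutError s ρ').pow 2).const_add
      (‖sob (-s) (u 0 - u' 0)‖ ^ 2 + ‖sob (-s) (v 0 - v' 0)‖ ^ 2)).const_mul (diffConst s h ρ' τ)
    rw [zero_pow two_ne_zero, add_zero] at l2
    exact le_of_tendsto_of_tendsto' l1 l2 step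

/-- Uniqueness. -/
lemma GoodSol.eqOn {s h M N μ τ : ℝ} (hs : 3 / 2 < s) {u v u' v' : ℝ → ComplexL2}
    (S : GoodSol s h M N μ τ u v) (S' : Sol s μ τ u' v') (hu : u 0 = u' 0) (hv : v 0 = v' 0) {t : ℝ}
    (ht : t ∈ Icc 0 τ) : u t = u' t ∧ v t = v' t := by
  -- The competitor is bounded only by compactness of the interval. This suffices because `stable`
  -- admits any size `ρ`.
  obtain ⟨a, ha⟩ := isCompact_Icc.exists_bound_of_continuousOn S'.cont₁
  obtain ⟨b, hb⟩ := isCompact_Icc.exists_bound_of_continuousOn S'.cont₂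
  have h1 := S.stable (max (M * N) (max a b)) u' v' (le_max_left _ _) S'
    (fun r hr => (ha r hr).trans ((le_max_left _ _).trans (le_max_right _ _)))
    (fun r hr => (hb r hr).trans ((le_max_right _ _).trans (le_max_right _ _))) t ht
  rw [hu, hv, sub_self, sub_self, map_zero, norm_zero] at h1
  have h2 := norm_le_of_sq_add_sq_le (c := 0) le_rfl (h1.trans (by simp))
  have h3 : ∀ {x y : ComplexL2}, ‖sob (-s) (x - y)‖ ≤ 0 → x = y := fun h => by
    have h4 := norm_le_zero_iff.1 h
    rw [map_sub, sub_eq_zero] at h4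
    exact sob_injective (by linarith) h4
  exact ⟨h3 h2.1, h3 h2.2⟩

/-! ### Coordinates on `V^s` -/

/-- `f` and `g` are the Fourier transforms of `J^σ ζ` and `J^σ T_μ(D)^{-1/2} v`, for
`U = (ζ, v)`. -/
def Coord (σ μ : ℝ) (U : State) (f g : ComplexL2) : Prop :=
  fourier U.1 = sob (-σ) f ∧ fourier U.2 = mulOp (symPhi μ) (sob (-σ) g)

lemma mulOp_symPhi_injective {μ : ℝ} {f g : ComplexL2}
    (h : mulOp (symPhi μ) f = mulOp (symPhi μ) g) : f = g := by
  apply Lp.ext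
  have h1 := mulOp_ae (bddMeas_symPhi μ) f
  rw [h] at h1
  filter_upwards [h1, mulOp_ae (bddMeas_symPhi μ) g] with ξ h2 h3
  rw [h3] at h2
  exact (mul_left_cancel₀ (Complex.ofReal_ne_zero.2 (phi_pos μ ξ).ne') h2).symm

lemma fourier_add (f g : RealL2) : fourier (f + g) = fourier f + fourier g := map_add fourierL f g

lemma fourier_sub (f g : RealL2) : fourier (f - g) = fourier f - fourier g := map_sub fourierL f g

lemma fourier_neg (f : RealL2) : fourier (-f) = -fourier f := map_neg fourierL f

lemma fourier_smul (c : ℝ) (f : RealL2) : fourier (c • f) = c • fourier f := map_smul fourierL c f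

lemma vNorm_sq (σ μ : ℝ) (U : State) : vNorm σ μ U ^ 2 = sobolevNormSq σ U.1 +
    ∫⁻ ξ, ENNReal.ofReal ((1 + sfreq μ ξ) * bracket σ ξ ^ 2) * ‖fourier U.2 ξ‖ₑ ^ 2 := by
  have mv := (measurable_enorm_coe (fourier U.2)).pow_const 2
  have mb : Measurable (fun ξ => bracket σ ξ ^ 2) := (measurable_bracket σ).pow_const 2
  rw [vNorm, ← ENNReal.rpow_natCast, ← ENNReal.rpow_mul]
  norm_num
  rw [add_assoc]
  congr 1
  rw [sobolevNormSq, halfDerivSobolevNormSq, weightedNormSq, weightedNormSq, ← lintegral_const_mul,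
    ← lintegral_add_left]
  · refine lintegral_congr fun ξ => ?_
    rw [show 2 * Real.pi * ξ = freq ξ from rfl, bracket_sq, add_mul, ENNReal.ofReal_add (by positivity)
      (mul_nonneg (sfreq_nonneg μ ξ) (by positivity)), add_mul, one_mul, sfreq, mul_assoc (Real.sqrt μ),
      ENNReal.ofReal_mul (Real.sqrt_nonneg μ), mul_assoc (ENNReal.ofReal (Real.sqrt μ))]
  · simp only [bracket_sq] at mb
    exact mb.ennreal_ofReal.mul mv
  · simp only [bracket_sq] at mb
    exact (measurable_freq.abs.mul mb).ennreal_ofReal.mul mv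

lemma sobolevNormSq_eq (σ : ℝ) (f : RealL2) :
    sobolevNormSq σ f = ∫⁻ ξ, ENNReal.ofReal (bracket σ ξ ^ 2) * ‖fourier f ξ‖ₑ ^ 2 := by
  simp only [bracket_sq]
  rfl

lemma ofReal_mul_enorm_sq {w : ℝ} (hw : 0 ≤ w) (m : ℝ) (z : ℂ) :
    ENNReal.ofReal w * ‖(m : ℂ) * z‖ₑ ^ 2 = ENNReal.ofReal (w * m ^ 2) * ‖z‖ₑ ^ 2 := by
  rw [enorm_mul, mul_pow, ← mul_assoc, ← ofReal_norm (m : ℂ), Complex.norm_real, Real.norm_eq_abs,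
    ← ENNReal.ofReal_pow (abs_nonneg m), sq_abs, ENNReal.ofReal_mul hw]

/-! ### The norm of `V^σ` in terms of the coordinates. -/

section Coordinates

variable {σ μ : ℝ} {U V : State} {f g f' g' : ComplexL2}

lemma Coord.unique (hσ : 0 ≤ σ) (h : Coord σ μ U f g) (h' : Coord σ μ U f' g') :
    f = f' ∧ g = g' :=
  ⟨sob_injective (by linarith) (h.1.symm.trans h'.1),
    sob_injective (by linarith) (mulOp_symPhi_injective (h.2.symm.trans h'.2))⟩

lemma Coord.eq (h : Coord σ μ U f g) (h' : Coord σ μ V f g) : U = V :=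
  Prod.ext (fourier_injective (h.1.trans h'.1.symm)) (fourier_injective (h.2.trans h'.2.symm))

lemma Coord.sub (h : Coord σ μ U f g) (h' : Coord σ μ V f' g') :
    Coord σ μ (U - V) (f - f') (g - g') := by
  refine ⟨?_, ?_⟩
  · rw [Prod.fst_sub, fourier_sub, h.1, h'.1, map_sub]
  · rw [Prod.snd_sub, fourier_sub, h.2, h'.2, map_sub, map_sub]

lemma Coord.smul (h : Coord σ μ U f g) (c : ℝ) : Coord σ μ (c • U) (c • f) (c • g) := by
  refine ⟨?_, ?_⟩
  · rw [Prod.smul_fst, fourier_smul, h.1, map_smul]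
  · rw [Prod.smul_snd, fourier_smul, h.2, map_smul, map_smul]

lemma Coord.herm (hσ : 0 ≤ σ) (h : Coord σ μ U f g) : Herm f ∧ Herm g := by
  have hJ : -σ ≤ 0 := by linarith
  constructor
  · rw [← herm_sob hJ, ← h.1]
    exact herm_fourier _
  · rw [← herm_sob hJ]
    refine mulOp_symPhi_injective (μ := μ) ?_
    rw [← reflConj_mulOp (bddMeas_symPhi μ) (fun ξ => by
      rw [symPhi, symPhi, phi_neg, Complex.conj_ofReal]), ← h.2]
    exact herm_fourier _

/-- The pair with given coordinates. -/
def ofCoord (σ μ : ℝ) (f g : ComplexL2) : State :=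
  (realInvF (sob (-σ) f), realInvF (mulOp (symPhi μ) (sob (-σ) g)))

lemma coord_ofCoord (hσ : 0 ≤ σ) (hf : Herm f) (hg : Herm g) : Coord σ μ (ofCoord σ μ f g) f g :=
  ⟨fourier_realInvF ((herm_sob (by linarith)).2 hf),
    fourier_realInvF (herm_symPhi ((herm_sob (by linarith)).2 hg))⟩

lemma Coord.pred (hσ : 1 ≤ σ) (h : Coord σ μ U f g) :
    Coord (σ - 1) μ U (sob (-1) f) (sob (-1) g) := by
  have e : ∀ x, sob (-(σ - 1)) (sob (-1) x) = sob (-σ) x := fun x => by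
    rw [sob_sob (by linarith) (by norm_num)]
    congr 2
    ring
  exact ⟨by rw [e]; exact h.1, by rw [e]; exact h.2⟩

lemma Coord.sobolevNormSq_fst (hσ : 0 ≤ σ) (h : Coord σ μ U f g) :
    sobolevNormSq σ U.1 = ‖f‖ₑ ^ 2 := by
  rw [sobolevNormSq_eq, enorm_sq_eq_lintegral]
  refine lintegral_congr_ae ?_
  have h1 := sob_ae (by linarith : -σ ≤ 0) f
  rw [← h.1] at h1
  filter_upwards [h1] with ξ h2
  rw [h2, ofReal_mul_enorm_sq (sq_nonneg _), ← mul_pow, mul_comm, mul_comm (bracket σ ξ),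
    bracket_neg_mul, one_pow, ENNReal.ofReal_one, mul_one]

lemma Coord.vNorm_sq (hσ : 0 ≤ σ) (h : Coord σ μ U f g) : vNorm σ μ U ^ 2 =
    ‖f‖ₑ ^ 2 + ∫⁻ ξ, ENNReal.ofReal ((1 + sfreq μ ξ) * phi μ ξ ^ 2) * ‖g ξ‖ₑ ^ 2 := by
  rw [WhithamBoussinesq.vNorm_sq, h.sobolevNormSq_fst hσ]
  congr 1
  refine lintegral_congr_ae ?_
  have h1 := mulOp_ae (bddMeas_symPhi μ) (sob (-σ) g)
  rw [← h.2] at h1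
  filter_upwards [h1, sob_ae (by linarith : -σ ≤ 0) g] with ξ h2 h3
  have h4 := sfreq_nonneg μ ξ
  rw [h2, h3, symPhi, ← mul_assoc, ← Complex.ofReal_mul, ofReal_mul_enorm_sq (by positivity)]
  congr 2
  calc (1 + sfreq μ ξ) * bracket σ ξ ^ 2 * (phi μ ξ * bracket (-σ) ξ) ^ 2
      = (1 + sfreq μ ξ) * phi μ ξ ^ 2 * (bracket (-σ) ξ * bracket σ ξ) ^ 2 := by ring
    _ = _ := by rw [bracket_neg_mul]; ring

/-- Together with the next lemma this is the equivalence of the `V^σ` norm and the norm of the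
coordinates: `φ^{-2} = x coth x` with `x = √μ|ξ|` lies between `(1 + x)/2` and `1 + x`. The
constants are free of `μ`. -/
lemma one_le_mul_phi_sq (μ ξ : ℝ) : 1 ≤ (1 + sfreq μ ξ) * phi μ ξ ^ 2 := by
  have h1 := xcoth_le (sfreq_nonneg μ ξ)
  rw [← psi_sq] at h1
  calc (1 : ℝ) = psi μ ξ ^ 2 * phi μ ξ ^ 2 := by rw [← mul_pow, psi_mul_phi, one_pow]
    _ ≤ _ := by gcongr

lemma mul_phi_sq_le_two (μ ξ : ℝ) : (1 + sfreq μ ξ) * phi μ ξ ^ 2 ≤ 2 := by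
  have h1 := one_le_xcoth (sfreq_nonneg μ ξ)
  have h2 := self_le_xcoth (sfreq_nonneg μ ξ)
  rw [← psi_sq] at h1 h2
  calc (1 + sfreq μ ξ) * phi μ ξ ^ 2 ≤ (2 * psi μ ξ ^ 2) * phi μ ξ ^ 2 := by gcongr; linarith
    _ = 2 * (psi μ ξ * phi μ ξ) ^ 2 := by ring
    _ = 2 := by rw [psi_mul_phi]; norm_num

lemma enorm_sq_add_eq_ofReal (f g : ComplexL2) :
    ‖f‖ₑ ^ 2 + ‖g‖ₑ ^ 2 = ENNReal.ofReal (‖f‖ ^ 2 + ‖g‖ ^ 2) := by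
  rw [ENNReal.ofReal_add (by positivity) (by positivity), ENNReal.ofReal_pow (norm_nonneg _),
    ENNReal.ofReal_pow (norm_nonneg _), ofReal_norm, ofReal_norm]

lemma Coord.le_vNorm_sq (hσ : 0 ≤ σ) (h : Coord σ μ U f g) :
    ENNReal.ofReal (‖f‖ ^ 2 + ‖g‖ ^ 2) ≤ vNorm σ μ U ^ 2 := by
  rw [h.vNorm_sq hσ, ← enorm_sq_add_eq_ofReal, enorm_sq_eq_lintegral g]
  gcongr with ξ
  exact le_mul_of_one_le_left' (ENNReal.one_le_ofReal.2 (one_le_mul_phi_sq μ ξ))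

lemma Coord.vNorm_sq_le (hσ : 0 ≤ σ) (h : Coord σ μ U f g) :
    vNorm σ μ U ^ 2 ≤ ENNReal.ofReal (2 * (‖f‖ ^ 2 + ‖g‖ ^ 2)) := by
  rw [h.vNorm_sq hσ, ENNReal.ofReal_mul zero_le_two, ← enorm_sq_add_eq_ofReal, mul_add,
    ENNReal.ofReal_ofNat, enorm_sq_eq_lintegral g, ← lintegral_const_mul]
  · refine add_le_add (le_mul_of_one_le_left' one_le_two) (lintegral_mono fun ξ => ?_)
    gcongr
    exact ENNReal.ofReal_le_ofNat.2 (mul_phi_sq_le_two μ ξ)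
  · exact (measurable_enorm_coe g).pow_const 2

lemma Coord.memV (hσ : 0 ≤ σ) (h : Coord σ μ U f g) : MemV σ μ U := by
  have h1 := (h.vNorm_sq_le hσ).trans_lt ENNReal.ofReal_lt_top
  rw [MemV]
  contrapose! h1
  rw [top_le_iff.1 h1]
  simp

/-- Comparison of the norm of `V^σ` with the norm of the coordinates. -/
lemma Coord.norm_le (hσ : 0 ≤ σ) (h : Coord σ μ U f g) :
    ‖f‖ ^ 2 + ‖g‖ ^ 2 ≤ (vNorm σ μ U).toReal ^ 2 := by
  rw [← ENNReal.toReal_pow, ← ENNReal.ofReal_le_iff_le_toReal]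
  · exact h.le_vNorm_sq hσ
  · exact ENNReal.pow_ne_top (h.memV hσ).ne

lemma Coord.le_norm (hσ : 0 ≤ σ) (h : Coord σ μ U f g) :
    (vNorm σ μ U).toReal ^ 2 ≤ 2 * (‖f‖ ^ 2 + ‖g‖ ^ 2) := by
  rw [← ENNReal.toReal_pow]
  exact ENNReal.toReal_le_of_le_ofReal (by positivity) (h.vNorm_sq_le hσ)

lemma memLp_two_of_lintegral_lt_top {u : ℝ → ℂ} (hu : StronglyMeasurable u)
    (h : ∫⁻ ξ, ‖u ξ‖ₑ ^ 2 < ∞) : MemLp u 2 := by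
  refine ⟨hu.aestronglyMeasurable, ?_⟩
  rw [eLpNorm_eq_lintegral_rpow_enorm_toReal (by norm_num) (by norm_num)]
  simp only [ENNReal.toReal_ofNat, ENNReal.rpow_two]
  exact ENNReal.rpow_lt_top_of_nonneg (by norm_num) h.ne

lemma exists_coord (hσ : 0 ≤ σ) (h : MemV σ μ U) : ∃ f g, Coord σ μ U f g := by
  have h1 : vNorm σ μ U ^ 2 < ∞ := ENNReal.pow_lt_top h
  rw [WhithamBoussinesq.vNorm_sq, ENNReal.add_lt_top, sobolevNormSq_eq] at h1
  have m1 : MemLp (fun ξ => ((bracket σ ξ : ℝ) : ℂ) * fourier U.1 ξ) 2 := by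
    refine memLp_two_of_lintegral_lt_top ((Complex.measurable_ofReal.comp
      (measurable_bracket σ)).stronglyMeasurable.mul (Lp.stronglyMeasurable _))
      (lt_of_le_of_lt (lintegral_mono fun ξ => ?_) h1.1)
    have := ofReal_mul_enorm_sq zero_le_one (bracket σ ξ) (fourier U.1 ξ)
    rw [ENNReal.ofReal_one, one_mul, one_mul] at this
    exact this.le
  have m2 : MemLp (fun ξ => ((psi μ ξ * bracket σ ξ : ℝ) : ℂ) * fourier U.2 ξ) 2 := by
    refine memLp_two_of_lintegral_lt_top ((Complex.measurable_ofReal.comp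
      ((measurable_psi μ).mul (measurable_bracket σ))).stronglyMeasurable.mul
      (Lp.stronglyMeasurable _)) (lt_of_le_of_lt (lintegral_mono fun ξ => ?_) h1.2)
    have := ofReal_mul_enorm_sq zero_le_one (psi μ ξ * bracket σ ξ) (fourier U.2 ξ)
    rw [ENNReal.ofReal_one, one_mul, one_mul] at this
    refine this.le.trans ?_
    rw [mul_pow, psi_sq]
    gcongr
    exact xcoth_le (sfreq_nonneg μ ξ)
  refine ⟨m1.toLp, m2.toLp, ?_, ?_⟩
  · apply Lp.ext
    filter_upwards [sob_ae (by linarith : -σ ≤ 0) m1.toLp, m1.coeFn_toLp] with ξ a1 a2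
    rw [a1, a2, ← mul_assoc, ← Complex.ofReal_mul, bracket_neg_mul, Complex.ofReal_one, one_mul]
  · apply Lp.ext
    filter_upwards [mulOp_ae (bddMeas_symPhi μ) (sob (-σ) m2.toLp),
      sob_ae (by linarith : -σ ≤ 0) m2.toLp, m2.coeFn_toLp] with ξ a1 a2 a3
    rw [a1, a2, a3, symPhi, ← mul_assoc, ← mul_assoc, ← Complex.ofReal_mul, ← Complex.ofReal_mul]
    have : phi μ ξ * bracket (-σ) ξ * (psi μ ξ * bracket σ ξ) = 1 := by
      calc _ = (psi μ ξ * phi μ ξ) * (bracket (-σ) ξ * bracket σ ξ) := by ring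
        _ = 1 := by rw [psi_mul_phi, bracket_neg_mul, one_mul]
    rw [this, Complex.ofReal_one, one_mul]

/-- Convergence in `V^σ` is convergence of the coordinates. -/
lemma tendsto_vNorm_iff (hσ : 0 ≤ σ) {l : Filter ℝ} {A : ℝ → State} {a b : ℝ → ComplexL2}
    (h : ∀ᶠ r in l, Coord σ μ (A r) (a r) (b r)) :
    Tendsto (fun r => vNorm σ μ (A r)) l (𝓝 0) ↔ Tendsto a l (𝓝 0) ∧ Tendsto b l (𝓝 0) := by
  have hsq : ∀ {F : ℝ → ℝ≥0∞}, Tendsto F l (𝓝 0) ↔ Tendsto (fun r => F r ^ 2) l (𝓝 0) := by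
    intro F
    refine ⟨fun hF => ?_, fun hF => ?_⟩
    · simpa using ENNReal.Tendsto.pow (n := 2) hF
    · have := hF.ennrpow_const (1 / 2)
      rw [ENNReal.zero_rpow_of_pos (by norm_num)] at this
      refine this.congr fun r => ?_
      rw [← ENNReal.rpow_natCast, ← ENNReal.rpow_mul]
      norm_num
  constructor
  · intro hA
    have h1 := (ENNReal.tendsto_toReal ENNReal.zero_ne_top).comp hA
    have hle : ∀ᶠ r in l, ‖a r‖ ≤ (vNorm σ μ (A r)).toReal ∧ ‖b r‖ ≤ (vNorm σ μ (A r)).toReal :=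
      h.mono fun r hr => norm_le_of_sq_add_sq_le ENNReal.toReal_nonneg (hr.norm_le hσ)
    rw [ENNReal.toReal_zero] at h1
    exact ⟨squeeze_zero_norm' (hle.mono fun r hr => hr.1) h1,
      squeeze_zero_norm' (hle.mono fun r hr => hr.2) h1⟩
  · rintro ⟨ha, hb⟩
    rw [hsq]
    have h1 : Tendsto (fun r => ENNReal.ofReal (2 * (‖a r‖ ^ 2 + ‖b r‖ ^ 2))) l (𝓝 0) := by
      have h2 := ((ha.norm.pow 2).add (hb.norm.pow 2)).const_mul 2
      have h3 := (ENNReal.continuous_ofReal.tendsto _).comp h2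
      rw [norm_zero, zero_pow two_ne_zero, add_zero, mul_zero, ENNReal.ofReal_zero] at h3
      exact h3
    exact tendsto_of_tendsto_of_tendsto_of_le_of_le' tendsto_const_nhds h1
      (Eventually.of_forall fun _ => zero_le) (h.mono fun r hr => hr.vNorm_sq_le hσ)

end Coordinates

/-! ### The system in coordinates -/

/-- `A'` is the Fourier transform of the derivative of the function with Fourier transform `A`. -/
def FreqDeriv (A A' : ComplexL2) : Prop :=
  ∀ᵐ ξ : ℝ, A' ξ = Complex.I * ((freq ξ : ℝ) : ℂ) * A ξ

lemma isSpaceDeriv_iff {f g : RealL2} : IsSpaceDeriv f g ↔ FreqDeriv (fourier f) (fourier g) :=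
  Iff.rfl

lemma FreqDeriv.unique {A B C : ComplexL2} (h : FreqDeriv A B) (h' : FreqDeriv A C) : B = C := by
  apply Lp.ext
  filter_upwards [h, h'] with ξ h1 h2
  rw [h1, h2]

/-- The product rule, which on the Fourier side is `freq a = freq (a - b) + freq b` under the
convolution integral. -/
lemma FreqDeriv.conv {A A' B B' : ComplexL2} (hA : FreqDeriv A A') (hB : FreqDeriv B B')
    (iA : Integrable A) (iB : Integrable B) :
    FreqDeriv (convOp A B) (convOp A B' + convOp B A') := by
  unfold FreqDeriv
  filter_upwards [Lp.coeFn_add (convOp A B') (convOp B A'), convOp_ae iA B, convOp_ae iA B',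
    convOp_ae iB A'] with a h1 h2 h3 h4
  rw [h1, Pi.add_apply, h2, h3, h4, conv_comm B A', WhithamBoussinesq.conv,
    WhithamBoussinesq.conv, WhithamBoussinesq.conv,
    ← integral_add (integrable_conv (Lp.memLp A) (Lp.memLp B') a)
      (integrable_conv (Lp.memLp A') (Lp.memLp B) a), ← integral_const_mul]
  refine integral_congr_ae ?_
  filter_upwards [(measurePreserving_sub_left' a).quasiMeasurePreserving.ae hA, hB] with b h5 h6
  rw [h5, h6, freq_sub]
  push_cast
  ring

lemma conj_symN (s : ℝ) (r : ℝ → ℝ) (hr : ∀ ξ, r (-ξ) = r ξ) (ξ : ℝ) :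
    (starRingEnd ℂ) (symN s 0 r (-ξ)) = symN s 0 r ξ := by
  simp only [symN, cut_zero, freq_neg, bracket_neg, hr, map_mul, Complex.conj_I,
    Complex.conj_ofReal]
  push_cast
  ring

lemma isFourierMultiplier_symbolT_iff {μ : ℝ} (hμ : 0 < μ) {f g : RealL2} :
    IsFourierMultiplier (fun ξ => (symbolT μ ξ : ℂ)) f g ↔
      fourier g = mulOp (symPhi μ) (mulOp (symPhi μ) (fourier f)) := by
  have e : (mulOp (symPhi μ) (mulOp (symPhi μ) (fourier f)) : ℝ → ℂ) =ᵐ[volume]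
      fun ξ => (symbolT μ (freq ξ) : ℂ) * fourier f ξ := by
    filter_upwards [mulOp_ae (bddMeas_symPhi μ) (mulOp (symPhi μ) (fourier f)),
      mulOp_ae (bddMeas_symPhi μ) (fourier f)] with ξ h1 h2
    rw [h1, h2, ← mul_assoc, symPhi, ← Complex.ofReal_mul, ← sq, phi_sq hμ]
  constructor
  · intro h
    apply Lp.ext
    filter_upwards [h, e] with ξ h1 h2
    rw [h1, h2]
    rfl
  · intro h
    rw [← h] at e
    exact e

/-! ### The full system as an evolution equation for the coordinates. -/

section Fields

variable {s μ : ℝ} (hs : 3 / 2 < s)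
include hs

lemma bddMeas_symN_one : BddMeas (symN s 0 fun _ => 1) :=
  bddMeas_symN (by linarith) le_rfl measurable_const (fun _ => zero_le_one) fun _ => le_rfl

lemma bddMeas_symN_phi (μ : ℝ) : BddMeas (symN s 0 (phi μ)) :=
  bddMeas_symN (by linarith) le_rfl (measurable_phi μ) (fun ξ => (phi_pos μ ξ).le) (phi_le_one μ)

lemma freqDeriv_fst (f : ComplexL2) :
    FreqDeriv (sob (-s) f) (mulOp (symN s 0 fun _ => 1) f) := by
  unfold FreqDeriv
  filter_upwards [sob_ae (by linarith : -s ≤ 0) f, mulOp_ae (bddMeas_symN_one hs) f] with ξ h1 h2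
  rw [h1, h2, symN, cut_zero]
  push_cast
  ring

lemma freqDeriv_snd (μ : ℝ) (g : ComplexL2) :
    FreqDeriv (mulOp (symPhi μ) (sob (-s) g)) (mulOp (symN s 0 (phi μ)) g) := by
  unfold FreqDeriv
  filter_upwards [mulOp_ae (bddMeas_symPhi μ) (sob (-s) g), sob_ae (by linarith : -s ≤ 0) g,
    mulOp_ae (bddMeas_symN_phi hs μ) g] with ξ h1 h2 h3
  rw [h1, h2, h3, symN, cut_zero, symPhi]
  push_cast
  ring

lemma herm_freqDeriv_fst {f : ComplexL2} (hf : Herm f) : Herm (mulOp (symN s 0 fun _ => 1) f) :=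
  herm_mulOp (bddMeas_symN_one hs) (conj_symN s _ fun _ => rfl) hf

lemma herm_freqDeriv_snd {g : ComplexL2} (hg : Herm g) : Herm (mulOp (symN s 0 (phi μ)) g) :=
  herm_mulOp (bddMeas_symN_phi hs μ) (conj_symN s _ (phi_neg μ)) hg

lemma integrable_symPhi_sob (μ : ℝ) (g : ComplexL2) :
    Integrable (mulOp (symPhi μ) (sob (-s) g)) :=
  (L1Le_mulOp (L1Le_sob hs g) (bddMeas_symPhi μ) (norm_symPhi_le_one μ)).one.integrable

/-- The vector field without weights. -/
lemma field_zero_eq (μ : ℝ) (f g : ComplexL2) :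
    field1 s 0 0 μ f g = -(mulOp (symN s 0 (phi μ)) g
      + (convOp (sob (-s) f) (mulOp (symN s 0 (phi μ)) g)
        + convOp (mulOp (symPhi μ) (sob (-s) g)) (mulOp (symN s 0 fun _ => 1) f))) ∧
    mulOp (symPhi μ) (field2 s 0 0 μ f g) =
      -(mulOp (symPhi μ) (mulOp (symPhi μ) (mulOp (symN s 0 fun _ => 1) f))
        + convOp (mulOp (symPhi μ) (sob (-s) g)) (mulOp (symN s 0 (phi μ)) g)) := by
  have O := orderBound_zero hs (le_refl (0 : ℝ))
  have bJ := bddMeas_bracket (show -s ≤ 0 by linarith)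
  have bF := bddMeas_symPhi μ
  have b1 := bddMeas_symN_one hs
  have bN := bddMeas_symN_phi hs μ
  have bO : BddMeas (fun _ => (1 : ℂ)) := ⟨measurable_const, 1, by simp⟩
  have e1 : symM 0 0 (fun _ => 1) = fun _ => (1 : ℂ) := by
    ext ξ; simp [symM, cut_zero, bracket_zero]
  have e5 : symL s (fun _ => 1) = fun ξ => ((bracket (-s) ξ : ℝ) : ℂ) := by
    ext ξ; simp [symL]
  have e6 : symL s (phi μ) = fun ξ => symPhi μ ξ * ((bracket (-s) ξ : ℝ) : ℂ) := by
    ext ξ; simp only [symL, symPhi]; push_cast; ring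
  have a3 : ∀ u, mulOp (symL s fun _ => 1) u = sob (-s) u := fun u => by rw [e5, sob]
  have a4 : ∀ u, mulOp (symL s (phi μ)) u = mulOp (symPhi μ) (sob (-s) u) := fun u => by
    rw [e6, sob, mulOp_mulOp bF bJ]
  have eL : symLin s 0 0 μ = symN s 0 (phi μ) := by
    ext ξ; rw [symLin, e1, one_mul]
  have eN : symN s 0 (phi μ) = fun ξ => symPhi μ ξ * symN s 0 (fun _ => 1) ξ := by
    ext ξ; simp only [symN, symPhi]; push_cast; ring
  have t1 := O.tame (symbolTriple_one_one_phi μ)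
  have t2 := O.tame (symbolTriple_one_phi_one μ)
  have t3 := O.tame (symbolTriple_psi_phi_phi μ)
  have ep : (fun ξ => symPhi μ ξ * symM 0 0 (psi μ) ξ) = fun _ => (1 : ℂ) := by
    ext ξ
    rw [symPhi, symM, cut_zero, bracket_zero, ← Complex.ofReal_mul, one_mul, one_mul, mul_comm,
      psi_mul_phi, Complex.ofReal_one]
  -- After multiplication by `phi` the outer symbol `psi` becomes `1`. The bound for `psi` carries
  -- over because `psi ≥ 1`.
  have t4 : Tame s (2 * 1) (fun _ => (1 : ℂ)) (symL s (phi μ)) (symN s 0 (phi μ)) := by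
    refine ⟨hs, by norm_num, measurable_const, t3.left, t3.right, fun a b => ?_⟩
    refine le_trans ?_ (t3.bound a b)
    gcongr
    rw [norm_mul, norm_mul]
    gcongr
    rw [norm_one, symM, cut_zero, bracket_zero, one_mul, one_mul, Complex.norm_real,
      Real.norm_of_nonneg (psi_pos μ a).le]
    exact one_le_psi μ a
  have t3' := mulOp_bil t3 bF (c' := 2 * 1) (by rw [ep]; exact t4) g g
  constructor
  · rw [field1, eL, bil_eq_convOp t1 (by rw [e1]; exact bO) f g (by
      rw [a3]; exact integrable_sob hs f), bil_eq_convOp t2 (by rw [e1]; exact bO) g f (by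
      rw [a4]; exact integrable_symPhi_sob hs μ g), e1, mulOp_one, mulOp_one, a3, a4, add_assoc]
  · rw [field2, map_neg, map_add, t3', ep, bil_eq_convOp t4 bO g g (by
      rw [a4]; exact integrable_symPhi_sob hs μ g), mulOp_one, a4, eL, eN, mulOp_mulOp bF b1]

variable {U Ut : State} {f g : ComplexL2}

lemma coord_pred_field_iff :
    Coord (s - 1) μ Ut (field1 s (s - 1) 0 μ f g) (field2 s (s - 1) 0 μ f g) ↔
      fourier Ut.1 = field1 s 0 0 μ f g ∧ fourier Ut.2 = mulOp (symPhi μ) (field2 s 0 0 μ f g) := by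
  rw [Coord, neg_sub, (sob_field_pred hs μ f g).1, (sob_field_pred hs μ f g).2]

/-- Every auxiliary function in `SatisfiesSystem` is determined by its Fourier transform. The
derivative of the product is identified by uniqueness in `FreqDeriv`, and the equations then force
the time derivative. -/
lemma SatisfiesSystem.coord (hμ : 0 < μ) (h : SatisfiesSystem 1 μ U Ut) (hU : Coord s μ U f g) :
    Coord (s - 1) μ Ut (field1 s (s - 1) 0 μ f g) (field2 s (s - 1) 0 μ f g) := by
  obtain ⟨ζx, vx, ζv, ζvx, Tζx, vvx, h1, h2, h3, h4, h5, h6, h7, h8⟩ := h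
  have dζ := freqDeriv_fst hs f
  have dv := freqDeriv_snd hs μ g
  have iζ := integrable_sob hs f
  have iv := integrable_symPhi_sob hs μ g
  rw [← hU.1] at dζ iζ
  rw [← hU.2] at dv iv
  have e1 := FreqDeriv.unique (isSpaceDeriv_iff.1 h1) dζ
  have e2 := FreqDeriv.unique (isSpaceDeriv_iff.1 h2) dv
  rw [isProduct_iff iζ] at h3
  have d4 := isSpaceDeriv_iff.1 h4
  rw [h3] at d4
  have e4 := FreqDeriv.unique d4 (dζ.conv dv iζ iv)
  rw [isFourierMultiplier_symbolT_iff hμ, e1] at h5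
  rw [isProduct_iff iv, e2] at h6
  rw [one_smul, add_assoc] at h7 h8
  rw [coord_pred_field_iff hs, (field_zero_eq hs μ f g).1, (field_zero_eq hs μ f g).2,
    eq_neg_of_add_eq_zero_left h7, eq_neg_of_add_eq_zero_left h8, fourier_neg, fourier_neg,
    fourier_add, fourier_add, e2, e4, h5, h6, ← hU.1, ← hU.2]
  exact ⟨rfl, rfl⟩

/-- All terms are Hermitian on the Fourier side, so they come from real functions, and the equations
define the time derivative. -/
lemma Coord.exists_satisfiesSystem (hμ : 0 < μ) (hU : Coord s μ U f g) :
    ∃ Ut, SatisfiesSystem 1 μ U Ut := by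
  have hf := (hU.herm (by linarith)).1
  have hg := (hU.herm (by linarith)).2
  have dζ := freqDeriv_fst hs f
  have dv := freqDeriv_snd hs μ g
  have iζ := integrable_sob hs f
  have iv := integrable_symPhi_sob hs μ g
  rw [← hU.1] at dζ iζ
  rw [← hU.2] at dv iv
  have hC : ∀ {u v : ComplexL2}, Integrable u → Herm u → Herm v → Herm (convOp u v) :=
    fun iu hu hv => by rw [Herm, reflConj_convOp iu, hu, hv]
  have hζ := herm_fourier U.1
  have hv := herm_fourier U.2
  have hζx := herm_freqDeriv_fst hs hf
  have hvx := herm_freqDeriv_snd (μ := μ) hs hg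
  have hζv := hC iζ hζ hv
  have hζvx := (hC iζ hζ hvx).add (hC iv hv hζx)
  have hT := herm_symPhi (μ := μ) (herm_symPhi (μ := μ) hζx)
  have hvvx := hC iv hv hvx
  have lift : ∀ {A : ComplexL2}, Herm A → ∃ h : RealL2, fourier h = A := fun hA =>
    ⟨_, fourier_realInvF hA⟩
  obtain ⟨ζx, eζx⟩ := lift hζx
  obtain ⟨vx, evx⟩ := lift hvx
  obtain ⟨ζv, eζv⟩ := lift hζv
  obtain ⟨ζvx, eζvx⟩ := lift hζvx
  obtain ⟨Tζx, eTζx⟩ := lift hT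
  obtain ⟨vvx, evvx⟩ := lift hvvx
  refine ⟨(-(vx + ζvx), -(Tζx + vvx)), ζx, vx, ζv, ζvx, Tζx, vvx, ?_, ?_, (isProduct_iff iζ).2 eζv,
    ?_, (isFourierMultiplier_symbolT_iff hμ).2 (by rw [eTζx, eζx]),
    (isProduct_iff iv).2 (by rw [evvx, evx]), ?_, ?_⟩
  · rw [isSpaceDeriv_iff, eζx]
    exact dζ
  · rw [isSpaceDeriv_iff, evx]
    exact dv
  · rw [isSpaceDeriv_iff, eζv, eζvx]
    exact dζ.conv dv iζ iv
  · exact (by rw [one_smul, add_assoc, neg_add_cancel] : -(vx + ζvx) + vx + (1 : ℝ) • ζvx = 0)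
  · exact (by rw [one_smul, add_assoc, neg_add_cancel] : -(Tζx + vvx) + Tζx + (1 : ℝ) • vvx = 0)

end Fields

/-! ### Scaling -/

lemma weightedNormSq_smul {w : ℝ → ℝ} (c : ℝ) (f : RealL2) :
    weightedNormSq w (c • f) = ENNReal.ofReal (c ^ 2) * weightedNormSq w f := by
  rw [weightedNormSq, weightedNormSq, ← lintegral_const_mul' _ _ ENNReal.ofReal_ne_top,
    fourier_smul]
  refine lintegral_congr_ae ?_
  filter_upwards [Lp.coeFn_smul c (fourier f)] with ξ h
  rw [h, Pi.smul_apply, enorm_smul, mul_pow, ← ofReal_norm, Real.norm_eq_abs,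
    ← ENNReal.ofReal_pow (abs_nonneg c), sq_abs]
  ring

lemma vNorm_smul (s μ c : ℝ) (U : State) :
    vNorm s μ (c • U) = ENNReal.ofReal |c| * vNorm s μ U := by
  rw [vNorm, vNorm, Prod.smul_fst, Prod.smul_snd, sobolevNormSq, sobolevNormSq,
    halfDerivSobolevNormSq, weightedNormSq_smul, weightedNormSq_smul, weightedNormSq_smul,
    mul_left_comm, ← mul_add, ← mul_add, ENNReal.mul_rpow_of_nonneg _ _ (by norm_num),
    ENNReal.ofReal_rpow_of_nonneg (sq_nonneg c) (by norm_num), ← Real.sqrt_eq_rpow,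
    Real.sqrt_sq_eq_abs]
  rfl

/-- Linear terms scale like `c` and quadratic ones like `c²`, which divides the coefficient of the
nonlinearity by `c`. The choice `c = ε` normalises it to `1`. -/
lemma SatisfiesSystem.smul {ε μ : ℝ} {U Ut : State} (h : SatisfiesSystem ε μ U Ut) {c : ℝ}
    (hc : c ≠ 0) : SatisfiesSystem (ε / c) μ (c • U) (c • Ut) := by
  obtain ⟨ζx, vx, ζv, ζvx, Tζx, vvx, h1, h2, h3, h4, h5, h6, h7, h8⟩ := h
  have mult : ∀ {m : ℝ → ℂ} {f g : RealL2} (k : ℝ), IsFourierMultiplier m f g →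
      IsFourierMultiplier m (k • f) (k • g) := by
    intro m f g k hm
    unfold IsFourierMultiplier
    rw [fourier_smul, fourier_smul]
    filter_upwards [hm, Lp.coeFn_smul k (fourier f), Lp.coeFn_smul k (fourier g)] with ξ a1 a2 a3
    rw [a2, a3, Pi.smul_apply, Pi.smul_apply, a1, mul_smul_comm]
  have prod : ∀ {f g p : RealL2}, IsProduct f g p → IsProduct (c • f) (c • g) (c ^ 2 • p) := by
    intro f g p hp
    unfold IsProduct
    filter_upwards [hp, Lp.coeFn_smul c f, Lp.coeFn_smul c g, Lp.coeFn_smul (c ^ 2) p]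
      with x a1 a2 a3 a4
    rw [a2, a3, a4, Pi.smul_apply, Pi.smul_apply, Pi.smul_apply, a1]
    simp only [smul_eq_mul]
    ring
  have e : ∀ x : RealL2, (ε / c) • c ^ 2 • x = c • ε • x := fun x => by
    rw [smul_smul, smul_smul]
    congr 1
    field_simp
  refine ⟨c • ζx, c • vx, c ^ 2 • ζv, c ^ 2 • ζvx, c • Tζx, c ^ 2 • vvx, mult c h1, mult c h2,
    prod h3, mult _ h4, mult c h5, prod h6, ?_, ?_⟩
  · rw [e, Prod.smul_fst, ← smul_add, ← smul_add, h7, smul_zero]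
  · rw [e, Prod.smul_snd, ← smul_add, ← smul_add, h8, smul_zero]

lemma ContinuousInV.smul {s μ τ : ℝ} {U : ℝ → State} (h : ContinuousInV s μ τ U) (c : ℝ) :
    ContinuousInV s μ τ (fun t => c • U t) := by
  intro t ht
  refine ⟨?_, ?_⟩
  · rw [MemV, vNorm_smul]
    exact ENNReal.mul_lt_top ENNReal.ofReal_lt_top (h t ht).1
  · simp only [← smul_sub, vNorm_smul]
    have := ENNReal.Tendsto.const_mul (h t ht).2 (Or.inr (ENNReal.ofReal_ne_top (r := |c|)))
    rwa [mul_zero] at this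

lemma HasTimeDerivInV.smul {s μ τ : ℝ} {U U' : ℝ → State} (h : HasTimeDerivInV s μ τ U U') (c : ℝ) :
    HasTimeDerivInV s μ τ (fun t => c • U t) (fun t => c • U' t) := by
  intro t ht
  have e : ∀ r, (r - t)⁻¹ • (c • U r - c • U t) - c • U' t
      = c • ((r - t)⁻¹ • (U r - U t) - U' t) := fun r => by
    rw [← smul_sub, smul_comm, ← smul_sub]
  simp only [e, vNorm_smul]
  have := ENNReal.Tendsto.const_mul (h t ht) (Or.inr (ENNReal.ofReal_ne_top (r := |c|)))
  rwa [mul_zero] at this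

lemma IsSolution.smul {s μ ε τ : ℝ} {U : ℝ → State} (h : IsSolution s μ ε τ U) {c : ℝ}
    (hc : c ≠ 0) : IsSolution s μ (ε / c) τ (fun t => c • U t) := by
  obtain ⟨h1, U', h2, h3, h4⟩ := h
  exact ⟨h1.smul c, fun t => c • U' t, h2.smul c, h3.smul c, fun t ht => (h4 t ht).smul hc⟩

/-! ### Solutions in coordinates -/

lemma tendsto_coord_iff {s μ : ℝ} (hs : 0 ≤ s) {S : Set ℝ} {t : ℝ} (ht : t ∈ S) {U : ℝ → State}
    {u v : ℝ → ComplexL2} (h : ∀ r ∈ S, Coord s μ (U r) (u r) (v r)) :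
    Tendsto (fun r => vNorm s μ (U r - U t)) (𝓝[S] t) (𝓝 0) ↔
      ContinuousWithinAt u S t ∧ ContinuousWithinAt v S t := by
  rw [tendsto_vNorm_iff hs (a := fun r => u r - u t) (b := fun r => v r - v t)
    (by filter_upwards [self_mem_nhdsWithin] with r hr using (h r hr).sub (h t ht)),
    ContinuousWithinAt, ContinuousWithinAt, tendsto_sub_nhds_zero_iff, tendsto_sub_nhds_zero_iff]

lemma tendsto_slope_coord_iff {s μ : ℝ} (hs : 1 ≤ s) {S : Set ℝ} {t : ℝ} (ht : t ∈ S)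
    {U : ℝ → State} {u v : ℝ → ComplexL2} (h : ∀ r ∈ S, Coord s μ (U r) (u r) (v r))
    {W : State} {p q : ComplexL2} (hW : Coord (s - 1) μ W p q) :
    Tendsto (fun r => vNorm (s - 1) μ ((r - t)⁻¹ • (U r - U t) - W)) (𝓝[S \ {t}] t) (𝓝 0) ↔
      HasDerivWithinAt (fun r => sob (-1) (u r)) p S t ∧
      HasDerivWithinAt (fun r => sob (-1) (v r)) q S t := by
  rw [tendsto_vNorm_iff (by linarith)
    (a := fun r => slope (fun r => sob (-1) (u r)) t r - p)
    (b := fun r => slope (fun r => sob (-1) (v r)) t r - q)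
    (by filter_upwards [self_mem_nhdsWithin] with r hr using
      ((((h r hr.1).pred hs).sub ((h t ht).pred hs)).smul _).sub hW),
    hasDerivWithinAt_iff_tendsto_slope, hasDerivWithinAt_iff_tendsto_slope,
    tendsto_sub_nhds_zero_iff, tendsto_sub_nhds_zero_iff]

lemma IsSolution.exists_sol {s μ τ : ℝ} (hs : 3 / 2 < s) (hμ : 0 < μ) {U : ℝ → State}
    (h : IsSolution s μ 1 τ U) :
    ∃ u v, Sol s μ τ u v ∧ ∀ t ∈ Icc 0 τ, Coord s μ (U t) (u t) (v t) := by
  obtain ⟨h1, U', h2, h3, h4⟩ := h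
  have hs0 : 0 ≤ s := by linarith
  have ex : ∀ t, ∃ p : ComplexL2 × ComplexL2, t ∈ Icc 0 τ → Coord s μ (U t) p.1 p.2 := fun t => by
    by_cases ht : t ∈ Icc 0 τ
    · obtain ⟨f, g, hfg⟩ := exists_coord hs0 (h1 t ht).1
      exact ⟨(f, g), fun _ => hfg⟩
    · exact ⟨0, fun h => absurd h ht⟩
  choose p hp using ex
  have hd := fun t ht => (tendsto_slope_coord_iff (by linarith) ht hp
    ((h4 t ht).coord hs hμ (hp t ht))).1 (h3 t ht)
  have hc := fun t ht => (tendsto_coord_iff hs0 ht hp).1 (h1 t ht).2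
  exact ⟨fun t => (p t).1, fun t => (p t).2,
    ⟨fun t ht => ((hp t ht).herm hs0).1, fun t ht => ((hp t ht).herm hs0).2,
      fun t ht => (hc t ht).1, fun t ht => (hc t ht).2, fun t ht => (hd t ht).1,
      fun t ht => (hd t ht).2⟩, hp⟩

lemma Sol.isSolution {s μ τ : ℝ} (hs : 3 / 2 < s) (hμ : 0 < μ) {u v : ℝ → ComplexL2}
    (S : Sol s μ τ u v) {U : ℝ → State} (hU : ∀ t ∈ Icc 0 τ, Coord s μ (U t) (u t) (v t)) :
    IsSolution s μ 1 τ U := by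
  have hs0 : 0 ≤ s := by linarith
  have ex : ∀ t, ∃ W, t ∈ Icc 0 τ → SatisfiesSystem 1 μ (U t) W := fun t => by
    by_cases ht : t ∈ Icc 0 τ
    · obtain ⟨W, hW⟩ := (hU t ht).exists_satisfiesSystem hs hμ
      exact ⟨W, fun _ => hW⟩
    · exact ⟨0, fun h => absurd h ht⟩
  choose U' hU' using ex
  have hc := fun t ht => (hU' t ht).coord hs hμ (hU t ht)
  have cp : ContinuousOn (fun t => vecField s (s - 1) 0 μ (u t, v t)) (Icc 0 τ) :=
    (continuous_vecField μ (orderBound_pred hs le_rfl)).comp_continuousOn (S.cont₁.prodMk S.cont₂)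
  refine ⟨fun t ht => ⟨(hU t ht).memV hs0, (tendsto_coord_iff hs0 ht hU).2
    ⟨S.cont₁ t ht, S.cont₂ t ht⟩⟩, U', fun t ht => ⟨(hc t ht).memV (by linarith),
    (tendsto_coord_iff (by linarith) ht hc).2 ⟨(cp t ht).fst, (cp t ht).snd⟩⟩,
    fun t ht => (tendsto_slope_coord_iff (by linarith) ht hU (hc t ht)).2
      ⟨S.deriv₁ t ht, S.deriv₂ t ht⟩, hU'⟩

/-! ### Non-cavitation -/

/-- The coordinate `f` belongs to `ε • U`, so the inverse transform of `sob (-s) f` is `ε ζ`, and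
non-cavitation is exactly the pointwise lower bound for the symmetrizer. -/
lemma NonCavitation.coercive {s ε h₀ μ : ℝ} (hs : 3 / 2 < s) {U : State}
    (h : NonCavitation ε h₀ U.1) {f g : ComplexL2} (hU : Coord s μ (ε • U) f g) :
    Coercive h₀ (sob (-s) f) := by
  have hi := integrable_sob hs f
  refine coercive_of_fourierInv_ge hi ?_
  have h1 := coe_fourierInv_ae hi
  rw [← hU.1, ← invF_apply, invF_fourier_real, hU.1, Prod.smul_fst] at h1
  filter_upwards [h, h1, complexify_ae (ε • U.1), Lp.coeFn_smul ε U.1] with x a1 a2 a3 a4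
  rw [← a2, a3, a4]
  simpa using a1

/-- Coercivity is stable under perturbations in `H^s`, which makes non-cavitation, with a smaller
constant, an open condition on the data. -/
lemma Coercive.of_close {s h h' : ℝ} (hs : 3 / 2 < s) {f f' : ComplexL2}
    (hc : Coercive h (sob (-s) f)) (hd : h' + decayConst s * ‖f' - f‖ ≤ h) :
    Coercive h' (sob (-s) f') := by
  intro x
  have h1 := hc x
  have h2 : ‖convOp (sob (-s) (f' - f)) x‖ ≤ decayConst s * ‖f' - f‖ * ‖x‖ := by
    refine (norm_convOp_sob_le hs (f' - f) x).trans ?_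
    have := decayConst_nonneg s
    gcongr
    exact norm_sob_le (by norm_num) _
  have h3 : inner ℝ (x + convOp (sob (-s) f') x) x =
      inner ℝ (x + convOp (sob (-s) f) x) x + inner ℝ (convOp (sob (-s) (f' - f)) x) x := by
    rw [← inner_add_left, map_sub, convOp_sub_left (integrable_sob hs f') (integrable_sob hs f)]
    congr 1
    abel
  have h4 := (abs_le.1 ((abs_real_inner_le_norm (convOp (sob (-s) (f' - f)) x) x).trans
    (mul_le_mul_of_nonneg_right h2 (norm_nonneg x)))).1
  rw [h3]
  nlinarith [mul_le_mul_of_nonneg_right hd (sq_nonneg ‖x‖)]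

/-! ### Continuous dependence and well-posedness -/

lemma GoodSol.norm_le {s h M N μ τ : ℝ} {u v : ℝ → ComplexL2} (S : GoodSol s h M N μ τ u v)
    (hM : 0 ≤ M) (hN : 0 ≤ N) (h0 : ‖u 0‖ ^ 2 + ‖v 0‖ ^ 2 ≤ N ^ 2) {t : ℝ} (ht : t ∈ Icc 0 τ) :
    ‖u t‖ ≤ M * N ∧ ‖v t‖ ≤ M * N := by
  refine norm_le_of_sq_add_sq_le (by positivity) ((S.bound t ht).trans ?_)
  rw [mul_pow]
  gcongr

lemma GoodSol.norm_tailOp_le {s h M N μ τ : ℝ} {u v : ℝ → ComplexL2} (S : GoodSol s h M N μ τ u v)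
    (hM : 0 ≤ M) {R η : ℝ} (hR : 0 < R) (h₁ : ‖tailOp R (u 0)‖ ≤ η) (h₂ : ‖tailOp R (v 0)‖ ≤ η)
    {t : ℝ} (ht : t ∈ Icc 0 τ) : ‖tailOp R (u t)‖ ≤ 2 * M * η ∧ ‖tailOp R (v t)‖ ≤ 2 * M * η := by
  have hη : 0 ≤ η := (norm_nonneg _).trans h₁
  refine norm_le_of_sq_add_sq_le (by positivity) ((S.tail t ht R hR).trans ?_)
  have h3 : ‖tailOp R (u 0)‖ ^ 2 + ‖tailOp R (v 0)‖ ^ 2 ≤ η ^ 2 + η ^ 2 := by gcongr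
  nlinarith [mul_le_mul_of_nonneg_left h3 (sq_nonneg M), sq_nonneg (M * η)]

/-- Solutions with close data are close. -/
lemma GoodSol.exists_close {s h M N μ τ : ℝ} (hs : 3 / 2 < s) (hh : 0 < h) (hM : 1 ≤ M)
    (hN : 0 ≤ N) (hτ : 0 ≤ τ) {u v : ℝ → ComplexL2} (S : GoodSol s h M N μ τ u v)
    {θ : ℝ} (hθ : 0 < θ) :
    ∃ η : ℝ, 0 < η ∧ ∀ u' v' : ℝ → ComplexL2, GoodSol s h M N μ τ u' v' →
      ‖u' 0‖ ^ 2 + ‖v' 0‖ ^ 2 ≤ N ^ 2 → ‖u' 0 - u 0‖ ≤ η → ‖v' 0 - v 0‖ ≤ η →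
      ∀ t ∈ Icc 0 τ, ‖u' t - u t‖ ≤ θ ∧ ‖v' t - v t‖ ≤ θ := by
  have hM0 : 0 < M := by linarith
  have hs0 : 0 ≤ s := by linarith
  have hJ : -s ≤ 0 := by linarith
  -- The tails of the two solutions contribute `2 M κ` and `4 M κ`, which is half of `θ`. The other
  -- half is left for the weak norm.
  set κ : ℝ := θ / (12 * M) with hκ
  have κ0 : 0 < κ := by positivity
  obtain ⟨R, hR, hRu, hRv⟩ : ∃ R : ℝ, 0 < R ∧ ‖tailOp R (u 0)‖ ≤ κ ∧ ‖tailOp R (v 0)‖ ≤ κ := by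
    have h1 := (tendsto_tailOp (u 0)).norm
    have h2 := (tendsto_tailOp (v 0)).norm
    rw [norm_zero] at h1 h2
    obtain ⟨k, hk⟩ := ((h1.eventually_lt_const κ0).and (h2.eventually_lt_const κ0)).exists
    exact ⟨(k : ℝ) + 1, by positivity, hk.1.le, hk.2.le⟩
  set B : ℝ := (1 + R ^ 2) ^ (s / 2) with hB
  have B0 : 0 < B := by positivity
  set K := diffConst s h (M * N) τ with hK
  have K0 : 0 ≤ K := diffConst_nonneg s hh (by positivity) hτ
  set L : ℝ := B * Real.sqrt (2 * K) with hL
  have L0 : 0 ≤ L := by positivity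
  -- The first entry keeps the tail of the perturbed datum below `2 κ`. The second makes the weak
  -- part, at most `L η`, no larger than `θ / 2`.
  set η : ℝ := min κ (θ / (2 * (L + 1))) with hη
  have η0 : 0 < η := lt_min κ0 (by positivity)
  have hηL : L * η ≤ θ / 2 := by
    calc L * η ≤ (L + 1) * (θ / (2 * (L + 1))) := by
          gcongr
          · linarith
          · exact min_le_right _ _
      _ = θ / 2 := by field_simp
  refine ⟨η, η0, fun u' v' S' h0' hu hv t ht => ?_⟩
  have tail0 : ∀ {x x' : ComplexL2}, ‖tailOp R x‖ ≤ κ → ‖x' - x‖ ≤ η → ‖tailOp R x'‖ ≤ 2 * κ := by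
    intro x x' h1 h2
    calc ‖tailOp R x'‖ = ‖tailOp R x + tailOp R (x' - x)‖ := by rw [← map_add, add_sub_cancel]
      _ ≤ κ + κ := (norm_add_le _ _).trans (add_le_add h1
          ((WhithamBoussinesq.norm_tailOp_le hR _).trans (h2.trans (min_le_left _ _))))
      _ = 2 * κ := by ring
  have t1 := S.norm_tailOp_le hM0.le hR hRu hRv ht
  have t2 := S'.norm_tailOp_le hM0.le hR (tail0 hRu hu) (tail0 hRv hv) ht
  have st := S.stable (M * N) u' v' le_rfl S'.toSol
    (fun r hr => (S'.norm_le hM0.le hN h0' hr).1) (fun r hr => (S'.norm_le hM0.le hN h0' hr).2) t ht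
  have d0 : ∀ {x x' : ComplexL2}, ‖x' - x‖ ≤ η → ‖sob (-s) (x - x')‖ ^ 2 ≤ η ^ 2 := fun h => by
    gcongr
    refine (norm_sob_le hJ _).trans ?_
    rwa [norm_sub_rev]
  have st' := norm_le_of_sq_add_sq_le (c := Real.sqrt (2 * K) * η) (by positivity) (st.trans (by
    rw [mul_pow, Real.sq_sqrt (by positivity)]
    nlinarith [mul_le_mul_of_nonneg_left (add_le_add (d0 hu) (d0 hv)) K0]))
  have fin : ∀ {x x' : ComplexL2}, ‖tailOp R x‖ ≤ 2 * M * κ → ‖tailOp R x'‖ ≤ 2 * M * (2 * κ) →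
      ‖sob (-s) (x - x')‖ ≤ Real.sqrt (2 * K) * η → ‖x' - x‖ ≤ θ := by
    intro x x' h1 h2 h3
    have h4 := norm_le_tailOp_add hs0 hR (x' - x)
    rw [map_sub, ← norm_neg (sob (-s) (x' - x)), ← map_neg, neg_sub] at h4
    have h5 := norm_sub_le (tailOp R x') (tailOp R x)
    have h6 : B * ‖sob (-s) (x - x')‖ ≤ L * η :=
      (mul_le_mul_of_nonneg_left h3 B0.le).trans (le_of_eq (by rw [hL]; ring))
    have h7 : M * κ = θ / 12 := by rw [hκ]; field_simp
    nlinarith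
  exact ⟨fin t1.1 t2.1 st'.1, fin t1.2 t2.2 st'.2⟩

/-! ### Return to general `ε` by scaling. -/

section Scaled

variable {s μ ε : ℝ} {U V : State} {f g : ComplexL2}

lemma Coord.norm_le_of_smul (hs : 0 ≤ s) (hε : 0 < ε) (h : Coord s μ (ε • U) f g) {a : ℝ}
    (ha : (vNorm s μ U).toReal ≤ a) : ‖f‖ ^ 2 + ‖g‖ ^ 2 ≤ (ε * a) ^ 2 := by
  refine (h.norm_le hs).trans ?_
  rw [vNorm_smul, ENNReal.toReal_mul, ENNReal.toReal_ofReal (abs_nonneg ε), abs_of_pos hε]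
  gcongr

lemma Coord.vNorm_le_of_smul (hs : 0 ≤ s) (hε : 0 < ε) (h : Coord s μ (ε • U) f g) {a : ℝ}
    (ha : 0 ≤ a) (hfg : ‖f‖ ^ 2 + ‖g‖ ^ 2 ≤ a ^ 2) : vNorm s μ U ≤ ENNReal.ofReal (2 * a / ε) := by
  have h1 := h.smul ε⁻¹
  rw [inv_smul_smul₀ hε.ne'] at h1
  rw [← ENNReal.ofReal_toReal (h1.memV hs).ne]
  refine ENNReal.ofReal_le_ofReal (abs_le_of_sq_le_sq' ((h1.le_norm hs).trans ?_)
    (by positivity)).2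
  rw [norm_smul, norm_smul, Real.norm_of_nonneg (inv_nonneg.2 hε.le), mul_pow, mul_pow, ← mul_add,
    div_pow, mul_pow, div_eq_inv_mul, inv_pow]
  have h2 : 0 ≤ (ε ^ 2)⁻¹ := by positivity
  nlinarith [mul_le_mul_of_nonneg_left hfg h2, mul_nonneg h2 (sq_nonneg a)]

lemma IsUniqueSolution.of_smul (hε : 0 < ε) {τ : ℝ} {U₀ : State} {U : ℝ → State}
    (h : IsUniqueSolution s μ 1 τ (ε • U₀) U) :
    IsUniqueSolution s μ ε τ U₀ (fun t => ε⁻¹ • U t) := by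
  have h1 := h.1.smul (inv_ne_zero hε.ne')
  rw [one_div, inv_inv] at h1
  refine ⟨h1, by simp only [h.2.1, inv_smul_smul₀ hε.ne'], fun W hW hW0 t ht => ?_⟩
  have h2 := hW.smul hε.ne'
  rw [div_self hε.ne'] at h2
  have h3 := h.2.2 _ h2 (by simp only [hW0]) ht
  simp only at h3
  simp only [← h3, inv_smul_smul₀ hε.ne']

/-- Existence and uniqueness for a given datum. -/
lemma exists_isUniqueSolution {h c₁ N : ℝ} (hs : 3 / 2 < s) (h0 : 0 < h) (h1 : h ≤ 1)
    (hc₁ : 0 < c₁) (hμ : 0 < μ) (hε : 0 < ε) (hN : 0 < N) (hNc : N ≤ c₁) (hU : Coord s μ (ε • U) f g)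
    (hsize : ‖f‖ ^ 2 + ‖g‖ ^ 2 ≤ N ^ 2) (hcoer : Coercive h (sob (-s) f)) :
    ∃ (W : ℝ → State) (u v : ℝ → ComplexL2), IsUniqueSolution s μ ε (lifespan s h c₁ / N) U W ∧
      GoodSol s h (growthFactor s h c₁) N μ (lifespan s h c₁ / N) u v ∧ u 0 = f ∧ v 0 = g ∧
      ∀ t ∈ Icc 0 (lifespan s h c₁ / N), Coord s μ (ε • W t) (u t) (v t) := by
  have hs0 : 0 ≤ s := by linarith
  have hτ : 0 < lifespan s h c₁ / N := div_pos (lifespan_pos h0 h1 hc₁) hN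
  obtain ⟨hf, hg⟩ := hU.herm hs0
  obtain ⟨u, v, u0, v0, S⟩ := exists_goodSol hs h0 h1 hc₁ μ hN hNc hf hg hsize hcoer
  have hV : ∀ t ∈ Icc 0 (lifespan s h c₁ / N), Coord s μ (ofCoord s μ (u t) (v t)) (u t) (v t) :=
    fun t ht => coord_ofCoord hs0 (S.herm₁ t ht) (S.herm₂ t ht)
  have z0 : (0 : ℝ) ∈ Icc 0 (lifespan s h c₁ / N) := left_mem_Icc.2 hτ.le
  have hV0 : ofCoord s μ (u 0) (v 0) = ε • U := by
    have := hV 0 z0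
    rw [u0, v0] at this ⊢
    exact this.eq hU
  have key : IsUniqueSolution s μ 1 (lifespan s h c₁ / N) (ε • U)
      (fun t => ofCoord s μ (u t) (v t)) := by
    refine ⟨S.toSol.isSolution hs hμ hV, hV0, fun W hW hW0 t ht => ?_⟩
    obtain ⟨u', v', S', hW'⟩ := hW.exists_sol hs hμ
    have e0 := hW' 0 z0
    rw [hW0] at e0
    have e1 := hU.unique hs0 e0
    have e2 := S.eqOn hs S' (u0.trans e1.1) (v0.trans e1.2) ht
    have e3 := hV t ht
    rw [e2.1, e2.2] at e3
    have e4 := (hW' t ht).eq e3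
    simp only [e4, e2.1, e2.2]
  exact ⟨_, u, v, key.of_smul hε, S, u0, v0, fun t ht => by
    simp only [smul_inv_smul₀ hε.ne']; exact hV t ht⟩

lemma Coord.add {f' g' : ComplexL2} (h : Coord s μ U f g) (h' : Coord s μ V f' g') :
    Coord s μ (U + V) (f + f') (g + g') := by
  have := h.sub (h'.smul (-1))
  simpa only [neg_smul, one_smul, sub_neg_eq_add] using this

lemma vNorm_toReal_pos (hs : 0 ≤ s) (hU : MemV s μ U) (h0 : U ≠ 0) : 0 < (vNorm s μ U).toReal := by
  refine lt_of_le_of_ne ENNReal.toReal_nonneg fun h => h0 ?_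
  obtain ⟨f, g, hfg⟩ := exists_coord hs hU
  have h1 := norm_le_of_sq_add_sq_le (c := 0) le_rfl (by
    have := hfg.norm_le hs
    rwa [← h] at this)
  rw [norm_le_zero_iff.1 h1.1, norm_le_zero_iff.1 h1.2] at hfg
  have h2 := hfg.smul 0
  rw [smul_zero, zero_smul] at h2
  exact hfg.eq h2

/-- The radius is at most the norm of `U₀`, so the size at most doubles. It is also small enough
that half of the coercivity constant is kept. These uniform bounds give all data in the ball the
same lifespan. -/
lemma exists_coord_of_close {U₀ : State} {h₀ r : ℝ} (hs : 3 / 2 < s) (hε : 0 < ε)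
    (hU₀ : MemV s μ U₀) (hcav : NonCavitation ε h₀ U₀.1) (hr : r ≤ (vNorm s μ U₀).toReal)
    (hr' : h₀ / 2 + decayConst s * (ε * r) ≤ h₀)
    (hU : vNorm s μ (U - U₀) < ENNReal.ofReal r) :
    ∃ f g, Coord s μ (ε • U) f g ∧ ‖f‖ ^ 2 + ‖g‖ ^ 2 ≤ (2 * (ε * (vNorm s μ U₀).toReal)) ^ 2 ∧
      Coercive (h₀ / 2) (sob (-s) f) := by
  have hs0 : 0 ≤ s := by linarith
  set n := (vNorm s μ U₀).toReal with hn
  have r0 : 0 ≤ r := by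
    by_contra hr0
    rw [ENNReal.ofReal_of_nonpos (by linarith)] at hU
    exact not_lt_zero hU
  obtain ⟨f, g, hfg⟩ := exists_coord hs0 hU₀
  obtain ⟨d, e, hde⟩ := exists_coord hs0 (hU.trans ENNReal.ofReal_lt_top : MemV s μ (U - U₀))
  have hfg := hfg.smul ε
  have hde := hde.smul ε
  have h1 := hfg.norm_le_of_smul hs0 hε le_rfl
  have h2 := hde.norm_le_of_smul hs0 hε (ENNReal.toReal_le_of_le_ofReal r0 hU.le)
  have h3 := hfg.add hde
  rw [← smul_add, add_sub_cancel] at h3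
  refine ⟨_, _, h3, ?_, (hcav.coercive hs hfg).of_close hs ?_⟩
  · have a1 := pow_le_pow_left₀ (norm_nonneg _) (norm_add_le (ε • f) (ε • d)) 2
    have a2 := pow_le_pow_left₀ (norm_nonneg _) (norm_add_le (ε • g) (ε • e)) 2
    have a3 : (ε * r) ^ 2 ≤ (ε * n) ^ 2 := by gcongr
    nlinarith [sq_nonneg (‖ε • f‖ - ‖ε • d‖), sq_nonneg (‖ε • g‖ - ‖ε • e‖)]
  · rw [add_sub_cancel_left]
    have a4 := (norm_le_of_sq_add_sq_le (by positivity) h2).1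
    have := mul_le_mul_of_nonneg_left a4 (decayConst_nonneg s)
    linarith

end Scaled

end

end WhithamBoussinesq

/-! ### Choice of the constants and conclusion. -/

theorem theorem1p5 (s : ℝ) (hs : 3 / 2 < s) (h₀ : ℝ) (hh₀ : 0 < h₀) (hh₀' : h₀ < 1)
    (c₀ : ℝ) (hc₀ : 0 < c₀) :
    ∃ c : ℝ, 0 < c ∧ ∃ C : ℝ, 0 < C ∧
      ∀ μ : ℝ, 0 < μ → μ < 1 → ∀ ε : ℝ, 0 < ε → ε < 1 →
      ∀ U₀ : WhithamBoussinesq.State, WhithamBoussinesq.MemV s μ U₀ → U₀ ≠ 0 →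
      WhithamBoussinesq.NonCavitation ε h₀ U₀.1 →
      ε ≤ c₀ * (WhithamBoussinesq.vNorm s μ U₀).toReal⁻¹ →
      ∀ T : ℝ, T = c * (WhithamBoussinesq.vNorm s μ U₀).toReal⁻¹ →
        -- existence, uniqueness and the bound by the data
        (∃ U : ℝ → WhithamBoussinesq.State,
          WhithamBoussinesq.IsUniqueSolution s μ ε (T / ε) U₀ U ∧
          ∀ t ∈ Set.Icc 0 (T / ε), WhithamBoussinesq.vNorm s μ (U t) ≤
            ENNReal.ofReal C * WhithamBoussinesq.vNorm s μ U₀) ∧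
        -- the flow map is defined and continuous on a neighbourhood of the data
        (∃ r : ℝ, 0 < r ∧
          ∃ F : WhithamBoussinesq.State → ℝ → WhithamBoussinesq.State,
            (∀ W₀ : WhithamBoussinesq.State,
              WhithamBoussinesq.vNorm s μ (W₀ - U₀) < ENNReal.ofReal r →
              WhithamBoussinesq.IsUniqueSolution s μ ε (T / ε) W₀ (F W₀)) ∧
            ∀ W₀ : WhithamBoussinesq.State,
              WhithamBoussinesq.vNorm s μ (W₀ - U₀) < ENNReal.ofReal r →
              ∀ δ : ℝ, 0 < δ → ∃ γ : ℝ, 0 < γ ∧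
                ∀ W₁ : WhithamBoussinesq.State,
                  WhithamBoussinesq.vNorm s μ (W₁ - U₀) < ENNReal.ofReal r →
                  WhithamBoussinesq.vNorm s μ (W₁ - W₀) < ENNReal.ofReal γ →
                  ∀ t ∈ Set.Icc 0 (T / ε),
                    WhithamBoussinesq.vNorm s μ (F W₁ t - F W₀ t) ≤ ENNReal.ofReal δ) := by
  open WhithamBoussinesq in
  have hs0 : 0 ≤ s := by linarith
  have hh : 0 < h₀ / 2 := half_pos hh₀
  have hh1 : h₀ / 2 ≤ 1 := by linarith
  have hc₁ : 0 < 2 * c₀ := by positivity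
  -- Half the depth and twice the size bound are used from the start, so that the construction
  -- covers a whole neighbourhood of the datum.
  set L := lifespan s (h₀ / 2) (2 * c₀) with hL
  have L0 : 0 < L := lifespan_pos hh hh1 hc₁
  set M := growthFactor s (h₀ / 2) (2 * c₀) with hM
  have M1 : 1 ≤ M := one_le_growthFactor hh hh1 hc₁
  have M0 : 0 < M := by linarith
  -- The factor `1 / 2` matches `N = 2 ε n`, so that `T / ε = L / N`. The factor `2` in `2 * M`
  -- covers the passage between the `V^s` norm and the coordinates.
  refine ⟨L / 2, half_pos L0, 2 * M, by positivity, ?_⟩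
  intro μ hμ _ ε hε _ U₀ hU₀ hne hcav hεc T hT
  set n := (vNorm s μ U₀).toReal with hn
  have n0 : 0 < n := vNorm_toReal_pos hs0 hU₀ hne
  set N := 2 * (ε * n) with hN
  have N0 : 0 < N := by positivity
  have hNc : N ≤ 2 * c₀ := by
    rw [← div_eq_mul_inv, le_div_iff₀ n0] at hεc
    linarith
  have hτ : T / ε = L / N := by
    rw [hT, hN]
    field_simp
  have τ0 : 0 ≤ L / N := by positivity
  rw [hτ]
  have hD := decayConst_nonneg s
  -- The second entry makes the loss of coercivity at most `h₀ / 2`. The added `1` avoids a division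
  -- by zero.
  set r := min n (h₀ / (2 * ((decayConst s + 1) * ε))) with hr
  have r0 : 0 < r := lt_min n0 (by positivity)
  have hr' : h₀ / 2 + decayConst s * (ε * r) ≤ h₀ := by
    have h1 : decayConst s * (ε * r) ≤
        (decayConst s + 1) * (ε * (h₀ / (2 * ((decayConst s + 1) * ε)))) := by
      gcongr
      · linarith
      · exact min_le_right _ _
    have h2 : (decayConst s + 1) * (ε * (h₀ / (2 * ((decayConst s + 1) * ε)))) = h₀ / 2 := by
      field_simp
    linarith
  have main : ∀ W₀ : State, ∃ (W : ℝ → State) (u v : ℝ → ComplexL2),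
      vNorm s μ (W₀ - U₀) < ENNReal.ofReal r → IsUniqueSolution s μ ε (L / N) W₀ W ∧
        GoodSol s (h₀ / 2) M N μ (L / N) u v ∧ ‖u 0‖ ^ 2 + ‖v 0‖ ^ 2 ≤ N ^ 2 ∧
        Coord s μ (ε • W₀) (u 0) (v 0) ∧
        ∀ t ∈ Set.Icc 0 (L / N), Coord s μ (ε • W t) (u t) (v t) := by
    intro W₀
    by_cases hW : vNorm s μ (W₀ - U₀) < ENNReal.ofReal r
    · obtain ⟨f, g, h1, h2, h3⟩ := exists_coord_of_close hs hε hU₀ hcav (min_le_left _ _) hr' hW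
      obtain ⟨W, u, v, h4, h5, rfl, rfl, h6⟩ :=
        exists_isUniqueSolution hs hh hh1 hc₁ hμ hε N0 hNc h1 h2 h3
      exact ⟨W, u, v, fun _ => ⟨h4, h5, h2, h1, h6⟩⟩
    -- The flow map is a function of all states, so it gets an arbitrary value outside the
    -- neighbourhood.
    · exact ⟨0, 0, 0, fun h => absurd h hW⟩
  choose F u v hF using main
  refine ⟨⟨F U₀, ?_⟩, r, r0, F, fun W₀ hW₀ => (hF W₀ hW₀).1, ?_⟩
  · have hz : vNorm s μ (U₀ - U₀) < ENNReal.ofReal r := by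
      have h1 := vNorm_smul s μ 0 (U₀ - U₀)
      rw [zero_smul, abs_zero, ENNReal.ofReal_zero, zero_mul] at h1
      rw [sub_self, h1]
      exact ENNReal.ofReal_pos.2 r0
    obtain ⟨h1, h2, -, h3, h4⟩ := hF U₀ hz
    refine ⟨h1, fun t ht => ?_⟩
    have h5 := h3.norm_le_of_smul hs0 hε le_rfl
    -- The bound of `GoodSol` is relative to the actual datum, of size `ε n`, and not to `N`, so the
    -- constant is not doubled here.
    have h6 : ‖u U₀ t‖ ^ 2 + ‖v U₀ t‖ ^ 2 ≤ (M * (ε * n)) ^ 2 := by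
      rw [mul_pow]
      exact (h2.bound t ht).trans (mul_le_mul_of_nonneg_left h5 (sq_nonneg M))
    refine ((h4 t ht).vNorm_le_of_smul hs0 hε (by positivity) h6).trans (le_of_eq ?_)
    rw [← ENNReal.ofReal_toReal hU₀.ne, ← ENNReal.ofReal_mul (by positivity), ← hn]
    congr 1
    field_simp
  · intro W₀ hW₀ δ hδ
    obtain ⟨-, S, -, h1, h2⟩ := hF W₀ hW₀
    -- Two coordinates within `ε δ / 4` have square sum at most `(ε δ / 2)²`, and the return to the
    -- `V^s` norm multiplies `ε δ / 2` by `2 / ε`.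
    obtain ⟨η, η0, hη⟩ := S.exists_close hs hh M1 N0.le τ0 (show 0 < ε * δ / 4 by positivity)
    refine ⟨η / ε, by positivity, fun W₁ hW₁ hγ t ht => ?_⟩
    obtain ⟨-, S', h3, h4, h5⟩ := hF W₁ hW₁
    have h6 := h4.sub h1
    rw [← smul_sub] at h6
    have h7 := h6.norm_le_of_smul hs0 hε (ENNReal.toReal_le_of_le_ofReal (by positivity) hγ.le)
    rw [mul_div_cancel₀ _ hε.ne'] at h7
    have h8 := norm_le_of_sq_add_sq_le η0.le h7
    have h9 := hη _ _ S' h3 h8.1 h8.2 t ht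
    have h10 := (h5 t ht).sub (h2 t ht)
    rw [← smul_sub] at h10
    refine (h10.vNorm_le_of_smul hs0 hε (a := ε * δ / 2) (by positivity) ?_).trans (le_of_eq ?_)
    · have a1 := pow_le_pow_left₀ (norm_nonneg _) h9.1 2
      have a2 := pow_le_pow_left₀ (norm_nonneg _) h9.2 2
      nlinarith [sq_nonneg (ε * δ)]
    · congr 1
      field_simp
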